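/- Let $k$ be a field of characteristic $3$ and let $V$ be a two-dimensional $k$-vector space with a nonzero alternating bilinear form $\langle\cdot|\cdot\rangle$. **The superalgebra $S_{1,2}$.** $B(1,2)=k1\oplus V$ (even part $k1$, odd part $V$) is the unital superalgebra with $uv=\langle u|v\rangle 1$ for $u,v\in V$, with the norm whose bilinear form $b$ is even and satisfies $b(1,1)=2$, $b(u,v)=\langle u|v\rangle$. With $\bar x=b(x,1)1-x$, $S_{1,2}$ is the same superspace with the same norm and the product $x\bullet y=\bar x\,\bar y$. **The superalgebra $\mathfrak g(S,S')$.** For a superalgebra $S$ with norm form $b$, $\mathfrak{tri}(S)=\mathfrak{tri}(S)_{\bar 0}\oplus\mathfrak{tri}(S)_{\bar 1}$, where $\mathfrak{tri}(S)_{i}$ consists of the triples $(d_0,d_1,d_2)\in\mathfrak{osp}(S,b)_i^3$ with $d_0(x\bullet y)=d_1(x)\bullet y+(-1)^{i|x|}x\bullet d_2(y)$, and $\theta(d_0,d_1,d_2)=(d_2,d_0,d_1)$. Put $l_x(y)=x\bullet y$, $r_x(y)=(-1)^{|x||y|}y\bullet x$, $\sigma_{x,y}(z)=(-1)^{|y||z|}b(x,z)y-(-1)^{|x|(|y|+|z|)}b(y,z)x$,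 and $t_{x,y}=(\sigma_{x,y},\tfrac12 b(x,y)1-r_xl_y,\tfrac12 b(x,y)1-l_xr_y)$. Then $$\mathfrak g(S,S')=\mathfrak{tri}(S)\oplus\mathfrak{tri}(S')\oplus\bigoplus_{i\in\mathbb Z/3}\iota_i(S\otimes S'),$$ where $\mathfrak{tri}(S)\oplus\mathfrak{tri}(S')$ is a subalgebra (componentwise supercommutators; the two summands commute), the bracket is superanticommutative, and for homogeneous elements $[(d_0,d_1,d_2),\iota_i(x\otimes x')]=\iota_i(d_i(x)\otimes x')$, $[(d_0',d_1',d_2'),\iota_i(x\otimes x')]=(-1)^{|d_i'||x|}\iota_i(x\otimes d_i'(x'))$, $[\iota_i(x\otimes x'),\iota_{i+1}(y\otimes y')]=(-1)^{|x'||y|}\iota_{i+2}((x\bullet y)\otimes(x'\bullet y'))$, and $[\iota_i(x\otimes x'),\iota_i(y\otimes y')]=(-1)^{|x||x'|+|x||y'|+|y||y'|}b'(x',y')\theta^i(t_{x,y})+(-1)^{|y||x'|}b(x,y)\theta'^i(t'_{x',y'})$. **Contragredient Lie superalgebras.** A realization of $A\in M_n(k)$ is a triple $(\mathfrak h,\{\alpha_i\},\{h_i\})$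 with $\dim\mathfrak h=2n-\operatorname{rank}A$, linearly independent $\alpha_1,\dots,\alpha_n\in\mathfrak h^*$ and $h_1,\dots,h_n\in\mathfrak h$, and $\alpha_j(h_i)=a_{ij}$. For $\tau\subseteq\{1,\dots,n\}$, $\tilde{\mathfrak g}(A,\tau)$ is the Lie superalgebra generated by the even space $\mathfrak h$ and $e_i,f_i$ ($i=1,\dots,n$; odd if and only if $i\in\tau$), subject to $[e_i,f_j]=\delta_{ij}h_i$, $[h,h']=0$, $[h,e_i]=\alpha_i(h)e_i$, $[h,f_i]=-\alpha_i(h)f_i$. It is $\mathbb Z$-graded with $\deg\mathfrak h=0$, $\deg e_i=1=-\deg f_i$. Let $\mathfrak i(A)$ be its largest $\mathbb Z$-homogeneous ideal intersecting $\mathfrak h$ trivially, $\mathfrak g(A,\tau)=\tilde{\mathfrak g}(A,\tau)/\mathfrak i(A)$, $\mathfrak g'(A,\tau)=[\mathfrak g(A,\tau),\mathfrak g(A,\tau)]$, and $\mathfrak c$ the centre of $\mathfrak g'(A,\tau)$. (A Lie superalgebra is required to satisfy, in addition to the graded identities, $[x,[x,x]]=0$ for every odd $x$, as usual in characteristic $3$.)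 **Statement.** Let $$A=\begin{pmatrix}2&-1&0&0\\-1&2&-1&0\\0&-2&2&-1\\0&0&1&0\end{pmatrix}\in M_4(k).$$ Then $\mathfrak g(S_{1,2},S_{1,2})$ is a Lie superalgebra; the matrix $A$ has a realization (on a space of dimension $5$), and for every realization of $A$ the Lie superalgebra $\mathfrak g(S_{1,2},S_{1,2})$ is isomorphic to the centerless derived contragredient Lie superalgebra $\mathfrak g'(A,\{4\})/\mathfrak c$. Moreover, $\mathfrak g(S_{1,2},S_{1,2})$ is simple, its even part is isomorphic to $\mathfrak{so}_7$ (the orthogonal Lie algebra of the split quadratic form $x_0^2+x_1x_2+x_3x_4+x_5x_6$ on $k^7$), and, under such an isomorphism, its odd part is, as a module for the even part, the direct sum of two copies of the eight-dimensional spin module of $\mathfrak{so}_7$ (the irreducible module of the even Clifford algebra, restricted to $\mathfrak{so}_7$). -/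

import Mathlib

open scoped TensorProduct

attribute [local instance] LieRing.ofAssociativeRing

noncomputable section

namespace Super

/-! ## Superspaces and superalgebras -/

/-- The sign `(-1)^a` for a parity `a`. -/
def sgn (k : Type*) [Field k] (a : ZMod 2) : k := if a = 0 then 1 else -1

theorem zmod2_cases (i : ZMod 2) : i = 0 ∨ i = 1 := by
  revert i; decide

theorem sum_zmod2 {M : Type*} [AddCommMonoid M] (f : ZMod 2 → M) : ∑ a, f a = f 0 + f 1 :=
  Fin.sum_univ_two (f : Fin 2 → M)

theorem zmod2_add_self : ∀ i : ZMod 2, i + i = 0 := by decide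

theorem zmod2_cancel_left : ∀ i j : ZMod 2, i + (i + j) = j := by decide

theorem zmod2_cancel_right : ∀ i j : ZMod 2, j + (i + j) = i := by decide

theorem zmod2_cancel₂ : ∀ a b c : ZMod 2, a + b + (c + b) = a + c := by decide

theorem zmod2_cancel₃ : ∀ a b c : ZMod 2, a + b + (a + c) = b + c := by decide

theorem one_add_one_zmod2 : (1 + 1 : ZMod 2) = 0 := rfl

/-- A superspace: a vector space `L = L₀ ⊕ L₁`, the decomposition being recorded by the projection
onto the odd part `L₁` along the even part `L₀`. -/
structure Superspace (k L : Type*) [Field k] [AddCommGroup L] [Module k L] where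
  odd : L →ₗ[k] L
  odd_odd : ∀ x, odd (odd x) = odd x

namespace Superspace

variable {k L M : Type*} [Field k] [AddCommGroup L] [Module k L] [AddCommGroup M] [Module k M]

/-- The projection of a superspace onto its component of parity `i`. -/
def comp (A : Superspace k L) (i : ZMod 2) : L →ₗ[k] L :=
  if i = 0 then LinearMap.id - A.odd else A.odd

/-- The homogeneous component of parity `i`. -/
def gr (A : Superspace k L) (i : ZMod 2) : Submodule k L := LinearMap.range (A.comp i)

theorem comp_zero (A : Superspace k L) (x : L) : A.comp 0 x = x - A.odd x := by
  simp [comp]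

theorem comp_one (A : Superspace k L) (x : L) : A.comp 1 x = A.odd x := by
  simp [comp]

theorem comp_comp (A : Superspace k L) (i j : ZMod 2) (x : L) :
    A.comp i (A.comp j x) = if i = j then A.comp j x else 0 := by
  rcases zmod2_cases i with rfl | rfl <;> rcases zmod2_cases j with rfl | rfl <;>
    simp [comp, A.odd_odd]

theorem comp_mem (A : Superspace k L) (i : ZMod 2) (x : L) : A.comp i x ∈ A.gr i := ⟨x, rfl⟩

theorem comp_of_mem {A : Superspace k L} {j : ZMod 2} {x : L} (hx : x ∈ A.gr j) (i : ZMod 2) :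
    A.comp i x = if i = j then x else 0 := by
  obtain ⟨y, rfl⟩ := hx
  exact A.comp_comp i j y

theorem mem_gr {A : Superspace k L} {i : ZMod 2} {x : L} : x ∈ A.gr i ↔ A.comp i x = x :=
  ⟨fun h => by simp [comp_of_mem h], fun h => h ▸ A.comp_mem i x⟩

theorem comp_add_comp (A : Superspace k L) (x : L) : A.comp 0 x + A.comp 1 x = x := by
  simp [comp]

theorem sum_comp (A : Superspace k L) (x : L) : ∑ i, A.comp i x = x :=
  (sum_zmod2 _).trans (A.comp_add_comp x)

/-- The product of two superspaces. -/
def prod (A : Superspace k L) (B : Superspace k M) : Superspace k (L × M) where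
  odd := A.odd.prodMap B.odd
  odd_odd x := by simp [A.odd_odd, B.odd_odd]

/-- The superspace of families, indexed by `ι`, of elements of a superspace. -/
def pi (ι : Type*) (A : Superspace k L) : Superspace k (ι → L) where
  odd := LinearMap.pi fun m => A.odd ∘ₗ LinearMap.proj m
  odd_odd x := by ext m; simp [A.odd_odd]

/-- The superspace of endomorphisms: an endomorphism is odd if it exchanges even and odd
vectors. -/
def endo (A : Superspace k L) : Superspace k (Module.End k L) where
  odd :=
    { toFun := fun f => A.comp 1 ∘ₗ f ∘ₗ A.comp 0 + A.comp 0 ∘ₗ f ∘ₗ A.comp 1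
      map_add' := fun f g => by ext x; simp; abel
      map_smul' := fun c f => by ext x; simp }
  odd_odd f := by ext x; simp [comp_comp]

/-- The tensor product of superspaces: `x ⊗ y` is odd if exactly one of `x`, `y` is. -/
def tensor (A : Superspace k L) (B : Superspace k M) : Superspace k (L ⊗[k] M) where
  odd := TensorProduct.map (A.comp 1) (B.comp 0) + TensorProduct.map (A.comp 0) (B.comp 1)
  odd_odd u := by
    rw [← LinearMap.comp_apply]
    congr 1
    ext x y
    simp [comp_comp]

/-- Bilinear maps which are even, that is, compatible with the gradings. -/
def IsEvenBilin {N : Type*} [AddCommGroup N] [Module k N] (A : Superspace k L)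
    (B : Superspace k M) (C : Superspace k N) (f : L →ₗ[k] M →ₗ[k] N) : Prop :=
  ∀ i j x y, x ∈ A.gr i → y ∈ B.gr j → f x y ∈ C.gr (i + j)

theorem prod_comp (A : Superspace k L) (B : Superspace k M) (i : ZMod 2) (x : L × M) :
    (A.prod B).comp i x = (A.comp i x.1, B.comp i x.2) := by
  rcases zmod2_cases i with rfl | rfl <;> ext <;> simp [comp, prod]

theorem pi_comp {ι : Type*} (A : Superspace k L) (i : ZMod 2) (x : ι → L) :
    (A.pi ι).comp i x = fun m => A.comp i (x m) := by
  rcases zmod2_cases i with rfl | rfl <;> ext <;> simp [comp, pi]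

theorem endo_comp (A : Superspace k L) (i : ZMod 2) (f : Module.End k L) (x : L) :
    A.endo.comp i f x = ∑ a, A.comp (a + i) (f (A.comp a x)) := by
  rw [sum_zmod2]
  rcases zmod2_cases i with rfl | rfl
  · simp [comp, endo]; abel
  · simp [comp, endo, one_add_one_zmod2]

theorem mem_endo_gr {A : Superspace k L} {i : ZMod 2} {f : Module.End k L} :
    f ∈ A.endo.gr i ↔ ∀ j, ∀ x ∈ A.gr j, f x ∈ A.gr (j + i) := by
  rw [mem_gr]
  constructor
  · intro h j x hx
    rw [← h, endo_comp, Finset.sum_eq_single j]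
    · exact comp_mem _ _ _
    · intro b _ hb
      rw [comp_of_mem hx, if_neg hb]; simp
    · simp
  · intro h
    ext x
    rw [endo_comp]
    conv_rhs => rw [← A.sum_comp x, map_sum]
    exact Finset.sum_congr rfl fun a _ => mem_gr.1 (h a _ (A.comp_mem a x))

theorem mem_prod_gr {A : Superspace k L} {B : Superspace k M} {i : ZMod 2} {x : L × M} :
    x ∈ (A.prod B).gr i ↔ x.1 ∈ A.gr i ∧ x.2 ∈ B.gr i := by
  simp only [mem_gr, prod_comp, Prod.ext_iff]

theorem mem_pi_gr {ι : Type*} {A : Superspace k L} {i : ZMod 2} {x : ι → L} :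
    x ∈ (A.pi ι).gr i ↔ ∀ m, x m ∈ A.gr i := by
  simp only [mem_gr, pi_comp, funext_iff]

theorem tensor_comp_tmul (A : Superspace k L) (B : Superspace k M) (i : ZMod 2) (x : L) (y : M) :
    (A.tensor B).comp i (x ⊗ₜ y) = ∑ a, A.comp a x ⊗ₜ[k] B.comp (i + a) y := by
  rw [sum_zmod2]
  rcases zmod2_cases i with rfl | rfl
  · simp [comp, tensor, TensorProduct.tmul_sub, TensorProduct.sub_tmul]; abel
  · simp [comp, tensor, one_add_one_zmod2, TensorProduct.tmul_sub, TensorProduct.sub_tmul]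
    abel

theorem tmul_mem {A : Superspace k L} {B : Superspace k M} {i j : ZMod 2} {x : L} {y : M}
    (hx : x ∈ A.gr i) (hy : y ∈ B.gr j) : x ⊗ₜ[k] y ∈ (A.tensor B).gr (i + j) := by
  rw [mem_gr, tensor_comp_tmul, Finset.sum_eq_single i]
  · rw [mem_gr.1 hx, show i + j + i = j by generalize i = a, j = b; revert a b; decide,
      mem_gr.1 hy]
  · intro b _ hb
    rw [comp_of_mem hx, if_neg hb, TensorProduct.zero_tmul]
  · simp

/-- To check a linear condition on homogeneous tensors it is enough to look at the tensors `x ⊗ y`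
with `x`, `y` homogeneous. -/
theorem tensor_induction {A : Superspace k L} {B : Superspace k M} {N : Type*} [AddCommGroup N]
    [Module k N] (f : L ⊗[k] M →ₗ[k] N) (P : Submodule k N) (i : ZMod 2)
    (h : ∀ a b, a + b = i → ∀ x ∈ A.gr a, ∀ y ∈ B.gr b, f (x ⊗ₜ y) ∈ P)
    {u : L ⊗[k] M} (hu : u ∈ (A.tensor B).gr i) : f u ∈ P := by
  rw [← mem_gr.1 hu]
  clear hu
  induction u with
  | zero => simp
  | add u v hu hv => rw [map_add, map_add]; exact P.add_mem hu hv
  | tmul x y =>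
    rw [tensor_comp_tmul, map_sum]
    refine P.sum_mem fun a _ => h a (i + a) ?_ _ (A.comp_mem _ _) _ (B.comp_mem _ _)
    generalize i = b
    revert a b; decide

end Superspace

/-- A (nonassociative) superalgebra: a superspace `L = L₀ ⊕ L₁` with a bilinear product such that
`Lᵢ Lⱼ ⊆ Lᵢ₊ⱼ`. -/
structure Superalgebra (k L : Type*) [Field k] [AddCommGroup L] [Module k L] extends
    Superspace k L where
  mul : L →ₗ[k] L →ₗ[k] L
  mul_mem : ∀ i j x y, x ∈ toSuperspace.gr i → y ∈ toSuperspace.gr j →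
    mul x y ∈ toSuperspace.gr (i + j)

namespace Superalgebra

variable {k L M : Type*} [Field k] [AddCommGroup L] [Module k L] [AddCommGroup M] [Module k M]

/-- The axioms of a Lie superalgebra. The last one, for odd elements, follows from the Jacobi
identity unless the characteristic is `3`; the condition `[x,x] = 0` for even `x` follows from
skew-symmetry unless the characteristic is `2`. -/
structure IsLie (A : Superalgebra k L) : Prop where
  self_even : ∀ x ∈ A.gr 0, A.mul x x = 0
  skew : ∀ i j, ∀ x ∈ A.gr i, ∀ y ∈ A.gr j, A.mul x y = -(sgn k (i * j) • A.mul y x)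
  jacobi : ∀ i j, ∀ x ∈ A.gr i, ∀ y ∈ A.gr j, ∀ z,
    A.mul x (A.mul y z) = A.mul (A.mul x y) z + sgn k (i * j) • A.mul y (A.mul x z)
  cube_odd : ∀ x ∈ A.gr 1, A.mul x (A.mul x x) = 0

/-- Graded two-sided ideals. -/
structure IsIdeal (A : Superalgebra k L) (I : Submodule k L) : Prop where
  odd_mem : ∀ x ∈ I, A.odd x ∈ I
  mul_mem_left : ∀ x, ∀ y ∈ I, A.mul x y ∈ I
  mul_mem_right : ∀ x ∈ I, ∀ y, A.mul x y ∈ I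

/-- A superalgebra is simple if its product is not zero and it has no graded ideals besides `0`
and itself. -/
def IsSimple (A : Superalgebra k L) : Prop :=
  (∃ x y, A.mul x y ≠ 0) ∧ ∀ I, A.IsIdeal I → I = ⊥ ∨ I = ⊤

/-- Isomorphisms of superalgebras: even linear bijections preserving the product. -/
structure Iso (A : Superalgebra k L) (B : Superalgebra k M) extends L ≃ₗ[k] M where
  map_odd : ∀ x, toLinearEquiv (A.odd x) = B.odd (toLinearEquiv x)
  map_mul : ∀ x y, toLinearEquiv (A.mul x y) = B.mul (toLinearEquiv x) (toLinearEquiv y)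

/-- The smallest graded ideal containing a set. -/
def idealSpan (A : Superalgebra k L) (s : Set L) : Submodule k L :=
  sInf {I | A.IsIdeal I ∧ s ⊆ I}

theorem isIdeal_idealSpan (A : Superalgebra k L) (s : Set L) : A.IsIdeal (A.idealSpan s) where
  odd_mem x hx := by
    simp only [idealSpan, Submodule.mem_sInf] at hx ⊢
    exact fun I hI => hI.1.odd_mem x (hx I hI)
  mul_mem_left x y hy := by
    simp only [idealSpan, Submodule.mem_sInf] at hy ⊢
    exact fun I hI => hI.1.mul_mem_left x y (hy I hI)
  mul_mem_right x hx y := by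
    simp only [idealSpan, Submodule.mem_sInf] at hx ⊢
    exact fun I hI => hI.1.mul_mem_right x (hx I hI) y

theorem isIdeal_sSup (A : Superalgebra k L) (S : Set (Submodule k L))
    (h : ∀ I ∈ S, A.IsIdeal I) : A.IsIdeal (sSup S) where
  odd_mem := by
    change sSup S ≤ (sSup S).comap A.odd
    exact sSup_le fun I hI x hx => le_sSup hI ((h I hI).odd_mem x hx)
  mul_mem_left a := by
    change sSup S ≤ (sSup S).comap (A.mul a)
    exact sSup_le fun I hI x hx => le_sSup hI ((h I hI).mul_mem_left a x hx)
  mul_mem_right := by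
    suffices H : ∀ y, sSup S ≤ (sSup S).comap (A.mul.flip y) from fun x hx y => H y hx
    exact fun y => sSup_le fun I hI x hx => le_sSup hI ((h I hI).mul_mem_right x hx y)

/-- The quotient superspace by a graded subspace. -/
def quotSpace (A : Superspace k L) (I : Submodule k L) (h : ∀ x ∈ I, A.odd x ∈ I) :
    Superspace k (L ⧸ I) where
  odd := I.mapQ I A.odd h
  odd_odd x := by
    obtain ⟨x, rfl⟩ := I.mkQ_surjective x
    simp [A.odd_odd]

theorem quotSpace_comp (A : Superspace k L) (I : Submodule k L) (h : ∀ x ∈ I, A.odd x ∈ I)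
    (i : ZMod 2) (x : L) : (quotSpace A I h).comp i (I.mkQ x) = I.mkQ (A.comp i x) := by
  rcases zmod2_cases i with rfl | rfl <;> simp [Superspace.comp, quotSpace]

/-- The product induced on the quotient by a graded ideal. -/
def quotMul (A : Superalgebra k L) (I : Submodule k L) (hI : A.IsIdeal I) :
    L ⧸ I →ₗ[k] L ⧸ I →ₗ[k] L ⧸ I :=
  I.liftQ
    { toFun := fun x => I.mapQ I (A.mul x) (fun y hy => hI.mul_mem_left x y hy)
      map_add' := fun x y => by ext z; simp
      map_smul' := fun c x => by ext z; simp }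
    (fun x hx => by
      rw [LinearMap.mem_ker]
      ext z
      simpa using hI.mul_mem_right x hx z)

theorem quotMul_mk (A : Superalgebra k L) (I : Submodule k L) (hI : A.IsIdeal I) (x y : L) :
    A.quotMul I hI (I.mkQ x) (I.mkQ y) = I.mkQ (A.mul x y) := rfl

/-- The quotient of a superalgebra by a graded ideal. -/
def quot (A : Superalgebra k L) (I : Submodule k L) (hI : A.IsIdeal I) :
    Superalgebra k (L ⧸ I) where
  toSuperspace := quotSpace A.toSuperspace I hI.odd_mem
  mul := A.quotMul I hI
  mul_mem i j x y hx hy := by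
    obtain ⟨x, rfl⟩ := I.mkQ_surjective x
    obtain ⟨y, rfl⟩ := I.mkQ_surjective y
    rw [← Superspace.mem_gr.1 hx, ← Superspace.mem_gr.1 hy, quotSpace_comp, quotSpace_comp,
      quotMul_mk, Superspace.mem_gr, quotSpace_comp, Superspace.mem_gr.1
        (A.mul_mem i j _ _ (A.comp_mem i x) (A.comp_mem j y))]

/-- A graded subalgebra as a superalgebra. -/
def restrict (A : Superalgebra k L) (N : Submodule k L) (hodd : ∀ x ∈ N, A.odd x ∈ N)
    (hmul : ∀ x ∈ N, ∀ y ∈ N, A.mul x y ∈ N) : Superalgebra k N where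
  odd := A.odd.restrict hodd
  odd_odd x := by ext; simp [A.odd_odd]
  mul := LinearMap.mk₂ k (fun x y => ⟨A.mul x y, hmul x x.2 y y.2⟩)
    (fun _ _ _ => by ext; simp) (fun _ _ _ => by ext; simp)
    (fun _ _ _ => by ext; simp) (fun _ _ _ => by ext; simp)
  mul_mem i j x y hx hy := by
    have key : ∀ (i : ZMod 2) (x : N),
        ((⟨A.odd.restrict hodd, fun x => by ext; simp [A.odd_odd]⟩ : Superspace k N).comp i x : L)
          = A.comp i x := by
      intro i x
      rcases zmod2_cases i with rfl | rfl <;> simp [Superspace.comp]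
    rw [Superspace.mem_gr] at hx hy ⊢
    rw [Subtype.ext_iff, key] at hx hy ⊢
    exact Superspace.mem_gr.1 (A.mul_mem i j _ _ (Superspace.mem_gr.2 hx) (Superspace.mem_gr.2 hy))

/-- The span of all products. -/
def derivedSubmodule (A : Superalgebra k L) : Submodule k L :=
  Submodule.span k {z | ∃ x y, z = A.mul x y}

theorem mul_mem_derived (A : Superalgebra k L) (x y : L) : A.mul x y ∈ A.derivedSubmodule :=
  Submodule.subset_span ⟨x, y, rfl⟩

theorem comp_mul (A : Superalgebra k L) (l : ZMod 2) (x y : L) :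
    A.comp l (A.mul x y) = ∑ i, ∑ j, if l = i + j then A.mul (A.comp i x) (A.comp j y) else 0 := by
  conv_lhs => rw [← A.sum_comp x, ← A.sum_comp y]
  simp only [map_sum, LinearMap.sum_apply]
  rw [Finset.sum_comm]
  exact Finset.sum_congr rfl fun i _ => Finset.sum_congr rfl fun j _ =>
    Superspace.comp_of_mem (A.mul_mem i j _ _ (A.comp_mem i x) (A.comp_mem j y)) l

/-- The derived superalgebra `A' = [A, A]`. -/
def derived (A : Superalgebra k L) : Superalgebra k A.derivedSubmodule :=
  A.restrict A.derivedSubmodule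
    (by
      change A.derivedSubmodule ≤ A.derivedSubmodule.comap A.odd
      refine Submodule.span_le.2 ?_
      rintro _ ⟨x, y, rfl⟩
      change A.odd (A.mul x y) ∈ A.derivedSubmodule
      rw [← Superspace.comp_one, comp_mul]
      refine Submodule.sum_mem _ fun i _ => Submodule.sum_mem _ fun j _ => ?_
      split_ifs
      · exact A.mul_mem_derived _ _
      · exact Submodule.zero_mem _)
    (fun x _ y _ => A.mul_mem_derived x y)

/-- The elements annihilating the whole superalgebra; for a Lie superalgebra, its centre. -/
def center (A : Superalgebra k L) : Submodule k L :=
  LinearMap.ker A.mul ⊓ LinearMap.ker A.mul.flip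

theorem mem_center {A : Superalgebra k L} {x : L} :
    x ∈ A.center ↔ ∀ y, A.mul x y = 0 ∧ A.mul y x = 0 := by
  simp only [center, Submodule.mem_inf, LinearMap.mem_ker, LinearMap.ext_iff,
    LinearMap.flip_apply, LinearMap.zero_apply, forall_and]

theorem isIdeal_center (A : Superalgebra k L) : A.IsIdeal A.center where
  odd_mem x hx := by
    have hx' := mem_center.1 hx
    have h1 : ∀ i j (y : L), A.mul (A.comp i x) (A.comp j y) = 0 ∧
        A.mul (A.comp j y) (A.comp i x) = 0 := by
      intro i j y
      have e : ∀ j (u : L), A.mul x (A.comp j u) = ∑ a, A.mul (A.comp a x) (A.comp j u) := by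
        intro j u
        conv_lhs => rw [← A.sum_comp x]
        simp
      have e' : ∀ j (u : L), A.mul (A.comp j u) x = ∑ a, A.mul (A.comp j u) (A.comp a x) := by
        intro j u
        conv_lhs => rw [← A.sum_comp x]
        simp
      constructor
      · have h0 := congrArg (A.comp (i + j)) (e j y)
        rw [(hx' _).1, map_zero, map_sum, Finset.sum_eq_single i] at h0
        · rw [Superspace.comp_of_mem
            (A.mul_mem i j _ _ (A.comp_mem i x) (A.comp_mem j y)), if_pos rfl] at h0
          exact h0.symm
        · intro b _ hb
          rw [Superspace.comp_of_mem (A.mul_mem b j _ _ (A.comp_mem b x) (A.comp_mem j y)), if_neg]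
          exact fun h => hb (add_right_cancel h).symm
        · simp
      · have h0 := congrArg (A.comp (j + i)) (e' j y)
        rw [(hx' _).2, map_zero, map_sum, Finset.sum_eq_single i] at h0
        · rw [Superspace.comp_of_mem
            (A.mul_mem j i _ _ (A.comp_mem j y) (A.comp_mem i x)), if_pos rfl] at h0
          exact h0.symm
        · intro b _ hb
          rw [Superspace.comp_of_mem (A.mul_mem j b _ _ (A.comp_mem j y) (A.comp_mem b x)), if_neg]
          exact fun h => hb (add_left_cancel h).symm
        · simp
    rw [mem_center]
    intro y
    rw [← Superspace.comp_one, ← A.sum_comp y]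
    simp [h1]
  mul_mem_left x y hy := by
    rw [(mem_center.1 hy x).2]; exact Submodule.zero_mem _
  mul_mem_right x hx y := by
    rw [(mem_center.1 hx y).1]; exact Submodule.zero_mem _

end Superalgebra


/-! ## The construction `𝔤(S, S')` -/

/-- The bilinear map `(x, y) ↦ f(x, y) - (-1)^{|x||y|} f(y, x)`. -/
def superSkew {k L M : Type*} [Field k] [AddCommGroup L] [Module k L] [AddCommGroup M]
    [Module k M] (A : Superspace k L) (f : L →ₗ[k] L →ₗ[k] M) : L →ₗ[k] L →ₗ[k] M :=
  ∑ a, ∑ c, (f.compl₁₂ (A.comp a) (A.comp c) - sgn k (a * c) • f.flip.compl₁₂ (A.comp a) (A.comp c))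

theorem superSkew_apply {k L M : Type*} [Field k] [AddCommGroup L] [Module k L] [AddCommGroup M]
    [Module k M] (A : Superspace k L) (f : L →ₗ[k] L →ₗ[k] M) (x y : L) :
    superSkew A f x y = ∑ a, ∑ c, (f (A.comp a x) (A.comp c y)
      - sgn k (a * c) • f (A.comp c y) (A.comp a x)) := by
  simp [superSkew, LinearMap.sum_apply]

theorem superSkew_even {k L M : Type*} [Field k] [AddCommGroup L] [Module k L] [AddCommGroup M]
    [Module k M] {A : Superspace k L} {B : Superspace k M} {f : L →ₗ[k] L →ₗ[k] M}
    (hf : A.IsEvenBilin A B f) : A.IsEvenBilin A B (superSkew A f) := by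
  intro i j x y hx hy
  rw [superSkew_apply]
  refine Submodule.sum_mem _ fun a _ => Submodule.sum_mem _ fun c _ => ?_
  rw [Superspace.comp_of_mem hx, Superspace.comp_of_mem hy]
  split_ifs
  · exact Submodule.sub_mem _ (hf i j _ _ hx hy)
      (Submodule.smul_mem _ _ (add_comm j i ▸ hf j i _ _ hy hx))
  all_goals simp

/-- A superalgebra with an even bilinear form `b`. (In characteristic different from `2` a quadratic
superform is determined by its bilinear form.) -/
structure FormedSuperalgebra (k S : Type*) [Field k] [AddCommGroup S] [Module k S] extends
    Superalgebra k S where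
  form : S →ₗ[k] S →ₗ[k] k
  form_even : ∀ i j x y, x ∈ toSuperspace.gr i → y ∈ toSuperspace.gr j → i ≠ j → form x y = 0

namespace FormedSuperalgebra

variable {k S S' : Type*} [Field k] [AddCommGroup S] [Module k S] [AddCommGroup S'] [Module k S']

/-- `σ_{x,y}(z) = (-1)^{|y||z|} b(x,z) y - (-1)^{|x|(|y|+|z|)} b(y,z) x`. -/
def sigma (A : FormedSuperalgebra k S) : S →ₗ[k] S →ₗ[k] Module.End k S :=
  LinearMap.mk₂ k (fun x y => ∑ a, ∑ c, ∑ e,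
      (sgn k (c * e) • (A.form (A.comp a x) ∘ₗ A.comp e).smulRight (A.comp c y)
        - sgn k (a * (c + e)) • (A.form (A.comp c y) ∘ₗ A.comp e).smulRight (A.comp a x)))
    (fun x x' y => by
      simp only [← Finset.sum_add_distrib]
      refine Finset.sum_congr rfl fun a _ => Finset.sum_congr rfl fun c _ =>
        Finset.sum_congr rfl fun e _ => ?_
      ext z; simp; module)
    (fun r x y => by
      simp only [Finset.smul_sum]
      refine Finset.sum_congr rfl fun a _ => Finset.sum_congr rfl fun c _ =>
        Finset.sum_congr rfl fun e _ => ?_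
      ext z; simp; module)
    (fun x y y' => by
      simp only [← Finset.sum_add_distrib]
      refine Finset.sum_congr rfl fun a _ => Finset.sum_congr rfl fun c _ =>
        Finset.sum_congr rfl fun e _ => ?_
      ext z; simp; module)
    (fun r x y => by
      simp only [Finset.smul_sum]
      refine Finset.sum_congr rfl fun a _ => Finset.sum_congr rfl fun c _ =>
        Finset.sum_congr rfl fun e _ => ?_
      ext z; simp; module)

theorem sum3_eq {M : Type*} [AddCommMonoid M] (F : ZMod 2 → ZMod 2 → ZMod 2 → M) (a c e : ZMod 2)
    (h : ∀ a' c' e', ¬ (a' = a ∧ c' = c ∧ e' = e) → F a' c' e' = 0) :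
    ∑ a', ∑ c', ∑ e', F a' c' e' = F a c e := by
  rw [Finset.sum_eq_single a, Finset.sum_eq_single c, Finset.sum_eq_single e]
  · intro b _ hb; exact h _ _ _ (by tauto)
  · simp
  · intro b _ hb; exact Finset.sum_eq_zero fun _ _ => h _ _ _ (by tauto)
  · simp
  · intro b _ hb
    exact Finset.sum_eq_zero fun _ _ => Finset.sum_eq_zero fun _ _ => h _ _ _ (by tauto)
  · simp

theorem sigma_apply (A : FormedSuperalgebra k S) {a c e : ZMod 2} {x y z : S} (hx : x ∈ A.gr a)
    (hy : y ∈ A.gr c) (hz : z ∈ A.gr e) :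
    A.sigma x y z = sgn k (c * e) • A.form x z • y - sgn k (a * (c + e)) • A.form y z • x := by
  have : A.sigma x y z = ∑ a', ∑ c', ∑ e',
      (sgn k (c' * e') • A.form (A.comp a' x) (A.comp e' z) • (A.comp c' y)
        - sgn k (a' * (c' + e')) • A.form (A.comp c' y) (A.comp e' z) • (A.comp a' x)) := by
    simp [sigma, LinearMap.sum_apply]
  rw [this, sum3_eq _ a c e]
  · simp [Superspace.comp_of_mem hx, Superspace.comp_of_mem hy, Superspace.comp_of_mem hz]
  · intro a' c' e' h
    simp only [Superspace.comp_of_mem hx, Superspace.comp_of_mem hy, Superspace.comp_of_mem hz]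
    by_cases h1 : a' = a <;> by_cases h2 : c' = c <;> by_cases h3 : e' = e <;>
      first | (simp [h1, h2, h3]; done) | (exfalso; tauto)

/-- The right multiplications `r_x(y) = (-1)^{|x||y|} y x`. -/
def rop (A : FormedSuperalgebra k S) : S →ₗ[k] Module.End k S where
  toFun x := ∑ a, ∑ e, sgn k (a * e) • (A.mul.flip (A.comp a x) ∘ₗ A.comp e)
  map_add' x y := by
    simp only [← Finset.sum_add_distrib]
    refine Finset.sum_congr rfl fun a _ => Finset.sum_congr rfl fun e _ => ?_
    ext z; simp
  map_smul' r x := by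
    simp only [Finset.smul_sum]
    refine Finset.sum_congr rfl fun a _ => Finset.sum_congr rfl fun e _ => ?_
    ext z; simp; module

theorem rop_apply (A : FormedSuperalgebra k S) {a e : ZMod 2} {x z : S} (hx : x ∈ A.gr a)
    (hz : z ∈ A.gr e) : A.rop x z = sgn k (a * e) • A.mul z x := by
  have : A.rop x z = ∑ a', ∑ e', sgn k (a' * e') • A.mul (A.comp e' z) (A.comp a' x) := by
    simp [rop, LinearMap.sum_apply]
  rw [this, Finset.sum_eq_single a, Finset.sum_eq_single e]
  · simp [Superspace.comp_of_mem hx, Superspace.comp_of_mem hz]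
  · intro b _ hb; simp [Superspace.comp_of_mem hz, hb]
  · simp
  · intro b _ hb; simp [Superspace.comp_of_mem hx, hb]
  · simp

/-- The three components of the triple
`t_{x,y} = (σ_{x,y}, ½ b(x,y) 1 - r_x l_y, ½ b(x,y) 1 - l_x r_y)`. -/
def tripleComp (A : FormedSuperalgebra k S) : ZMod 3 → (S →ₗ[k] S →ₗ[k] Module.End k S) :=
  ![A.sigma,
    LinearMap.mk₂ k (fun x y => ((2 : k)⁻¹ * A.form x y) • LinearMap.id - A.rop x ∘ₗ A.mul y)
      (fun _ _ _ => by ext z; simp; module) (fun _ _ _ => by ext z; simp; module)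
      (fun _ _ _ => by ext z; simp; module) (fun _ _ _ => by ext z; simp; module),
    LinearMap.mk₂ k (fun x y => ((2 : k)⁻¹ * A.form x y) • LinearMap.id - A.mul x ∘ₗ A.rop y)
      (fun _ _ _ => by ext z; simp; module) (fun _ _ _ => by ext z; simp; module)
      (fun _ _ _ => by ext z; simp; module) (fun _ _ _ => by ext z; simp; module)]

/-- The triple `t_{x,y}`. -/
def triple (A : FormedSuperalgebra k S) : S →ₗ[k] S →ₗ[k] (ZMod 3 → Module.End k S) :=
  LinearMap.mk₂ k (fun x y m => A.tripleComp m x y)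
    (fun _ _ _ => by funext m; simp) (fun _ _ _ => by funext m; simp)
    (fun _ _ _ => by funext m; simp) (fun _ _ _ => by funext m; simp)

/-- The component of parity `i` of the orthosymplectic Lie superalgebra `𝔬𝔰𝔭(S, b)`. -/
def osp (A : FormedSuperalgebra k S) (i : ZMod 2) : Submodule k (Module.End k S) where
  carrier := {f | f ∈ A.endo.gr i ∧
    ∀ j, ∀ x ∈ A.gr j, ∀ y, A.form (f x) y + sgn k (i * j) * A.form x (f y) = 0}
  add_mem' := by
    rintro f g ⟨hf, hf'⟩ ⟨hg, hg'⟩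
    refine ⟨Submodule.add_mem _ hf hg, fun j x hx y => ?_⟩
    simp only [LinearMap.add_apply, map_add]
    linear_combination hf' j x hx y + hg' j x hx y
  zero_mem' := ⟨Submodule.zero_mem _, by simp⟩
  smul_mem' := by
    rintro c f ⟨hf, hf'⟩
    refine ⟨Submodule.smul_mem _ _ hf, fun j x hx y => ?_⟩
    simp only [LinearMap.smul_apply, map_smul, smul_eq_mul]
    linear_combination c * hf' j x hx y

/-- The component of parity `i` of the triality Lie superalgebra: the triples `(d₀, d₁, d₂)` in
`𝔬𝔰𝔭(S, b)ᵢ` such that `d₀(xy) = d₁(x) y + (-1)^{i|x|} x d₂(y)`. -/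
def triPart (A : FormedSuperalgebra k S) (i : ZMod 2) :
    Submodule k (ZMod 3 → Module.End k S) where
  carrier := {d | (∀ m, d m ∈ A.osp i) ∧ ∀ j, ∀ x ∈ A.gr j, ∀ y,
    d 0 (A.mul x y) = A.mul (d 1 x) y + sgn k (i * j) • A.mul x (d 2 y)}
  add_mem' := by
    rintro f g ⟨hf, hf'⟩ ⟨hg, hg'⟩
    refine ⟨fun m => Submodule.add_mem _ (hf m) (hg m), fun j x hx y => ?_⟩
    simp only [Pi.add_apply, LinearMap.add_apply, map_add, hf' j x hx y, hg' j x hx y]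
    module
  zero_mem' := ⟨fun m => Submodule.zero_mem _, by simp⟩
  smul_mem' := by
    rintro c f ⟨hf, hf'⟩
    refine ⟨fun m => Submodule.smul_mem _ _ (hf m), fun j x hx y => ?_⟩
    simp only [Pi.smul_apply, LinearMap.smul_apply, map_smul, hf' j x hx y]
    module

/-- The triality Lie superalgebra, as a space of triples of endomorphisms. -/
def tri (A : FormedSuperalgebra k S) : Submodule k (ZMod 3 → Module.End k S) :=
  A.triPart 0 ⊔ A.triPart 1

/-- The power `θⁱ` of `θ(d₀, d₁, d₂) = (d₂, d₀, d₁)`. -/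
def theta (k S : Type*) [Field k] [AddCommGroup S] [Module k S] (i : ZMod 3) :
    (ZMod 3 → Module.End k S) →ₗ[k] (ZMod 3 → Module.End k S) :=
  LinearMap.funLeft k (Module.End k S) (fun m => m - i)

/-- The superspace of triples of endomorphisms. -/
def triples (A : FormedSuperalgebra k S) : Superspace k (ZMod 3 → Module.End k S) :=
  A.endo.pi (ZMod 3)

theorem triPart_le (A : FormedSuperalgebra k S) (i : ZMod 2) : A.triPart i ≤ A.triples.gr i :=
  fun _ hd => Superspace.mem_pi_gr.2 fun m => (hd.1 m).1

theorem triPart_le_tri (A : FormedSuperalgebra k S) (i : ZMod 2) : A.triPart i ≤ A.tri := by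
  rcases zmod2_cases i with rfl | rfl
  · exact le_sup_left
  · exact le_sup_right

theorem comp_mem_triPart (A : FormedSuperalgebra k S) {d : ZMod 3 → Module.End k S}
    (hd : d ∈ A.tri) (i : ZMod 2) : A.triples.comp i d ∈ A.triPart i := by
  obtain ⟨d0, h0, d1, h1, rfl⟩ := Submodule.mem_sup.1 hd
  rw [map_add, Superspace.comp_of_mem (A.triPart_le 0 h0),
    Superspace.comp_of_mem (A.triPart_le 1 h1)]
  rcases zmod2_cases i with rfl | rfl
  · simpa using h0
  · simpa using h1

theorem sgn_mul_self (a : ZMod 2) : sgn k a * sgn k a = 1 := by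
  unfold sgn; split_ifs <;> simp

theorem sgn_add (a b : ZMod 2) : sgn k (a + b) = sgn k a * sgn k b := by
  rcases zmod2_cases a with rfl | rfl <;> rcases zmod2_cases b with rfl | rfl <;>
    simp [sgn, one_add_one_zmod2]

theorem endo_mul_mem (A : Superspace k S) {i j : ZMod 2} {f g : Module.End k S}
    (hf : f ∈ A.endo.gr i) (hg : g ∈ A.endo.gr j) : f * g ∈ A.endo.gr (i + j) := by
  rw [Superspace.mem_endo_gr] at *
  intro l x hx
  have := hf _ _ (hg l x hx)
  rwa [add_assoc, add_comm j i] at this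

/-- The supercommutator of homogeneous elements of the triality Lie superalgebra lies in it. -/
theorem supercomm_mem (A : FormedSuperalgebra k S) {i j : ZMod 2} {d e : ZMod 3 → Module.End k S}
    (hd : d ∈ A.triPart i) (he : e ∈ A.triPart j) :
    d * e - sgn k (i * j) • (e * d) ∈ A.triPart (i + j) := by
  have sc : sgn k (j * i) = sgn k (i * j) := by rw [mul_comm]
  refine ⟨fun m => ⟨?_, fun l x hx y => ?_⟩, fun l x hx y => ?_⟩
  · exact Submodule.sub_mem _ (endo_mul_mem _ (hd.1 m).1 (he.1 m).1)
      (Submodule.smul_mem _ _ (add_comm j i ▸ endo_mul_mem _ (he.1 m).1 (hd.1 m).1))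
  · have hd1 := (hd.1 m).2 _ _ (Superspace.mem_endo_gr.1 (he.1 m).1 l x hx) y
    have hd2 := (hd.1 m).2 _ _ hx (e m y)
    have he1 := (he.1 m).2 _ _ (Superspace.mem_endo_gr.1 (hd.1 m).1 l x hx) y
    have he2 := (he.1 m).2 _ _ hx (d m y)
    have s1 := sgn_mul_self (k := k) (i * j)
    simp only [mul_add, add_mul, sgn_add, sc] at hd1 hd2 he1 he2 ⊢
    simp only [Pi.sub_apply, Pi.mul_apply, Pi.smul_apply, LinearMap.sub_apply,
      LinearMap.smul_apply, Module.End.mul_apply, map_sub, map_smul, smul_eq_mul]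
    linear_combination hd1 - sgn k (i * j) * he1 - sgn k (i * l) * sgn k (i * j) * he2
      + sgn k (j * l) * hd2 + sgn k (j * l) * A.form (d m x) (e m y) * s1
  · have hd1 := hd.2 _ _ (Superspace.mem_endo_gr.1 (he.1 1).1 l x hx) y
    have hd2 := hd.2 _ _ hx (e 2 y)
    have he1 := he.2 _ _ (Superspace.mem_endo_gr.1 (hd.1 1).1 l x hx) y
    have he2 := he.2 _ _ hx (d 2 y)
    have s1 : sgn k (i * j) = 1 ∨ sgn k (i * j) = -1 := by unfold sgn; split_ifs <;> simp
    simp only [Pi.sub_apply, Pi.mul_apply, Pi.smul_apply, LinearMap.sub_apply,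
      LinearMap.smul_apply, Module.End.mul_apply, map_sub, map_smul, hd.2 l x hx y,
      he.2 l x hx y, map_add, hd1, hd2, he1, he2]
    simp only [mul_add, add_mul, sgn_add, sc]
    rcases s1 with s1 | s1 <;> simp only [s1] <;> module


theorem forall_zmod3 (m : ZMod 3) : m = 0 ∨ m = 1 ∨ m = 2 := by
  revert m; decide

theorem rop_mem (A : FormedSuperalgebra k S) {i : ZMod 2} {x : S} (hx : x ∈ A.gr i) :
    A.rop x ∈ A.endo.gr i := by
  rw [Superspace.mem_endo_gr]
  intro l z hz
  rw [A.rop_apply hx hz]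
  exact Submodule.smul_mem _ _ (A.mul_mem _ _ _ _ hz hx)

theorem lop_mem (A : FormedSuperalgebra k S) {i : ZMod 2} {x : S} (hx : x ∈ A.gr i) :
    A.mul x ∈ A.endo.gr i := by
  rw [Superspace.mem_endo_gr]
  intro l z hz
  exact add_comm i l ▸ A.mul_mem _ _ _ _ hx hz

theorem form_id_mem (A : FormedSuperalgebra k S) {i j : ZMod 2} {x y : S} (hx : x ∈ A.gr i)
    (hy : y ∈ A.gr j) (c : k) :
    (c * A.form x y) • (LinearMap.id : Module.End k S) ∈ A.endo.gr (i + j) := by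
  by_cases h : i = j
  · subst h
    rw [zmod2_add_self, Superspace.mem_endo_gr]
    intro l z hz
    simpa using Submodule.smul_mem _ _ hz
  · simp [A.form_even i j x y hx hy h]

theorem triple_even (A : FormedSuperalgebra k S) :
    A.IsEvenBilin A.toSuperspace A.triples A.triple := by
  intro i j x y hx hy
  refine Superspace.mem_pi_gr.2 fun m => ?_
  rcases forall_zmod3 m with rfl | rfl | rfl
  · change A.sigma x y ∈ _
    rw [Superspace.mem_endo_gr]
    intro l z hz
    rw [A.sigma_apply hx hy hz]
    refine Submodule.sub_mem _ (Submodule.smul_mem _ _ ?_) (Submodule.smul_mem _ _ ?_)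
    · by_cases h : i = l
      · subst h
        rw [zmod2_cancel_left]; exact Submodule.smul_mem _ _ hy
      · simp [A.form_even _ _ x z hx hz h]
    · by_cases h : j = l
      · subst h
        rw [zmod2_cancel_right]; exact Submodule.smul_mem _ _ hx
      · simp [A.form_even _ _ y z hy hz h]
  · exact Submodule.sub_mem _ (A.form_id_mem hx hy _) (endo_mul_mem _ (A.rop_mem hx) (A.lop_mem hy))
  · exact Submodule.sub_mem _ (A.form_id_mem hx hy _) (endo_mul_mem _ (A.lop_mem hx) (A.rop_mem hy))

/-- The space of triples of endomorphisms of `S`, triples of endomorphisms of `S'`, and elements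
`∑ ιᵢ(uᵢ)` with `uᵢ ∈ S ⊗ S'`; it contains `𝔤(S, S')`. -/
abbrev Ambient (k S S' : Type*) [Field k] [AddCommGroup S] [Module k S] [AddCommGroup S']
    [Module k S'] : Type _ :=
  (ZMod 3 → Module.End k S) × (ZMod 3 → Module.End k S') × (ZMod 3 → S ⊗[k] S')

/-- The grading of `⊕ᵢ ιᵢ(S ⊗ S')`. -/
def tensors (A : FormedSuperalgebra k S) (B : FormedSuperalgebra k S') :
    Superspace k (ZMod 3 → S ⊗[k] S') :=
  (A.tensor B.toSuperspace).pi (ZMod 3)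

/-- The grading of the ambient space. -/
def ambientSpace (A : FormedSuperalgebra k S) (B : FormedSuperalgebra k S') :
    Superspace k (Ambient k S S') :=
  A.triples.prod (B.triples.prod (A.tensors B))

/-- `(d₀, d₁, d₂) · ιᵢ(x ⊗ x') = ιᵢ(dᵢ(x) ⊗ x')`. -/
def actLeft (k S S' : Type*) [Field k] [AddCommGroup S] [Module k S] [AddCommGroup S']
    [Module k S'] :
    (ZMod 3 → Module.End k S) →ₗ[k] (ZMod 3 → S ⊗[k] S') →ₗ[k] (ZMod 3 → S ⊗[k] S') :=
  LinearMap.mk₂ k (fun d u i => TensorProduct.map (d i) LinearMap.id (u i))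
    (fun _ _ _ => by funext i; simp [TensorProduct.map_add_left])
    (fun _ _ _ => by funext i; simp [TensorProduct.map_smul_left])
    (fun _ _ _ => by funext i; simp)
    (fun _ _ _ => by funext i; simp)

/-- `(d'₀, d'₁, d'₂) · ιᵢ(x ⊗ x') = (-1)^{|d'ᵢ||x|} ιᵢ(x ⊗ d'ᵢ(x'))`. -/
def actRight (A : FormedSuperalgebra k S) (B : FormedSuperalgebra k S') :
    (ZMod 3 → Module.End k S') →ₗ[k] (ZMod 3 → S ⊗[k] S') →ₗ[k] (ZMod 3 → S ⊗[k] S') :=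
  LinearMap.mk₂ k (fun d u i => ∑ a, ∑ c,
      sgn k (c * a) • TensorProduct.map (A.comp a) (B.endo.comp c (d i)) (u i))
    (fun _ _ _ => by
      funext i; simp [TensorProduct.map_add_right, Finset.sum_add_distrib, smul_add])
    (fun r _ _ => by
      funext i
      simp only [Pi.smul_apply, map_smul, LinearMap.smul_apply, TensorProduct.map_smul_right,
        Finset.smul_sum]
      exact Finset.sum_congr rfl fun a _ => Finset.sum_congr rfl fun c _ => smul_comm _ r _)
    (fun _ _ _ => by funext i; simp [Finset.sum_add_distrib, smul_add])
    (fun r _ _ => by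
      funext i
      simp only [Pi.smul_apply, map_smul, Finset.smul_sum]
      exact Finset.sum_congr rfl fun a _ => Finset.sum_congr rfl fun c _ => smul_comm _ r _)

/-- `(x ⊗ x', y ⊗ y') ↦ (-1)^{|x'||y|} xy ⊗ x'y'`. -/
def tensorMul (A : FormedSuperalgebra k S) (B : FormedSuperalgebra k S') :
    S ⊗[k] S' →ₗ[k] S ⊗[k] S' →ₗ[k] S ⊗[k] S' :=
  ∑ a', ∑ c, sgn k (a' * c) •
    TensorProduct.map₂ (A.mul.compl₂ (A.comp c)) (B.mul ∘ₗ B.comp a')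

/-- The part of the bracket given by
`(ιᵢ(x ⊗ x'), ιᵢ₊₁(y ⊗ y')) ↦ (-1)^{|x'||y|} ιᵢ₊₂(xy ⊗ x'y')`. -/
def cyclicMul (A : FormedSuperalgebra k S) (B : FormedSuperalgebra k S') :
    (ZMod 3 → S ⊗[k] S') →ₗ[k] (ZMod 3 → S ⊗[k] S') →ₗ[k] (ZMod 3 → S ⊗[k] S') :=
  LinearMap.mk₂ k (fun u v m => A.tensorMul B (u (m + 1)) (v (m + 2)))
    (fun _ _ _ => by funext i; simp) (fun _ _ _ => by funext i; simp)
    (fun _ _ _ => by funext i; simp) (fun _ _ _ => by funext i; simp)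

/-- `(x ⊗ x', y ⊗ y') ↦ (-1)^{|x||x'|+|x||y'|+|y||y'|} b'(x',y') t_{x,y}`. -/
def pairLeft (A : FormedSuperalgebra k S) (B : FormedSuperalgebra k S') :
    S ⊗[k] S' →ₗ[k] S ⊗[k] S' →ₗ[k] (ZMod 3 → Module.End k S) :=
  ∑ a, ∑ a', ∑ c, ∑ c', sgn k (a * a' + a * c' + c * c') •
    (TensorProduct.map₂ (A.triple.compl₁₂ (A.comp a) (A.comp c))
      (B.form.compl₁₂ (B.comp a') (B.comp c'))).compr₂ (TensorProduct.rid k _).toLinearMap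

/-- `(x ⊗ x', y ⊗ y') ↦ (-1)^{|y||x'|} b(x,y) t'_{x',y'}`. -/
def pairRight (A : FormedSuperalgebra k S) (B : FormedSuperalgebra k S') :
    S ⊗[k] S' →ₗ[k] S ⊗[k] S' →ₗ[k] (ZMod 3 → Module.End k S') :=
  ∑ a', ∑ c, sgn k (c * a') •
    (TensorProduct.map₂ (A.form.compl₂ (A.comp c))
      (B.triple ∘ₗ B.comp a')).compr₂ (TensorProduct.lid k _).toLinearMap

/-- The bilinear map whose super-skew-symmetrization gives the bracket, except for the brackets
`[ιᵢ(S ⊗ S'), ιᵢ(S ⊗ S')]`. -/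
def halfBracket (A : FormedSuperalgebra k S) (B : FormedSuperalgebra k S') :
    Ambient k S S' →ₗ[k] Ambient k S S' →ₗ[k] Ambient k S S' :=
  LinearMap.mk₂ k (fun X Y => (X.1 * Y.1, X.2.1 * Y.2.1,
      actLeft k S S' X.1 Y.2.2 + A.actRight B X.2.1 Y.2.2 + A.cyclicMul B X.2.2 Y.2.2))
    (fun _ _ _ => by
      refine Prod.ext (by simp [add_mul]) (Prod.ext (by simp [add_mul]) ?_)
      simp only [Prod.fst_add, Prod.snd_add, map_add, LinearMap.add_apply]; abel)
    (fun _ _ _ => by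
      refine Prod.ext (by simp) (Prod.ext (by simp) ?_)
      simp)
    (fun _ _ _ => by
      refine Prod.ext (by simp [mul_add]) (Prod.ext (by simp [mul_add]) ?_)
      simp only [Prod.snd_add, map_add]; abel)
    (fun _ _ _ => by
      refine Prod.ext (by simp) (Prod.ext (by simp) ?_)
      simp)

/-- The brackets `[ιᵢ(S ⊗ S'), ιᵢ(S ⊗ S')]`:
`[ιᵢ(x ⊗ x'), ιᵢ(y ⊗ y')] = (-1)^{|x||x'|+|x||y'|+|y||y'|} b'(x',y') θⁱ(t_{x,y})
+ (-1)^{|y||x'|} b(x,y) θ'ⁱ(t'_{x',y'})`. -/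
def diagBracket (A : FormedSuperalgebra k S) (B : FormedSuperalgebra k S') :
    Ambient k S S' →ₗ[k] Ambient k S S' →ₗ[k] Ambient k S S' :=
  LinearMap.mk₂ k (fun X Y => (∑ i, theta k S i (A.pairLeft B (X.2.2 i) (Y.2.2 i)),
      ∑ i, theta k S' i (A.pairRight B (X.2.2 i) (Y.2.2 i)), 0))
    (fun _ _ _ => by simp [Finset.sum_add_distrib])
    (fun _ _ _ => by simp [Finset.smul_sum])
    (fun _ _ _ => by simp [Finset.sum_add_distrib])
    (fun _ _ _ => by simp [Finset.smul_sum])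

theorem diagBracket_apply (A : FormedSuperalgebra k S) (B : FormedSuperalgebra k S')
    (X Y : Ambient k S S') :
    A.diagBracket B X Y = (∑ i, theta k S i (A.pairLeft B (X.2.2 i) (Y.2.2 i)),
      ∑ i, theta k S' i (A.pairRight B (X.2.2 i) (Y.2.2 i)), 0) := rfl

/-- The bracket of `𝔤(S, S')`, on the ambient space. -/
def bracket (A : FormedSuperalgebra k S) (B : FormedSuperalgebra k S') :
    Ambient k S S' →ₗ[k] Ambient k S S' →ₗ[k] Ambient k S S' :=
  superSkew (A.ambientSpace B) (A.halfBracket B) + A.diagBracket B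

theorem actLeft_even (A : FormedSuperalgebra k S) (B : FormedSuperalgebra k S') {i j : ZMod 2}
    {d : ZMod 3 → Module.End k S} {u : ZMod 3 → S ⊗[k] S'} (hd : d ∈ A.triples.gr i)
    (hu : u ∈ (A.tensors B).gr j) : actLeft k S S' d u ∈ (A.tensors B).gr (i + j) := by
  refine Superspace.mem_pi_gr.2 fun m => ?_
  refine Superspace.tensor_induction (TensorProduct.map (d m) LinearMap.id)
    ((A.tensor B.toSuperspace).gr (i + j)) j ?_ (Superspace.mem_pi_gr.1 hu m)
  rintro a b rfl x hx y hy
  have := Superspace.tmul_mem (Superspace.mem_endo_gr.1 (Superspace.mem_pi_gr.1 hd m) a x hx) hy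
  rw [show i + (a + b) = a + i + b by abel]
  simpa using this

theorem actRight_even (A : FormedSuperalgebra k S) (B : FormedSuperalgebra k S') {i j : ZMod 2}
    {d : ZMod 3 → Module.End k S'} {u : ZMod 3 → S ⊗[k] S'} (hd : d ∈ B.triples.gr i)
    (hu : u ∈ (A.tensors B).gr j) : A.actRight B d u ∈ (A.tensors B).gr (i + j) := by
  refine Superspace.mem_pi_gr.2 fun m => ?_
  change ∑ a, ∑ c, sgn k (c * a) • TensorProduct.map (A.comp a) (B.endo.comp c (d m)) (u m) ∈ _
  refine Submodule.sum_mem _ fun a _ => Submodule.sum_mem _ fun c _ => Submodule.smul_mem _ _ ?_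
  refine Superspace.tensor_induction (TensorProduct.map (A.comp a) (B.endo.comp c (d m)))
    ((A.tensor B.toSuperspace).gr (i + j)) j ?_ (Superspace.mem_pi_gr.1 hu m)
  rintro a b rfl x hx y hy
  have hdm := Superspace.mem_pi_gr.1 hd m
  have := Superspace.tmul_mem hx (Superspace.mem_endo_gr.1 hdm b y hy)
  rw [TensorProduct.map_tmul, Superspace.comp_of_mem hx, Superspace.comp_of_mem hdm,
    show i + (a + b) = a + (b + i) by abel]
  split_ifs <;> simp [this]

theorem tensorMul_even (A : FormedSuperalgebra k S) (B : FormedSuperalgebra k S') :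
    (A.tensor B.toSuperspace).IsEvenBilin (A.tensor B.toSuperspace) (A.tensor B.toSuperspace)
      (A.tensorMul B) := by
  intro i j u v hu hv
  refine Superspace.tensor_induction ((A.tensorMul B).flip v)
    ((A.tensor B.toSuperspace).gr (i + j)) i ?_ hu
  rintro a a' rfl x hx x' hx'
  refine Superspace.tensor_induction (A.tensorMul B (x ⊗ₜ x'))
    ((A.tensor B.toSuperspace).gr (a + a' + j)) j ?_ hv
  rintro c c' rfl y hy y' hy'
  simp only [tensorMul, LinearMap.sum_apply, LinearMap.smul_apply, TensorProduct.map₂_apply_tmul,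
    TensorProduct.map_tmul]
  refine Submodule.sum_mem _ fun p _ => Submodule.sum_mem _ fun q _ => Submodule.smul_mem _ _ ?_
  rw [show a + a' + (c + c') = (a + c) + (a' + c') by abel]
  have := Superspace.tmul_mem (A.mul_mem _ _ _ _ hx hy) (B.mul_mem _ _ _ _ hx' hy')
  simp only [LinearMap.compl₂_apply, LinearMap.comp_apply, Superspace.comp_of_mem hy,
    Superspace.comp_of_mem hx']
  split_ifs <;> simp [this]

theorem pairLeft_even (A : FormedSuperalgebra k S) (B : FormedSuperalgebra k S') {i j : ZMod 2}
    {u v : S ⊗[k] S'} (hu : u ∈ (A.tensor B.toSuperspace).gr i)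
    (hv : v ∈ (A.tensor B.toSuperspace).gr j) : A.pairLeft B u v ∈ A.triples.gr (i + j) := by
  refine Superspace.tensor_induction ((A.pairLeft B).flip v) (A.triples.gr (i + j)) i ?_ hu
  rintro a a' rfl x hx x' hx'
  refine Superspace.tensor_induction (A.pairLeft B (x ⊗ₜ x')) (A.triples.gr (a + a' + j)) j ?_ hv
  rintro c c' rfl y hy y' hy'
  simp only [pairLeft, LinearMap.sum_apply, LinearMap.smul_apply, TensorProduct.map₂_apply_tmul,
    TensorProduct.map_tmul,
    LinearMap.compr₂_apply]
  refine Submodule.sum_mem _ fun p _ => Submodule.sum_mem _ fun p' _ => Submodule.sum_mem _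
    fun q _ => Submodule.sum_mem _ fun q' _ => Submodule.smul_mem _ _ ?_
  simp only [LinearMap.compl₁₂_apply, LinearEquiv.coe_coe, TensorProduct.rid_tmul,
    Superspace.comp_of_mem hx, Superspace.comp_of_mem hx', Superspace.comp_of_mem hy,
    Superspace.comp_of_mem hy']
  by_cases h : a' = c'
  · subst h
    rw [zmod2_cancel₂]
    refine Submodule.smul_mem _ _ ?_
    have := A.triple_even _ _ _ _ hx hy
    split_ifs <;> simp [this]
  · have := B.form_even _ _ _ _ hx' hy' h
    split_ifs <;> simp [this]

theorem pairRight_even (A : FormedSuperalgebra k S) (B : FormedSuperalgebra k S') {i j : ZMod 2}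
    {u v : S ⊗[k] S'} (hu : u ∈ (A.tensor B.toSuperspace).gr i)
    (hv : v ∈ (A.tensor B.toSuperspace).gr j) : A.pairRight B u v ∈ B.triples.gr (i + j) := by
  refine Superspace.tensor_induction ((A.pairRight B).flip v) (B.triples.gr (i + j)) i ?_ hu
  rintro a a' rfl x hx x' hx'
  refine Superspace.tensor_induction (A.pairRight B (x ⊗ₜ x')) (B.triples.gr (a + a' + j)) j ?_ hv
  rintro c c' rfl y hy y' hy'
  simp only [pairRight, LinearMap.sum_apply, LinearMap.smul_apply, TensorProduct.map₂_apply_tmul,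
    TensorProduct.map_tmul,
    LinearMap.compr₂_apply]
  refine Submodule.sum_mem _ fun p _ => Submodule.sum_mem _ fun q _ => Submodule.smul_mem _ _ ?_
  simp only [LinearMap.compl₂_apply, LinearMap.comp_apply, LinearEquiv.coe_coe,
    TensorProduct.lid_tmul, Superspace.comp_of_mem hx', Superspace.comp_of_mem hy]
  by_cases h : a = c
  · subst h
    rw [zmod2_cancel₃]
    refine Submodule.smul_mem _ _ ?_
    have := B.triple_even _ _ _ _ hx' hy'
    split_ifs <;> simp [this]
  · have := A.form_even _ _ _ _ hx hy h
    split_ifs <;> simp [this]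

theorem theta_even (A : FormedSuperalgebra k S) {j : ZMod 2} {d : ZMod 3 → Module.End k S}
    (hd : d ∈ A.triples.gr j) (i : ZMod 3) : theta k S i d ∈ A.triples.gr j :=
  Superspace.mem_pi_gr.2 fun m => Superspace.mem_pi_gr.1 hd (m - i)

theorem triples_mul_mem (A : FormedSuperalgebra k S) {i j : ZMod 2}
    {d e : ZMod 3 → Module.End k S} (hd : d ∈ A.triples.gr i) (he : e ∈ A.triples.gr j) :
    d * e ∈ A.triples.gr (i + j) :=
  Superspace.mem_pi_gr.2 fun m =>
    endo_mul_mem _ (Superspace.mem_pi_gr.1 hd m) (Superspace.mem_pi_gr.1 he m)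

theorem bracket_even (A : FormedSuperalgebra k S) (B : FormedSuperalgebra k S') :
    (A.ambientSpace B).IsEvenBilin (A.ambientSpace B) (A.ambientSpace B) (A.bracket B) := by
  intro i j X Y hX hY
  refine Submodule.add_mem _ (superSkew_even ?_ i j X Y hX hY) ?_
  · intro i j X Y hX hY
    obtain ⟨h1, h2⟩ := Superspace.mem_prod_gr.1 hX
    obtain ⟨h2, h3⟩ := Superspace.mem_prod_gr.1 h2
    obtain ⟨g1, g2⟩ := Superspace.mem_prod_gr.1 hY
    obtain ⟨g2, g3⟩ := Superspace.mem_prod_gr.1 g2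
    refine Superspace.mem_prod_gr.2 ⟨A.triples_mul_mem h1 g1,
      Superspace.mem_prod_gr.2 ⟨B.triples_mul_mem h2 g2, ?_⟩⟩
    refine Submodule.add_mem _ (Submodule.add_mem _ (A.actLeft_even B h1 g3)
      (A.actRight_even B h2 g3)) (Superspace.mem_pi_gr.2 fun m => ?_)
    exact A.tensorMul_even B _ _ _ _ (Superspace.mem_pi_gr.1 h3 _) (Superspace.mem_pi_gr.1 g3 _)
  · obtain ⟨h1, h2⟩ := Superspace.mem_prod_gr.1 hX
    obtain ⟨h2, h3⟩ := Superspace.mem_prod_gr.1 h2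
    obtain ⟨g1, g2⟩ := Superspace.mem_prod_gr.1 hY
    obtain ⟨g2, g3⟩ := Superspace.mem_prod_gr.1 g2
    rw [diagBracket_apply]
    refine Superspace.mem_prod_gr.2 ⟨?_, Superspace.mem_prod_gr.2 ⟨?_, Submodule.zero_mem _⟩⟩
    · change ∑ i, theta k S i (A.pairLeft B (X.2.2 i) (Y.2.2 i)) ∈ _
      exact Submodule.sum_mem _ fun m _ => A.theta_even (A.pairLeft_even B
        (Superspace.mem_pi_gr.1 h3 m) (Superspace.mem_pi_gr.1 g3 m)) m
    · change ∑ i, theta k S' i (A.pairRight B (X.2.2 i) (Y.2.2 i)) ∈ _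
      exact Submodule.sum_mem _ fun m _ => B.theta_even (A.pairRight_even B
        (Superspace.mem_pi_gr.1 h3 m) (Superspace.mem_pi_gr.1 g3 m)) m

/-- The ambient space with the bracket, as a superalgebra. -/
def ambientAlgebra (A : FormedSuperalgebra k S) (B : FormedSuperalgebra k S') :
    Superalgebra k (Ambient k S S') where
  toSuperspace := A.ambientSpace B
  mul := A.bracket B
  mul_mem := A.bracket_even B

/-- The space `𝔤(S, S') = (𝔱𝔯𝔦(S) ⊕ 𝔱𝔯𝔦(S')) ⊕ (⊕ᵢ ιᵢ(S ⊗ S'))`. -/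
def magicSubmodule (A : FormedSuperalgebra k S) (B : FormedSuperalgebra k S') :
    Submodule k (Ambient k S S') :=
  A.tri.prod (B.tri.prod ⊤)

/-- The property that the triples `θⁱ(t_{x,y})` belong to the triality Lie superalgebra (true for
every symmetric composition superalgebra), needed for `𝔤(S, S')` to be closed under the bracket. -/
def HasTriality (A : FormedSuperalgebra k S) : Prop :=
  ∀ (i : ZMod 3) (x y : S), theta k S i (A.triple x y) ∈ A.tri

theorem theta_pairLeft_mem (A : FormedSuperalgebra k S) (B : FormedSuperalgebra k S')
    (hA : A.HasTriality) (i : ZMod 3) (u v : S ⊗[k] S') :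
    theta k S i (A.pairLeft B u v) ∈ A.tri := by
  induction u with
  | zero => simp
  | add u u' hu hu' => simp only [map_add, LinearMap.add_apply]; exact Submodule.add_mem _ hu hu'
  | tmul x x' =>
    induction v with
    | zero => simp
    | add u u' hu hu' => simp only [map_add]; exact Submodule.add_mem _ hu hu'
    | tmul y y' =>
      simp only [pairLeft, LinearMap.sum_apply, LinearMap.smul_apply,
        TensorProduct.map₂_apply_tmul,
    TensorProduct.map_tmul, LinearMap.compr₂_apply, map_sum, map_smul,
        LinearEquiv.coe_coe, TensorProduct.rid_tmul, LinearMap.compl₁₂_apply]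
      exact Submodule.sum_mem _ fun p _ => Submodule.sum_mem _ fun p' _ => Submodule.sum_mem _
        fun q _ => Submodule.sum_mem _ fun q' _ => Submodule.smul_mem _ _
          (Submodule.smul_mem _ _ (hA i _ _))

theorem theta_pairRight_mem (A : FormedSuperalgebra k S) (B : FormedSuperalgebra k S')
    (hB : B.HasTriality) (i : ZMod 3) (u v : S ⊗[k] S') :
    theta k S' i (A.pairRight B u v) ∈ B.tri := by
  induction u with
  | zero => simp
  | add u u' hu hu' => simp only [map_add, LinearMap.add_apply]; exact Submodule.add_mem _ hu hu'
  | tmul x x' =>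
    induction v with
    | zero => simp
    | add u u' hu hu' => simp only [map_add]; exact Submodule.add_mem _ hu hu'
    | tmul y y' =>
      simp only [pairRight, LinearMap.sum_apply, LinearMap.smul_apply,
        TensorProduct.map₂_apply_tmul,
    TensorProduct.map_tmul, LinearMap.compr₂_apply, map_sum, map_smul,
        LinearEquiv.coe_coe, TensorProduct.lid_tmul, LinearMap.comp_apply]
      exact Submodule.sum_mem _ fun p _ => Submodule.sum_mem _ fun q _ => Submodule.smul_mem _ _
          (Submodule.smul_mem _ _ (hB i _ _))

theorem bracket_mem (A : FormedSuperalgebra k S) (B : FormedSuperalgebra k S')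
    (hA : A.HasTriality) (hB : B.HasTriality) (X : Ambient k S S') (hX : X ∈ A.magicSubmodule B)
    (Y : Ambient k S S') (hY : Y ∈ A.magicSubmodule B) :
    A.bracket B X Y ∈ A.magicSubmodule B := by
  obtain ⟨h1, h2, -⟩ := hX
  obtain ⟨g1, g2, -⟩ := hY
  have hl : ∑ i, theta k S i (A.pairLeft B (X.2.2 i) (Y.2.2 i)) ∈ A.tri :=
    Submodule.sum_mem _ fun i _ => A.theta_pairLeft_mem B hA i _ _
  have hr : ∑ i, theta k S' i (A.pairRight B (X.2.2 i) (Y.2.2 i)) ∈ B.tri :=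
    Submodule.sum_mem _ fun i _ => A.theta_pairRight_mem B hB i _ _
  refine Submodule.add_mem _ ?_ (diagBracket_apply A B X Y ▸ ⟨hl, hr, trivial⟩)
  rw [superSkew_apply]
  refine Submodule.sum_mem _ fun a _ => Submodule.sum_mem _ fun c _ => ?_
  simp only [ambientSpace, Superspace.prod_comp]
  refine ⟨?_, ?_, trivial⟩
  · exact A.triPart_le_tri _ (A.supercomm_mem (A.comp_mem_triPart h1 a) (A.comp_mem_triPart g1 c))
  · exact B.triPart_le_tri _ (B.supercomm_mem (B.comp_mem_triPart h2 a) (B.comp_mem_triPart g2 c))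

/-- The superalgebra `𝔤(S, S')`. -/
def magic (A : FormedSuperalgebra k S) (B : FormedSuperalgebra k S')
    (hA : A.HasTriality) (hB : B.HasTriality) : Superalgebra k (A.magicSubmodule B) :=
  (A.ambientAlgebra B).restrict (A.magicSubmodule B)
    (fun X hX => by
      obtain ⟨h1, h2, -⟩ := hX
      have e : (A.ambientAlgebra B).odd X = (A.ambientSpace B).comp 1 X :=
        ((A.ambientSpace B).comp_one X).symm
      rw [e, ambientSpace, Superspace.prod_comp, Superspace.prod_comp]
      exact ⟨A.triPart_le_tri _ (A.comp_mem_triPart h1 1),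
        B.triPart_le_tri _ (B.comp_mem_triPart h2 1), trivial⟩)
    (A.bracket_mem B hA hB)

end FormedSuperalgebra

/-! ## The symmetric composition superalgebra `S_{1,2}` -/

namespace FormedSuperalgebra

variable {k S : Type*} [Field k] [AddCommGroup S] [Module k S]

/-- The map `x ↦ x̄ = b(x, e) e - x`. -/
def conj (A : FormedSuperalgebra k S) (e : S) : S →ₗ[k] S :=
  (A.form.flip e).smulRight e - LinearMap.id

/-- The para-Hurwitz superalgebra of a Hurwitz superalgebra with unit `e`: the same norm, and the
product `x • y = x̄ ȳ`. -/
def para (A : FormedSuperalgebra k S) (e : S) (he : e ∈ A.gr 0) : FormedSuperalgebra k S where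
  toSuperspace := A.toSuperspace
  mul := A.mul.compl₁₂ (A.conj e) (A.conj e)
  mul_mem i j x y hx hy := by
    have key : ∀ i, ∀ x ∈ A.gr i, A.conj e x ∈ A.gr i := by
      intro i x hx
      refine Submodule.sub_mem _ ?_ hx
      by_cases h : i = 0
      · subst h; exact Submodule.smul_mem _ _ he
      · have : A.form x e = 0 := A.form_even i 0 x e hx he h
        simp [this]
    exact A.mul_mem i j _ _ (key i x hx) (key j y hy)
  form := A.form
  form_even := A.form_even

end FormedSuperalgebra

/-- A two-dimensional vector space with a nonzero alternating bilinear form. -/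
structure SymplecticPlane (k V : Type*) [Field k] [AddCommGroup V] [Module k V] where
  form : V →ₗ[k] V →ₗ[k] k
  alt : ∀ v, form v v = 0
  ne_zero : form ≠ 0
  finrank_eq : Module.finrank k V = 2

namespace SymplecticPlane

variable {k V : Type*} [Field k] [AddCommGroup V] [Module k V]

theorem anti (ω : SymplecticPlane k V) (u v : V) : ω.form u v = - ω.form v u := by
  have h := ω.alt (u + v)
  simp only [map_add, LinearMap.add_apply, ω.alt] at h
  linear_combination h

theorem cyclic (ω : SymplecticPlane k V) (u v w : V) :
    ω.form u v • w + ω.form v w • u + ω.form w u • v = 0 := by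
  have : FiniteDimensional k V := Module.finite_of_finrank_eq_succ ω.finrank_eq
  let b := Module.finBasisOfFinrankEq k V ω.finrank_eq
  have hb : ∀ x, ∃ p q : k, x = p • b 0 + q • b 1 := fun x =>
    ⟨b.repr x 0, b.repr x 1, by conv_lhs => rw [← b.sum_repr x, Fin.sum_univ_two]⟩
  obtain ⟨p, q, rfl⟩ := hb u
  obtain ⟨p', q', rfl⟩ := hb v
  obtain ⟨p'', q'', rfl⟩ := hb w
  simp only [map_add, LinearMap.add_apply, map_smul, LinearMap.smul_apply, ω.alt,
    ω.anti (b 1) (b 0), smul_eq_mul]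
  module

/-- The superspace `k1 ⊕ V`, with even part `k1` and odd part `V`. -/
def space (k V : Type*) [Field k] [AddCommGroup V] [Module k V] : Superspace k (k × V) where
  odd := LinearMap.inr k k V ∘ₗ LinearMap.snd k k V
  odd_odd x := by simp

theorem mem_gr_zero {x : k × V} : x ∈ (space k V).gr 0 ↔ x.2 = 0 := by
  rw [Superspace.mem_gr, Superspace.comp_zero]
  simp [space, Prod.ext_iff, eq_comm]

theorem mem_gr_one {x : k × V} : x ∈ (space k V).gr 1 ↔ x.1 = 0 := by
  rw [Superspace.mem_gr, Superspace.comp_one]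
  simp [space, Prod.ext_iff, eq_comm]

/-- The superalgebra `B(1,2) = k1 ⊕ V`, with unit `1`, `uv = ⟨u|v⟩ 1` for `u, v ∈ V`, and norm given
by `q(1) = 1` (so that `b(1,1) = 2`) and `b(u,v) = ⟨u|v⟩`. -/
def hurwitz (ω : SymplecticPlane k V) : FormedSuperalgebra k (k × V) where
  toSuperspace := space k V
  mul := LinearMap.mk₂ k
    (fun x y => (x.1 * y.1 + ω.form x.2 y.2, x.1 • y.2 + y.1 • x.2))
    (fun x x' y => by ext <;> simp <;> first | ring1 | module)
    (fun r x y => by ext <;> simp <;> first | ring1 | module)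
    (fun x y y' => by ext <;> simp <;> first | ring1 | module)
    (fun r x y => by ext <;> simp <;> first | ring1 | module)
  mul_mem i j x y hx hy := by
    rcases zmod2_cases i with rfl | rfl <;> rcases zmod2_cases j with rfl | rfl <;>
      simp only [add_zero, zero_add, one_add_one_zmod2, mem_gr_zero, mem_gr_one] at hx hy ⊢ <;>
      simp [hx, hy]
  form := LinearMap.mk₂ k (fun x y => 2 * (x.1 * y.1) + ω.form x.2 y.2)
    (fun x x' y => by simp; ring) (fun r x y => by simp; ring)
    (fun x y y' => by simp; ring) (fun r x y => by simp; ring)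
  form_even i j x y hx hy hij := by
    rcases zmod2_cases i with rfl | rfl <;> rcases zmod2_cases j with rfl | rfl <;>
      simp only [mem_gr_zero, mem_gr_one] at hx hy <;> simp_all

/-- The para-Hurwitz superalgebra `S_{1,2}` of `B(1,2)`. -/
def S12 (ω : SymplecticPlane k V) : FormedSuperalgebra k (k × V) :=
  ω.hurwitz.para (1, 0) (mem_gr_zero.2 rfl)

theorem S12_mul (ω : SymplecticPlane k V) (x y : k × V) :
    ω.S12.mul x y = (x.1 * y.1 + ω.form x.2 y.2, -(x.1 • y.2 + y.1 • x.2)) := by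
  ext
  · simp [S12, hurwitz, FormedSuperalgebra.para, FormedSuperalgebra.conj]; ring
  · simp [S12, hurwitz, FormedSuperalgebra.para, FormedSuperalgebra.conj]; module

theorem S12_form (ω : SymplecticPlane k V) (x y : k × V) :
    ω.S12.form x y = 2 * (x.1 * y.1) + ω.form x.2 y.2 := rfl

theorem S12_comp (ω : SymplecticPlane k V) (i : ZMod 2) (x : k × V) :
    ω.S12.comp i x = if i = 0 then (x.1, 0) else (0, x.2) := by
  change (space k V).comp i x = _
  rcases zmod2_cases i with rfl | rfl
  · rw [Superspace.comp_zero]; ext <;> simp [space]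
  · rw [Superspace.comp_one]; simp [space]

theorem S12_sigma (ω : SymplecticPlane k V) (x y z : k × V) :
    ω.S12.sigma x y z = (y.1 * ω.form x.2 z.2 - x.1 * ω.form y.2 z.2,
      (2 * (z.1 * x.1)) • y.2 - (2 * (z.1 * y.1)) • x.2 - ω.form x.2 z.2 • y.2
        - ω.form y.2 z.2 • x.2) := by
  ext
  · simp [FormedSuperalgebra.sigma, sum_zmod2, S12_comp, S12_form, sgn, one_add_one_zmod2]; ring_nf
  · simp [FormedSuperalgebra.sigma, sum_zmod2, S12_comp, S12_form, sgn, one_add_one_zmod2]; module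

theorem S12_rop (ω : SymplecticPlane k V) (x z : k × V) :
    ω.S12.rop x z = (z.1 * x.1 - ω.form z.2 x.2, -(z.1 • x.2 + x.1 • z.2)) := by
  ext
  · simp [FormedSuperalgebra.rop, sum_zmod2, S12_comp, S12_mul, sgn]; ring_nf
  · simp [FormedSuperalgebra.rop, sum_zmod2, S12_comp, S12_mul, sgn]

theorem S12_triple [CharP k 3] (ω : SymplecticPlane k V) (x y : k × V) (m : ZMod 3) :
    ω.S12.triple x y m = ω.S12.sigma x y := by
  have h3 : (3 : k) = 0 := by exact_mod_cast CharP.cast_eq_zero k 3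
  have h2 : (2 : k)⁻¹ = -1 := by
    refine inv_eq_of_mul_eq_one_right ?_
    linear_combination -h3
  obtain ⟨r, u⟩ := x
  obtain ⟨s, v⟩ := y
  have hu : (3 : k) • u = 0 := by rw [h3, zero_smul]
  have hv : (3 : k) • v = 0 := by rw [h3, zero_smul]
  rcases FormedSuperalgebra.forall_zmod3 m with rfl | rfl | rfl
  · rfl
  · change ((2 : k)⁻¹ * _) • LinearMap.id - ω.S12.rop (r, u) ∘ₗ ω.S12.mul (s, v) = _
    refine LinearMap.ext fun z => ?_
    obtain ⟨t, w⟩ := z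
    have hw : (3 : k) • w = 0 := by rw [h3, zero_smul]
    have hc := ω.cyclic u v w
    rw [ω.anti w u] at hc
    rw [S12_sigma]
    ext
    · simp [S12_rop, S12_mul, S12_form, h2]
      rw [ω.anti w u, ω.anti v u]
      linear_combination (-r * s * t) * h3
    · simp [S12_rop, S12_mul, S12_form, h2]
      linear_combination (norm := module) (-1 : k) • hc + (ω.form v w) • hu - (r * s) • hw - (r * t) • hv + (t * s) • hu
  · change ((2 : k)⁻¹ * _) • LinearMap.id - ω.S12.mul (r, u) ∘ₗ ω.S12.rop (s, v) = _
    refine LinearMap.ext fun z => ?_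
    obtain ⟨t, w⟩ := z
    have hw : (3 : k) • w = 0 := by rw [h3, zero_smul]
    have hc := ω.cyclic u v w
    rw [ω.anti w u] at hc
    rw [S12_sigma]
    ext
    · simp [S12_rop, S12_mul, S12_form, h2]
      rw [ω.anti w v]
      linear_combination (-r * s * t) * h3
    · simp [S12_rop, S12_mul, S12_form, h2]
      rw [ω.anti w v]
      linear_combination (norm := module) (-1 : k) • hc + (ω.form v w) • hu - (r * s) • hw - (r * t) • hv + (t * s) • hu

theorem S12_sigma_mem [CharP k 3] (ω : SymplecticPlane k V) {a c : ZMod 2} {x y : k × V}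
    (hx : x ∈ ω.S12.gr a) (hy : y ∈ ω.S12.gr c) :
    (fun _ => ω.S12.sigma x y : ZMod 3 → Module.End k (k × V)) ∈ ω.S12.triPart (a + c) := by
  have h3 : (3 : k) = 0 := by exact_mod_cast CharP.cast_eq_zero k 3
  have h3V : ∀ v : V, (3 : k) • v = 0 := fun v => by rw [h3, zero_smul]
  have hc : ∀ u v w : V, ω.form u v • w + ω.form v w • u - ω.form u w • v = 0 := fun u v w => by
    have := ω.cyclic u v w
    rw [ω.anti w u] at this
    rw [← this]; module
  refine ⟨fun _ => ⟨Superspace.mem_pi_gr.1 (ω.S12.triple_even a c x y hx hy) 0,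
    fun j z hz z' => ?_⟩, fun j z hz z' => ?_⟩
  · change x ∈ (space k V).gr a at hx
    change y ∈ (space k V).gr c at hy
    change z ∈ (space k V).gr j at hz
    obtain ⟨r, u⟩ := x
    obtain ⟨s, v⟩ := y
    obtain ⟨t, w⟩ := z
    obtain ⟨t', w'⟩ := z'
    rcases zmod2_cases a with rfl | rfl <;> rcases zmod2_cases c with rfl | rfl <;>
      rcases zmod2_cases j with rfl | rfl <;>
      simp only [mem_gr_zero, mem_gr_one] at hx hy hz <;> subst hx hy hz <;>
      simp [S12_form, S12_sigma, sgn, one_add_one_zmod2] <;>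
      first
      | ring1
      | (rw [ω.anti w v]; ring1)
      | (rw [ω.anti w u]; ring1)
      | (rw [ω.anti w v, ω.anti w u]; ring1)
  · change x ∈ (space k V).gr a at hx
    change y ∈ (space k V).gr c at hy
    change z ∈ (space k V).gr j at hz
    obtain ⟨r, u⟩ := x
    obtain ⟨s, v⟩ := y
    obtain ⟨t, w⟩ := z
    obtain ⟨t', w'⟩ := z'
    rcases zmod2_cases a with rfl | rfl <;> rcases zmod2_cases c with rfl | rfl <;>
      rcases zmod2_cases j with rfl | rfl <;>
      simp only [mem_gr_zero, mem_gr_one] at hx hy hz <;> subst hx hy hz <;> ext <;>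
      simp [S12_mul, S12_sigma, sgn, one_add_one_zmod2] <;>
      first
      | ring1
      | (rw [ω.anti w v]; ring1)
      | (rw [ω.anti w u]; ring1)
      | (rw [ω.anti w v, ω.anti w u]; ring1)
      | module
      | linear_combination (norm := module) (2 * t * t' * r) • h3V v
      | linear_combination (norm := module) (-(2 * t * t' * s)) • h3V u
      | linear_combination (norm := module) (-r) • hc v w w' + (r * ω.form w w') • h3V v
      | linear_combination (norm := module) s • hc u w w' - (s * ω.form w w') • h3V u

theorem S12_hasTriality [CharP k 3] (ω : SymplecticPlane k V) : ω.S12.HasTriality := by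
  intro i x y
  have e : FormedSuperalgebra.theta k (k × V) i (ω.S12.triple x y)
      = fun _ => ω.S12.sigma x y := by
    funext m
    exact ω.S12_triple x y (m - i)
  rw [e]
  have e2 : (fun _ => ω.S12.sigma x y : ZMod 3 → Module.End k (k × V))
      = ∑ a, ∑ c, fun _ => ω.S12.sigma (ω.S12.comp a x) (ω.S12.comp c y) := by
    funext m
    conv_lhs => rw [← ω.S12.sum_comp x, ← ω.S12.sum_comp y]
    simp only [map_sum, LinearMap.sum_apply, Finset.sum_apply]
    exact Finset.sum_comm
  rw [e2]
  exact Submodule.sum_mem _ fun a _ => Submodule.sum_mem _ fun c _ =>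
    ω.S12.triPart_le_tri _ (ω.S12_sigma_mem (ω.S12.comp_mem a x) (ω.S12.comp_mem c y))

end SymplecticPlane

/-- The superalgebra `𝔤(S_{1,2}, S_{1,2})`. -/
def gS12S12 {k V : Type*} [Field k] [CharP k 3] [AddCommGroup V] [Module k V]
    (ω : SymplecticPlane k V) : Superalgebra k (ω.S12.magicSubmodule ω.S12) :=
  ω.S12.magic ω.S12 ω.S12_hasTriality ω.S12_hasTriality

/-! ## Contragredient Lie superalgebras -/

/-- The parity of a nonassociative word, given the parities of the letters. -/
def wordParity {X : Type*} (par : X → ZMod 2) : FreeMagma X → ZMod 2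
  | FreeMagma.of x => par x
  | FreeMagma.mul a b => wordParity par a + wordParity par b

/-- The degree of a nonassociative word, given the degrees of the letters. -/
def wordDegree {X : Type*} (deg : X → ℤ) : FreeMagma X → ℤ
  | FreeMagma.of x => deg x
  | FreeMagma.mul a b => wordDegree deg a + wordDegree deg b

/-- The superspace structure of the free nonassociative algebra on letters with given parities. -/
def freeSpace (k : Type*) {X : Type*} [Field k] (par : X → ZMod 2) :
    Superspace k (FreeNonUnitalNonAssocAlgebra k X) where
  odd := (MonoidAlgebra.basis (FreeMagma X) k).constr k fun w =>
    if wordParity par w = 1 then MonoidAlgebra.basis (FreeMagma X) k w else 0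
  odd_odd x := by
    rw [← LinearMap.comp_apply]
    congr 1
    refine (MonoidAlgebra.basis (FreeMagma X) k).ext fun w => ?_
    rw [LinearMap.comp_apply, Module.Basis.constr_basis]
    split_ifs with h
    · rw [Module.Basis.constr_basis, if_pos h]
    · simp

theorem freeSpace_comp (k : Type*) {X : Type*} [Field k] (par : X → ZMod 2) (i : ZMod 2)
    (w : FreeMagma X) : (freeSpace k par).comp i (MonoidAlgebra.basis (FreeMagma X) k w) =
      if i = wordParity par w then MonoidAlgebra.basis (FreeMagma X) k w else 0 := by
  rcases zmod2_cases i with rfl | rfl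
  · rw [Superspace.comp_zero]
    simp only [freeSpace, Module.Basis.constr_basis]
    rcases zmod2_cases (wordParity par w) with h | h <;> simp [h]
  · rw [Superspace.comp_one]
    simp only [freeSpace, Module.Basis.constr_basis, eq_comm]

theorem mem_freeSpace_gr {k X : Type*} [Field k] {par : X → ZMod 2} {i : ZMod 2}
    {x : FreeNonUnitalNonAssocAlgebra k X} (hx : x ∈ (freeSpace k par).gr i) :
    x ∈ Submodule.span k {y | ∃ w, wordParity par w = i ∧
      y = MonoidAlgebra.basis (FreeMagma X) k w} := by
  obtain ⟨x, rfl⟩ := hx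
  have hx := (MonoidAlgebra.basis (FreeMagma X) k).mem_span x
  induction hx using Submodule.span_induction with
  | zero => simp
  | add a b _ _ ha hb => rw [map_add]; exact Submodule.add_mem _ ha hb
  | smul c a _ ha => rw [map_smul]; exact Submodule.smul_mem _ _ ha
  | mem a ha =>
    obtain ⟨w, rfl⟩ := ha
    rw [freeSpace_comp]
    split_ifs with h
    · exact Submodule.subset_span ⟨w, h.symm, rfl⟩
    · exact Submodule.zero_mem _

/-- The free nonassociative superalgebra on letters with given parities. -/
def free (k : Type*) {X : Type*} [Field k] (par : X → ZMod 2) :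
    Superalgebra k (FreeNonUnitalNonAssocAlgebra k X) where
  toSuperspace := freeSpace k par
  mul := LinearMap.mul k (FreeNonUnitalNonAssocAlgebra k X)
  mul_mem i j x y hx hy := by
    replace hx := mem_freeSpace_gr hx
    replace hy := mem_freeSpace_gr hy
    induction hx using Submodule.span_induction with
    | zero => simp
    | add a b _ _ ha hb => rw [map_add, LinearMap.add_apply]; exact Submodule.add_mem _ ha hb
    | smul c a _ ha => rw [map_smul, LinearMap.smul_apply]; exact Submodule.smul_mem _ _ ha
    | mem a ha =>
      induction hy using Submodule.span_induction with
      | zero => simp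
      | add a b _ _ ha hb => rw [map_add]; exact Submodule.add_mem _ ha hb
      | smul c a _ ha => rw [map_smul]; exact Submodule.smul_mem _ _ ha
      | mem b hb =>
        obtain ⟨w, rfl, rfl⟩ := ha
        obtain ⟨w', rfl, rfl⟩ := hb
        have e : LinearMap.mul k (FreeNonUnitalNonAssocAlgebra k X)
            (MonoidAlgebra.basis (FreeMagma X) k w) (MonoidAlgebra.basis (FreeMagma X) k w')
            = MonoidAlgebra.basis (FreeMagma X) k (w * w') := by
          simp [MonoidAlgebra.basis_apply, MonoidAlgebra.single_mul_single]
        rw [e, Superspace.mem_gr, freeSpace_comp]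
        exact if_pos rfl

/-- A realization `(𝔥, {αᵢ}, {hᵢ})` of a square matrix. -/
structure Realization {k : Type*} [Field k] {n : ℕ} (A : Matrix (Fin n) (Fin n) k)
    (h : Type*) [AddCommGroup h] [Module k h] where
  root : Fin n → Module.Dual k h
  coroot : Fin n → h
  root_indep : LinearIndependent k root
  coroot_indep : LinearIndependent k coroot
  root_coroot : ∀ i j, root j (coroot i) = A i j
  finite : Module.Finite k h
  finrank_add_rank : Module.finrank k h + A.rank = 2 * n

/-- The generators of `𝔤̃(A, τ)`: the elements of `𝔥`, the `eᵢ` and the `fᵢ`. -/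
inductive Gen (n : ℕ) (h : Type*)
  | cartan (x : h)
  | e (i : Fin n)
  | f (i : Fin n)

/-- The parities: `𝔥` is even, `eᵢ` and `fᵢ` are odd if and only if `i ∈ τ`. -/
def Gen.parity {n : ℕ} {h : Type*} (τ : Finset (Fin n)) : Gen n h → ZMod 2
  | .cartan _ => 0
  | .e i => if i ∈ τ then 1 else 0
  | .f i => if i ∈ τ then 1 else 0

/-- The degrees: `0` on `𝔥`, `1` for `eᵢ` and `-1` for `fᵢ`. -/
def Gen.degree {n : ℕ} {h : Type*} : Gen n h → ℤ
  | .cartan _ => 0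
  | .e _ => 1
  | .f _ => -1

namespace Realization

variable {k : Type*} [Field k] {n : ℕ} {A : Matrix (Fin n) (Fin n) k} {h : Type*} [AddCommGroup h]
  [Module k h]

/-- The free nonassociative superalgebra on the generators. -/
abbrev freeAlg (_ : Realization A h) (τ : Finset (Fin n)) :
    Superalgebra k (FreeNonUnitalNonAssocAlgebra k (Gen n h)) :=
  free k (Gen.parity τ)

/-- A generator, as an element of the free algebra. -/
abbrev gen (k : Type*) [Field k] {n : ℕ} {h : Type*} (x : Gen n h) :
    FreeNonUnitalNonAssocAlgebra k (Gen n h) :=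
  FreeNonUnitalNonAssocAlgebra.of k x

/-- The elements of the free algebra that vanish in `𝔤̃(A, τ)`: the identities of Lie superalgebras,
the linear relations of `𝔥`, and the relations `[eᵢ,fⱼ] = δᵢⱼ hᵢ`, `[h,h'] = 0`, `[h,eᵢ] = αᵢ(h) eᵢ`,
`[h,fᵢ] = -αᵢ(h) fᵢ`. -/
inductive Relator (R : Realization A h) (τ : Finset (Fin n)) :
    FreeNonUnitalNonAssocAlgebra k (Gen n h) → Prop
  | self_even (x) (hx : x ∈ (R.freeAlg τ).gr 0) : Relator R τ (x * x)
  | skew (i j x y) (hx : x ∈ (R.freeAlg τ).gr i) (hy : y ∈ (R.freeAlg τ).gr j) :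
      Relator R τ (x * y + sgn k (i * j) • (y * x))
  | jacobi (i j x y z) (hx : x ∈ (R.freeAlg τ).gr i) (hy : y ∈ (R.freeAlg τ).gr j) :
      Relator R τ (x * (y * z) - (x * y) * z - sgn k (i * j) • (y * (x * z)))
  | cube_odd (x) (hx : x ∈ (R.freeAlg τ).gr 1) : Relator R τ (x * (x * x))
  | cartan_add (x y : h) :
      Relator R τ (gen k (.cartan (x + y)) - gen k (.cartan x) - gen k (.cartan y))
  | cartan_smul (c : k) (x : h) :
      Relator R τ (gen k (.cartan (c • x)) - c • gen k (.cartan x))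
  | ef_same (i : Fin n) :
      Relator R τ (gen k (.e i) * gen k (.f i) - gen k (.cartan (R.coroot i)))
  | ef_ne (i j : Fin n) (hij : i ≠ j) : Relator R τ (gen k (.e i) * gen k (.f j))
  | cartan_cartan (x y : h) : Relator R τ (gen k (.cartan x) * gen k (.cartan y))
  | cartan_e (x : h) (i : Fin n) :
      Relator R τ (gen k (.cartan x) * gen k (.e i) - R.root i x • gen k (.e i))
  | cartan_f (x : h) (i : Fin n) :
      Relator R τ (gen k (.cartan x) * gen k (.f i) + R.root i x • gen k (.f i))

/-- The ideal of relations of `𝔤̃(A, τ)`. -/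
def relIdeal (R : Realization A h) (τ : Finset (Fin n)) :
    Submodule k (FreeNonUnitalNonAssocAlgebra k (Gen n h)) :=
  (R.freeAlg τ).idealSpan {x | R.Relator τ x}

/-- The underlying space of `𝔤̃(A, τ)`. -/
abbrev TildeSpace (R : Realization A h) (τ : Finset (Fin n)) : Type _ :=
  FreeNonUnitalNonAssocAlgebra k (Gen n h) ⧸ R.relIdeal τ

/-- The Lie superalgebra `𝔤̃(A, τ)` generated by `𝔥` and the `eᵢ`, `fᵢ`, subject to the relations
above. -/
def tilde (R : Realization A h) (τ : Finset (Fin n)) : Superalgebra k (R.TildeSpace τ) :=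
  (R.freeAlg τ).quot (R.relIdeal τ) ((R.freeAlg τ).isIdeal_idealSpan _)

/-- The component of degree `m` of `𝔤̃(A, τ)`. -/
def tildeDegree (R : Realization A h) (τ : Finset (Fin n)) (m : ℤ) :
    Submodule k (R.TildeSpace τ) :=
  (Submodule.span k {y | ∃ w, wordDegree Gen.degree w = m ∧
    y = MonoidAlgebra.basis (FreeMagma (Gen n h)) k w}).map (R.relIdeal τ).mkQ

/-- The ideals of `𝔤̃(A, τ)` that are homogeneous for the `ℤ`-grading and intersect `𝔥`
trivially. -/
structure IsHomogeneousAvoiding (R : Realization A h) (τ : Finset (Fin n))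
    (I : Submodule k (R.TildeSpace τ)) : Prop where
  isIdeal : (R.tilde τ).IsIdeal I
  homogeneous : I ≤ ⨆ m : ℤ, I ⊓ R.tildeDegree τ m
  avoids : ∀ x : h, (R.relIdeal τ).mkQ (gen k (.cartan x)) ∈ I →
    (R.relIdeal τ).mkQ (gen k (.cartan x)) = 0

/-- The largest homogeneous ideal `𝔦(A)` of `𝔤̃(A, τ)` that intersects `𝔥` trivially. -/
def maxIdeal (R : Realization A h) (τ : Finset (Fin n)) : Submodule k (R.TildeSpace τ) :=
  sSup {I | R.IsHomogeneousAvoiding τ I}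

/-- The contragredient Lie superalgebra `𝔤(A, τ) = 𝔤̃(A, τ) / 𝔦(A)`. -/
def contragredient (R : Realization A h) (τ : Finset (Fin n)) :
    Superalgebra k (R.TildeSpace τ ⧸ R.maxIdeal τ) :=
  (R.tilde τ).quot (R.maxIdeal τ) ((R.tilde τ).isIdeal_sSup _ fun _ hI => hI.isIdeal)

/-- The centerless derived contragredient Lie superalgebra `𝔤'(A, τ) / 𝔠`, where
`𝔤'(A, τ) = [𝔤(A, τ), 𝔤(A, τ)]` and `𝔠` is the centre of `𝔤'(A, τ)`. -/
def centerlessDerived (R : Realization A h) (τ : Finset (Fin n)) :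
    Superalgebra k
      ((R.contragredient τ).derivedSubmodule ⧸ (R.contragredient τ).derived.center) :=
  (R.contragredient τ).derived.quot _ (R.contragredient τ).derived.isIdeal_center

end Realization

/-- The matrix `A_{S_{1,2},S_{1,2}}`. -/
def cartanS12S12 (k : Type*) [Field k] : Matrix (Fin 4) (Fin 4) k :=
  !![2, -1, 0, 0; -1, 2, -1, 0; 0, -2, 2, -1; 0, 0, 1, 0]

/-! ## The orthogonal Lie algebra and its spin module -/

/-- The orthogonal Lie algebra `𝔰𝔬(W, Q)`: the endomorphisms that are skew-adjoint for the polar form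
of `Q`. -/
abbrev so {k W : Type*} [Field k] [AddCommGroup W] [Module k W] (Q : QuadraticForm k W) :
    LieSubalgebra k (Module.End k W) :=
  skewAdjointLieSubalgebra Q.polarBilin

/-- The split quadratic form `x₀² + x₁x₂ + x₃x₄ + x₅x₆` on `k⁷`; its orthogonal Lie algebra is `𝔰𝔬₇`,
of type `B₃`. -/
def splitForm7 (k : Type*) [Field k] : QuadraticForm k (Fin 7 → k) :=
  QuadraticMap.linMulLin (LinearMap.proj 0) (LinearMap.proj 0)
    + QuadraticMap.linMulLin (LinearMap.proj 1) (LinearMap.proj 2)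
    + QuadraticMap.linMulLin (LinearMap.proj 3) (LinearMap.proj 4)
    + QuadraticMap.linMulLin (LinearMap.proj 5) (LinearMap.proj 6)

/-- A representation of `𝔰𝔬(W, Q)`, with `W` of odd dimension, is the spin representation if it is the
restriction of an irreducible representation of the even Clifford algebra along the embedding
`𝔰𝔬(W, Q) → Cl₀(W, Q)`, which sends the endomorphism `z ↦ Q(y,z) x - Q(x,z) y` to `½ (xy - yx)`
(the endomorphism of `W` induced by the commutator with this element). -/
def IsSpinRep {k W M : Type*} [Field k] [AddCommGroup W] [Module k W] [AddCommGroup M] [Module k M]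
    (Q : QuadraticForm k W) (ρ : so Q →ₗ⁅k⁆ Module.End k M) : Prop :=
  ∃ φ : CliffordAlgebra.even Q →ₐ[k] Module.End k M,
    Nontrivial M ∧
    (∀ N : Submodule k M, (∀ c, ∀ m ∈ N, φ c m ∈ N) → N = ⊥ ∨ N = ⊤) ∧
    ∀ (a : so Q) (x y : W),
      (∀ z, (a : Module.End k W) z = QuadraticMap.polar Q y z • x - QuadraticMap.polar Q x z • y) →
      ρ a = φ ((2 : k)⁻¹ • ((CliffordAlgebra.even.ι Q).bilin x y
        - (CliffordAlgebra.even.ι Q).bilin y x))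

end Super

end

/-! The theorem reduces to one explicit table of structure constants over the prime field. For
`S_{1,2}` in characteristic 3 the three components of `t_{x,y}` coincide, and solving the triality
equations shows that every triality triple is constant, `(d,d,d)` with `d` in the span of the
`σ_{x,y}`, which has dimension `3|2` (`tri_le`). Hence `𝔤(S_{1,2},S_{1,2})` has dimension `5 + 5 +
27 = 37`. The constant triples and the `ιᵢ(x ⊗ y)`, for a symplectic basis of `V`, form a basis
whose brackets have coefficients in the prime field (`Label.bracket_toAmbient`).

The elements `ιᵢ(1 ⊗ 1)` multiply like the cross product, which is split because `1 + 1 + 1 = 0`.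
This gives a second basis over the prime field, made of root vectors and three Cartan elements: 21
even vectors that multiply like the `eᵢ ∧ eⱼ` of `𝔰𝔬₇`, and 8 + 8 odd vectors on which they act as
on spinors. `IsRootBasis` records this basis with its table and `exists_isRootBasis` produces it.
All four assertions about the superalgebra are then consequences of the table. Finite identities are
evaluated in the kernel on lists of coefficients modulo 3 and transferred to `k` by
`Comb.eval_eq_zero`.

Lie axioms: the elements that act as superderivations are stable under multiplication by such
elements, so the Jacobi identity is only tested with one of eight generators in front. The map `x ↦
[x,[x,x]]` is additive on the odd part and vanishes on the odd basis vectors.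

Simplicity: for the long root vector `B 7` the operator `(ad B 7)²` has rank one with image `k B 7`.
An ideal therefore contains `B 7`, which generates everything, or is killed by the coordinate of the
opposite root vector, and this coordinate generates the whole dual space (`IsRootBasis.isSimple`).

Contragredient presentation: no defining relations beyond those of `𝔤̃(A,τ)` are needed. Let
`𝔤̃(A,τ)` act on the simple algebra `L` by `ad eᵢ`, `ad fᵢ` and diagonal derivations `D(x)`, `x ∈ 𝔥`
(`IsModel`). Simplicity of `L` forces every homogeneous ideal that avoids `𝔥` to act by zero
(`le_ker`), so `𝔤(A,τ)` acts. Conversely the kernel is homogeneous and vanishes in degrees `±1`, so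
its part of nonzero degree is itself a homogeneous ideal avoiding `𝔥`. In `𝔤(A,τ)` the kernel thus
comes from `𝔥`, and it is central. The derived algebra maps onto `ad L ≅ L`, and the kernel of this
map is exactly its centre (`ker_derivedHom`). Two facts on `𝔤̃(A,τ)` enter: the ideal of relations
is homogeneous (`relIdeal_le_homRelIdeal`), and its components of degree `0`, `1`, `-1` are spanned
by `𝔥`, the `eᵢ` and the `fᵢ` (`tildeDegree_le`).

Even and odd part: creation and annihilation operators make `k⁸` a Clifford module. Half the
commutators of these operators are the matrices by which the even root vectors act on either half of
the odd part (`gamma_comm`, `mul_spinPair`), and even words in the operators give all matrix units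
up to sign, whence irreducibility. -/

noncomputable section

namespace Super

/-! ## Formal linear combinations with coefficients in the prime field -/

/-- A formal linear combination of elements of `ι`, with natural number coefficients. -/
abbrev Comb (ι : Type*) := List (ι × ℕ)

namespace Comb

variable {ι κ k L M : Type*} [Field k] [AddCommGroup L] [Module k L] [AddCommGroup M] [Module k M]

/-- The value of a formal linear combination at a family of vectors. -/
def eval (k : Type*) [Field k] [Module k L] (B : ι → L) : Comb ι → L
  | [] => 0
  | t :: ℓ => (t.2 : k) • B t.1 + eval k B ℓ

/-- A scalar multiple of a formal linear combination. -/
def scale (c : ℕ) : Comb ι → Comb ι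
  | [] => []
  | t :: ℓ => (t.1, c * t.2) :: scale c ℓ

/-- Linear substitution in a formal linear combination. -/
def bind (ℓ : Comb ι) (f : ι → Comb κ) : Comb κ :=
  match ℓ with
  | [] => []
  | t :: ℓ => scale t.2 (f t.1) ++ bind ℓ f

/-- The coefficient of an element in a formal linear combination. -/
def coeffAt [DecidableEq ι] (n : ι) : Comb ι → ℕ
  | [] => 0
  | t :: ℓ => bif decide (t.1 = n) then t.2 + coeffAt n ℓ else coeffAt n ℓ

/-- All the coefficients of a formal linear combination are divisible by three. -/
def isZero [DecidableEq ι] (ℓ : Comb ι) : Bool :=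
  ℓ.all fun t => Nat.beq (Nat.mod (coeffAt t.1 ℓ) 3) 0

/-- Two formal linear combinations have the same coefficients modulo three. -/
def eqv [DecidableEq ι] (ℓ ℓ' : Comb ι) : Bool := isZero (ℓ ++ scale 2 ℓ')

@[simp] theorem eval_nil (B : ι → L) : eval k B [] = 0 := rfl

@[simp] theorem eval_cons (B : ι → L) (t : ι × ℕ) (ℓ : Comb ι) :
    eval k B (t :: ℓ) = (t.2 : k) • B t.1 + eval k B ℓ := rfl

@[simp] theorem eval_append (B : ι → L) (ℓ ℓ' : Comb ι) :
    eval k B (ℓ ++ ℓ') = eval k B ℓ + eval k B ℓ' := by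
  induction ℓ with
  | nil => simp
  | cons t ℓ ih => simp [ih, add_assoc]

@[simp] theorem eval_scale (B : ι → L) (c : ℕ) (ℓ : Comb ι) :
    eval k B (scale c ℓ) = (c : k) • eval k B ℓ := by
  induction ℓ with
  | nil => simp [scale]
  | cons t ℓ ih => simp [scale, ih, mul_smul]

theorem map_eval (f : L →ₗ[k] M) (B : ι → L) (ℓ : Comb ι) :
    f (eval k B ℓ) = eval k (fun i => f (B i)) ℓ := by
  induction ℓ with
  | nil => simp
  | cons t ℓ ih => simp [ih]

theorem eval_congr {B B' : ι → L} {ℓ : Comb ι} (h : ∀ t ∈ ℓ, B t.1 = B' t.1) :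
    eval k B ℓ = eval k B' ℓ := by
  induction ℓ with
  | nil => rfl
  | cons t ℓ ih =>
    rw [eval_cons, eval_cons, h t (by simp), ih fun t ht => h t (by simp [ht])]

theorem eval_bind (B : κ → L) (ℓ : Comb ι) (f : ι → Comb κ) :
    eval k B (bind ℓ f) = eval k (fun i => eval k B (f i)) ℓ := by
  induction ℓ with
  | nil => rfl
  | cons t ℓ ih => simp [bind, ih]

theorem eval_map (B : κ → L) (ℓ : Comb ι) (f : ι → κ) :
    eval k B (ℓ.map fun t => (f t.1, t.2)) = eval k (fun i => B (f i)) ℓ := by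
  induction ℓ with
  | nil => rfl
  | cons t ℓ ih => simp [ih]

theorem eval_mem {B : ι → L} {ℓ : Comb ι} {N : Submodule k L} (h : ∀ t ∈ ℓ, B t.1 ∈ N) :
    eval k B ℓ ∈ N := by
  induction ℓ with
  | nil => simp
  | cons t ℓ ih =>
    exact N.add_mem (N.smul_mem _ (h t (by simp))) (ih fun t ht => h t (by simp [ht]))

/-- The same index may occur several times in a list; this collects repeated occurrences. -/
theorem eval_eq_sum [DecidableEq ι] (B : ι → L) (ℓ : Comb ι) (S : Finset ι)
    (h : ∀ t ∈ ℓ, t.1 ∈ S) : eval k B ℓ = ∑ n ∈ S, (coeffAt n ℓ : k) • B n := by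
  induction ℓ with
  | nil => simp [coeffAt]
  | cons t ℓ ih =>
    have e : ∀ n, ((coeffAt n (t :: ℓ) : ℕ) : k) • B n
        = (if n = t.1 then (t.2 : k) • B n else 0) + (coeffAt n ℓ : k) • B n := by
      intro n
      by_cases hn : t.1 = n
      · simp [coeffAt, hn, add_smul]
      · simp [coeffAt, hn, Ne.symm hn]
    rw [eval_cons, ih fun t ht => h t (by simp [ht]), Finset.sum_congr rfl fun n _ => e n,
      Finset.sum_add_distrib, Finset.sum_ite_eq', if_pos (h t (by simp))]

variable [CharP k 3]

theorem natCast_eq_zero_of_mod {n : ℕ} (h : n % 3 = 0) : (n : k) = 0 :=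
  (CharP.cast_eq_zero_iff k 3 n).2 (Nat.dvd_of_mod_eq_zero h)

/-- After collecting repeated indices every coefficient is a multiple of 3. This is the passage from
Boolean computations to identities in an arbitrary vector space over `k`. The family `B` need not be
independent. -/
theorem eval_eq_zero [DecidableEq ι] (B : ι → L) {ℓ : Comb ι} (h : isZero ℓ = true) :
    eval k B ℓ = 0 := by
  rw [eval_eq_sum B ℓ (ℓ.map Prod.fst).toFinset (fun t ht => by
    simp only [List.mem_toFinset, List.mem_map]; exact ⟨t, ht, rfl⟩)]
  refine Finset.sum_eq_zero fun n hn => ?_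
  simp only [List.mem_toFinset, List.mem_map] at hn
  obtain ⟨t, ht, rfl⟩ := hn
  rw [natCast_eq_zero_of_mod, zero_smul]
  exact Nat.eq_of_beq_eq_true (List.all_eq_true.1 h t ht)

theorem two_eq_neg_one : (2 : k) = -1 := by
  have h3 : (3 : k) = 0 := by exact_mod_cast CharP.cast_eq_zero k 3
  linear_combination h3

/-- Since `2 = -1` in `k`, scaling by 2 is negation, and natural coefficients suffice for
differences. -/
theorem eval_eq_of_eqv [DecidableEq ι] (B : ι → L) {ℓ ℓ' : Comb ι} (h : eqv ℓ ℓ' = true) :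
    eval k B ℓ = eval k B ℓ' := by
  have := eval_eq_zero (k := k) B h
  rwa [eval_append, eval_scale, Nat.cast_ofNat, two_eq_neg_one, neg_one_smul,
    ← sub_eq_add_neg, sub_eq_zero] at this

end Comb

/-- A Boolean function takes the value `true` below a bound. -/
def allBelow (n : ℕ) (f : ℕ → Bool) : Bool := (List.range n).all f

theorem of_allBelow {n : ℕ} {f : ℕ → Bool} (h : allBelow n f = true) {i : ℕ} (hi : i < n) :
    f i = true := List.all_eq_true.1 h i (List.mem_range.2 hi)

end Super

/-! ### Explicit brackets of constant triples and of the `ιᵢ(x ⊗ y)`. -/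

namespace Super

namespace FormedSuperalgebra

variable {k S S' : Type*} [Field k] [AddCommGroup S] [Module k S] [AddCommGroup S'] [Module k S']
  (A : FormedSuperalgebra k S) (B : FormedSuperalgebra k S')

/-- The constant triple `(d, d, d)` of the first factor. -/
def constLeft (k S' : Type*) [Field k] [Module k S] [AddCommGroup S'] [Module k S']
    (d : Module.End k S) : Ambient k S S' := (fun _ => d, 0, 0)

/-- The constant triple `(d, d, d)` of the second factor. -/
def constRight (k S : Type*) [Field k] [AddCommGroup S] [Module k S] [Module k S']
    (d : Module.End k S') : Ambient k S S' := (0, fun _ => d, 0)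

/-- The element `ιᵢ(w)`. -/
def iota (i : ZMod 3) (w : S ⊗[k] S') : Ambient k S S' := (0, 0, Pi.single i w)

variable {A B}

theorem constLeft_mem {a : ZMod 2} {d : Module.End k S} (hd : d ∈ A.endo.gr a) :
    constLeft k S' d ∈ (A.ambientSpace B).gr a :=
  Superspace.mem_prod_gr.2 ⟨Superspace.mem_pi_gr.2 fun _ => hd,
    Superspace.mem_prod_gr.2 ⟨Submodule.zero_mem _, Submodule.zero_mem _⟩⟩

theorem constRight_mem {a : ZMod 2} {d : Module.End k S'} (hd : d ∈ B.endo.gr a) :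
    constRight k S d ∈ (A.ambientSpace B).gr a :=
  Superspace.mem_prod_gr.2 ⟨Submodule.zero_mem _,
    Superspace.mem_prod_gr.2 ⟨Superspace.mem_pi_gr.2 fun _ => hd, Submodule.zero_mem _⟩⟩

theorem iota_mem {a : ZMod 2} {w : S ⊗[k] S'} (hw : w ∈ (A.tensor B.toSuperspace).gr a)
    (i : ZMod 3) : iota i w ∈ (A.ambientSpace B).gr a := by
  refine Superspace.mem_prod_gr.2 ⟨Submodule.zero_mem _,
    Superspace.mem_prod_gr.2 ⟨Submodule.zero_mem _, Superspace.mem_pi_gr.2 fun m => ?_⟩⟩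
  change (Pi.single i w : ZMod 3 → S ⊗[k] S') m ∈ _
  by_cases h : m = i
  · subst h; simpa using hw
  · simp [h]

/-- For homogeneous arguments a single term of the double sum in `superSkew` survives. Every bracket
formula below is obtained from this one by evaluating `halfBracket` in both orders. -/
theorem bracket_of_mem {a c : ZMod 2} {X Y : Ambient k S S'}
    (hX : X ∈ (A.ambientSpace B).gr a) (hY : Y ∈ (A.ambientSpace B).gr c) :
    A.bracket B X Y = A.halfBracket B X Y - sgn k (a * c) • A.halfBracket B Y X
      + A.diagBracket B X Y := by
  rw [bracket, LinearMap.add_apply, LinearMap.add_apply, superSkew_apply]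
  congr 1
  rw [Finset.sum_eq_single a, Finset.sum_eq_single c]
  · simp [Superspace.comp_of_mem hX, Superspace.comp_of_mem hY]
  · intro b _ hb; simp [Superspace.comp_of_mem hY, hb]
  · simp
  · intro b _ hb; simp [Superspace.comp_of_mem hX, hb]
  · simp

variable (A B)

theorem halfBracket_apply (X Y : Ambient k S S') :
    A.halfBracket B X Y = (X.1 * Y.1, X.2.1 * Y.2.1,
      actLeft k S S' X.1 Y.2.2 + A.actRight B X.2.1 Y.2.2 + A.cyclicMul B X.2.2 Y.2.2) := rfl

theorem half_left_left (d e : Module.End k S) :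
    A.halfBracket B (constLeft k S' d) (constLeft k S' e) = constLeft k S' (d * e) := by
  simp [halfBracket_apply, constLeft]; rfl

theorem half_right_right (d e : Module.End k S') :
    A.halfBracket B (constRight k S d) (constRight k S e) = constRight k S (d * e) := by
  simp [halfBracket_apply, constRight]; rfl

theorem half_left_right (d : Module.End k S) (e : Module.End k S') :
    A.halfBracket B (constLeft k S' d) (constRight k S e) = 0 := by
  simp [halfBracket_apply, constLeft, constRight]

theorem half_right_left (d : Module.End k S) (e : Module.End k S') :
    A.halfBracket B (constRight k S e) (constLeft k S' d) = 0 := by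
  simp [halfBracket_apply, constLeft, constRight]

theorem half_left_iota (d : Module.End k S) (i : ZMod 3) (w : S ⊗[k] S') :
    A.halfBracket B (constLeft k S' d) (iota i w)
      = iota i (TensorProduct.map d LinearMap.id w) := by
  simp only [halfBracket_apply, constLeft, iota, map_zero, LinearMap.zero_apply, add_zero,
    mul_zero]
  refine Prod.ext rfl (Prod.ext rfl (funext fun m => ?_))
  change TensorProduct.map d LinearMap.id ((Pi.single i w : ZMod 3 → S ⊗[k] S') m) = _
  by_cases h : m = i
  · subst h; simp
  · simp [h]

theorem half_iota_left (d : Module.End k S) (i : ZMod 3) (w : S ⊗[k] S') :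
    A.halfBracket B (iota i w) (constLeft k S' d) = 0 := by
  simp [halfBracket_apply, constLeft, iota]

theorem half_iota_right (d : Module.End k S') (i : ZMod 3) (w : S ⊗[k] S') :
    A.halfBracket B (iota i w) (constRight k S d) = 0 := by
  simp [halfBracket_apply, constRight, iota]

theorem half_right_iota {c a : ZMod 2} {d : Module.End k S'} (hd : d ∈ B.endo.gr c) {x : S}
    (hx : x ∈ A.gr a) (y : S') (i : ZMod 3) :
    A.halfBracket B (constRight k S d) (iota i (x ⊗ₜ y)) = sgn k (c * a) • iota i (x ⊗ₜ d y) := by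
  simp only [halfBracket_apply, constRight, iota, map_zero, LinearMap.zero_apply, add_zero,
    zero_add, mul_zero]
  refine Prod.ext (by simp) (Prod.ext (by simp) (funext fun m => ?_))
  change ∑ a, ∑ c, sgn k (c * a) • TensorProduct.map (A.comp a) (B.endo.comp c d)
    ((Pi.single i (x ⊗ₜ y) : ZMod 3 → S ⊗[k] S') m) = sgn k (c * a) •
    (Pi.single i (x ⊗ₜ d y) : ZMod 3 → S ⊗[k] S') m
  by_cases h : m = i
  · subst h
    rw [Finset.sum_eq_single a, Finset.sum_eq_single c]
    · simp [Superspace.comp_of_mem hx, Superspace.comp_of_mem hd]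
    · intro b _ hb; simp [Superspace.comp_of_mem hd, hb]
    · simp
    · intro b _ hb; simp [Superspace.comp_of_mem hx, hb]
    · simp
  · simp [h]

theorem half_iota_iota (i j : ZMod 3) (w z : S ⊗[k] S') :
    A.halfBracket B (iota i w) (iota j z)
      = if j = i + 1 then iota (i + 2) (A.tensorMul B w z) else 0 := by
  simp only [halfBracket_apply, iota, map_zero, LinearMap.zero_apply, add_zero, zero_add,
    mul_zero]
  have e : ∀ m, A.cyclicMul B (Pi.single i w) (Pi.single j z) m
      = A.tensorMul B ((Pi.single i w : ZMod 3 → S ⊗[k] S') (m + 1))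
        ((Pi.single j z : ZMod 3 → S ⊗[k] S') (m + 2)) := fun m => rfl
  split_ifs with h
  · subst h
    refine Prod.ext rfl (Prod.ext rfl (funext fun m => (e m).trans ?_))
    by_cases hm : m = i + 2
    -- Position `m` of the cyclic product reads positions `m + 1` and `m + 2`; modulo 3 these are
    -- `i` and `i + 1` exactly for `m = i + 2`.
    · subst hm
      rw [show i + 2 + 1 = i by generalize i = x; revert x; decide,
        show i + 2 + 2 = i + 1 by generalize i = x; revert x; decide]
      simp
    · have h1 : m + 1 ≠ i := by
        rintro rfl; exact hm (by generalize m = x; revert x; decide)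
      simp [hm, h1]
  · refine Prod.ext rfl (Prod.ext rfl (funext fun m => (e m).trans ?_))
    by_cases hm : m + 1 = i
    · have h2 : m + 2 ≠ j := by
        rintro rfl; exact h (by rw [← hm]; generalize m = x; revert x; decide)
      simp [h2]
    · simp [hm]

theorem diag_of_left_fst (d : Module.End k S) (Y : Ambient k S S') :
    A.diagBracket B (constLeft k S' d) Y = 0 := by
  simp [diagBracket_apply, constLeft]

theorem diag_of_left_snd (d : Module.End k S) (Y : Ambient k S S') :
    A.diagBracket B Y (constLeft k S' d) = 0 := by
  simp [diagBracket_apply, constLeft]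

theorem diag_of_right_fst (d : Module.End k S') (Y : Ambient k S S') :
    A.diagBracket B (constRight k S d) Y = 0 := by
  simp [diagBracket_apply, constRight]

theorem diag_of_right_snd (d : Module.End k S') (Y : Ambient k S S') :
    A.diagBracket B Y (constRight k S d) = 0 := by
  simp [diagBracket_apply, constRight]

theorem diag_iota_of_ne {i j : ZMod 3} (h : i ≠ j) (w z : S ⊗[k] S') :
    A.diagBracket B (iota i w) (iota j z) = 0 := by
  have e : ∀ l, (Pi.single i w : ZMod 3 → S ⊗[k] S') l = 0
      ∨ (Pi.single j z : ZMod 3 → S ⊗[k] S') l = 0 := by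
    intro l
    by_cases hl : l = i
    · subst hl; simp [h]
    · simp [hl]
  have e1 : ∀ l, A.pairLeft B ((Pi.single i w : ZMod 3 → S ⊗[k] S') l)
      ((Pi.single j z : ZMod 3 → S ⊗[k] S') l) = 0 := fun l => by
    rcases e l with h | h <;> simp [h]
  have e2 : ∀ l, A.pairRight B ((Pi.single i w : ZMod 3 → S ⊗[k] S') l)
      ((Pi.single j z : ZMod 3 → S ⊗[k] S') l) = 0 := fun l => by
    rcases e l with h | h <;> simp [h]
  simp [diagBracket_apply, iota, e1, e2]

theorem diag_iota_same (i : ZMod 3) (w z : S ⊗[k] S') :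
    A.diagBracket B (iota i w) (iota i z)
      = (theta k S i (A.pairLeft B w z), theta k S' i (A.pairRight B w z), 0) := by
  simp only [diagBracket_apply, iota]
  rw [Finset.sum_eq_single i, Finset.sum_eq_single i]
  · simp
  · intro b _ hb; simp [hb]
  · simp
  · intro b _ hb; simp [hb]
  · simp

variable {A B}

theorem tensorMul_tmul {a' c : ZMod 2} {x y : S} {x' y' : S'}
    (hx' : x' ∈ B.gr a') (hy : y ∈ A.gr c) :
    A.tensorMul B (x ⊗ₜ x') (y ⊗ₜ y') = sgn k (a' * c) • (A.mul x y ⊗ₜ B.mul x' y') := by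
  simp only [tensorMul, LinearMap.sum_apply, LinearMap.smul_apply, TensorProduct.map₂_apply_tmul,
    LinearMap.comp_apply]
  rw [Finset.sum_eq_single a', Finset.sum_eq_single c]
  · simp [Superspace.comp_of_mem hx', Superspace.comp_of_mem hy]
  · intro b _ hb; simp [Superspace.comp_of_mem hy, hb]
  · simp
  · intro b _ hb; simp [Superspace.comp_of_mem hx', hb]
  · simp

theorem pairLeft_tmul {a a' c c' : ZMod 2} {x y : S} {x' y' : S'} (hx : x ∈ A.gr a)
    (hx' : x' ∈ B.gr a') (hy : y ∈ A.gr c) (hy' : y' ∈ B.gr c') :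
    A.pairLeft B (x ⊗ₜ x') (y ⊗ₜ y')
      = sgn k (a * a' + a * c' + c * c') • B.form x' y' • A.triple x y := by
  simp only [pairLeft, LinearMap.sum_apply, LinearMap.smul_apply, TensorProduct.map₂_apply_tmul,
    LinearMap.compr₂_apply, LinearEquiv.coe_coe]
  rw [Finset.sum_eq_single a, Finset.sum_eq_single a', Finset.sum_eq_single c,
    Finset.sum_eq_single c']
  · simp [Superspace.comp_of_mem hx, Superspace.comp_of_mem hx', Superspace.comp_of_mem hy,
      Superspace.comp_of_mem hy']
  · intro b _ hb; simp [Superspace.comp_of_mem hy', hb]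
  · simp
  · intro b _ hb; simp [Superspace.comp_of_mem hy, hb]
  · simp
  · intro b _ hb; simp [Superspace.comp_of_mem hx', hb]
  · simp
  · intro b _ hb; simp [Superspace.comp_of_mem hx, hb]
  · simp

theorem pairRight_tmul {a' c : ZMod 2} {x y : S} {x' y' : S'}
    (hx' : x' ∈ B.gr a') (hy : y ∈ A.gr c) :
    A.pairRight B (x ⊗ₜ x') (y ⊗ₜ y') = sgn k (c * a') • A.form x y • B.triple x' y' := by
  simp only [pairRight, LinearMap.sum_apply, LinearMap.smul_apply, TensorProduct.map₂_apply_tmul,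
    LinearMap.compr₂_apply, LinearMap.comp_apply, LinearEquiv.coe_coe]
  rw [Finset.sum_eq_single a', Finset.sum_eq_single c]
  · simp [Superspace.comp_of_mem hx', Superspace.comp_of_mem hy]
  · intro b _ hb; simp [Superspace.comp_of_mem hy, hb]
  · simp
  · intro b _ hb; simp [Superspace.comp_of_mem hx', hb]
  · simp

/-! ### The brackets of homogeneous elements -/

theorem bracket_left_left {a c : ZMod 2} {d e : Module.End k S} (hd : d ∈ A.endo.gr a)
    (he : e ∈ A.endo.gr c) : A.bracket B (constLeft k S' d) (constLeft k S' e)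
      = constLeft k S' (d * e - sgn k (a * c) • (e * d)) := by
  rw [bracket_of_mem (constLeft_mem hd) (constLeft_mem he), half_left_left, half_left_left,
    diag_of_left_fst, add_zero]
  simp only [constLeft, Prod.smul_mk, smul_zero, Prod.mk_sub_mk, sub_zero]
  rfl

theorem bracket_right_right {a c : ZMod 2} {d e : Module.End k S'} (hd : d ∈ B.endo.gr a)
    (he : e ∈ B.endo.gr c) : A.bracket B (constRight k S d) (constRight k S e)
      = constRight k S (d * e - sgn k (a * c) • (e * d)) := by
  rw [bracket_of_mem (constRight_mem hd) (constRight_mem he), half_right_right, half_right_right,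
    diag_of_right_fst, add_zero]
  simp only [constRight, Prod.smul_mk, smul_zero, Prod.mk_sub_mk, sub_zero]
  rfl

theorem bracket_left_right {a c : ZMod 2} {d : Module.End k S} {e : Module.End k S'}
    (hd : d ∈ A.endo.gr a) (he : e ∈ B.endo.gr c) :
    A.bracket B (constLeft k S' d) (constRight k S e) = 0 := by
  rw [bracket_of_mem (constLeft_mem hd) (constRight_mem he), half_left_right, half_right_left,
    diag_of_left_fst]
  simp

theorem bracket_right_left {a c : ZMod 2} {d : Module.End k S} {e : Module.End k S'}
    (hd : d ∈ A.endo.gr a) (he : e ∈ B.endo.gr c) :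
    A.bracket B (constRight k S e) (constLeft k S' d) = 0 := by
  rw [bracket_of_mem (constRight_mem he) (constLeft_mem hd), half_left_right, half_right_left,
    diag_of_left_snd]
  simp

theorem bracket_left_iota {a b c : ZMod 2} {d : Module.End k S} (hd : d ∈ A.endo.gr c) {x : S}
    {y : S'} (hx : x ∈ A.gr a) (hy : y ∈ B.gr b) (i : ZMod 3) :
    A.bracket B (constLeft k S' d) (iota i (x ⊗ₜ y)) = iota i (d x ⊗ₜ y) := by
  rw [bracket_of_mem (constLeft_mem hd) (iota_mem (Superspace.tmul_mem hx hy) i), half_left_iota,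
    half_iota_left, diag_of_left_fst]
  simp

theorem bracket_iota_left {a b c : ZMod 2} {d : Module.End k S} (hd : d ∈ A.endo.gr c) {x : S}
    {y : S'} (hx : x ∈ A.gr a) (hy : y ∈ B.gr b) (i : ZMod 3) :
    A.bracket B (iota i (x ⊗ₜ y)) (constLeft k S' d)
      = -(sgn k ((a + b) * c) • iota i (d x ⊗ₜ y)) := by
  rw [bracket_of_mem (iota_mem (Superspace.tmul_mem hx hy) i) (constLeft_mem hd), half_left_iota,
    half_iota_left, diag_of_left_snd]
  simp

theorem bracket_right_iota {a b c : ZMod 2} {d : Module.End k S'} (hd : d ∈ B.endo.gr c) {x : S}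
    {y : S'} (hx : x ∈ A.gr a) (hy : y ∈ B.gr b) (i : ZMod 3) :
    A.bracket B (constRight k S d) (iota i (x ⊗ₜ y)) = sgn k (c * a) • iota i (x ⊗ₜ d y) := by
  rw [bracket_of_mem (constRight_mem hd) (iota_mem (Superspace.tmul_mem hx hy) i),
    half_right_iota A B hd hx, half_iota_right, diag_of_right_fst]
  simp

theorem bracket_iota_right {a b c : ZMod 2} {d : Module.End k S'} (hd : d ∈ B.endo.gr c) {x : S}
    {y : S'} (hx : x ∈ A.gr a) (hy : y ∈ B.gr b) (i : ZMod 3) :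
    A.bracket B (iota i (x ⊗ₜ y)) (constRight k S d)
      = -(sgn k ((a + b) * c) • sgn k (c * a) • iota i (x ⊗ₜ d y)) := by
  rw [bracket_of_mem (iota_mem (Superspace.tmul_mem hx hy) i) (constRight_mem hd),
    half_right_iota A B hd hx, half_iota_right, diag_of_right_snd]
  simp

theorem bracket_iota_succ {a a' c c' : ZMod 2} {x y : S} {x' y' : S'} (hx : x ∈ A.gr a)
    (hx' : x' ∈ B.gr a') (hy : y ∈ A.gr c) (hy' : y' ∈ B.gr c') (i : ZMod 3) :
    A.bracket B (iota i (x ⊗ₜ x')) (iota (i + 1) (y ⊗ₜ y'))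
      = sgn k (a' * c) • iota (i + 2) (A.mul x y ⊗ₜ B.mul x' y') := by
  have h1 : i ≠ i + 1 := by generalize i = m; revert m; decide
  have h2 : i ≠ i + 1 + 1 := by generalize i = m; revert m; decide
  rw [bracket_of_mem (iota_mem (Superspace.tmul_mem hx hx') i)
    (iota_mem (Superspace.tmul_mem hy hy') _), half_iota_iota, half_iota_iota, if_pos rfl,
    if_neg h2, diag_iota_of_ne A B h1, tensorMul_tmul hx' hy]
  simp only [smul_zero, sub_zero, add_zero, iota, Pi.single_smul, Prod.smul_mk]

/-- The cyclic product sees only the order `i`, `i + 1`. In the opposite order the whole bracket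
comes from the skew-symmetrizing term. -/
theorem bracket_succ_iota {a a' c c' : ZMod 2} {x y : S} {x' y' : S'} (hx : x ∈ A.gr a)
    (hx' : x' ∈ B.gr a') (hy : y ∈ A.gr c) (hy' : y' ∈ B.gr c') (i : ZMod 3) :
    A.bracket B (iota (i + 1) (y ⊗ₜ y')) (iota i (x ⊗ₜ x'))
      = -(sgn k ((c + c') * (a + a')) • sgn k (a' * c) •
          iota (i + 2) (A.mul x y ⊗ₜ B.mul x' y')) := by
  have h1 : i + 1 ≠ i := by generalize i = m; revert m; decide
  have h2 : i ≠ i + 1 + 1 := by generalize i = m; revert m; decide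
  rw [bracket_of_mem (iota_mem (Superspace.tmul_mem hy hy') _)
    (iota_mem (Superspace.tmul_mem hx hx') i), half_iota_iota, half_iota_iota, if_pos rfl,
    if_neg h2, diag_iota_of_ne A B h1, tensorMul_tmul hx' hy]
  simp only [zero_sub, add_zero, iota, Pi.single_smul, Prod.smul_mk, smul_zero]

/-- The triples are assumed constant, as they are for `S_{1,2}` in characteristic 3. The rotation
`θⁱ` then has no effect, and the formula is the same in all three positions. -/
theorem bracket_iota_same {a a' c c' : ZMod 2} {x y : S} {x' y' : S'} (hx : x ∈ A.gr a)
    (hx' : x' ∈ B.gr a') (hy : y ∈ A.gr c) (hy' : y' ∈ B.gr c') (i : ZMod 3)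
    {d : Module.End k S} {d' : Module.End k S'} (hd : A.triple x y = fun _ => d)
    (hd' : B.triple x' y' = fun _ => d') :
    A.bracket B (iota i (x ⊗ₜ x')) (iota i (y ⊗ₜ y'))
      = (sgn k (a * a' + a * c' + c * c') * B.form x' y') • constLeft k S' d
        + (sgn k (c * a') * A.form x y) • constRight k S d' := by
  have h1 : ¬ i = i + 1 := by generalize i = m; revert m; decide
  rw [bracket_of_mem (iota_mem (Superspace.tmul_mem hx hx') i)
    (iota_mem (Superspace.tmul_mem hy hy') _), half_iota_iota, half_iota_iota, if_neg h1,
    if_neg h1, diag_iota_same, pairLeft_tmul hx hx' hy hy', pairRight_tmul hx' hy, hd, hd']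
  simp only [smul_zero, sub_zero, zero_add, constLeft, constRight, Prod.smul_mk, mul_smul,
    map_smul, Prod.mk_add_mk, add_zero]
  rfl

end FormedSuperalgebra

end Super

namespace Super

/-! ## Structure constants of `S_{1,2}` and its derivations -/

/-- The multiples of basis elements: the code `3 n + c`, with `c ∈ {1, 2}`, stands for `c` times the
`n`-th basis element, and `0` stands for zero. -/
def monomial (m : ℕ) : Comb ℕ :=
  bif Nat.beq m 0 then [] else [(Nat.div m 3, Nat.mod m 3)]

theorem eval_monomial {k L : Type*} [Field k] [AddCommGroup L] [Module k L] (B : ℕ → L) (m : ℕ) :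
    Comb.eval k B (monomial m) = ((m % 3 : ℕ) : k) • B (m / 3) := by
  cases m with
  | zero => simp [monomial]
  | succ m => exact add_zero _

/-- The entries of a table. -/
def entry (t : List (List ℕ)) (p q : ℕ) : ℕ := (t.getD p []).getD q 0

/-- The parity as an element of `ZMod 2`. -/
def parityOf (a : Bool) : ZMod 2 := bif a then 1 else 0

/-- The sign of a parity, as a natural number modulo three. -/
def signOf (a : Bool) : ℕ := bif a then 2 else 1

theorem parityOf_mul (a c : Bool) : parityOf a * parityOf c = parityOf (a && c) := by
  cases a <;> cases c <;> rfl

theorem parityOf_add (a c : Bool) : parityOf a + parityOf c = parityOf (xor a c) := by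
  cases a <;> cases c <;> rfl

theorem sgn_parityOf {k : Type*} [Field k] [CharP k 3] (a : Bool) :
    sgn k (parityOf a) = (signOf a : k) := by
  cases a
  · simp [parityOf, signOf, sgn]
  · simp [parityOf, signOf, sgn, Comb.two_eq_neg_one]

namespace SymplecticPlane

/-- The indices `1`, `2` stand for the odd basis vectors of `S_{1,2}`. -/
def vecOdd (a : ℕ) : Bool := Nat.ble 1 a

/-- The parities of the basis of the derivation algebra of `S_{1,2}`. -/
def derOdd (p : ℕ) : Bool := Nat.ble 3 p

/-- The indices 0, 1, 2 stand for `1, u, v` with `⟨u|v⟩ = 1`, and the coefficient 2 stands for `-1`.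
In the tables that follow, the derivations 0 to 4 are `σ_{u,u}`, `σ_{u,v}`, `σ_{v,v}`, `σ_{1,u}`,
`σ_{1,v}`: the first three span a copy of `𝔰𝔭(V)`, the last two are odd. -/
def formTable (a c : ℕ) : ℕ := entry [[2, 0, 0], [0, 0, 1], [0, 2, 0]] a c

def mulTable (a c : ℕ) : Comb ℕ := monomial (entry [[1, 5, 8], [5, 0, 1], [8, 2, 0]] a c)

def actTable (p a : ℕ) : Comb ℕ :=
  monomial (entry [[0, 0, 4], [0, 4, 8], [0, 8, 0], [5, 0, 2], [8, 1, 0]] p a)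

def sigmaTable (a c : ℕ) : Comb ℕ :=
  monomial (entry [[0, 10, 13], [11, 1, 4], [14, 4, 7]] a c)

def commTable (p q : ℕ) : Comb ℕ :=
  monomial (entry [[0, 1, 5, 0, 10], [2, 0, 7, 10, 14], [4, 8, 0, 14, 0], [0, 11, 13, 2, 5],
    [11, 13, 0, 5, 8]] p q)

variable {k V : Type*} [Field k] [AddCommGroup V] [Module k V]

/-- The basis of `S_{1,2}` given by a basis of the plane. -/
def vec (b : Module.Basis (Fin 2) k V) : ℕ → k × V
  | 0 => (1, 0)
  | 1 => (0, b 0)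
  | _ => (0, b 1)

/-- The basis of the derivation algebra of `S_{1,2}`. -/
def der (ω : SymplecticPlane k V) (b : Module.Basis (Fin 2) k V) : ℕ → Module.End k (k × V)
  | 0 => ω.S12.sigma (vec b 1) (vec b 1)
  | 1 => ω.S12.sigma (vec b 1) (vec b 2)
  | 2 => ω.S12.sigma (vec b 2) (vec b 2)
  | 3 => ω.S12.sigma (vec b 0) (vec b 1)
  | _ => ω.S12.sigma (vec b 0) (vec b 2)

theorem exists_basis (ω : SymplecticPlane k V) :
    ∃ b : Module.Basis (Fin 2) k V, ω.form (b 0) (b 1) = 1 := by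
  have : FiniteDimensional k V := Module.finite_of_finrank_eq_succ ω.finrank_eq
  obtain ⟨u, hu⟩ : ∃ u, ω.form u ≠ 0 := by
    by_contra! h
    exact ω.ne_zero (LinearMap.ext h)
  obtain ⟨v, hv⟩ : ∃ v, ω.form u v ≠ 0 := by
    by_contra! h
    exact hu (LinearMap.ext h)
  have hli : LinearIndependent k ![u, (ω.form u v)⁻¹ • v] := by
    rw [LinearIndependent.pair_iff]
    intro s t hst
    have h1 := congrArg (ω.form u) hst
    have h2 := congrArg (fun x => ω.form x v) hst
    simp [ω.alt, hv] at h1 h2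
    exact ⟨h2, h1⟩
  refine ⟨basisOfLinearIndependentOfCardEqFinrank hli (by simp [ω.finrank_eq]), ?_⟩
  simp [hv]

variable {b : Module.Basis (Fin 2) k V} {ω : SymplecticPlane k V}

theorem vec_mem (a : ℕ) : vec b a ∈ ω.S12.gr (parityOf (vecOdd a)) := by
  match a with
  | 0 => exact mem_gr_zero.2 rfl
  | 1 => exact mem_gr_one.2 rfl
  | _ + 2 => exact mem_gr_one.2 rfl

theorem der_mem (p : ℕ) : der ω b p ∈ ω.S12.endo.gr (parityOf (derOdd p)) := by
  have h : ∀ a c, ω.S12.sigma (vec b a) (vec b c)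
      ∈ ω.S12.endo.gr (parityOf (vecOdd a) + parityOf (vecOdd c)) := fun a c =>
    Superspace.mem_pi_gr.1 (ω.S12.triple_even _ _ _ _ (vec_mem a) (vec_mem c)) 0
  match p with
  | 0 => exact h 1 1
  | 1 => exact h 1 2
  | 2 => exact h 2 2
  | 3 => exact h 0 1
  | _ + 4 => exact h 0 2

theorem hom_ext {M : Type*} [AddCommGroup M] [Module k M] {f g : k × V →ₗ[k] M}
    (h : ∀ a < 3, f (vec b a) = g (vec b a)) : f = g := by
  refine LinearMap.prod_ext (LinearMap.ext_ring ?_) (b.ext fun i => ?_)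
  · exact h 0 (by norm_num)
  · fin_cases i
    · exact h 1 (by norm_num)
    · exact h 2 (by norm_num)

theorem add_self_eq_neg (k : Type*) {V : Type*} [Field k] [AddCommGroup V] [Module k V] [CharP k 3]
    (v : V) : v + v = -v := by
  rw [← two_smul k, Comb.two_eq_neg_one, neg_one_smul]

theorem neg_sub_self_eq (k : Type*) {V : Type*} [Field k] [AddCommGroup V] [Module k V] [CharP k 3]
    (v : V) : -v - v = v := by
  rw [← neg_add', add_self_eq_neg k, neg_neg]

variable [CharP k 3] (hb : ω.form (b 0) (b 1) = 1)
include hb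

theorem form_vec {a c : ℕ} (ha : a < 3) (hc : c < 3) :
    ω.S12.form (vec b a) (vec b c) = (formTable a c : k) := by
  have hb' : ω.form (b 1) (b 0) = -1 := by rw [ω.anti, hb]
  interval_cases a <;> interval_cases c <;>
    simp [vec, S12_form, formTable, entry, hb, hb', ω.alt, Comb.two_eq_neg_one]

theorem mul_vec {a c : ℕ} (ha : a < 3) (hc : c < 3) :
    ω.S12.mul (vec b a) (vec b c) = Comb.eval k (vec b) (mulTable a c) := by
  have hb' : ω.form (b 1) (b 0) = -1 := by rw [ω.anti, hb]
  interval_cases a <;> interval_cases c <;>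
    simp [vec, S12_mul, mulTable, entry, eval_monomial, hb, hb', ω.alt, Comb.two_eq_neg_one]

theorem der_vec {p a : ℕ} (hp : p < 5) (ha : a < 3) :
    der ω b p (vec b a) = Comb.eval k (vec b) (actTable p a) := by
  have hb' : ω.form (b 1) (b 0) = -1 := by rw [ω.anti, hb]
  interval_cases p <;> interval_cases a <;>
    simp [der, vec, S12_sigma, actTable, entry, eval_monomial, hb, hb', ω.alt, Comb.two_eq_neg_one,
      add_self_eq_neg k, neg_sub_self_eq k]

theorem sigma_vec {a c : ℕ} (ha : a < 3) (hc : c < 3) :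
    ω.S12.sigma (vec b a) (vec b c) = Comb.eval k (der ω b) (sigmaTable a c) := by
  have hb' : ω.form (b 1) (b 0) = -1 := by rw [ω.anti, hb]
  refine hom_ext (b := b) fun e he => ?_
  interval_cases a <;> interval_cases c <;> interval_cases e <;>
    simp [der, vec, S12_sigma, sigmaTable, entry, eval_monomial, hb, hb', ω.alt,
      Comb.two_eq_neg_one, add_self_eq_neg k, neg_sub_self_eq k]

/-- Both sides are determined by their values on the three basis vectors, where they are products of
rows of `actTable`. -/
theorem comm_der {p q : ℕ} (hp : p < 5) (hq : q < 5) :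
    der ω b p * der ω b q
      - sgn k (parityOf (derOdd p) * parityOf (derOdd q)) • (der ω b q * der ω b p)
      = Comb.eval k (der ω b) (commTable p q) := by
  -- The sign in front of the second product is minus the sign of the two parities, hence `+1`
  -- exactly when both derivations are odd; this is the negation inside `signOf`.
  have key : allBelow 5 (fun p => allBelow 5 fun q => allBelow 3 fun a =>
      Comb.eqv (Comb.bind (actTable q a) (actTable p) ++ Comb.scale (signOf !(derOdd p && derOdd q))
        (Comb.bind (actTable p a) (actTable q)))
      (Comb.bind (commTable p q) fun r => actTable r a)) = true := by decide +kernel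
  have low : allBelow 5 (fun p => allBelow 5 fun q =>
      (commTable p q).all fun t => Nat.blt t.1 5) = true := by decide +kernel
  have lowa : allBelow 5 (fun p => allBelow 3 fun q =>
      (actTable p q).all fun t => Nat.blt t.1 3) = true := by decide +kernel
  refine hom_ext (b := b) fun a ha => ?_
  have h := Comb.eval_eq_of_eqv (k := k) (vec b)
    (of_allBelow (of_allBelow (of_allBelow key hp) hq) ha)
  have e1 : ∀ {p q}, p < 5 → q < 5 → der ω b p (der ω b q (vec b a))
      = Comb.eval k (vec b) (Comb.bind (actTable q a) (actTable p)) := by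
    intro p q hp hq
    rw [der_vec hb hq ha, Comb.map_eval, Comb.eval_bind]
    refine Comb.eval_congr fun t ht => der_vec hb hp ?_
    simpa using List.all_eq_true.1 (of_allBelow (of_allBelow lowa hq) ha) t ht
  have e2 : Comb.eval k (der ω b) (commTable p q) (vec b a)
      = Comb.eval k (vec b) (Comb.bind (commTable p q) fun r => actTable r a) := by
    have := Comb.map_eval (LinearMap.applyₗ (vec b a)) (der ω b) (commTable p q)
    simp only [LinearMap.applyₗ_apply_apply] at this
    rw [this, Comb.eval_bind]
    refine Comb.eval_congr fun t ht => der_vec hb ?_ ha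
    simpa using List.all_eq_true.1 (of_allBelow (of_allBelow low hp) hq) t ht
  rw [e2, ← h, Comb.eval_append, Comb.eval_scale, ← e1 hp hq, ← e1 hq hp, parityOf_mul,
    sgn_parityOf]
  cases derOdd p && derOdd q <;> simp [signOf, Comb.two_eq_neg_one, sub_eq_add_neg]

end SymplecticPlane

end Super

/-! ### The triality algebra of `S_{1,2}` consists of constant triples. -/

namespace Super

namespace SymplecticPlane

variable {k V : Type*} [Field k] [AddCommGroup V] [Module k V]

theorem mem_S12_zero {ω : SymplecticPlane k V} {x : k × V} : x ∈ ω.S12.gr 0 ↔ x.2 = 0 :=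
  mem_gr_zero

theorem mem_S12_one {ω : SymplecticPlane k V} {x : k × V} : x ∈ ω.S12.gr 1 ↔ x.1 = 0 :=
  mem_gr_one

/-- The span of the constant triples of the derivations of `S_{1,2}`. -/
def constTriples (ω : SymplecticPlane k V) (b : Module.Basis (Fin 2) k V) :
    Submodule k (ZMod 3 → Module.End k (k × V)) :=
  (Submodule.span k (Set.range fun p : Fin 5 => der ω b p)).map (LinearMap.pi fun _ => LinearMap.id)

variable {b : Module.Basis (Fin 2) k V} {ω : SymplecticPlane k V}

theorem const_mem_constTriples {d : ZMod 3 → Module.End k (k × V)} (f : Fin 5 → k)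
    (h : ∀ m, d m = ∑ p, f p • der ω b p) : d ∈ constTriples ω b :=
  ⟨∑ p, f p • der ω b p, Submodule.sum_mem _ fun p _ => Submodule.smul_mem _ _
    (Submodule.subset_span ⟨p, rfl⟩), funext fun m => (h m).symm⟩

variable [CharP k 3] (hb : ω.form (b 0) (b 1) = 1)
include hb

/-- Invariance of the norm gives `4 d(1) = 0`, so an even triple kills `1`. As `1 • y = -y` for `y ∈
V`, the triality equation with one argument equal to `1` identifies `d₀` with `d₂`, and with `d₁`,
on `V`. What remains is one endomorphism of `V` that is skew for `⟨·|·⟩`, that is, of trace zero. -/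
theorem triPart_zero_le : ω.S12.triPart 0 ≤ constTriples ω b := by
  intro d hd
  have hb' : ω.form (b 1) (b 0) = -1 := by rw [ω.anti, hb]
  have h3 : (3 : k) = 0 := by exact_mod_cast CharP.cast_eq_zero k 3
  have gr0 : ((1, 0) : k × V) ∈ ω.S12.gr 0 := mem_gr_zero.2 rfl
  have gr1 : ∀ v, ((0, v) : k × V) ∈ ω.S12.gr 1 := fun v => mem_gr_one.2 rfl
  have h0 : ∀ m, d m (1, 0) = 0 := by
    intro m
    have hm : (d m (1, 0)).2 = 0 :=
      mem_S12_zero.1 (by simpa using Superspace.mem_endo_gr.1 (hd.1 m).1 0 _ gr0)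
    have := (hd.1 m).2 0 _ gr0 (1, 0)
    simp [S12_form, sgn] at this
    refine Prod.ext ?_ hm
    rw [Prod.fst_zero]
    linear_combination this - (d m (1, 0)).1 * h3
  have h1 : ∀ m v, (d m (0, v)).1 = 0 := fun m v =>
    mem_S12_one.1 (by simpa using Superspace.mem_endo_gr.1 (hd.1 m).1 1 _ (gr1 v))
  have hr : ∀ v, d 0 (0, v) = d 2 (0, v) := by
    intro v
    have := hd.2 0 _ gr0 (0, v)
    simp only [S12_mul, h0] at this
    simp [sgn, h1] at this
    rw [show ((0 : k), -v) = -(0, v) by simp, map_neg] at this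
    refine Prod.ext ?_ (neg_injective ?_)
    · rw [h1, h1]
    · exact congrArg Prod.snd this
  have hl : ∀ v, d 0 (0, v) = d 1 (0, v) := by
    intro v
    have := hd.2 1 _ (gr1 v) (1, 0)
    simp only [S12_mul, h0] at this
    simp [sgn, h1] at this
    rw [show ((0 : k), -v) = -(0, v) by simp, map_neg] at this
    refine Prod.ext ?_ (neg_injective ?_)
    · rw [h1, h1]
    · exact congrArg Prod.snd this
  have hall : ∀ m v, d m (0, v) = d 0 (0, v) := by
    intro m v
    rcases FormedSuperalgebra.forall_zmod3 m with rfl | rfl | rfl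
    · rfl
    · exact (hl v).symm
    · exact (hr v).symm
  have hc : ∀ x : V, x = b.repr x 0 • b 0 + b.repr x 1 • b 1 := fun x => by
    conv_lhs => rw [← b.sum_repr x, Fin.sum_univ_two]
  have hskew : b.repr (d 0 (0, b 0)).2 0 + b.repr (d 0 (0, b 1)).2 1 = 0 := by
    have := (hd.1 0).2 1 _ (gr1 (b 0)) (0, b 1)
    rw [S12_form, S12_form, hc (d 0 (0, b 0)).2, hc (d 0 (0, b 1)).2] at this
    simpa [sgn, hb, ω.alt] using this
  -- On `V` the derivations 0, 1, 2 are `b₁ ↦ b₀`, the diagonal map with eigenvalues `1, -1`, and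
  -- `b₀ ↦ -b₁`; the coefficients are read off the matrix of `d`.
  refine const_mem_constTriples ![b.repr (d 0 (0, b 1)).2 0, b.repr (d 0 (0, b 0)).2 0,
    -b.repr (d 0 (0, b 0)).2 1, 0, 0] fun m => ?_
  refine hom_ext (b := b) fun a ha => ?_
  interval_cases a
  · simp [Fin.sum_univ_five, vec, der, S12_sigma, h0]
    rfl
  · refine Prod.ext ?_ ?_
    · simp [Fin.sum_univ_five, vec, der, S12_sigma, h1, ω.alt]
    · change (d m (0, b 0)).2 = _
      rw [hall]
      conv_lhs => rw [hc (d 0 (0, b 0)).2]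
      simp [Fin.sum_univ_five, vec, der, S12_sigma, hb', ω.alt, add_self_eq_neg k]
  · refine Prod.ext ?_ ?_
    · simp [Fin.sum_univ_five, vec, der, S12_sigma, h1, hb, ω.alt]
    · change (d m (0, b 1)).2 = _
      rw [hall]
      conv_lhs => rw [hc (d 0 (0, b 1)).2]
      simp [Fin.sum_univ_five, vec, der, S12_sigma, hb, ω.alt, neg_sub_self_eq k]
      rw [← neg_smul, eq_neg_of_add_eq_zero_right hskew]

/-- Invariance of the norm shows that an odd component `dₘ` is determined by the vector `wₘ =
dₘ(1)`, through `dₘ(v) = -⟨v|wₘ⟩ 1`; here `2 = -1` is used. The triality equation on `V × V` with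
equal arguments yields `w₁ = w₂`, and with a symplectic pair yields `w₀ = w₁`. -/
theorem triPart_one_le : ω.S12.triPart 1 ≤ constTriples ω b := by
  intro d hd
  have hb' : ω.form (b 1) (b 0) = -1 := by rw [ω.anti, hb]
  have h3 : (3 : k) = 0 := by exact_mod_cast CharP.cast_eq_zero k 3
  have gr0 : ((1, 0) : k × V) ∈ ω.S12.gr 0 := mem_gr_zero.2 rfl
  have gr1 : ∀ v, ((0, v) : k × V) ∈ ω.S12.gr 1 := fun v => mem_gr_one.2 rfl
  have h0 : ∀ m, (d m (1, 0)).1 = 0 := fun m =>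
    mem_S12_one.1 (by simpa using Superspace.mem_endo_gr.1 (hd.1 m).1 0 _ gr0)
  have h1 : ∀ m v, (d m (0, v)).2 = 0 := fun m v =>
    mem_S12_zero.1 (Superspace.mem_endo_gr.1 (hd.1 m).1 1 _ (gr1 v))
  have hc : ∀ x : V, x = b.repr x 0 • b 0 + b.repr x 1 • b 1 := fun x => by
    conv_lhs => rw [← b.sum_repr x, Fin.sum_univ_two]
  have hφ : ∀ m v, (d m (0, v)).1 = -ω.form v (d m (1, 0)).2 := by
    intro m v
    have := (hd.1 m).2 1 _ (gr1 v) (1, 0)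
    simp [S12_form, sgn] at this
    linear_combination (-1 : k) * this + (d m (0, v)).1 * h3
  have hφ0 : ∀ m, (d m (0, b 0)).1 = -b.repr (d m (1, 0)).2 1 := by
    intro m
    rw [hφ]
    conv_lhs => rw [hc (d m (1, 0)).2]
    simp [hb, ω.alt]
  have hφ1 : ∀ m, (d m (0, b 1)).1 = b.repr (d m (1, 0)).2 0 := by
    intro m
    rw [hφ]
    conv_lhs => rw [hc (d m (1, 0)).2]
    simp [hb', ω.alt]
  have hrel : ∀ v w, ω.form v w • (d 0 (1, 0)).2 = (d 2 (0, w)).1 • v - (d 1 (0, v)).1 • w := by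
    intro v w
    have := congrArg Prod.snd (hd.2 1 _ (gr1 v) (0, w))
    simp [S12_mul, sgn, h1] at this
    rw [show (ω.form v w, (0 : V)) = ω.form v w • ((1 : k), (0 : V)) by simp, map_smul,
      Prod.smul_snd] at this
    rw [this]; abel
  have e0 : (d 2 (0, b 0)).1 = (d 1 (0, b 0)).1 := by
    have := hrel (b 0) (b 0)
    rw [ω.alt, zero_smul, ← sub_smul] at this
    exact sub_eq_zero.1 ((smul_eq_zero.1 this.symm).resolve_right (b.ne_zero 0))
  have e1 : (d 2 (0, b 1)).1 = (d 1 (0, b 1)).1 := by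
    have := hrel (b 1) (b 1)
    rw [ω.alt, zero_smul, ← sub_smul] at this
    exact sub_eq_zero.1 ((smul_eq_zero.1 this.symm).resolve_right (b.ne_zero 1))
  have e21 : (d 2 (1, 0)).2 = (d 1 (1, 0)).2 := by
    rw [hc (d 2 (1, 0)).2, hc (d 1 (1, 0)).2, ← hφ1, ← hφ1, e1,
      ← neg_neg (b.repr (d 2 (1, 0)).2 1), ← neg_neg (b.repr (d 1 (1, 0)).2 1), ← hφ0, ← hφ0, e0]
  have e01 : (d 0 (1, 0)).2 = (d 1 (1, 0)).2 := by
    have := hrel (b 0) (b 1)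
    rw [hb, one_smul, e1, hφ1, hφ0, neg_smul, sub_neg_eq_add] at this
    rw [this, ← hc]
  have hall : ∀ m, (d m (1, 0)).2 = (d 0 (1, 0)).2 := by
    intro m
    rcases FormedSuperalgebra.forall_zmod3 m with rfl | rfl | rfl
    · rfl
    · exact e01.symm
    · rw [e21, e01]
  -- The derivations 3 and 4 send `1` to `-b₀` and `-b₁`, whence the signs.
  refine const_mem_constTriples ![0, 0, 0, -b.repr (d 0 (1, 0)).2 0,
    -b.repr (d 0 (1, 0)).2 1] fun m => ?_
  refine hom_ext (b := b) fun a ha => ?_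
  interval_cases a
  · refine Prod.ext ?_ ?_
    · simp [Fin.sum_univ_five, vec, der, S12_sigma, h0]
    · change (d m (1, 0)).2 = _
      rw [hall]
      conv_lhs => rw [hc (d 0 (1, 0)).2]
      simp [Fin.sum_univ_five, vec, der, S12_sigma, Comb.two_eq_neg_one]
  · refine Prod.ext ?_ ?_
    · change (d m (0, b 0)).1 = _
      rw [hφ0, hall]
      simp [Fin.sum_univ_five, vec, der, S12_sigma, hb', ω.alt]
    · simp [Fin.sum_univ_five, vec, der, S12_sigma, h1, ω.alt]
  · refine Prod.ext ?_ ?_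
    · change (d m (0, b 1)).1 = _
      rw [hφ1, hall]
      simp [Fin.sum_univ_five, vec, der, S12_sigma, hb, ω.alt]
    · simp [Fin.sum_univ_five, vec, der, S12_sigma, h1, ω.alt]

theorem tri_le : ω.S12.tri ≤ constTriples ω b :=
  sup_le (triPart_zero_le hb) (triPart_one_le hb)

omit hb in
theorem const_der_mem (p : ℕ) : (fun _ => der ω b p) ∈ ω.S12.tri := by
  have h : ∀ a c, (fun _ => ω.S12.sigma (vec b a) (vec b c) : ZMod 3 → Module.End k (k × V))
      ∈ ω.S12.tri := fun a c =>
    ω.S12.triPart_le_tri _ (ω.S12_sigma_mem (vec_mem a) (vec_mem c))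
  match p with
  | 0 => exact h 1 1
  | 1 => exact h 1 2
  | 2 => exact h 2 2
  | 3 => exact h 0 1
  | _ + 4 => exact h 0 2

theorem der_linearIndependent : LinearIndependent k fun p : Fin 5 => der ω b p := by
  have hb' : ω.form (b 1) (b 0) = -1 := by rw [ω.anti, hb]
  rw [Fintype.linearIndependent_iff]
  intro f hf
  have hz : ∀ c : k, -c - c = 0 → c = 0 := fun c h => by rwa [neg_sub_self_eq k] at h
  have h0 := congrArg (fun g => g (vec b 0)) hf
  have h1 := congrArg (fun g => b.repr (g (vec b 1)).2) hf
  have h2 := congrArg (fun g => b.repr (g (vec b 2)).2) hf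
  have h3 := congrArg (fun g => (g (vec b 0)).2) hf
  have h3' := congrArg b.repr h3
  have h1' := DFunLike.congr_fun h1
  have h2' := DFunLike.congr_fun h2
  have h30 := DFunLike.congr_fun h3' 0
  have h31 := DFunLike.congr_fun h3' 1
  have h10 := h1' 0
  have h11 := h1' 1
  have h20 := h2' 0
  simp [Fin.sum_univ_five, vec, der, S12_sigma, hb, hb', ω.alt, add_self_eq_neg k,
    neg_sub_self_eq k, Comb.two_eq_neg_one] at h10 h11 h20 h30 h31
  intro p
  fin_cases p <;> simp [*]

end SymplecticPlane

end Super

namespace Super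

/-! ## A table of structure constants of `𝔤(S_{1,2}, S_{1,2})` -/

/-- Labels for the elements of a basis of `𝔤(S_{1,2}, S_{1,2})`: the constant triples of the basis
derivations of both factors, and the `ιᵢ(x ⊗ y)` with `x`, `y` basis vectors. -/
inductive Label
  | left (p : ℕ)
  | right (p : ℕ)
  | tens (i a b : ℕ)
  deriving DecidableEq

namespace Label

open SymplecticPlane

/-- The labels that occur. -/
def valid : Label → Bool
  | left p => Nat.blt p 5
  | right p => Nat.blt p 5
  | tens i a b => Nat.blt i 3 && Nat.blt a 3 && Nat.blt b 3

/-- The parity of a labelled element. -/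
def odd : Label → Bool
  | left p => derOdd p
  | right p => derOdd p
  | tens _ a b => xor (vecOdd a) (vecOdd b)

/-- The tensor product of two formal linear combinations, placed in position `i`. -/
def tensor (i : ℕ) (ℓ ℓ' : Comb ℕ) : Comb Label :=
  Comb.bind ℓ fun a => ℓ'.map fun t => (tens i a t.1, t.2)

/-- The bracket `[ιᵢ(x ⊗ x'), ιᵢ₊₁(y ⊗ y')]`. -/
def cyclic (i a b c d : ℕ) : Comb Label :=
  Comb.scale (signOf (vecOdd b && vecOdd c)) (tensor ((i + 2) % 3) (mulTable a c) (mulTable b d))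

/-- The brackets of labelled elements. -/
def bracket : Label → Label → Comb Label
  | left p, left q => (commTable p q).map fun t => (left t.1, t.2)
  | right p, right q => (commTable p q).map fun t => (right t.1, t.2)
  | left _, right _ => []
  | right _, left _ => []
  | left p, tens i a b => (actTable p a).map fun t => (tens i t.1 b, t.2)
  | right p, tens i a b =>
    Comb.scale (signOf (derOdd p && vecOdd a)) ((actTable p b).map fun t => (tens i a t.1, t.2))
  | tens i a b, left p =>
    Comb.scale (2 * signOf (xor (vecOdd a) (vecOdd b) && derOdd p))
      ((actTable p a).map fun t => (tens i t.1 b, t.2))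
  | tens i a b, right p =>
    Comb.scale (2 * signOf (xor (vecOdd a) (vecOdd b) && derOdd p))
      (Comb.scale (signOf (derOdd p && vecOdd a))
        ((actTable p b).map fun t => (tens i a t.1, t.2)))
  | tens i a b, tens j c d =>
    bif Nat.beq i j then
      Comb.scale (signOf (xor (xor (vecOdd a && vecOdd b) (vecOdd a && vecOdd d))
          (vecOdd c && vecOdd d)) * formTable b d)
        ((sigmaTable a c).map fun t => (left t.1, t.2)) ++
      Comb.scale (signOf (vecOdd c && vecOdd b) * formTable a c)
        ((sigmaTable b d).map fun t => (right t.1, t.2))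
    else bif Nat.beq j ((i + 1) % 3) then cyclic i a b c d
    else Comb.scale (2 * signOf (xor (vecOdd a) (vecOdd b) && xor (vecOdd c) (vecOdd d)))
      (cyclic j c d a b)

variable {k V : Type*} [Field k] [AddCommGroup V] [Module k V] [CharP k 3]
  {ω : SymplecticPlane k V} {b : Module.Basis (Fin 2) k V}

/-- The labelled elements. -/
def toAmbient (ω : SymplecticPlane k V) (b : Module.Basis (Fin 2) k V) :
    Label → FormedSuperalgebra.Ambient k (k × V) (k × V)
  | left p => FormedSuperalgebra.constLeft k _ (der ω b p)
  | right p => FormedSuperalgebra.constRight k _ (der ω b p)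
  | tens i a c => FormedSuperalgebra.iota (i : ZMod 3) (vec b a ⊗ₜ vec b c)

omit [CharP k 3] in
theorem toAmbient_odd (x : Label) :
    toAmbient ω b x ∈ (ω.S12.ambientSpace ω.S12).gr (parityOf x.odd) := by
  cases x with
  | left p => exact FormedSuperalgebra.constLeft_mem (der_mem p)
  | right p => exact FormedSuperalgebra.constRight_mem (der_mem p)
  | tens i a c =>
    refine FormedSuperalgebra.iota_mem ?_ _
    rw [odd, ← parityOf_add]
    exact Superspace.tmul_mem (vec_mem a) (vec_mem c)

theorem toAmbient_mem (x : Label) : toAmbient ω b x ∈ ω.S12.magicSubmodule ω.S12 := by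
  cases x with
  | left p => exact ⟨const_der_mem p, Submodule.zero_mem _, trivial⟩
  | right p => exact ⟨Submodule.zero_mem _, const_der_mem p, trivial⟩
  | tens i a c => exact ⟨Submodule.zero_mem _, Submodule.zero_mem _, trivial⟩

omit [CharP k 3] in
theorem eval_left (ℓ : Comb ℕ) :
    Comb.eval k (toAmbient ω b) (ℓ.map fun t => (left t.1, t.2))
      = FormedSuperalgebra.constLeft k _ (Comb.eval k (der ω b) ℓ) := by
  rw [Comb.eval_map]
  induction ℓ with
  | nil => rfl
  | cons t ℓ ih =>
    rw [Comb.eval_cons, ih, Comb.eval_cons]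
    simp only [toAmbient, FormedSuperalgebra.constLeft, Prod.smul_mk, Prod.mk_add_mk, smul_zero,
      add_zero]
    rfl

omit [CharP k 3] in
theorem eval_right (ℓ : Comb ℕ) :
    Comb.eval k (toAmbient ω b) (ℓ.map fun t => (right t.1, t.2))
      = FormedSuperalgebra.constRight k _ (Comb.eval k (der ω b) ℓ) := by
  rw [Comb.eval_map]
  induction ℓ with
  | nil => rfl
  | cons t ℓ ih =>
    rw [Comb.eval_cons, ih, Comb.eval_cons]
    simp only [toAmbient, FormedSuperalgebra.constRight, Prod.smul_mk, Prod.mk_add_mk, smul_zero,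
      add_zero]
    rfl

/-- `ιᵢ` as a linear map. -/
def iotaₗ (k S S' : Type*) [Field k] [AddCommGroup S] [Module k S] [AddCommGroup S']
    [Module k S'] (i : ZMod 3) : S ⊗[k] S' →ₗ[k] FormedSuperalgebra.Ambient k S S' :=
  LinearMap.inr k _ _ ∘ₗ LinearMap.inr k _ _ ∘ₗ LinearMap.single k (fun _ => S ⊗[k] S') i

omit [CharP k 3] in
theorem eval_tens_left (i c : ℕ) (ℓ : Comb ℕ) :
    Comb.eval k (toAmbient ω b) (ℓ.map fun t => (tens i t.1 c, t.2))
      = FormedSuperalgebra.iota (i : ZMod 3) (Comb.eval k (vec b) ℓ ⊗ₜ vec b c) := by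
  refine (Comb.eval_map _ ℓ fun n => tens i n c).trans ?_
  exact (Comb.map_eval (iotaₗ k _ _ (i : ZMod 3) ∘ₗ (TensorProduct.mk k _ _).flip (vec b c))
    (vec b) ℓ).symm

omit [CharP k 3] in
theorem eval_tens_right (i a : ℕ) (ℓ : Comb ℕ) :
    Comb.eval k (toAmbient ω b) (ℓ.map fun t => (tens i a t.1, t.2))
      = FormedSuperalgebra.iota (i : ZMod 3) (vec b a ⊗ₜ Comb.eval k (vec b) ℓ) := by
  refine (Comb.eval_map _ ℓ fun n => tens i a n).trans ?_
  exact (Comb.map_eval (iotaₗ k _ _ (i : ZMod 3) ∘ₗ TensorProduct.mk k _ _ (vec b a))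
    (vec b) ℓ).symm

omit [CharP k 3] in
theorem eval_tensor (i : ℕ) (ℓ ℓ' : Comb ℕ) :
    Comb.eval k (toAmbient ω b) (tensor i ℓ ℓ') = FormedSuperalgebra.iota (i : ZMod 3)
      (Comb.eval k (vec b) ℓ ⊗ₜ Comb.eval k (vec b) ℓ') := by
  rw [tensor, Comb.eval_bind, Comb.eval_congr (B' := fun a =>
    FormedSuperalgebra.iota (i : ZMod 3) (vec b a ⊗ₜ Comb.eval k (vec b) ℓ'))
    fun t _ => eval_tens_right i t.1 ℓ']
  exact (Comb.map_eval (iotaₗ k _ _ (i : ZMod 3) ∘ₗ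
    (TensorProduct.mk k _ _).flip (Comb.eval k (vec b) ℓ')) (vec b) ℓ).symm

theorem neg_signOf (a : Bool) : ((2 * signOf a : ℕ) : k) = -(signOf a : k) := by
  push_cast
  rw [Comb.two_eq_neg_one, neg_one_mul]

theorem natCast_mod_three (i : ℕ) : ((i % 3 : ℕ) : ZMod 3) = i := by
  simp

theorem triple_vec (x y : k × V) : ω.S12.triple x y = fun _ => ω.S12.sigma x y :=
  funext fun m => ω.S12_triple x y m

variable (hb : ω.form (b 0) (b 1) = 1)
include hb

theorem bracket_cyclic {i a c a' c' : ℕ} (ha : a < 3) (hc : c < 3)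
    (ha' : a' < 3) (hc' : c' < 3) :
    ω.S12.bracket ω.S12 (toAmbient ω b (tens i a c)) (FormedSuperalgebra.iota ((i : ZMod 3) + 1)
      (vec b a' ⊗ₜ vec b c')) = Comb.eval k (toAmbient ω b) (cyclic i a c a' c') := by
  rw [cyclic, Comb.eval_scale, eval_tensor, ← mul_vec hb ha ha', ← mul_vec hb hc hc',
    toAmbient, FormedSuperalgebra.bracket_iota_succ (vec_mem _) (vec_mem _) (vec_mem _) (vec_mem _),
    parityOf_mul, sgn_parityOf]
  simp

theorem bracket_cyclic' {i a c a' c' : ℕ} (ha : a < 3) (hc : c < 3)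
    (ha' : a' < 3) (hc' : c' < 3) :
    ω.S12.bracket ω.S12 (FormedSuperalgebra.iota ((i : ZMod 3) + 1)
      (vec b a' ⊗ₜ vec b c')) (toAmbient ω b (tens i a c)) =
    Comb.eval k (toAmbient ω b) (Comb.scale
      (2 * signOf (xor (vecOdd a') (vecOdd c') && xor (vecOdd a) (vecOdd c)))
      (cyclic i a c a' c')) := by
  rw [Comb.eval_scale, cyclic, Comb.eval_scale, eval_tensor, ← mul_vec hb ha ha',
    ← mul_vec hb hc hc', toAmbient,
    FormedSuperalgebra.bracket_succ_iota (vec_mem _) (vec_mem _) (vec_mem _) (vec_mem _),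
    parityOf_mul, sgn_parityOf, parityOf_add, parityOf_add, parityOf_mul, sgn_parityOf,
    neg_signOf, neg_smul]
  simp

theorem bracket_toAmbient_left {p : ℕ} {y : Label} (hx : (left p).valid = true)
    (hy : y.valid = true) : ω.S12.bracket ω.S12 (toAmbient ω b (left p)) (toAmbient ω b y)
      = Comb.eval k (toAmbient ω b) (bracket (left p) y) := by
  have hp : p < 5 := by simpa [valid] using hx
  cases y with
  | left q =>
    have hq : q < 5 := by simpa [valid] using hy
    rw [bracket, eval_left, ← comm_der hb hp hq]
    rw [toAmbient, toAmbient, FormedSuperalgebra.bracket_left_left (der_mem p) (der_mem q)]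
  | right q =>
    rw [toAmbient, toAmbient, FormedSuperalgebra.bracket_left_right (der_mem p) (der_mem q)]
    rfl
  | tens i a c =>
    simp only [valid, Bool.and_eq_true, Nat.blt_eq] at hy
    rw [bracket, eval_tens_left, ← der_vec hb hp hy.1.2]
    rw [toAmbient, toAmbient,
        FormedSuperalgebra.bracket_left_iota (der_mem p) (vec_mem a) (vec_mem c)]

theorem bracket_toAmbient_right {p : ℕ} {y : Label} (hx : (right p).valid = true)
    (hy : y.valid = true) : ω.S12.bracket ω.S12 (toAmbient ω b (right p)) (toAmbient ω b y)
      = Comb.eval k (toAmbient ω b) (bracket (right p) y) := by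
  have hp : p < 5 := by simpa [valid] using hx
  cases y with
  | left q =>
    rw [toAmbient, toAmbient, FormedSuperalgebra.bracket_right_left (der_mem q) (der_mem p)]
    rfl
  | right q =>
    have hq : q < 5 := by simpa [valid] using hy
    rw [bracket, eval_right, ← comm_der hb hp hq]
    rw [toAmbient, toAmbient, FormedSuperalgebra.bracket_right_right (der_mem p) (der_mem q)]
  | tens i a c =>
    simp only [valid, Bool.and_eq_true, Nat.blt_eq] at hy
    rw [bracket, Comb.eval_scale, eval_tens_right, ← der_vec hb hp hy.2, ← sgn_parityOf,
      ← parityOf_mul]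
    rw [toAmbient, toAmbient,
        FormedSuperalgebra.bracket_right_iota (der_mem p) (vec_mem a) (vec_mem c)]

theorem bracket_toAmbient_tens {i a c j a' c' : ℕ} (hx : (tens i a c).valid = true)
    (hy : (tens j a' c').valid = true) :
    ω.S12.bracket ω.S12 (toAmbient ω b (tens i a c)) (toAmbient ω b (tens j a' c'))
      = Comb.eval k (toAmbient ω b) (bracket (tens i a c) (tens j a' c')) := by
  simp only [valid, Bool.and_eq_true, Nat.blt_eq] at hx
  simp only [valid, Bool.and_eq_true, Nat.blt_eq] at hy
  rw [bracket]
  by_cases hij : i = j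
  · subst hij
    rw [Nat.beq_refl, cond_true, Comb.eval_append, Comb.eval_scale, Comb.eval_scale,
      eval_left, eval_right, ← sigma_vec hb hx.1.2 hy.1.2, ← sigma_vec hb hx.2 hy.2,
      Nat.cast_mul, Nat.cast_mul, ← form_vec hb hx.2 hy.2, ← form_vec hb hx.1.2 hy.1.2,
      ← sgn_parityOf, ← sgn_parityOf, ← parityOf_add, ← parityOf_add, ← parityOf_mul,
      ← parityOf_mul, ← parityOf_mul, ← parityOf_mul]
    rw [toAmbient, toAmbient, FormedSuperalgebra.bracket_iota_same (vec_mem a) (vec_mem c)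
      (vec_mem a') (vec_mem c') _ (triple_vec _ _) (triple_vec _ _)]
  · rw [Bool.eq_false_iff.2 fun h => hij (Nat.eq_of_beq_eq_true h), cond_false]
    by_cases hj : j = (i + 1) % 3
    · rw [show Nat.beq j ((i + 1) % 3) = true from by rw [hj, Nat.beq_refl], cond_true,
        ← bracket_cyclic hb hx.1.2 hx.2 hy.1.2 hy.2]
      simp only [toAmbient, hj, natCast_mod_three, Nat.cast_add, Nat.cast_one]
    · rw [Bool.eq_false_iff.2 fun h => hj (Nat.eq_of_beq_eq_true h), cond_false,
        ← bracket_cyclic' hb hy.1.2 hy.2 hx.1.2 hx.2]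
      -- Two positions below 3 that are distinct and not in the order `i`, `i + 1` are in the
      -- opposite cyclic order.
      have hi : i = (j + 1) % 3 := by omega
      conv_lhs => rw [hi]
      simp only [toAmbient, natCast_mod_three, Nat.cast_add, Nat.cast_one]

/-- This is the last statement in which the definition of the bracket is used; afterwards all
brackets are computed with labels. -/
theorem bracket_toAmbient {x y : Label} (hx : x.valid = true) (hy : y.valid = true) :
    ω.S12.bracket ω.S12 (toAmbient ω b x) (toAmbient ω b y)
      = Comb.eval k (toAmbient ω b) (bracket x y) := by
  cases x with
  | left p => exact bracket_toAmbient_left hb hx hy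
  | right p => exact bracket_toAmbient_right hb hx hy
  | tens i a c =>
    have hx' := hx
    simp only [valid, Bool.and_eq_true, Nat.blt_eq] at hx'
    cases y with
    | left q =>
      have hq : q < 5 := by simpa [valid] using hy
      rw [bracket, Comb.eval_scale, eval_tens_left, ← der_vec hb hq hx'.1.2, neg_signOf,
        ← sgn_parityOf, ← parityOf_mul, ← parityOf_add, neg_smul]
      rw [toAmbient, toAmbient,
        FormedSuperalgebra.bracket_iota_left (der_mem q) (vec_mem a) (vec_mem c)]
    | right q =>
      have hq : q < 5 := by simpa [valid] using hy
      rw [bracket, Comb.eval_scale, Comb.eval_scale, eval_tens_right, ← der_vec hb hq hx'.2,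
        neg_signOf, ← sgn_parityOf, ← sgn_parityOf, ← parityOf_mul, ← parityOf_mul,
        ← parityOf_add, neg_smul]
      rw [toAmbient, toAmbient,
        FormedSuperalgebra.bracket_iota_right (der_mem q) (vec_mem a) (vec_mem c)]
    | tens j a' c' => exact bracket_toAmbient_tens hb hx hy

end Label

end Super

/-! ### Root vectors over the prime field and their structure constants. -/

namespace Super

namespace Label

/-- The element `E` of a standard basis `E`, `F`, `H` of the split three-dimensional simple Lie
algebra with basis `ι₀`, `ι₁`, `ι₂`, tensored with two basis vectors. -/
def tensE (a b : ℕ) : Comb Label := [(tens 0 a b, 1), (tens 1 a b, 1), (tens 2 a b, 2)]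

/-- The element `F` tensored with two basis vectors. -/
def tensF (a b : ℕ) : Comb Label := [(tens 0 a b, 1), (tens 1 a b, 1), (tens 2 a b, 1)]

/-- The element `H` tensored with two basis vectors. -/
def tensH (a b : ℕ) : Comb Label := [(tens 0 a b, 1), (tens 1 a b, 2)]

/-- A basis of `𝔤(S_{1,2}, S_{1,2})`. The first 21 elements correspond to the elements `eᵢ ∧ eⱼ`,
`i < j`, of `𝔰𝔬₇`, the next 8 and the last 8 to the basis of the spin module. -/
def rootVector (n : ℕ) : Comb Label :=
  [tensH 1 1, Comb.scale 2 (tensH 2 2), tensH 1 2, tensH 2 1, tensE 0 0, Comb.scale 2 (tensF 0 0),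
    [(left 1, 2), (right 1, 2)], [(left 0, 1)], [(right 0, 1)], tensE 1 1, tensF 1 1,
    [(right 2, 1)], [(left 2, 1)], Comb.scale 2 (tensE 2 2), Comb.scale 2 (tensF 2 2),
    [(left 1, 2), (right 1, 1)], tensE 1 2, tensF 1 2, tensE 2 1, tensF 2 1, tensH 0 0,
    (left 4, 2) :: Comb.scale 2 (tensH 2 0), (right 3, 2) :: Comb.scale 2 (tensH 0 1),
    (right 4, 2) :: Comb.scale 2 (tensH 0 2), (left 3, 2) :: Comb.scale 2 (tensH 1 0),
    Comb.scale 2 (tensE 2 0), Comb.scale 2 (tensE 0 1), Comb.scale 2 (tensE 0 2),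
    Comb.scale 2 (tensE 1 0), tensF 2 0, tensF 0 1, tensF 0 2, tensF 1 0,
    (left 4, 1) :: Comb.scale 2 (tensH 2 0), (right 3, 1) :: Comb.scale 2 (tensH 0 1),
    (right 4, 1) :: Comb.scale 2 (tensH 0 2), (left 3, 1) :: Comb.scale 2 (tensH 1 0)].getD n []

/-- The position of a label. -/
def code : Label → ℕ
  | left p => p
  | right p => 5 + p
  | tens i a b => 10 + 9 * i + 3 * a + b

/-- The labelled elements in terms of the root vectors. -/
def inRootVectors (x : Label) : Comb ℕ :=
  (([
    [22], [19, 46], [37], [73, 110], [64, 101], [25], [19, 47], [34], [67, 104], [70, 107],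
    [13, 17, 62], [68, 80, 91, 104], [71, 83, 94, 107], [74, 86, 97, 110], [2, 28, 31],
    [8, 49, 52], [65, 77, 88, 101], [11, 55, 58], [4, 41, 44], [13, 17, 61], [67, 80, 91, 103],
    [70, 83, 94, 106], [73, 86, 97, 109], [1, 28, 31], [7, 49, 52], [64, 77, 88, 100],
    [10, 55, 58], [5, 41, 44], [13, 16], [80, 92], [83, 95], [86, 98], [28, 32], [49, 53],
    [77, 89], [55, 59], [41, 43]]).getD
    x.code []).flatMap monomial

end Label

/-- The codes of the brackets of the root vectors. -/
def structureTable : List (List ℕ) :=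
  [
   [0, 112, 22, 25, 28, 31, 2, 0, 0, 0, 0, 7, 10, 13, 16, 0, 0, 0, 0, 0, 0, 68, 0, 73, 0, 79, 0,
    86, 0, 92, 0, 97, 0, 103, 0, 110, 0],
   [113, 0, 34, 37, 40, 43, 4, 7, 10, 13, 16, 0, 0, 0, 0, 0, 0, 0, 0, 0, 0, 0, 64, 0, 71, 0, 77,
    0, 82, 0, 88, 0, 95, 0, 101, 0, 106],
   [23, 35, 0, 114, 49, 52, 0, 0, 2, 0, 0, 0, 5, 0, 0, 8, 0, 0, 13, 16, 0, 71, 74, 0, 0, 82, 85,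
    0, 0, 95, 98, 0, 0, 106, 109, 0, 0],
   [26, 38, 117, 0, 55, 58, 0, 2, 0, 0, 0, 5, 0, 0, 0, 10, 13, 16, 0, 0, 0, 0, 0, 64, 67, 0, 0,
    77, 80, 0, 0, 88, 91, 0, 0, 101, 104],
   [29, 41, 50, 56, 0, 120, 0, 0, 0, 0, 2, 0, 0, 0, 5, 0, 0, 8, 0, 11, 14, 77, 80, 83, 86, 0, 0,
    0, 0, 101, 104, 107, 110, 0, 0, 0, 0],
   [32, 44, 53, 59, 129, 0, 0, 0, 0, 2, 0, 0, 0, 5, 0, 0, 8, 0, 11, 0, 16, 0, 0, 0, 0, 64, 67, 70,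
    73, 0, 0, 0, 0, 88, 91, 94, 97],
   [1, 5, 0, 0, 0, 0, 0, 22, 25, 28, 31, 35, 38, 41, 44, 0, 0, 0, 0, 0, 0, 64, 68, 70, 74, 76, 80,
    82, 86, 88, 92, 94, 98, 100, 104, 106, 110],
   [0, 8, 0, 1, 0, 0, 23, 0, 0, 0, 0, 0, 119, 50, 53, 23, 0, 0, 28, 31, 0, 73, 0, 0, 0, 85, 0, 0,
    0, 97, 0, 0, 0, 109, 0, 0, 0],
   [0, 11, 1, 0, 0, 0, 26, 0, 0, 0, 0, 116, 0, 56, 59, 25, 28, 31, 0, 0, 0, 0, 0, 67, 0, 0, 0, 79,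
    0, 0, 0, 91, 0, 0, 0, 103, 0],
   [0, 14, 0, 0, 0, 1, 29, 0, 0, 0, 0, 49, 55, 0, 131, 0, 0, 23, 0, 26, 29, 79, 0, 86, 0, 0, 0, 0,
    0, 103, 0, 110, 0, 0, 0, 0, 0],
   [0, 17, 0, 0, 1, 0, 32, 0, 0, 0, 0, 52, 58, 122, 0, 0, 23, 0, 26, 0, 31, 0, 0, 0, 0, 67, 0, 74,
    0, 0, 0, 0, 0, 91, 0, 98, 0],
   [8, 0, 0, 4, 0, 0, 34, 0, 118, 50, 53, 0, 0, 0, 0, 35, 0, 0, 40, 43, 0, 0, 71, 0, 0, 0, 83, 0,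
    0, 0, 95, 0, 0, 0, 107, 0, 0],
   [11, 0, 4, 0, 0, 0, 37, 115, 0, 56, 59, 0, 0, 0, 0, 37, 40, 43, 0, 0, 0, 0, 0, 0, 65, 0, 0, 0,
    77, 0, 0, 0, 89, 0, 0, 0, 101],
   [14, 0, 0, 0, 0, 4, 40, 49, 55, 0, 130, 0, 0, 0, 0, 0, 0, 35, 0, 38, 41, 0, 77, 0, 82, 0, 0, 0,
    0, 0, 101, 0, 106, 0, 0, 0, 0],
   [17, 0, 0, 0, 4, 0, 43, 52, 58, 121, 0, 0, 0, 0, 0, 0, 35, 0, 38, 0, 43, 0, 0, 0, 0, 0, 65, 0,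
    70, 0, 0, 0, 0, 0, 89, 0, 94],
   [0, 0, 7, 11, 0, 0, 0, 22, 26, 0, 0, 34, 38, 0, 0, 0, 49, 52, 56, 59, 0, 64, 67, 71, 74, 76,
    79, 83, 86, 88, 91, 95, 98, 100, 103, 107, 110],
   [0, 0, 0, 14, 0, 7, 0, 0, 29, 0, 22, 0, 41, 0, 34, 50, 0, 0, 0, 135, 50, 82, 85, 0, 0, 0, 0, 0,
    0, 106, 109, 0, 0, 0, 0, 0, 0],
   [0, 0, 0, 17, 7, 0, 0, 0, 32, 22, 0, 0, 44, 34, 0, 53, 0, 0, 126, 0, 52, 0, 0, 0, 0, 70, 73, 0,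
    0, 0, 0, 0, 0, 94, 97, 0, 0],
   [0, 0, 14, 0, 0, 10, 0, 29, 0, 0, 25, 41, 0, 0, 37, 55, 0, 132, 0, 0, 56, 0, 0, 77, 80, 0, 0,
    0, 0, 0, 0, 101, 104, 0, 0, 0, 0],
   [0, 0, 17, 0, 10, 0, 0, 32, 0, 25, 0, 44, 0, 37, 0, 58, 123, 0, 0, 0, 58, 0, 0, 0, 0, 0, 0, 65,
    68, 0, 0, 0, 0, 0, 0, 89, 92],
   [0, 0, 0, 0, 13, 17, 0, 0, 0, 28, 32, 0, 0, 40, 44, 0, 49, 53, 55, 59, 0, 64, 67, 70, 73, 77,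
    80, 83, 86, 88, 91, 94, 97, 101, 104, 107, 110],
   [67, 0, 70, 0, 76, 0, 65, 74, 0, 80, 0, 0, 0, 0, 0, 65, 83, 0, 0, 0, 65, 0, 0, 0, 0, 0, 0, 0,
    0, 0, 59, 43, 17, 38, 10, 5, 137],
   [0, 65, 73, 0, 79, 0, 67, 0, 0, 0, 0, 70, 0, 76, 0, 68, 86, 0, 0, 0, 68, 0, 0, 0, 0, 0, 0, 0,
    0, 58, 0, 16, 31, 11, 26, 125, 2],
   [74, 0, 0, 65, 82, 0, 71, 0, 68, 85, 0, 0, 0, 0, 0, 70, 0, 0, 76, 0, 71, 0, 0, 0, 0, 0, 0, 0,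
    0, 44, 17, 0, 52, 4, 134, 35, 8],
   [0, 70, 0, 68, 85, 0, 73, 0, 0, 0, 0, 0, 64, 83, 0, 73, 0, 0, 79, 0, 74, 0, 0, 0, 0, 0, 0, 0,
    0, 16, 32, 53, 0, 128, 1, 7, 23],
   [80, 0, 83, 0, 0, 65, 77, 86, 0, 0, 68, 0, 0, 0, 0, 77, 0, 71, 0, 0, 76, 0, 0, 0, 0, 0, 0, 0,
    0, 37, 10, 5, 133, 0, 55, 41, 14],
   [0, 76, 86, 0, 0, 68, 79, 0, 0, 0, 0, 82, 0, 0, 64, 80, 0, 74, 0, 0, 79, 0, 0, 0, 0, 0, 0, 0,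
    0, 11, 25, 127, 2, 56, 0, 13, 29],
   [85, 0, 0, 76, 0, 71, 83, 0, 80, 0, 73, 0, 0, 0, 0, 82, 0, 0, 0, 64, 82, 0, 0, 0, 0, 0, 0, 0,
    0, 4, 136, 34, 8, 40, 14, 0, 50],
   [0, 83, 0, 79, 0, 74, 85, 0, 0, 0, 0, 0, 76, 0, 71, 85, 0, 0, 0, 67, 85, 0, 0, 0, 0, 0, 0, 0,
    0, 124, 1, 7, 22, 13, 28, 49, 0],
   [91, 0, 94, 0, 100, 0, 89, 98, 0, 104, 0, 0, 0, 0, 0, 89, 107, 0, 0, 0, 89, 0, 58, 44, 16, 37,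
    11, 4, 124, 0, 0, 0, 0, 0, 0, 0, 0],
   [0, 89, 97, 0, 103, 0, 91, 0, 0, 0, 0, 94, 0, 100, 0, 92, 110, 0, 0, 0, 92, 59, 0, 17, 32, 10,
    25, 136, 1, 0, 0, 0, 0, 0, 0, 0, 0],
   [98, 0, 0, 89, 106, 0, 95, 0, 92, 109, 0, 0, 0, 0, 0, 94, 0, 0, 100, 0, 95, 43, 16, 0, 53, 5,
    127, 34, 7, 0, 0, 0, 0, 0, 0, 0, 0],
   [0, 94, 0, 92, 109, 0, 97, 0, 0, 0, 0, 0, 88, 107, 0, 97, 0, 0, 103, 0, 98, 17, 31, 52, 0, 133,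
    2, 8, 22, 0, 0, 0, 0, 0, 0, 0, 0],
   [104, 0, 107, 0, 0, 89, 101, 110, 0, 0, 92, 0, 0, 0, 0, 101, 0, 95, 0, 0, 100, 38, 11, 4, 128,
    0, 56, 40, 13, 0, 0, 0, 0, 0, 0, 0, 0],
   [0, 100, 110, 0, 0, 92, 103, 0, 0, 0, 0, 106, 0, 0, 88, 104, 0, 98, 0, 0, 103, 10, 26, 134, 1,
    55, 0, 14, 28, 0, 0, 0, 0, 0, 0, 0, 0],
   [109, 0, 0, 100, 0, 95, 107, 0, 104, 0, 97, 0, 0, 0, 0, 106, 0, 0, 0, 88, 106, 5, 125, 35, 7,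
    41, 13, 0, 49, 0, 0, 0, 0, 0, 0, 0, 0],
   [0, 107, 0, 103, 0, 98, 109, 0, 0, 0, 0, 0, 100, 0, 95, 109, 0, 0, 0, 91, 109, 137, 2, 8, 23,
    14, 29, 50, 0, 0, 0, 0, 0, 0, 0, 0, 0]]

/-- The brackets of the root vectors: the code `3 n + c` stands for `c` times the root vector with
number `n`, and a code from `111` on for an element of the span of those with numbers
`6`, `15`, `20`. -/
def structureConst (p q : ℕ) : Comb ℕ :=
  let m := entry structureTable p q
  bif Nat.blt m 111 then monomial m
  -- The three coefficients are the base-three digits of `m - 111`; the lowest can be read from `m`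
  -- itself because 3 divides 111. The vectors 6, 15, 20 correspond to `e₁ ∧ e₂`, `e₃ ∧ e₄`, `e₅ ∧
  -- e₆` and span a Cartan subalgebra.
  else [(6, Nat.mod m 3), (15, Nat.mod (Nat.div (Nat.sub m 111) 3) 3),
    (20, Nat.div (Nat.sub m 111) 9)]

namespace Label

/-- The vectors `ιᵢ(1 ⊗ 1)` satisfy the cross product relations, and `ι₀ + ι₁ + ι₂` is isotropic
because `1 + 1 + 1 = 0`. Root vectors with coefficients in the prime field therefore exist, and
their brackets are a finite computation modulo 3. -/
theorem rootVector_bracket : allBelow 37 (fun p => allBelow 37 fun q => Comb.eqv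
    (Comb.bind (rootVector p) fun x => Comb.bind (rootVector q) fun y => bracket x y)
    (Comb.bind (structureConst p q) rootVector)) = true := by
  decide +kernel

end Label

end Super

/-! ### The root vectors form a basis of `𝔤(S_{1,2}, S_{1,2})`. -/

namespace Super

theorem Comb.bilin_eval {ι κ η k L M N : Type*} [Field k] [AddCommGroup L] [Module k L]
    [AddCommGroup M] [Module k M] [AddCommGroup N] [Module k N] (m : L →ₗ[k] M →ₗ[k] N)
    {B : ι → L} {B' : κ → M} {D : η → N} {T : ι → κ → Comb η} {ℓ : Comb ι} {ℓ' : Comb κ}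
    (h : ∀ s ∈ ℓ, ∀ t ∈ ℓ', m (B s.1) (B' t.1) = Comb.eval k D (T s.1 t.1)) :
    m (Comb.eval k B ℓ) (Comb.eval k B' ℓ')
      = Comb.eval k D (Comb.bind ℓ fun x => Comb.bind ℓ' fun y => T x y) := by
  rw [← LinearMap.flip_apply, Comb.map_eval, Comb.eval_bind]
  refine Comb.eval_congr fun s hs => ?_
  rw [LinearMap.flip_apply, Comb.map_eval, Comb.eval_bind]
  exact Comb.eval_congr fun t ht => h s hs t ht

/-- A basis of a superalgebra, numbered by the natural numbers below `37`, with the structure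
constants of the table. -/
structure IsRootBasis {k L : Type*} [Field k] [AddCommGroup L] [Module k L]
    (A : Superalgebra k L) (B : ℕ → L) : Prop where
  linearIndependent : LinearIndependent k fun p : Fin 37 => B p
  span : ⊤ ≤ Submodule.span k (Set.range fun p : Fin 37 => B p)
  odd : ∀ p < 37, A.odd (B p) = if 21 ≤ p then B p else 0
  mul : ∀ p < 37, ∀ q < 37, A.mul (B p) (B q) = Comb.eval k B (structureConst p q)

namespace Label

open SymplecticPlane

theorem rootVector_valid : allBelow 37 (fun p => (rootVector p).all fun t =>
    t.1.valid && (t.1.odd == Nat.ble 21 p)) = true := by decide +kernel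

/-- An explicit inverse of the change of basis. It shows that the root vectors span; their
independence then follows by counting dimensions. -/
theorem inRootVectors_correct : (((List.range 5).all fun p => Comb.eqv
      (Comb.bind (inRootVectors (left p)) rootVector) [(left p, 1)] &&
      Comb.eqv (Comb.bind (inRootVectors (right p)) rootVector) [(right p, 1)]) &&
    (allBelow 3 fun i => allBelow 3 fun a => allBelow 3 fun b => Comb.eqv
      (Comb.bind (inRootVectors (tens i a b)) rootVector) [(tens i a b, 1)])) = true := by
  decide +kernel

theorem inRootVectors_lt (x : Label) (t : ℕ × ℕ) (ht : t ∈ inRootVectors x) : t.1 < 37 := by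
  have key : allBelow 37 (fun n => ((inRootVectors (left n)).all fun t => Nat.blt t.1 37)) = true := by
    decide +kernel
  by_cases hx : x.code < 37
  · have e : inRootVectors x = inRootVectors (left x.code) := rfl
    rw [e] at ht
    exact Nat.blt_eq ▸ List.all_eq_true.1 (of_allBelow key hx) t ht
  · rw [inRootVectors, List.getD_eq_default] at ht
    · simp at ht
    · exact not_lt.1 hx

theorem inRootVectors_eqv {x : Label} (hx : x.valid = true) :
    Comb.eqv (Comb.bind (inRootVectors x) rootVector) [(x, 1)] = true := by
  have h := inRootVectors_correct
  rw [Bool.and_eq_true] at h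
  cases x with
  | left p =>
    have := List.all_eq_true.1 h.1 p (by simpa [valid] using hx)
    rw [Bool.and_eq_true] at this
    exact this.1
  | right p =>
    have := List.all_eq_true.1 h.1 p (by simpa [valid] using hx)
    rw [Bool.and_eq_true] at this
    exact this.2
  | tens i a b =>
    simp only [valid, Bool.and_eq_true, Nat.blt_eq] at hx
    exact of_allBelow (of_allBelow (of_allBelow h.2 hx.1.1) hx.1.2) hx.2

theorem valid_of_mem {p : ℕ} (hp : p < 37) {t : Label × ℕ} (ht : t ∈ rootVector p) :
    t.1.valid = true ∧ t.1.odd = Nat.ble 21 p := by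
  have := List.all_eq_true.1 (of_allBelow rootVector_valid hp) t ht
  simpa using this

section

variable {k L : Type*} [Field k] [AddCommGroup L] [Module k L] {A : Superalgebra k L}
  {C : Label → L}

theorem root_odd (hC : ∀ x, A.odd (C x) = if x.odd then C x else 0) {p : ℕ} (hp : p < 37) :
    A.odd (Comb.eval k C (rootVector p)) =
      if 21 ≤ p then Comb.eval k C (rootVector p) else 0 := by
  rw [Comb.map_eval]
  split_ifs with h
  · refine Comb.eval_congr fun t ht => ?_
    rw [hC, if_pos]
    rw [(valid_of_mem hp ht).2]; exact Nat.ble_eq_true_of_le h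
  · have e : ∀ ℓ : Comb Label, Comb.eval k (fun _ => (0 : L)) ℓ = 0 := fun ℓ => by
      induction ℓ with
      | nil => rfl
      | cons t ℓ ih => simp [ih]
    refine (Comb.eval_congr fun t ht => ?_).trans (e _)
    rw [hC, if_neg]
    rw [(valid_of_mem hp ht).2]; exact fun h' => h (Nat.le_of_ble_eq_true h')

variable [CharP k 3]

theorem root_mul (hC : ∀ x y, x.valid = true → y.valid = true →
      A.mul (C x) (C y) = Comb.eval k C (bracket x y)) {p q : ℕ} (hp : p < 37) (hq : q < 37) :
    A.mul (Comb.eval k C (rootVector p)) (Comb.eval k C (rootVector q))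
      = Comb.eval k (fun n => Comb.eval k C (rootVector n)) (structureConst p q) := by
  rw [Comb.bilin_eval (k := k) A.mul (T := bracket) (D := C)
    (ℓ := rootVector p) (ℓ' := rootVector q) fun s hs t ht =>
    hC _ _ (valid_of_mem hp hs).1 (valid_of_mem hq ht).1,
    Comb.eval_eq_of_eqv _ (of_allBelow (of_allBelow rootVector_bracket hp) hq),
    Comb.eval_bind]

theorem mem_span_root (C : Label → L) {x : Label} (hx : x.valid = true) :
    C x ∈ Submodule.span k
      (Set.range fun p : Fin 37 => Comb.eval k C (rootVector p)) := by
  have := Comb.eval_eq_of_eqv (k := k) C (inRootVectors_eqv hx)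
  rw [Comb.eval_bind] at this
  have e : C x = Comb.eval k C [(x, 1)] := by simp
  rw [e, ← this]
  exact Comb.eval_mem fun t ht =>
    Submodule.subset_span ⟨(⟨t.1, inRootVectors_lt x t ht⟩ : Fin 37), rfl⟩

/-- Spanning is inherited from the labelled elements through the inverse change of basis, and 37
spanning vectors in dimension 37 are independent. Parities and brackets are transported linearly
from the labels. -/
theorem isRootBasis_of_labels (hodd : ∀ x, A.odd (C x) = if x.odd then C x else 0)
    (hmul : ∀ x y, x.valid = true → y.valid = true →
      A.mul (C x) (C y) = Comb.eval k C (bracket x y))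
    (hspan : ⊤ ≤ Submodule.span k (C '' {x | x.valid = true}))
    (hrank : Module.finrank k L = 37) :
    IsRootBasis A fun p => Comb.eval k C (rootVector p) := by
  have h : ⊤ ≤ Submodule.span k
      (Set.range fun p : Fin 37 => Comb.eval k C (rootVector p)) := by
    refine hspan.trans (Submodule.span_le.2 ?_)
    rintro _ ⟨x, hx, rfl⟩
    exact mem_span_root C hx
  exact ⟨linearIndependent_of_top_le_span_of_card_eq_finrank h
    (by rw [hrank, Fintype.card_fin]), h, fun _ hp => root_odd hodd hp,
    fun _ hp _ hq => root_mul hmul hp hq⟩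

end

variable {k V : Type*} [Field k] [AddCommGroup V] [Module k V]

/-- The labelled elements of `𝔤(S_{1,2}, S_{1,2})`. -/
def toMagic [CharP k 3] (ω : SymplecticPlane k V) (b : Module.Basis (Fin 2) k V) (x : Label) :
    ω.S12.magicSubmodule ω.S12 := ⟨toAmbient ω b x, toAmbient_mem x⟩

variable {ω : SymplecticPlane k V} {b : Module.Basis (Fin 2) k V}

theorem toMagic_odd [CharP k 3] (x : Label) :
    (gS12S12 ω).odd (toMagic ω b x) = if x.odd then toMagic ω b x else 0 := by
  have h : (ω.S12.ambientSpace ω.S12).comp 1 (toAmbient ω b x)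
      = if (1 : ZMod 2) = parityOf x.odd then toAmbient ω b x else 0 :=
    Superspace.comp_of_mem (toAmbient_odd x) 1
  rw [Superspace.comp_one] at h
  refine Subtype.ext (Eq.trans h ?_)
  cases x.odd
  · rw [parityOf, cond_false, if_neg zero_ne_one.symm]; rfl
  · rw [parityOf, cond_true, if_pos rfl]; rfl

theorem toMagic_mul [CharP k 3] (hb : ω.form (b 0) (b 1) = 1) {x y : Label}
    (hx : x.valid = true) (hy : y.valid = true) :
    (gS12S12 ω).mul (toMagic ω b x) (toMagic ω b y)
      = Comb.eval k (toMagic ω b) (bracket x y) := by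
  refine Subtype.ext ((bracket_toAmbient hb hx hy).trans ?_)
  exact (Comb.map_eval (ω.S12.magicSubmodule ω.S12).subtype (toMagic ω b) _).symm

/-- The basis of `S_{1,2}` given by a basis of the plane. -/
def vecBasis (b : Module.Basis (Fin 2) k V) : Module.Basis (Unit ⊕ Fin 2) k (k × V) :=
  (Module.Basis.singleton Unit k).prod b

theorem vecBasis_eq (i : Unit ⊕ Fin 2) :
    ∃ a < 3, vecBasis b i = vec b a := by
  rcases i with i | i
  · exact ⟨0, by norm_num, by simp [vecBasis, vec]⟩
  · fin_cases i
    · exact ⟨1, by norm_num, by simp [vecBasis, vec]⟩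
    · exact ⟨2, by norm_num, by simp [vecBasis, vec]⟩

/-- A family of coordinates, as a constant triple of derivations. -/
def constTriple (ω : SymplecticPlane k V) (b : Module.Basis (Fin 2) k V) :
    (Fin 5 → k) →ₗ[k] (ZMod 3 → Module.End k (k × V)) :=
  LinearMap.pi (fun _ => LinearMap.id) ∘ₗ
    Fintype.linearCombination k fun p : Fin 5 => der ω b p

theorem range_constTriple [CharP k 3] (hb : ω.form (b 0) (b 1) = 1) :
    LinearMap.range (constTriple ω b) = ω.S12.tri := by
  refine le_antisymm ?_ fun d hd => ?_
  · rintro _ ⟨f, rfl⟩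
    rw [constTriple, LinearMap.comp_apply, Fintype.linearCombination_apply, map_sum]
    refine Submodule.sum_mem _ fun p _ => ?_
    rw [map_smul]
    exact Submodule.smul_mem _ _ (const_der_mem p)
  · obtain ⟨e, he, rfl⟩ := tri_le hb hd
    obtain ⟨f, rfl⟩ := (Submodule.mem_span_range_iff_exists_fun k).1 he
    exact ⟨f, congrArg (LinearMap.pi fun _ => LinearMap.id)
      (Fintype.linearCombination_apply k (fun p : Fin 5 => der ω b p) f)⟩

theorem constTriple_injective [CharP k 3] (hb : ω.form (b 0) (b 1) = 1) :
    Function.Injective (constTriple ω b) := fun _ _ h =>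
  (linearIndependent_iff_injective_fintypeLinearCombination.1 (der_linearIndependent hb))
    (congrFun h 0)

/-- Coordinates on `𝔤(S_{1,2}, S_{1,2})`. -/
def coordinates (ω : SymplecticPlane k V) (b : Module.Basis (Fin 2) k V) :
    ((Fin 5 → k) × (Fin 5 → k) × (ZMod 3 → (k × V) ⊗[k] (k × V))) →ₗ[k]
      FormedSuperalgebra.Ambient k (k × V) (k × V) :=
  (constTriple ω b).prodMap ((constTriple ω b).prodMap LinearMap.id)

theorem range_coordinates [CharP k 3] (hb : ω.form (b 0) (b 1) = 1) :
    LinearMap.range (coordinates ω b) = ω.S12.magicSubmodule ω.S12 := by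
  rw [coordinates, LinearMap.range_prodMap, LinearMap.range_prodMap, range_constTriple hb,
    LinearMap.range_id]
  rfl

/-- Each triality algebra contributes 5, and each of the three copies of `S ⊗ S'` contributes `3 ·
3`. -/
theorem finrank_magic [CharP k 3] (hb : ω.form (b 0) (b 1) = 1) :
    Module.finrank k (ω.S12.magicSubmodule ω.S12) = 37 := by
  have hi : Function.Injective (coordinates ω b) :=
    (constTriple_injective hb).prodMap ((constTriple_injective hb).prodMap Function.injective_id)
  rw [← range_coordinates hb, LinearMap.finrank_range_of_inj hi]
  have := Module.Finite.of_basis b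
  have h2 : Module.finrank k V = 2 := by
    rw [Module.finrank_eq_card_basis b, Fintype.card_fin]
  have h3 : Module.finrank k (ZMod 3 → (k × V) ⊗[k] (k × V)) = 27 := by
    rw [Module.finrank_pi_fintype]
    simp [h2, ZMod.card]
  rw [Module.finrank_prod, Module.finrank_prod, h3]
  simp

theorem coordinates_mem (x : (Fin 5 → k) × (Fin 5 → k) × (ZMod 3 → (k × V) ⊗[k] (k × V))) :
    coordinates ω b x ∈ Submodule.span k (toAmbient ω b '' {x | x.valid = true}) := by
  obtain ⟨f, f', u⟩ := x
  have e : coordinates ω b (f, f', u) = coordinates ω b (f, 0, 0) + coordinates ω b (0, f', 0)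
      + coordinates ω b (0, 0, u) := by
    rw [← map_add, ← map_add]; simp
  rw [e]
  refine Submodule.add_mem _ (Submodule.add_mem _ ?_ ?_) ?_
  · change (coordinates ω b ∘ₗ LinearMap.inl k _ _) f ∈ _
    rw [LinearMap.pi_apply_eq_sum_univ (coordinates ω b ∘ₗ LinearMap.inl k _ _) f]
    refine Submodule.sum_mem _ fun p _ => Submodule.smul_mem _ _
      (Submodule.subset_span ⟨left p, by simp [valid], ?_⟩)
    refine Prod.ext (funext fun _ => ?_) (Prod.ext ?_ rfl)
    · change der ω b p = Fintype.linearCombination k (fun p : Fin 5 => der ω b p) _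
      rw [Fintype.linearCombination_apply, Finset.sum_eq_single p]
      · simp
      · intro q _ hq; simp [hq.symm]
      · simp
    · exact (map_zero (constTriple ω b)).symm
  · change (coordinates ω b ∘ₗ LinearMap.inr k _ _ ∘ₗ LinearMap.inl k _ _) f' ∈ _
    rw [LinearMap.pi_apply_eq_sum_univ
      (coordinates ω b ∘ₗ LinearMap.inr k _ _ ∘ₗ LinearMap.inl k _ _) f']
    refine Submodule.sum_mem _ fun p _ => Submodule.smul_mem _ _
      (Submodule.subset_span ⟨right p, by simp [valid], ?_⟩)
    refine Prod.ext ?_ (Prod.ext (funext fun _ => ?_) rfl)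
    · exact (map_zero (constTriple ω b)).symm
    · change der ω b p = Fintype.linearCombination k (fun p : Fin 5 => der ω b p) _
      rw [Fintype.linearCombination_apply, Finset.sum_eq_single p]
      · simp
      · intro q _ hq; simp [hq.symm]
      · simp
  · let B := Pi.basis fun _ : ZMod 3 => (vecBasis b).tensorProduct (vecBasis b)
    suffices h : ⊤ ≤ (Submodule.span k (toAmbient ω b '' {x | x.valid = true})).comap
        (coordinates ω b ∘ₗ LinearMap.inr k _ _ ∘ₗ LinearMap.inr k _ _) from
      h (Submodule.mem_top (x := u))
    rw [← B.span_eq, Submodule.span_le]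
    rintro _ ⟨⟨i, s, t⟩, rfl⟩
    obtain ⟨a, ha, has⟩ := vecBasis_eq (b := b) s
    obtain ⟨c, hc, hct⟩ := vecBasis_eq (b := b) t
    refine Submodule.subset_span ⟨tens i.val a c, by simp [valid, ha, hc, ZMod.val_lt i], ?_⟩
    refine Prod.ext ?_ (Prod.ext ?_ ?_)
    · exact (map_zero (constTriple ω b)).symm
    · exact (map_zero (constTriple ω b)).symm
    · change Pi.single ((i.val : ℕ) : ZMod 3) (vec b a ⊗ₜ vec b c) = B ⟨i, s, t⟩
      rw [Pi.basis_apply, Module.Basis.tensorProduct_apply, has, hct, ZMod.natCast_zmod_val]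

theorem span_toMagic [CharP k 3] (hb : ω.form (b 0) (b 1) = 1) :
    ⊤ ≤ Submodule.span k (toMagic ω b '' {x | x.valid = true}) := by
  rw [← Submodule.map_le_map_iff_of_injective (ω.S12.magicSubmodule ω.S12).injective_subtype,
    Submodule.map_span, ← Set.image_comp, Submodule.map_top, Submodule.range_subtype]
  refine (range_coordinates hb).symm.le.trans ?_
  rintro _ ⟨x, rfl⟩
  exact coordinates_mem x

end Label

/-- The rest of the proof uses `𝔤(S_{1,2}, S_{1,2})` only through this basis and its table. -/
theorem exists_isRootBasis {k V : Type*} [Field k] [AddCommGroup V] [Module k V] [CharP k 3]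
    (ω : SymplecticPlane k V) : ∃ B, IsRootBasis (gS12S12 ω) B :=
  let ⟨_, hb⟩ := ω.exists_basis
  ⟨_, Label.isRootBasis_of_labels (C := Label.toMagic ω _) Label.toMagic_odd
    (fun _ _ hx hy => Label.toMagic_mul hb hx hy) (Label.span_toMagic hb)
    (Label.finrank_magic hb)⟩

end Super

/-! ### The Lie superalgebra axioms, checked on generators. -/

namespace Super

namespace Superalgebra

variable {k L : Type*} [Field k] [AddCommGroup L] [Module k L] (A : Superalgebra k L)

/-- Multiplication by an element satisfies the identity of superderivations of parity `i`. -/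
def IsDerivAt (i : ZMod 2) (x : L) : Prop :=
  ∀ j, ∀ y ∈ A.gr j, ∀ z,
    A.mul x (A.mul y z) = A.mul (A.mul x y) z + sgn k (i * j) • A.mul y (A.mul x z)

variable {A}

/-- The derivation identity for `x`, applied to `y`, says that multiplication by `xy` is the
supercommutator of multiplication by `x` and by `y`, and the supercommutator of two superderivations
is a superderivation. No skew-symmetry is needed. -/
theorem IsDerivAt.mul {i j : ZMod 2} {x y : L} (hx : A.IsDerivAt i x) (hy : A.IsDerivAt j y)
    (hxi : x ∈ A.gr i) (hyj : y ∈ A.gr j) : A.IsDerivAt (i + j) (A.mul x y) := by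
  have e : ∀ w, A.mul (A.mul x y) w = A.mul x (A.mul y w) - sgn k (i * j) • A.mul y (A.mul x w) :=
    fun w => eq_sub_of_add_eq (hx j y hyj w).symm
  intro l z hz w
  have hyz := A.mul_mem _ _ _ _ hyj hz
  have hxz := A.mul_mem _ _ _ _ hxi hz
  rw [e, e, e, hy l z hz, hx l z hz]
  simp only [map_add, map_smul, map_sub, LinearMap.sub_apply, LinearMap.smul_apply]
  rw [hx _ _ hyz, hy _ _ hxz, hx _ _ hz, hy _ _ hz]
  rcases zmod2_cases i with rfl | rfl <;> rcases zmod2_cases j with rfl | rfl <;>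
    rcases zmod2_cases l with rfl | rfl <;> simp [sgn, one_add_one_zmod2] <;> abel

/-- The elements whose homogeneous components satisfy the Jacobi identity. -/
def jacobiSubmodule (A : Superalgebra k L) : Submodule k L where
  carrier := {x | ∀ i, A.IsDerivAt i (A.comp i x)}
  zero_mem' i j y hy z := by simp
  add_mem' {a b} ha hb i j y hy z := by
    simp only [map_add, LinearMap.add_apply, ha i j y hy z, hb i j y hy z, smul_add]
    abel
  smul_mem' c a ha i j y hy z := by
    simp only [map_smul, LinearMap.smul_apply, ha i j y hy z, smul_add]
    rw [smul_comm]

/-- Because of this closure the Jacobi identity has to be tested only for generators in the first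
argument. -/
theorem mul_mem_jacobiSubmodule {i : ZMod 2} {g x : L} (hg : g ∈ A.gr i)
    (hg' : g ∈ A.jacobiSubmodule) (hx : x ∈ A.jacobiSubmodule) :
    A.mul g x ∈ A.jacobiSubmodule := by
  have h : A.mul g x = ∑ j, A.mul g (A.comp j x) := by rw [← map_sum, A.sum_comp]
  rw [h]
  refine Submodule.sum_mem _ fun j _ l => ?_
  have hm := A.mul_mem _ _ _ _ hg (A.comp_mem j x)
  rw [Superspace.comp_of_mem hm]
  split_ifs with hl
  · subst hl
    have h1 := hg' i
    rw [Superspace.mem_gr.1 hg] at h1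
    exact h1.mul (hx j) hg (A.comp_mem j x)
  · intro m y _ z
    simp

/-- The mixed terms of the cube of `x + y` are two Jacobi sums, with arguments `x, x, y` and `y, y,
x`, and these vanish. So the cube map is additive on the odd part, although in characteristic 3 its
vanishing is an independent axiom. -/
theorem cube_add (hs : ∀ x ∈ A.gr 1, ∀ y ∈ A.gr 1, A.mul x y = A.mul y x)
    (hs' : ∀ x ∈ A.gr 0, ∀ y ∈ A.gr 1, A.mul y x = - A.mul x y)
    (hj : ∀ x ∈ A.gr 1, ∀ y ∈ A.gr 1, ∀ z,
      A.mul x (A.mul y z) = A.mul (A.mul x y) z - A.mul y (A.mul x z))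
    {x y : L} (hx : x ∈ A.gr 1) (hy : y ∈ A.gr 1) :
    A.mul (x + y) (A.mul (x + y) (x + y)) = A.mul x (A.mul x x) + A.mul y (A.mul y y) := by
  have key : ∀ x ∈ A.gr 1, ∀ y ∈ A.gr 1,
      A.mul x (A.mul x y) + A.mul x (A.mul y x) + A.mul y (A.mul x x) = 0 := by
    intro x hx y hy
    have h1 := hj x hx x hx y
    rw [hs y hy x hx, hs' _ (A.mul_mem _ _ _ _ hx hx) y hy]
    nth_rewrite 1 [h1]
    abel
  have h1 := key x hx y hy
  have h2 := key y hy x hx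
  simp only [map_add, LinearMap.add_apply]
  rw [← sub_eq_zero]
  calc _ = (A.mul x (A.mul x y) + A.mul x (A.mul y x) + A.mul y (A.mul x x))
        + (A.mul y (A.mul y x) + A.mul y (A.mul x y) + A.mul x (A.mul y y)) := by abel
    _ = 0 := by rw [h1, h2, add_zero]

end Superalgebra

/-- The numbers of the root vectors for the simple roots. -/
def simpleRoots : List ℕ := [8, 17, 4, 21]

/-- The numbers of the root vectors for the opposites of the simple roots. -/
def negSimpleRoots : List ℕ := [11, 18, 5, 36]

/-- Expressions of the root vectors as brackets of generators and previous root vectors. -/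
def buildTable : List (ℕ × Comb (ℕ × ℕ)) :=
  [(10, [((8, 17), 1)]), (2, [((17, 4), 1)]), (25, [((4, 21), 2)]), (20, [((4, 5), 1)]), (15,
   [((17, 18), 2), ((4, 5), 1)]), (6, [((8, 11), 2), ((17, 18), 2), ((4, 5), 1)]), (0, [((4,
   10), 2)]), (16, [((4, 2), 2)]), (23, [((21, 2), 1)]), (22, [((21, 0), 1)]), (27, [((21, 16),
   2)]), (13, [((11, 18), 1)]), (3, [((18, 5), 1)]), (32, [((5, 36), 1)]), (1, [((5, 13), 2)]),
   (19, [((5, 3), 2)]), (34, [((36, 3), 1)]), (35, [((36, 1), 2)]), (30, [((36, 19), 1)]), (9,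
   [((8, 16), 1)]), (26, [((8, 27), 1)]), (7, [((17, 9), 1)]), (24, [((17, 26), 1)]), (28, [((4,
   24), 2)]), (14, [((11, 19), 1)]), (31, [((11, 30), 2)]), (12, [((18, 14), 1)]), (33, [((18,
   31), 2)]), (29, [((5, 33), 1)])]

/-- The entries of the table express root vectors in terms of brackets of generators and elements
of a list, or previous entries. -/
def isBuild : List ℕ → List (ℕ × Comb (ℕ × ℕ)) → Bool
  | _, [] => true
  | ℓ, t :: ts =>
    (Comb.eqv (Comb.bind t.2 fun x => structureConst x.1 x.2) [(t.1, 1)] &&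
      t.2.all fun x => List.elem x.1.1 (simpleRoots ++ negSimpleRoots) && List.elem x.1.2 ℓ &&
        Nat.blt x.1.2 37) && isBuild (t.1 :: ℓ) ts

/-- A certificate that the root vectors of the three even simple roots `ε₁ - ε₂`, `ε₂ - ε₃`, `ε₃` of
`𝔰𝔬₇` and of one odd root, with their opposites, generate: each remaining basis vector is a
combination of products of a generator with a vector already reached. -/
theorem isBuild_buildTable : isBuild (simpleRoots ++ negSimpleRoots) buildTable = true := by
  decide +kernel

theorem buildTable_complete : allBelow 37 (fun p => List.elem p (simpleRoots ++ negSimpleRoots) ||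
    buildTable.any fun t => Nat.beq t.1 p) = true := by
  decide +kernel

/-- The signed Jacobi identity for basis vectors. -/
def jacobiComb (p q r : ℕ) : Comb ℕ :=
  Comb.bind (structureConst q r) (structureConst p) ++
    (Comb.scale 2 (Comb.bind (structureConst p q) fun s => structureConst s r) ++
    Comb.scale (bif Nat.ble 21 p && Nat.ble 21 q then 1 else 2)
      (Comb.bind (structureConst p r) (structureConst q)))

/-- Only the eight generators occur in the first place; `mul_mem_jacobiSubmodule` extends the
identity to all basis vectors. -/
theorem jacobiComb_isZero : (simpleRoots ++ negSimpleRoots).all (fun p =>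
    allBelow 37 fun q => allBelow 37 fun r => Comb.isZero (jacobiComb p q r)) = true := by
  decide +kernel

theorem structureConst_skew : allBelow 37 (fun p => allBelow 37 fun q => Comb.isZero
    (structureConst p q ++ Comb.scale (bif Nat.ble 21 p && Nat.ble 21 q then 2 else 1)
      (structureConst q p))) = true := by
  decide +kernel

theorem structureConst_lt : allBelow 37 (fun p => allBelow 37 fun q =>
    (structureConst p q).all fun t => Nat.blt t.1 37) = true := by
  decide +kernel

theorem structureConst_self : allBelow 37 (fun p => Comb.isZero (structureConst p p)) = true := by
  decide +kernel

theorem ble_eq_decide (m n : ℕ) : Nat.ble m n = decide (m ≤ n) :=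
  Bool.eq_iff_iff.2 (by rw [Nat.ble_eq, decide_eq_true_iff])

namespace IsRootBasis

variable {k L : Type*} [Field k] [AddCommGroup L] [Module k L] {A : Superalgebra k L} {B : ℕ → L}

theorem eq_top_of_mem (h : IsRootBasis A B) {N : Submodule k L} (hN : ∀ p < 37, B p ∈ N) :
    N = ⊤ := by
  refine top_le_iff.1 (h.span.trans (Submodule.span_le.2 ?_))
  rintro _ ⟨p, rfl⟩
  exact hN p p.2

theorem gens_lt {p : ℕ} (hp : p ∈ simpleRoots ++ negSimpleRoots) : p < 37 := by
  simp only [simpleRoots, negSimpleRoots, List.cons_append, List.nil_append, List.mem_cons,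
    List.not_mem_nil, or_false] at hp
  omega

theorem odd_gr (h : IsRootBasis A B) {p : ℕ} (hp : p < 37) (h' : 21 ≤ p) : B p ∈ A.gr 1 := by
  rw [Superspace.mem_gr, Superspace.comp_one, h.odd p hp, if_pos h']

theorem even_gr (h : IsRootBasis A B) {p : ℕ} (h' : p < 21) : B p ∈ A.gr 0 := by
  rw [Superspace.mem_gr, Superspace.comp_zero, h.odd p (by omega), if_neg (by omega), sub_zero]

/-- The parity of a root vector. -/
def rootParity (p : ℕ) : ZMod 2 := if 21 ≤ p then 1 else 0

theorem mem_gr (h : IsRootBasis A B) {p : ℕ} (hp : p < 37) : B p ∈ A.gr (rootParity p) := by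
  rw [rootParity]
  split_ifs with h'
  · exact h.odd_gr hp h'
  · exact h.even_gr (not_le.1 h')

theorem mul_eval (h : IsRootBasis A B) {p : ℕ} (hp : p < 37) {ℓ : Comb ℕ}
    (hℓ : ∀ t ∈ ℓ, t.1 < 37) :
    A.mul (B p) (Comb.eval k B ℓ) = Comb.eval k B (Comb.bind ℓ (structureConst p)) := by
  rw [Comb.map_eval, Comb.eval_bind]
  exact Comb.eval_congr fun t ht => h.mul p hp _ (hℓ t ht)

theorem eval_mul (h : IsRootBasis A B) {p : ℕ} (hp : p < 37) {ℓ : Comb ℕ}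
    (hℓ : ∀ t ∈ ℓ, t.1 < 37) : A.mul (Comb.eval k B ℓ) (B p)
      = Comb.eval k B (Comb.bind ℓ fun s => structureConst s p) := by
  rw [← LinearMap.flip_apply, Comb.map_eval, Comb.eval_bind]
  exact Comb.eval_congr fun t ht => h.mul _ (hℓ t ht) p hp

theorem lt_of_mem {p q : ℕ} (hp : p < 37) (hq : q < 37) {t : ℕ × ℕ}
    (ht : t ∈ structureConst p q) : t.1 < 37 :=
  Nat.blt_eq ▸ List.all_eq_true.1 (of_allBelow (of_allBelow structureConst_lt hp) hq) t ht

variable [CharP k 3]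

/-- Induction along a certificate. The starting list is arbitrary, so that the lemma serves both for
generation by the generators and for the ideal generated by a single root vector. -/
theorem mem_of_isBuild (h : IsRootBasis A B) {N : Submodule k L}
    (hN : ∀ g ∈ simpleRoots ++ negSimpleRoots, ∀ x ∈ N, A.mul (B g) x ∈ N)
    (ts : List (ℕ × Comb (ℕ × ℕ))) : ∀ ℓ : List ℕ, (∀ p ∈ ℓ, B p ∈ N) →
      isBuild ℓ ts = true → ∀ t ∈ ts, B t.1 ∈ N := by
  induction ts with
  | nil => simp
  | cons t ts ih =>
    intro ℓ hℓ hb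
    rw [isBuild, Bool.and_eq_true, Bool.and_eq_true] at hb
    have ht : B t.1 ∈ N := by
      have e := Comb.eval_eq_of_eqv (k := k) B hb.1.1
      rw [Comb.eval_bind, Comb.eval_cons, Comb.eval_nil, Nat.cast_one, one_smul, add_zero] at e
      rw [← e]
      refine Comb.eval_mem fun x hx => ?_
      have hx' := List.all_eq_true.1 hb.1.2 x hx
      rw [Bool.and_eq_true, Bool.and_eq_true, List.elem_iff, List.elem_iff, Nat.blt_eq] at hx'
      rw [← h.mul _ (gens_lt hx'.1.1) _ hx'.2]
      exact hN _ hx'.1.1 _ (hℓ _ hx'.1.2)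
    rintro s (_ | ⟨_, hs⟩)
    · exact ht
    · refine ih (t.1 :: ℓ) ?_ hb.2 s hs
      rintro p (_ | ⟨_, hp⟩)
      · exact ht
      · exact hℓ p hp

/-- A subspace that contains the root vectors for the simple roots and their opposites, and is
stable under multiplication by them, is the whole algebra. -/
theorem eq_top_of_gens (h : IsRootBasis A B) {N : Submodule k L}
    (h1 : ∀ g ∈ simpleRoots ++ negSimpleRoots, B g ∈ N)
    (h2 : ∀ g ∈ simpleRoots ++ negSimpleRoots, ∀ x ∈ N, A.mul (B g) x ∈ N) : N = ⊤ := by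
  refine h.eq_top_of_mem fun p hp => ?_
  have := of_allBelow buildTable_complete hp
  rw [Bool.or_eq_true, List.elem_iff] at this
  rcases this with h' | h'
  · exact h1 p h'
  · obtain ⟨t, ht, e⟩ := List.any_eq_true.1 h'
    rw [← Nat.eq_of_beq_eq_true e]
    exact h.mem_of_isBuild h2 _ _ h1 isBuild_buildTable t ht

theorem isDerivAt_gen (h : IsRootBasis A B) {g : ℕ} (hg : g ∈ simpleRoots ++ negSimpleRoots) :
    A.IsDerivAt (rootParity g) (B g) := by
  have hg' := gens_lt hg
  have key : ∀ q < 37, ∀ r < 37, A.mul (B g) (A.mul (B q) (B r)) = A.mul (A.mul (B g) (B q)) (B r)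
      + sgn k (rootParity g * rootParity q) • A.mul (B q) (A.mul (B g) (B r)) := by
    intro q hq r hr
    have e := Comb.eval_eq_zero (k := k) B (of_allBelow (of_allBelow
      (List.all_eq_true.1 jacobiComb_isZero g hg) hq) hr)
    rw [h.mul q hq r hr, h.mul g hg' q hq, h.mul g hg' r hr,
      h.mul_eval hg' fun t ht => lt_of_mem hq hr ht, h.eval_mul hr fun t ht => lt_of_mem hg' hq ht,
      h.mul_eval hq fun t ht => lt_of_mem hg' hr ht]
    rw [jacobiComb, Comb.eval_append, Comb.eval_append, Comb.eval_scale, Comb.eval_scale,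
      Nat.cast_ofNat, Comb.two_eq_neg_one] at e
    -- The basis vectors from number 21 on are the odd ones, so the test on the numbers computes the
    -- sign.
    have hs : ((bif Nat.ble 21 g && Nat.ble 21 q then 1 else 2 : ℕ) : k)
        = - sgn k (rootParity g * rootParity q) := by
      by_cases h1 : 21 ≤ g <;> by_cases h2 : 21 ≤ q <;>
        simp [rootParity, ble_eq_decide, h1, h2, sgn, Comb.two_eq_neg_one]
    rw [hs] at e
    rw [← sub_eq_zero, ← e]
    module
  intro j y hy z
  rw [← Superspace.mem_gr.1 hy]
  clear hy
  have hy : y ∈ (⊤ : Submodule k L) := trivial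
  have hz : z ∈ (⊤ : Submodule k L) := trivial
  replace hy := h.span hy
  replace hz := h.span hz
  induction hy using Submodule.span_induction with
  | zero => simp
  | add a b _ _ ha hb => simp only [map_add, LinearMap.add_apply, ha, hb, smul_add]; abel
  | smul c a _ ha =>
    simp only [map_smul, LinearMap.smul_apply, ha, smul_add]
    rw [smul_comm]
  | mem y hy =>
    obtain ⟨q, rfl⟩ := hy
    simp only [Superspace.comp_of_mem (h.mem_gr q.2)]
    split_ifs with hj
    · subst hj
      induction hz using Submodule.span_induction with
      | zero => simp
      | add a b _ _ ha hb => simp only [map_add, ha, hb, smul_add]; abel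
      | smul c a _ ha =>
        simp only [map_smul, ha, smul_add]
        rw [smul_comm]
      | mem z hz =>
        obtain ⟨r, rfl⟩ := hz
        exact key q q.2 r r.2
    · simp

theorem jacobiSubmodule_eq_top (h : IsRootBasis A B) : A.jacobiSubmodule = ⊤ := by
  have h1 : ∀ g ∈ simpleRoots ++ negSimpleRoots, B g ∈ A.jacobiSubmodule := by
    intro g hg i
    rw [Superspace.comp_of_mem (h.mem_gr (gens_lt hg))]
    split_ifs with hi
    · rw [hi]; exact h.isDerivAt_gen hg
    · intro j y _ z
      simp
  exact h.eq_top_of_gens h1 fun g hg x hx =>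
    Superalgebra.mul_mem_jacobiSubmodule (h.mem_gr (gens_lt hg)) (h1 g hg) hx

theorem skew (h : IsRootBasis A B) (i j : ZMod 2) (x y : L) :
    A.mul (A.comp i x) (A.comp j y) = -(sgn k (i * j) • A.mul (A.comp j y) (A.comp i x)) := by
  have hx : x ∈ (⊤ : Submodule k L) := trivial
  have hy : y ∈ (⊤ : Submodule k L) := trivial
  replace hx := h.span hx
  replace hy := h.span hy
  induction hx using Submodule.span_induction with
  | zero => simp
  | add a b _ _ ha hb => simp only [map_add, LinearMap.add_apply, ha, hb, smul_add]; abel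
  | smul c a _ ha =>
    simp only [map_smul, LinearMap.smul_apply, ha, smul_neg]
    rw [smul_comm]
  | mem x hx =>
    obtain ⟨p, rfl⟩ := hx
    induction hy using Submodule.span_induction with
    | zero => simp
    | add a b _ _ ha hb => simp only [map_add, LinearMap.add_apply, ha, hb, smul_add]; abel
    | smul c a _ ha =>
      simp only [map_smul, LinearMap.smul_apply, ha, smul_neg]
      rw [smul_comm]
    | mem y hy =>
      obtain ⟨q, rfl⟩ := hy
      simp only [Superspace.comp_of_mem (h.mem_gr p.2), Superspace.comp_of_mem (h.mem_gr q.2)]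
      split_ifs with hi hj
      · subst hi hj
        have e := Comb.eval_eq_zero (k := k) B
          (of_allBelow (of_allBelow structureConst_skew p.2) q.2)
        rw [Comb.eval_append, Comb.eval_scale, ← h.mul p p.2 q q.2, ← h.mul q q.2 p p.2] at e
        have hs : ((bif Nat.ble 21 p && Nat.ble 21 q then 2 else 1 : ℕ) : k)
            = sgn k (rootParity p * rootParity q) := by
          by_cases h1 : 21 ≤ (p : ℕ) <;> by_cases h2 : 21 ≤ (q : ℕ) <;>
            simp [rootParity, ble_eq_decide, h1, h2, sgn, Comb.two_eq_neg_one]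
        rw [hs] at e
        exact eq_neg_of_add_eq_zero_left e
      · simp
      · simp
      · simp

theorem isLie (h : IsRootBasis A B) : A.IsLie := by
  have hskew : ∀ i j, ∀ x ∈ A.gr i, ∀ y ∈ A.gr j,
      A.mul x y = -(sgn k (i * j) • A.mul y x) := by
    intro i j x hx y hy
    have := h.skew i j x y
    rwa [Superspace.mem_gr.1 hx, Superspace.mem_gr.1 hy] at this
  have hjac : ∀ i j, ∀ x ∈ A.gr i, ∀ y ∈ A.gr j, ∀ z,
      A.mul x (A.mul y z) = A.mul (A.mul x y) z + sgn k (i * j) • A.mul y (A.mul x z) := by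
    intro i j x hx y hy z
    have hx' : x ∈ A.jacobiSubmodule := h.jacobiSubmodule_eq_top ▸ Submodule.mem_top
    have := hx' i
    rw [Superspace.mem_gr.1 hx] at this
    exact this j y hy z
  refine ⟨fun x hx => ?_, hskew, hjac, fun x hx => ?_⟩
  -- Skew-symmetry gives `2 [x,x] = 0`, and 2 is invertible.
  · have e := hskew 0 0 x hx x hx
    rw [mul_zero, sgn, if_pos rfl, one_smul, ← add_eq_zero_iff_eq_neg, ← two_smul k,
      Comb.two_eq_neg_one, neg_one_smul, neg_eq_zero] at e
    exact e
  · rw [← Superspace.mem_gr.1 hx]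
    clear hx
    have hx : x ∈ (⊤ : Submodule k L) := trivial
    replace hx := h.span hx
    induction hx using Submodule.span_induction with
    | zero => simp
    | add a b _ _ ha hb =>
      rw [map_add, Superalgebra.cube_add _ _ _ (A.comp_mem 1 a) (A.comp_mem 1 b), ha, hb, add_zero]
      · intro x hx y hy
        simpa [sgn] using hskew 1 1 x hx y hy
      · intro x hx y hy
        simpa [sgn] using hskew 1 0 y hy x hx
      · intro x hx y hy z
        simpa [sgn, ← sub_eq_add_neg] using hjac 1 1 x hx y hy z
    | smul c a _ ha => simp only [map_smul, LinearMap.smul_apply, ha, smul_zero]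
    | mem y hy =>
      obtain ⟨q, rfl⟩ := hy
      simp only [Superspace.comp_of_mem (h.mem_gr q.2)]
      split_ifs with hi
      -- Even the odd root vectors satisfy `[x,x] = 0`, so the cube vanishes on the basis;
      -- additivity does the rest.
      · rw [h.mul q q.2 q q.2, Comb.eval_eq_zero B (of_allBelow structureConst_self q.2), map_zero]
      · simp

end IsRootBasis

end Super

/-! ### Simplicity through an extremal root vector. -/

namespace Super

/-- Expressions of the generators in terms of brackets of generators with a long root vector, and
previous entries. -/
def thetaTable : List (ℕ × Comb (ℕ × ℕ)) :=
  [(24, [((21, 7), 2)]), (9, [((18, 7), 2)]), (26, [((18, 24), 2)]), (0, [((5, 9), 2)]), (22,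
   [((5, 26), 1)]), (2, [((11, 0), 2)]), (23, [((11, 22), 2)]), (4, [((18, 2), 2)]), (25, [((18,
   23), 2)]), (10, [((5, 0), 2)]), (17, [((5, 2), 2)]), (20, [((5, 4), 2)]), (21, [((5, 25),
   1)]), (36, [((36, 20), 1)]), (8, [((18, 10), 1)]), (18, [((18, 20), 2)]), (5, [((5, 20),
   1)]), (13, [((11, 18), 1)]), (11, [((17, 13), 1)])]

theorem isBuild_thetaTable : isBuild [7] thetaTable = true := by decide +kernel

theorem thetaTable_complete :
    (simpleRoots ++ negSimpleRoots).all (fun p => thetaTable.any fun t => Nat.beq t.1 p) = true := by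
  decide +kernel

/-- The square of the adjoint action of a long root vector has rank one. -/
theorem structureConst_theta : allBelow 37 (fun r =>
    Comb.eqv (Comb.bind (structureConst 7 r) (structureConst 7))
      (bif Nat.beq r 12 then [(7, 2)] else [])) = true := by decide +kernel

/-- Expressions of the coordinates in terms of composites of previous coordinates with
multiplication by generators. -/
def dualTable : List (ℕ × Comb (ℕ × ℕ)) :=
  [(33, [((21, 12), 2)]), (14, [((18, 12), 1)]), (31, [((18, 33), 2)]), (1, [((5, 14), 2)]), (35,
   [((5, 31), 1)]), (29, [((4, 33), 2)]), (19, [((11, 14), 1)]), (30, [((11, 31), 2)]), (3,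
   [((11, 1), 1)]), (34, [((11, 35), 2)]), (5, [((18, 3), 1)]), (32, [((18, 34), 2)]), (13,
   [((5, 1), 2)]), (18, [((5, 3), 2)]), (20, [((5, 5), 1)]), (36, [((5, 32), 1)]), (21, [((36,
   20), 2)]), (11, [((18, 13), 2)]), (17, [((18, 20), 2)]), (4, [((5, 20), 2)]), (25, [((5, 21),
   1)]), (2, [((5, 17), 2)]), (23, [((36, 2), 2)]), (10, [((11, 17), 2)]), (0, [((11, 2), 2)]),
   (22, [((11, 23), 2)]), (16, [((5, 2), 2)]), (27, [((5, 23), 1)]), (9, [((5, 0), 2)]), (26,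
   [((5, 22), 1)]), (8, [((17, 10), 2)]), (7, [((18, 9), 2)]), (24, [((18, 26), 2)]), (28, [((5,
   24), 1)]), (6, [((8, 8), 2), ((17, 17), 2), ((4, 4), 2)]), (15, [((17, 17), 2), ((4, 4),
   2)])]

/-- The value at a basis vector of a combination of composites of coordinates with multiplication
by basis vectors. -/
def dualValue (ℓ : Comb (ℕ × ℕ)) (r : ℕ) : ℕ :=
  (ℓ.map fun x => x.2 * Comb.coeffAt x.1.2 (structureConst x.1.1 r)).sum

/-- The entries of the table express coordinates in terms of previous ones. -/
def isDualBuild : List ℕ → List (ℕ × Comb (ℕ × ℕ)) → Bool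
  | _, [] => true
  | ℓ, t :: ts =>
    (allBelow 37 (fun r => Nat.beq (dualValue t.2 r % 3) (bif Nat.beq r t.1 then 1 else 0)) &&
      (Nat.blt t.1 37 && t.2.all fun x => Nat.blt x.1.1 37 && List.elem x.1.2 ℓ &&
        Nat.blt x.1.2 37)) && isDualBuild (t.1 :: ℓ) ts

/-- The dual counterpart of generation: starting from the coordinate 12, composing with
multiplications by basis vectors reaches all the coordinates. -/
theorem isDualBuild_dualTable : isDualBuild [12] dualTable = true := by decide +kernel

theorem dualTable_complete : allBelow 37 (fun p => Nat.beq p 12 ||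
    dualTable.any fun t => Nat.beq t.1 p) = true := by
  decide +kernel

theorem beq_eq_decide (m n : ℕ) : Nat.beq m n = decide (m = n) :=
  Bool.eq_iff_iff.2 (by rw [Nat.beq_eq, decide_eq_true_iff])

namespace IsRootBasis

variable {k L : Type*} [Field k] [AddCommGroup L] [Module k L] {A : Superalgebra k L} {B : ℕ → L}

/-- The basis, indexed by a finite type. -/
def basis (h : IsRootBasis A B) : Module.Basis (Fin 37) k L := .mk h.linearIndependent h.span

theorem basis_apply (h : IsRootBasis A B) (p : Fin 37) : h.basis p = B p :=
  Module.Basis.mk_apply _ _ _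

/-- The coordinates. -/
def coord (h : IsRootBasis A B) (p : ℕ) : L →ₗ[k] k :=
  if hp : p < 37 then h.basis.coord ⟨p, hp⟩ else 0

theorem coord_apply (h : IsRootBasis A B) {p q : ℕ} (hp : p < 37) (hq : q < 37) :
    h.coord p (B q) = if p = q then 1 else 0 := by
  have := h.basis_apply ⟨q, hq⟩
  rw [coord, dif_pos hp, ← this, Module.Basis.coord_apply, Module.Basis.repr_self,
    Finsupp.single_apply]
  simp [eq_comm]

theorem ext_coord (h : IsRootBasis A B) {x : L} (hx : ∀ p < 37, h.coord p x = 0) : x = 0 := by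
  refine h.basis.ext_elem fun p => ?_
  have := hx p p.2
  rw [coord, dif_pos p.2] at this
  simpa using this

theorem hom_ext (h : IsRootBasis A B) {M : Type*} [AddCommGroup M] [Module k M]
    {f g : L →ₗ[k] M} (hfg : ∀ p < 37, f (B p) = g (B p)) : f = g :=
  h.basis.ext fun p => by rw [h.basis_apply]; exact hfg p p.2

theorem coord_eval (h : IsRootBasis A B) {p : ℕ} (hp : p < 37) {ℓ : Comb ℕ}
    (hℓ : ∀ t ∈ ℓ, t.1 < 37) : h.coord p (Comb.eval k B ℓ) = (Comb.coeffAt p ℓ : k) := by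
  induction ℓ with
  | nil => simp [Comb.coeffAt]
  | cons t ℓ ih =>
    rw [Comb.eval_cons, map_add, map_smul, h.coord_apply hp (hℓ t (by simp)),
      ih fun s hs => hℓ s (by simp [hs])]
    by_cases e : t.1 = p
    · simp [Comb.coeffAt, e]
    · simp [Comb.coeffAt, e, Ne.symm e]

theorem dualValue_eq (h : IsRootBasis A B) {ℓ : Comb (ℕ × ℕ)} {r : ℕ} (hr : r < 37)
    (hℓ : ∀ x ∈ ℓ, x.1.1 < 37 ∧ x.1.2 < 37) :
    Comb.eval k (fun x : ℕ × ℕ => h.coord x.2 ∘ₗ A.mul (B x.1)) ℓ (B r) = (dualValue ℓ r : k) := by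
  induction ℓ with
  | nil => simp [dualValue]
  | cons t ℓ ih =>
    obtain ⟨h1, h2⟩ := hℓ t (by simp)
    rw [Comb.eval_cons, LinearMap.add_apply, ih fun x hx => hℓ x (by simp [hx]),
      LinearMap.smul_apply, LinearMap.comp_apply, h.mul _ h1 r hr,
      h.coord_eval h2 fun s hs => lt_of_mem h1 hr hs]
    simp [dualValue]

variable [CharP k 3]

/-- It is applied to the annihilator of an ideal, which is stable under `f ↦ f ∘ ad x`. -/
theorem coord_mem_of_isDualBuild (h : IsRootBasis A B) {N : Submodule k (L →ₗ[k] k)}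
    (hN : ∀ p < 37, ∀ f ∈ N, f ∘ₗ A.mul (B p) ∈ N)
    (ts : List (ℕ × Comb (ℕ × ℕ))) : ∀ ℓ : List ℕ, (∀ p ∈ ℓ, h.coord p ∈ N) →
      isDualBuild ℓ ts = true → ∀ t ∈ ts, h.coord t.1 ∈ N := by
  induction ts with
  | nil => simp
  | cons t ts ih =>
    intro ℓ hℓ hb
    rw [isDualBuild, Bool.and_eq_true, Bool.and_eq_true, Bool.and_eq_true, Nat.blt_eq] at hb
    obtain ⟨⟨hv, ht, hall⟩, hb⟩ := hb
    have hall' : ∀ x ∈ t.2, (x.1.1 < 37 ∧ x.1.2 ∈ ℓ) ∧ x.1.2 < 37 := fun x hx => by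
      have := List.all_eq_true.1 hall x hx
      rwa [Bool.and_eq_true, Bool.and_eq_true, List.elem_iff, Nat.blt_eq, Nat.blt_eq] at this
    have ht : h.coord t.1 ∈ N := by
      have e : h.coord t.1 = Comb.eval k (fun x : ℕ × ℕ => h.coord x.2 ∘ₗ A.mul (B x.1)) t.2 := by
        refine h.hom_ext fun r hr => ?_
        rw [h.dualValue_eq hr fun x hx => ⟨(hall' x hx).1.1, (hall' x hx).2⟩, h.coord_apply ht hr]
        have := Nat.eq_of_beq_eq_true (of_allBelow hv hr)
        rw [← Nat.div_add_mod (dualValue t.2 r) 3, this, Nat.cast_add, Nat.cast_mul,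
          CharP.cast_eq_zero k 3, zero_mul, zero_add, beq_eq_decide]
        by_cases hrt : r = t.1
        · simp [hrt]
        · simp [hrt, Ne.symm hrt]
      rw [e]
      exact Comb.eval_mem fun x hx => hN _ (hall' x hx).1.1 _ (hℓ _ (hall' x hx).1.2)
    rintro s (_ | ⟨_, hs⟩)
    · exact ht
    · refine ih (t.1 :: ℓ) ?_ hb s hs
      rintro p (_ | ⟨_, hp⟩)
      · exact ht
      · exact hℓ p hp

theorem theta_sq (h : IsRootBasis A B) (x : L) :
    A.mul (B 7) (A.mul (B 7) x) = (2 : k) • h.coord 12 x • B 7 := by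
  have e : A.mul (B 7) ∘ₗ A.mul (B 7) = (h.coord 12).smulRight ((2 : k) • B 7) := by
    refine h.hom_ext fun r hr => ?_
    have := Comb.eval_eq_of_eqv (k := k) B (of_allBelow structureConst_theta hr)
    rw [LinearMap.comp_apply, h.mul 7 (by norm_num) r hr,
      h.mul_eval (by norm_num) fun t ht => lt_of_mem (by norm_num) hr ht, this,
      LinearMap.smulRight_apply, h.coord_apply (by norm_num) hr]
    by_cases h12 : r = 12
    · simp [h12]
    · simp [h12, Ne.symm h12, beq_eq_decide]
  rw [smul_comm]
  exact LinearMap.congr_fun e x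

/-- The vector `B 7` belongs to the long root `ε₁ + ε₂` and `B 12` to its opposite. By `theta_sq`,
applying `ad B 7` twice to an element of an ideal gives a multiple of `B 7` by twice its coordinate
12. Either that coordinate is nonzero somewhere on the ideal, which then contains `B 7` and every
generator, or it lies in the annihilator of the ideal, and with it every coordinate. -/
theorem isSimple (h : IsRootBasis A B) : A.IsSimple := by
  have h2 : (2 : k) ≠ 0 := by rw [Comb.two_eq_neg_one]; exact neg_ne_zero.2 one_ne_zero
  -- A nonzero product: by `theta_sq` it equals `2 B 7`.
  refine ⟨⟨B 7, A.mul (B 7) (B 12), ?_⟩, fun I hI => ?_⟩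
  · rw [h.theta_sq, h.coord_apply (by norm_num) (by norm_num), if_pos rfl, one_smul]
    exact smul_ne_zero h2 (h.linearIndependent.ne_zero (7 : Fin 37))
  by_cases h7 : B 7 ∈ I
  · right
    have key := h.mem_of_isBuild (N := I) (fun g _ x hx => hI.mul_mem_left _ x hx) thetaTable [7]
      (by simpa using h7) isBuild_thetaTable
    refine h.eq_top_of_gens (fun g hg => ?_) fun g _ x hx => hI.mul_mem_left _ x hx
    obtain ⟨t, ht, e⟩ := List.any_eq_true.1 (List.all_eq_true.1 thetaTable_complete g hg)
    rw [← Nat.eq_of_beq_eq_true e]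
    exact key t ht
  · left
    let N : Submodule k (L →ₗ[k] k) := Submodule.dualAnnihilator I
    have hN : ∀ f : L →ₗ[k] k, f ∈ N ↔ ∀ x ∈ I, f x = 0 := fun f =>
      Submodule.mem_dualAnnihilator f
    have h12 : h.coord 12 ∈ N := by
      rw [hN]
      -- If the coordinate 12 of some `x ∈ I` were nonzero, `(ad B 7)² x` would be a nonzero
      -- multiple of `B 7` in `I`.
      intro x hx
      by_contra hc
      refine h7 ?_
      have := I.smul_mem ((2 : k) * h.coord 12 x)⁻¹
        (hI.mul_mem_left (B 7) _ (hI.mul_mem_left (B 7) x hx))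
      rwa [h.theta_sq, ← mul_smul (2 : k), inv_smul_smul₀ (mul_ne_zero h2 hc)] at this
    have key := h.coord_mem_of_isDualBuild (N := N) (fun p _ f hf => by
      rw [hN] at hf ⊢
      exact fun x hx => hf _ (hI.mul_mem_left _ x hx)) dualTable [12] (by simpa using h12)
      isDualBuild_dualTable
    refine (Submodule.eq_bot_iff I).2 fun x hx => h.ext_coord fun p hp => ?_
    have := of_allBelow dualTable_complete hp
    rw [Bool.or_eq_true] at this
    rcases this with h' | h'
    · rw [Nat.eq_of_beq_eq_true h']; exact (hN _).1 h12 x hx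
    · obtain ⟨t, ht, e⟩ := List.any_eq_true.1 h'
      rw [← Nat.eq_of_beq_eq_true e]
      exact (hN _).1 (key t ht) x hx

end IsRootBasis

end Super

namespace Super

/-! ## Lie superalgebras of endomorphisms, and homomorphisms from free superalgebras -/

namespace Superspace

variable {k L : Type*} [Field k] [AddCommGroup L] [Module k L]

theorem mul_mem_endo {A : Superspace k L} {i j : ZMod 2} {f g : Module.End k L}
    (hf : f ∈ A.endo.gr i) (hg : g ∈ A.endo.gr j) : f * g ∈ A.endo.gr (i + j) := by
  rw [mem_endo_gr] at *
  intro l x hx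
  have := hf _ _ (hg l x hx)
  rwa [add_assoc, add_comm j i] at this

/-- The endomorphisms of a superspace, with the supercommutator. -/
def commutator (A : Superspace k L) : Superalgebra k (Module.End k L) where
  toSuperspace := A.endo
  mul := superSkew A.endo (LinearMap.mul k (Module.End k L))
  mul_mem := superSkew_even fun _ _ _ _ hf hg => mul_mem_endo hf hg

theorem commutator_mul {A : Superspace k L} {i j : ZMod 2} {f g : Module.End k L}
    (hf : f ∈ A.endo.gr i) (hg : g ∈ A.endo.gr j) :
    A.commutator.mul f g = f * g - sgn k (i * j) • (g * f) := by
  refine (superSkew_apply _ _ f g).trans ?_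
  rw [Finset.sum_eq_single i, Finset.sum_eq_single j]
  · rw [mem_gr.1 hf, mem_gr.1 hg]; rfl
  · intro b _ hb
    rw [comp_of_mem hg, if_neg hb]; simp
  · simp
  · intro b _ hb
    refine Finset.sum_eq_zero fun c _ => ?_
    rw [comp_of_mem hf, if_neg hb]; simp
  · simp

/-- Associativity gives the identities on homogeneous triples. For odd `x` one has `[x,x] = 2x²`,
which commutes with `x`, so the cubic axiom holds in every characteristic. -/
theorem isLie_commutator (A : Superspace k L) : A.commutator.IsLie := by
  have hjac : ∀ i j l, ∀ x ∈ A.endo.gr i, ∀ y ∈ A.endo.gr j, ∀ z ∈ A.endo.gr l,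
      A.commutator.mul x (A.commutator.mul y z) = A.commutator.mul (A.commutator.mul x y) z
        + sgn k (i * j) • A.commutator.mul y (A.commutator.mul x z) := by
    intro i j l x hx y hy z hz
    rw [commutator_mul hx (A.commutator.mul_mem _ _ _ _ hy hz),
      commutator_mul (A.commutator.mul_mem _ _ _ _ hx hy) hz,
      commutator_mul hy (A.commutator.mul_mem _ _ _ _ hx hz),
      commutator_mul hy hz, commutator_mul hx hy, commutator_mul hx hz]
    rcases zmod2_cases i with rfl | rfl <;> rcases zmod2_cases j with rfl | rfl <;>
      rcases zmod2_cases l with rfl | rfl <;>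
      simp [sgn, one_add_one_zmod2, mul_assoc, mul_add, add_mul, mul_sub, sub_mul] <;> abel
  refine ⟨fun x hx => ?_, fun i j x hx y hy => ?_, fun i j x hx y hy z => ?_, fun x hx => ?_⟩
  · rw [commutator_mul hx hx]; simp [sgn]
  · rw [commutator_mul hx hy, commutator_mul hy hx]
    rcases zmod2_cases i with rfl | rfl <;> rcases zmod2_cases j with rfl | rfl <;>
      simp [sgn, add_comm]
  · rw [← A.endo.sum_comp z]
    simp only [map_sum, Finset.smul_sum, ← Finset.sum_add_distrib]
    exact Finset.sum_congr rfl fun l _ => hjac i j l x hx y hy _ (A.endo.comp_mem l z)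
  · rw [commutator_mul hx (A.commutator.mul_mem _ _ _ _ hx hx), commutator_mul hx hx]
    simp [sgn, one_add_one_zmod2, mul_add, add_mul, mul_assoc]

end Superspace

namespace Superalgebra

section FreeLift

variable {k X M : Type*} [Field k] [AddCommGroup M] [Module k M]

/-- The value of a nonassociative word in a superalgebra. -/
def wordValue (A : Superalgebra k M) (g : X → M) : FreeMagma X → M
  | FreeMagma.of x => g x
  | FreeMagma.mul a b => A.mul (wordValue A g a) (wordValue A g b)

/-- A nonassociative word, as an element of the free algebra. -/
abbrev word (k : Type*) [Field k] (w : FreeMagma X) : FreeNonUnitalNonAssocAlgebra k X :=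
  MonoidAlgebra.basis (FreeMagma X) k w

theorem word_mul (w w' : FreeMagma X) : word k (w * w') = word k w * word k w' := by
  simp [word, MonoidAlgebra.basis_apply, MonoidAlgebra.single_mul_single]

theorem word_mem (par : X → ZMod 2) (w : FreeMagma X) :
    word k w ∈ (freeSpace k par).gr (wordParity par w) := by
  rw [Superspace.mem_gr, freeSpace_comp, if_pos rfl]

theorem span_word : Submodule.span k (Set.range (word k : FreeMagma X → _)) = ⊤ :=
  (MonoidAlgebra.basis (FreeMagma X) k).span_eq

/-- The homomorphism from the free superalgebra with given values at the generators. -/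
def freeLift (A : Superalgebra k M) (g : X → M) : FreeNonUnitalNonAssocAlgebra k X →ₗ[k] M :=
  (MonoidAlgebra.basis (FreeMagma X) k).constr k (wordValue A g)

variable {A : Superalgebra k M} {g : X → M}

theorem freeLift_word (w : FreeMagma X) : freeLift A g (word k w) = wordValue A g w :=
  Module.Basis.constr_basis _ _ _ _

theorem freeLift_of (x : X) : freeLift A g (FreeNonUnitalNonAssocAlgebra.of k x) = g x :=
  freeLift_word (FreeMagma.of x)

theorem freeLift_mul (x y : FreeNonUnitalNonAssocAlgebra k X) :
    freeLift A g (x * y) = A.mul (freeLift A g x) (freeLift A g y) := by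
  have e : (LinearMap.mul k (FreeNonUnitalNonAssocAlgebra k X)).compr₂ (freeLift A g)
      = A.mul.compl₁₂ (freeLift A g) (freeLift A g) := by
    refine (MonoidAlgebra.basis (FreeMagma X) k).ext fun w =>
      (MonoidAlgebra.basis (FreeMagma X) k).ext fun w' => ?_
    change freeLift A g (word k w * word k w') =
      A.mul (freeLift A g (word k w)) (freeLift A g (word k w'))
    rw [← word_mul, freeLift_word, freeLift_word, freeLift_word]
    rfl
  exact LinearMap.congr_fun₂ e x y

theorem wordValue_mem {par : X → ZMod 2} (hg : ∀ x, g x ∈ A.gr (par x)) (w : FreeMagma X) :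
    wordValue A g w ∈ A.gr (wordParity par w) := by
  induction w with
  | ih1 x => exact hg x
  | ih2 a b ha hb => exact A.mul_mem _ _ _ _ ha hb

theorem freeLift_comp {par : X → ZMod 2} (hg : ∀ x, g x ∈ A.gr (par x)) (i : ZMod 2)
    (x : FreeNonUnitalNonAssocAlgebra k X) :
    freeLift A g ((freeSpace k par).comp i x) = A.comp i (freeLift A g x) := by
  rw [← LinearMap.comp_apply, ← LinearMap.comp_apply]
  congr 1
  refine (MonoidAlgebra.basis (FreeMagma X) k).ext fun w => ?_
  change freeLift A g ((freeSpace k par).comp i (word k w)) = A.comp i (freeLift A g (word k w))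
  rw [freeLift_word, freeSpace_comp, Superspace.comp_of_mem (wordValue_mem hg w)]
  split_ifs
  · exact freeLift_word w
  · exact map_zero _

theorem freeLift_mem {par : X → ZMod 2} (hg : ∀ x, g x ∈ A.gr (par x)) {i : ZMod 2}
    {x : FreeNonUnitalNonAssocAlgebra k X} (hx : x ∈ (freeSpace k par).gr i) :
    freeLift A g x ∈ A.gr i := by
  rw [Superspace.mem_gr, ← freeLift_comp hg, Superspace.mem_gr.1 hx]

end FreeLift

variable {k L : Type*} [Field k] [AddCommGroup L] [Module k L] {A : Superalgebra k L}

theorem IsLie.mul_comm (hA : A.IsLie) (x y : L) :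
    A.mul x y = -∑ i, ∑ j, sgn k (i * j) • A.mul (A.comp j y) (A.comp i x) := by
  conv_lhs => rw [← A.sum_comp x, ← A.sum_comp y]
  simp only [map_sum, LinearMap.sum_apply, ← Finset.sum_neg_distrib]
  rw [Finset.sum_comm]
  exact Finset.sum_congr rfl fun i _ => Finset.sum_congr rfl fun j _ =>
    hA.skew i j _ (A.comp_mem i x) _ (A.comp_mem j y)

theorem comp_mem_of_odd {I : Submodule k L} (h : ∀ x ∈ I, A.odd x ∈ I) (i : ZMod 2) {x : L}
    (hx : x ∈ I) : A.comp i x ∈ I := by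
  rcases zmod2_cases i with rfl | rfl
  · rw [Superspace.comp_zero]; exact I.sub_mem hx (h x hx)
  · rw [Superspace.comp_one]; exact h x hx

/-- In a Lie superalgebra, graded left ideals are ideals. -/
theorem IsLie.isIdeal (hA : A.IsLie) {I : Submodule k L} (h : ∀ x ∈ I, A.odd x ∈ I)
    (hl : ∀ x, ∀ y ∈ I, A.mul x y ∈ I) : A.IsIdeal I where
  odd_mem := h
  mul_mem_left := hl
  mul_mem_right x hx y := by
    rw [hA.mul_comm]
    exact I.neg_mem (Submodule.sum_mem _ fun i _ => Submodule.sum_mem _ fun j _ =>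
      I.smul_mem _ (hl _ _ (comp_mem_of_odd h i hx)))

/-- A submodule that is stable under left multiplication by two homogeneous elements is stable under
left multiplication by their product. -/
theorem IsLie.mul_mul_mem (hA : A.IsLie) {i j : ZMod 2} {x y z : L} (hx : x ∈ A.gr i)
    (hy : y ∈ A.gr j) {N : Submodule k L} (h1 : A.mul x (A.mul y z) ∈ N)
    (h2 : A.mul y (A.mul x z) ∈ N) : A.mul (A.mul x y) z ∈ N := by
  rw [← sub_eq_of_eq_add (hA.jacobi i j x hx y hy z)]
  exact N.sub_mem h1 (N.smul_mem _ h2)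

theorem IsLie.mul_mul_mem' (hA : A.IsLie) {i j : ZMod 2} {x y z : L} (hx : x ∈ A.gr i)
    (hy : y ∈ A.gr j) {N : Submodule k L} (h1 : A.mul (A.mul x y) z ∈ N)
    (h2 : A.mul y (A.mul x z) ∈ N) : A.mul x (A.mul y z) ∈ N := by
  rw [hA.jacobi i j x hx y hy z]
  exact N.add_mem h1 (N.smul_mem _ h2)

theorem mul_mem_gr_ad (A : Superalgebra k L) {i : ZMod 2} {x : L} (hx : x ∈ A.gr i) :
    A.mul x ∈ A.endo.gr i := by
  rw [Superspace.mem_endo_gr]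
  intro j y hy
  rw [add_comm]
  exact A.mul_mem _ _ _ _ hx hy

/-- The adjoint representation is a homomorphism. -/
theorem IsLie.ad_mul (hA : A.IsLie) (x y : L) :
    A.mul (A.mul x y) = A.toSuperspace.commutator.mul (A.mul x) (A.mul y) := by
  have key : ∀ i j, ∀ x ∈ A.gr i, ∀ y ∈ A.gr j,
      A.mul (A.mul x y) = A.toSuperspace.commutator.mul (A.mul x) (A.mul y) := by
    intro i j x hx y hy
    rw [Superspace.commutator_mul (A.mul_mem_gr_ad hx) (A.mul_mem_gr_ad hy)]
    ext z
    exact (sub_eq_of_eq_add (hA.jacobi i j x hx y hy z)).symm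
  rw [← A.sum_comp x, ← A.sum_comp y]
  simp only [map_sum, LinearMap.sum_apply]
  exact Finset.sum_congr rfl fun j _ => Finset.sum_congr rfl fun i _ =>
    key i j _ (A.comp_mem i x) _ (A.comp_mem j y)

theorem ad_comp (A : Superalgebra k L) (i : ZMod 2) (x : L) :
    A.mul (A.comp i x) = A.endo.comp i (A.mul x) := by
  conv_rhs => rw [← A.sum_comp x]
  simp only [map_sum]
  rw [Finset.sum_eq_single i]
  · rw [Superspace.mem_gr.1 (A.mul_mem_gr_ad (A.comp_mem i x))]
  · intro b _ hb
    rw [Superspace.comp_of_mem (A.mul_mem_gr_ad (A.comp_mem b x)), if_neg hb.symm]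
  · simp

end Superalgebra

end Super

namespace Super

/-! ## The grading of `𝔤̃(A, τ)` -/

namespace Superalgebra

variable {k X : Type*} [Field k] {par : X → ZMod 2} {deg : X → ℤ}

/-- The span of the words of a given degree. -/
def wordSpan (k : Type*) {X : Type*} [Field k] (deg : X → ℤ) (m : ℤ) :
    Submodule k (FreeNonUnitalNonAssocAlgebra k X) :=
  Submodule.span k {y | ∃ w, wordDegree deg w = m ∧ y = MonoidAlgebra.basis (FreeMagma X) k w}

theorem word_mem_wordSpan (w : FreeMagma X) : word k w ∈ wordSpan k deg (wordDegree deg w) :=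
  Submodule.subset_span ⟨w, rfl, rfl⟩

theorem mul_mem_wordSpan {m m' : ℤ} {x y : FreeNonUnitalNonAssocAlgebra k X}
    (hx : x ∈ wordSpan k deg m) (hy : y ∈ wordSpan k deg m') :
    x * y ∈ wordSpan k deg (m + m') := by
  have h : Submodule.map₂ (LinearMap.mul k (FreeNonUnitalNonAssocAlgebra k X))
      (wordSpan k deg m) (wordSpan k deg m') ≤ wordSpan k deg (m + m') := by
    rw [wordSpan, wordSpan, Submodule.map₂_span_span, Submodule.span_le]
    rintro _ ⟨_, ⟨w, rfl, rfl⟩, _, ⟨w', rfl, rfl⟩, rfl⟩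
    exact Submodule.subset_span ⟨w * w', rfl, (word_mul w w').symm⟩
  exact h (Submodule.apply_mem_map₂ _ hx hy)

theorem mul_mem_wordSpan_of_eq {m m' l : ℤ} (e : m + m' = l)
    {x y : FreeNonUnitalNonAssocAlgebra k X} (hx : x ∈ wordSpan k deg m)
    (hy : y ∈ wordSpan k deg m') : x * y ∈ wordSpan k deg l :=
  e ▸ mul_mem_wordSpan hx hy

theorem odd_mem_wordSpan {m : ℤ} {x : FreeNonUnitalNonAssocAlgebra k X}
    (hx : x ∈ wordSpan k deg m) : (freeSpace k par).odd x ∈ wordSpan k deg m := by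
  suffices h : wordSpan k deg m ≤ Submodule.comap (freeSpace k par).odd (wordSpan k deg m) from h hx
  refine Submodule.span_le.2 ?_
  rintro _ ⟨w, rfl, rfl⟩
  change (freeSpace k par).odd (word k w) ∈ wordSpan k deg (wordDegree deg w)
  rw [← Superspace.comp_one, freeSpace_comp]
  split_ifs
  · exact word_mem_wordSpan w
  · exact Submodule.zero_mem _

theorem mem_span_word (x : FreeNonUnitalNonAssocAlgebra k X) :
    x ∈ Submodule.span k (Set.range (word k)) := span_word (k := k) (X := X) ▸ Submodule.mem_top

theorem iSup_wordSpan : ⨆ m, wordSpan k deg m = ⊤ := by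
  rw [← top_le_iff, ← span_word, Submodule.span_le]
  rintro _ ⟨w, rfl⟩
  exact Submodule.mem_iSup_of_mem _ (word_mem_wordSpan w)

/-- The projection onto the span of the words of degree zero. -/
def projZero (k : Type*) {X : Type*} [Field k] (deg : X → ℤ) :
    FreeNonUnitalNonAssocAlgebra k X →ₗ[k] FreeNonUnitalNonAssocAlgebra k X :=
  (MonoidAlgebra.basis (FreeMagma X) k).constr k fun w =>
    if wordDegree deg w = 0 then word k w else 0

theorem projZero_of_mem {m : ℤ} {x : FreeNonUnitalNonAssocAlgebra k X}
    (hx : x ∈ wordSpan k deg m) : projZero k deg x = if m = 0 then x else 0 := by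
  induction hx using Submodule.span_induction with
  | zero => simp
  | add a b _ _ ha hb => rw [map_add, ha, hb]; split_ifs <;> simp
  | smul c a _ ha => rw [map_smul, ha]; split_ifs <;> simp
  | mem x hx =>
    obtain ⟨w, rfl, rfl⟩ := hx
    exact Module.Basis.constr_basis _ _ _ _

end Superalgebra

namespace Realization

open Superalgebra

variable {k : Type*} [Field k] {n : ℕ} {A : Matrix (Fin n) (Fin n) k} {h : Type*} [AddCommGroup h]
  [Module k h] (R : Realization A h) (τ : Finset (Fin n))

theorem subset_relIdeal {x : FreeNonUnitalNonAssocAlgebra k (Gen n h)} (hx : R.Relator τ x) :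
    x ∈ R.relIdeal τ := by
  simp only [relIdeal, idealSpan, Submodule.mem_sInf]
  exact fun I hI => hI.2 hx

theorem mk_eq_zero {x : FreeNonUnitalNonAssocAlgebra k (Gen n h)} (hx : R.Relator τ x) :
    (R.relIdeal τ).mkQ x = 0 := by
  rw [← LinearMap.mem_ker, Submodule.ker_mkQ]
  exact R.subset_relIdeal τ hx

theorem exists_mk_of_mem_gr {i : ZMod 2} {x : R.TildeSpace τ} (hx : x ∈ (R.tilde τ).gr i) :
    ∃ u ∈ (R.freeAlg τ).gr i, (R.relIdeal τ).mkQ u = x := by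
  obtain ⟨u, rfl⟩ := (R.relIdeal τ).mkQ_surjective x
  refine ⟨(R.freeAlg τ).comp i u, (R.freeAlg τ).comp_mem i u, ?_⟩
  exact (quotSpace_comp _ _ ((R.freeAlg τ).isIdeal_idealSpan _).odd_mem i u).symm.trans
    (Superspace.mem_gr.1 hx)

theorem tilde_mul (x y : FreeNonUnitalNonAssocAlgebra k (Gen n h)) :
    (R.tilde τ).mul ((R.relIdeal τ).mkQ x) ((R.relIdeal τ).mkQ y)
      = (R.relIdeal τ).mkQ (x * y) := rfl

theorem isLie_tilde : (R.tilde τ).IsLie where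
  self_even x hx := by
    obtain ⟨x, hx', rfl⟩ := R.exists_mk_of_mem_gr τ hx
    exact R.mk_eq_zero τ (.self_even x hx')
  skew i j x hx y hy := by
    obtain ⟨x, hx', rfl⟩ := R.exists_mk_of_mem_gr τ hx
    obtain ⟨y, hy', rfl⟩ := R.exists_mk_of_mem_gr τ hy
    have := R.mk_eq_zero τ (.skew i j x y hx' hy')
    rw [map_add, map_smul] at this
    exact eq_neg_of_add_eq_zero_left this
  jacobi i j x hx y hy z := by
    obtain ⟨x, hx', rfl⟩ := R.exists_mk_of_mem_gr τ hx
    obtain ⟨y, hy', rfl⟩ := R.exists_mk_of_mem_gr τ hy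
    obtain ⟨z, rfl⟩ := (R.relIdeal τ).mkQ_surjective z
    have := R.mk_eq_zero τ (.jacobi i j x y z hx' hy')
    rw [map_sub, map_sub, map_smul, sub_sub] at this
    exact sub_eq_zero.1 this
  cube_odd x hx := by
    obtain ⟨x, hx', rfl⟩ := R.exists_mk_of_mem_gr τ hx
    exact R.mk_eq_zero τ (.cube_odd x hx')

/-- The homogeneous part of the ideal of relations. -/
def homRelIdeal : Submodule k (FreeNonUnitalNonAssocAlgebra k (Gen n h)) :=
  ⨆ m : ℤ, R.relIdeal τ ⊓ wordSpan k Gen.degree m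

theorem isIdeal_relIdeal : (R.freeAlg τ).IsIdeal (R.relIdeal τ) :=
  (R.freeAlg τ).isIdeal_idealSpan _

theorem mem_homRelIdeal {m : ℤ} {x : FreeNonUnitalNonAssocAlgebra k (Gen n h)}
    (hx : x ∈ R.relIdeal τ) (hm : x ∈ wordSpan k Gen.degree m) : x ∈ R.homRelIdeal τ :=
  Submodule.mem_iSup_of_mem m ⟨hx, hm⟩

/-- Stability under products may be tested on words, which are homogeneous. It remains to show that
all relators lie in this ideal; then the ideal of relations is homogeneous. -/
theorem isIdeal_homRelIdeal : (R.freeAlg τ).IsIdeal (R.homRelIdeal τ) where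
  odd_mem := by
    change R.homRelIdeal τ ≤ (R.homRelIdeal τ).comap (R.freeAlg τ).odd
    exact iSup_le fun m x hx => R.mem_homRelIdeal τ ((R.isIdeal_relIdeal τ).odd_mem x hx.1)
      (odd_mem_wordSpan hx.2)
  mul_mem_left x y hy := by
    have hx : x ∈ Submodule.span k (Set.range (word k)) := mem_span_word _
    induction hx using Submodule.span_induction with
    | zero => simp
    | add a b _ _ ha hb => rw [map_add]; exact Submodule.add_mem _ ha hb
    | smul c a _ ha => rw [map_smul]; exact Submodule.smul_mem _ _ ha
    | mem x hx =>
      obtain ⟨w, rfl⟩ := hx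
      suffices H : R.homRelIdeal τ ≤ (R.homRelIdeal τ).comap ((R.freeAlg τ).mul (word k w)) from
        H hy
      exact iSup_le fun m y hy => R.mem_homRelIdeal τ
        ((R.isIdeal_relIdeal τ).mul_mem_left _ y hy.1)
        (mul_mem_wordSpan (word_mem_wordSpan w) hy.2)
  mul_mem_right y hy x := by
    have hx : x ∈ Submodule.span k (Set.range (word k)) := mem_span_word _
    induction hx using Submodule.span_induction with
    | zero => simp
    | add a b _ _ ha hb => rw [map_add]; exact Submodule.add_mem _ ha hb
    | smul c a _ ha => rw [map_smul]; exact Submodule.smul_mem _ _ ha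
    | mem x hx =>
      obtain ⟨w, rfl⟩ := hx
      suffices H : R.homRelIdeal τ ≤ (R.homRelIdeal τ).comap
        ((R.freeAlg τ).mul.flip (word k w)) from H hy
      exact iSup_le fun m y hy => R.mem_homRelIdeal τ
        ((R.isIdeal_relIdeal τ).mul_mem_right y hy.1 _)
        (mul_mem_wordSpan hy.2 (word_mem_wordSpan w))

/-- The arguments of this relator need not be homogeneous for the `ℤ`-grading. It is bilinear, so
they can be replaced by words of the right parity, for which the relator is homogeneous. -/
theorem skew_mem_homRelIdeal {i j : ZMod 2} {x y : FreeNonUnitalNonAssocAlgebra k (Gen n h)}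
    (hx : x ∈ (R.freeAlg τ).gr i) (hy : y ∈ (R.freeAlg τ).gr j) :
    x * y + sgn k (i * j) • (y * x) ∈ R.homRelIdeal τ := by
  replace hx := mem_freeSpace_gr hx
  replace hy := mem_freeSpace_gr hy
  induction hx using Submodule.span_induction with
  | zero => simp
  | add a b _ _ ha hb =>
    convert Submodule.add_mem _ ha hb using 1
    rw [add_mul, mul_add, smul_add]; abel
  | smul c a _ ha =>
    convert Submodule.smul_mem _ c ha using 1
    rw [smul_mul_assoc, mul_smul_comm, smul_add, smul_comm c]
  | mem a ha =>
    induction hy using Submodule.span_induction with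
    | zero => simp
    | add c d _ _ hc hd =>
      convert Submodule.add_mem _ hc hd using 1
      rw [add_mul, mul_add, smul_add]; abel
    | smul r c _ hc =>
      convert Submodule.smul_mem _ r hc using 1
      rw [smul_mul_assoc, mul_smul_comm, smul_add, smul_comm r]
    | mem b hb =>
      obtain ⟨w, rfl, rfl⟩ := ha
      obtain ⟨w', rfl, rfl⟩ := hb
      refine R.mem_homRelIdeal τ (m := wordDegree Gen.degree w + wordDegree Gen.degree w')
        (R.subset_relIdeal τ (.skew _ _ _ _ (word_mem _ w) (word_mem _ w'))) ?_
      refine Submodule.add_mem _ (mul_mem_wordSpan (word_mem_wordSpan w) (word_mem_wordSpan w'))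
        (Submodule.smul_mem _ _ ?_)
      rw [add_comm]
      exact mul_mem_wordSpan (word_mem_wordSpan w') (word_mem_wordSpan w)

theorem jacobi_mem_homRelIdeal {i j : ZMod 2} {x y z : FreeNonUnitalNonAssocAlgebra k (Gen n h)}
    (hx : x ∈ (R.freeAlg τ).gr i) (hy : y ∈ (R.freeAlg τ).gr j) :
    x * (y * z) - (x * y) * z - sgn k (i * j) • (y * (x * z)) ∈ R.homRelIdeal τ := by
  replace hx := mem_freeSpace_gr hx
  replace hy := mem_freeSpace_gr hy
  have hz : z ∈ Submodule.span k (Set.range (word k)) := mem_span_word _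
  induction hx using Submodule.span_induction with
  | zero => simp
  | add a b _ _ ha hb =>
    convert Submodule.add_mem _ ha hb using 1
    simp only [add_mul, mul_add, smul_add]; abel
  | smul c a _ ha =>
    convert Submodule.smul_mem _ c ha using 1
    simp only [smul_mul_assoc, mul_smul_comm, smul_sub, smul_comm c]
  | mem a ha =>
    induction hy using Submodule.span_induction with
    | zero => simp
    | add c d _ _ hc hd =>
      convert Submodule.add_mem _ hc hd using 1
      simp only [add_mul, mul_add, smul_add]; abel
    | smul r c _ hc =>
      convert Submodule.smul_mem _ r hc using 1
      simp only [smul_mul_assoc, mul_smul_comm, smul_sub, smul_comm r]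
    | mem b hb =>
      induction hz using Submodule.span_induction with
      | zero => simp
      | add c d _ _ hc hd =>
        convert Submodule.add_mem _ hc hd using 1
        simp only [mul_add, smul_add]; abel
      | smul r c _ hc =>
        convert Submodule.smul_mem _ r hc using 1
        simp only [mul_smul_comm, smul_sub, smul_comm r]
      | mem c hc =>
        obtain ⟨w, rfl, rfl⟩ := ha
        obtain ⟨w', rfl, rfl⟩ := hb
        obtain ⟨w'', rfl⟩ := hc
        have h1 := word_mem_wordSpan (k := k) (deg := Gen.degree) w
        have h2 := word_mem_wordSpan (k := k) (deg := Gen.degree) w'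
        have h3 := word_mem_wordSpan (k := k) (deg := Gen.degree) w''
        refine R.mem_homRelIdeal τ (m := wordDegree Gen.degree w +
          (wordDegree Gen.degree w' + wordDegree Gen.degree w''))
          (R.subset_relIdeal τ (.jacobi _ _ _ _ _ (word_mem _ w) (word_mem _ w'))) ?_
        refine Submodule.sub_mem _ (Submodule.sub_mem _
          (mul_mem_wordSpan h1 (mul_mem_wordSpan h2 h3)) ?_) (Submodule.smul_mem _ _ ?_)
        · rw [← add_assoc]
          exact mul_mem_wordSpan (mul_mem_wordSpan h1 h2) h3
        · rw [add_left_comm]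
          exact mul_mem_wordSpan h2 (mul_mem_wordSpan h1 h3)

/-- The cubic relator is not multilinear. In the quotient by `homRelIdeal`, skew-symmetry and the
Jacobi identity already hold, so the cube map is additive on the odd part by `cube_add`, and again
words suffice. -/
theorem cube_mem_homRelIdeal {x : FreeNonUnitalNonAssocAlgebra k (Gen n h)}
    (hx : x ∈ (R.freeAlg τ).gr 1) : x * (x * x) ∈ R.homRelIdeal τ := by
  let Q := (R.freeAlg τ).quot (R.homRelIdeal τ) (R.isIdeal_homRelIdeal τ)
  let π := (R.homRelIdeal τ).mkQ
  have hπ : ∀ {x}, π x = 0 ↔ x ∈ R.homRelIdeal τ := fun {x} => by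
    rw [← LinearMap.mem_ker, Submodule.ker_mkQ]
  have hcomp : ∀ i x, Q.comp i (π x) = π ((R.freeAlg τ).comp i x) := fun i x =>
    quotSpace_comp _ _ (R.isIdeal_homRelIdeal τ).odd_mem i x
  have hlift : ∀ i, ∀ x ∈ Q.gr i, ∃ u ∈ (R.freeAlg τ).gr i, π u = x := by
    intro i x hx
    obtain ⟨u, rfl⟩ := (R.homRelIdeal τ).mkQ_surjective x
    exact ⟨_, (R.freeAlg τ).comp_mem i u, (hcomp i u).symm.trans (Superspace.mem_gr.1 hx)⟩
  have hgr : ∀ i, ∀ x ∈ (R.freeAlg τ).gr i, π x ∈ Q.gr i := by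
    intro i x hx
    rw [Superspace.mem_gr, hcomp, Superspace.mem_gr.1 hx]
  have hskew : ∀ i j, ∀ x ∈ Q.gr i, ∀ y ∈ Q.gr j, Q.mul x y = -(sgn k (i * j) • Q.mul y x) := by
    intro i j x hx y hy
    obtain ⟨x, hx', rfl⟩ := hlift i x hx
    obtain ⟨y, hy', rfl⟩ := hlift j y hy
    have := hπ.2 (R.skew_mem_homRelIdeal τ hx' hy')
    rw [map_add, map_smul] at this
    exact eq_neg_of_add_eq_zero_left this
  have hcube : ∀ x ∈ (R.freeAlg τ).gr 1, ∀ y ∈ (R.freeAlg τ).gr 1,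
      Q.mul (π x + π y) (Q.mul (π x + π y) (π x + π y))
        = Q.mul (π x) (Q.mul (π x) (π x)) + Q.mul (π y) (Q.mul (π y) (π y)) := by
    intro x hx y hy
    refine cube_add (fun x hx y hy => ?_) (fun x hx y hy => ?_) (fun x hx y hy z => ?_)
      (hgr 1 x hx) (hgr 1 y hy)
    · simpa [sgn] using hskew 1 1 x hx y hy
    · simpa [sgn] using hskew 1 0 y hy x hx
    · obtain ⟨x, hx', rfl⟩ := hlift 1 x hx
      obtain ⟨y, hy', rfl⟩ := hlift 1 y hy
      obtain ⟨z, rfl⟩ := (R.homRelIdeal τ).mkQ_surjective z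
      have := hπ.2 (R.jacobi_mem_homRelIdeal τ (z := z) hx' hy')
      rw [map_sub, map_sub, map_smul, sub_sub] at this
      have := sub_eq_zero.1 this
      simp only [sgn, mul_one, one_ne_zero, if_false, neg_one_smul, ← sub_eq_add_neg] at this
      exact this
  have key : x ∈ (R.freeAlg τ).gr 1 ∧ Q.mul (π x) (Q.mul (π x) (π x)) = 0 := by
    replace hx := mem_freeSpace_gr hx
    induction hx using Submodule.span_induction with
    | zero => exact ⟨Submodule.zero_mem _, by simp⟩
    | add a b _ _ ha hb =>
      refine ⟨Submodule.add_mem _ ha.1 hb.1, ?_⟩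
      rw [map_add, hcube a ha.1 b hb.1, ha.2, hb.2, add_zero]
    | smul c a _ ha =>
      refine ⟨Submodule.smul_mem _ _ ha.1, ?_⟩
      simp only [map_smul, LinearMap.smul_apply, ha.2, smul_zero]
    | mem a ha =>
      obtain ⟨w, hw, rfl⟩ := ha
      have hw' : word k w ∈ (R.freeAlg τ).gr 1 := hw ▸ word_mem _ w
      have h1 := word_mem_wordSpan (k := k) (deg := Gen.degree) w
      exact ⟨hw', hπ.2 (R.mem_homRelIdeal τ (R.subset_relIdeal τ (.cube_odd _ hw'))
        (mul_mem_wordSpan h1 (mul_mem_wordSpan h1 h1)))⟩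
  exact hπ.1 key.2

omit [AddCommGroup h] [Module k h] in
theorem gen_cartan_mem (x : h) : gen k (.cartan x : Gen n h) ∈ wordSpan k Gen.degree 0 :=
  Submodule.subset_span ⟨FreeMagma.of (.cartan x), rfl, rfl⟩

omit [AddCommGroup h] [Module k h] in
theorem gen_e_mem (i : Fin n) : gen k (.e i : Gen n h) ∈ wordSpan k Gen.degree 1 :=
  Submodule.subset_span ⟨FreeMagma.of (.e i), rfl, rfl⟩

omit [AddCommGroup h] [Module k h] in
theorem gen_f_mem (i : Fin n) : gen k (.f i : Gen n h) ∈ wordSpan k Gen.degree (-1) :=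
  Submodule.subset_span ⟨FreeMagma.of (.f i), rfl, rfl⟩

theorem relator_mem_homRelIdeal (h2 : (2 : k) ≠ 0)
    {x : FreeNonUnitalNonAssocAlgebra k (Gen n h)} (hx : R.Relator τ x) :
    x ∈ R.homRelIdeal τ := by
  have hc := gen_cartan_mem (k := k) (n := n) (h := h)
  have he := gen_e_mem (k := k) (n := n) (h := h)
  have hf := gen_f_mem (k := k) (n := n) (h := h)
  cases hx with
  | self_even x hx =>
    -- For even `x` the skew-symmetry relator with both arguments `x` is `2 x²`.
    have := R.skew_mem_homRelIdeal τ hx hx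
    rw [mul_zero, sgn, if_pos rfl, one_smul, ← two_smul k] at this
    exact (Submodule.smul_mem_iff _ h2).1 this
  | skew i j x y hx hy => exact R.skew_mem_homRelIdeal τ hx hy
  | jacobi i j x y z hx hy => exact R.jacobi_mem_homRelIdeal τ hx hy
  | cube_odd x hx => exact R.cube_mem_homRelIdeal τ hx
  | cartan_add x y =>
    exact R.mem_homRelIdeal τ (R.subset_relIdeal τ (.cartan_add x y))
      (Submodule.sub_mem _ (Submodule.sub_mem _ (hc _) (hc _)) (hc _))
  | cartan_smul c x =>
    exact R.mem_homRelIdeal τ (R.subset_relIdeal τ (.cartan_smul c x))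
      (Submodule.sub_mem _ (hc _) (Submodule.smul_mem _ _ (hc _)))
  | ef_same i =>
    exact R.mem_homRelIdeal τ (R.subset_relIdeal τ (.ef_same i))
      (Submodule.sub_mem _ (mul_mem_wordSpan_of_eq (by norm_num) (he i) (hf i)) (hc _))
  | ef_ne i j hij =>
    exact R.mem_homRelIdeal τ (R.subset_relIdeal τ (.ef_ne i j hij))
      (mul_mem_wordSpan (he i) (hf j))
  | cartan_cartan x y =>
    exact R.mem_homRelIdeal τ (R.subset_relIdeal τ (.cartan_cartan x y))
      (mul_mem_wordSpan (hc x) (hc y))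
  | cartan_e x i =>
    exact R.mem_homRelIdeal τ (R.subset_relIdeal τ (.cartan_e x i))
      (Submodule.sub_mem _ (mul_mem_wordSpan_of_eq (zero_add 1) (hc x) (he i))
        (Submodule.smul_mem _ _ (he i)))
  | cartan_f x i =>
    exact R.mem_homRelIdeal τ (R.subset_relIdeal τ (.cartan_f x i))
      (Submodule.add_mem _ (mul_mem_wordSpan_of_eq (zero_add _) (hc x) (hf i))
        (Submodule.smul_mem _ _ (hf i)))

/-- The ideal of relations is homogeneous for the `ℤ`-grading. -/
theorem relIdeal_le_homRelIdeal (h2 : (2 : k) ≠ 0) : R.relIdeal τ ≤ R.homRelIdeal τ :=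
  sInf_le ⟨R.isIdeal_homRelIdeal τ, fun _ hx => R.relator_mem_homRelIdeal τ h2 hx⟩

/-- An element of degree zero that is a sum of elements of other degrees vanishes. -/
theorem mk_eq_zero_of_mem (h2 : (2 : k) ≠ 0) {u : FreeNonUnitalNonAssocAlgebra k (Gen n h)}
    (hu : u ∈ wordSpan k Gen.degree 0)
    (hm : (R.relIdeal τ).mkQ u ∈ ⨆ m : {m : ℤ // m ≠ 0}, R.tildeDegree τ m) :
    (R.relIdeal τ).mkQ u = 0 := by
  -- Homogeneity of the ideal of relations is what makes the projection to degree zero preserve it.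
  have h1 : R.relIdeal τ ≤ (R.relIdeal τ).comap (projZero k Gen.degree) :=
    (R.relIdeal_le_homRelIdeal τ h2).trans (iSup_le fun m x hx => by
      rw [Submodule.mem_comap, projZero_of_mem hx.2]
      split_ifs
      · exact hx.1
      · exact Submodule.zero_mem _)
  have h3 : (⨆ m : {m : ℤ // m ≠ 0}, R.tildeDegree τ m)
      = (⨆ m : {m : ℤ // m ≠ 0}, wordSpan k Gen.degree (m : ℤ)).map (R.relIdeal τ).mkQ :=
    (Submodule.map_iSup _ _).symm
  rw [h3] at hm
  obtain ⟨v, hv, e⟩ := hm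
  have hv0 : projZero k Gen.degree v = 0 := by
    suffices H : (⨆ m : {m : ℤ // m ≠ 0}, wordSpan k (Gen.degree (n := n) (h := h)) (m : ℤ))
      ≤ LinearMap.ker (projZero k Gen.degree) from H hv
    exact iSup_le fun m x hx => by rw [LinearMap.mem_ker, projZero_of_mem hx, if_neg m.2]
  have hd : u - v ∈ R.relIdeal τ := by
    rw [← Submodule.ker_mkQ (R.relIdeal τ), LinearMap.mem_ker, map_sub, e, sub_self]
  have := h1 hd
  rw [Submodule.mem_comap, map_sub, hv0, projZero_of_mem hu, if_pos rfl, sub_zero] at this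
  rwa [← LinearMap.mem_ker, Submodule.ker_mkQ]

theorem iSup_tildeDegree : ⨆ m : ℤ, R.tildeDegree τ m = ⊤ := by
  have : (⨆ m : ℤ, R.tildeDegree τ m)
      = (⨆ m : ℤ, wordSpan k Gen.degree m).map (R.relIdeal τ).mkQ := (Submodule.map_iSup _ _).symm
  rw [this, iSup_wordSpan, Submodule.map_top, Submodule.range_mkQ]

theorem odd_mem_tildeDegree {m : ℤ} {x : R.TildeSpace τ} (hx : x ∈ R.tildeDegree τ m) :
    (R.tilde τ).odd x ∈ R.tildeDegree τ m := by
  obtain ⟨u, hu, rfl⟩ := hx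
  exact ⟨_, odd_mem_wordSpan hu, rfl⟩

theorem mul_mem_tildeDegree {m m' : ℤ} {x y : R.TildeSpace τ} (hx : x ∈ R.tildeDegree τ m)
    (hy : y ∈ R.tildeDegree τ m') : (R.tilde τ).mul x y ∈ R.tildeDegree τ (m + m') := by
  obtain ⟨u, hu, rfl⟩ := hx
  obtain ⟨v, hv, rfl⟩ := hy
  exact ⟨_, mul_mem_wordSpan hu hv, rfl⟩

end Realization

end Super

namespace Super

/-! ## The triangular decomposition of `𝔤̃(A, τ)` -/

namespace Superalgebra

variable {k L : Type*} [Field k] [AddCommGroup L] [Module k L] {A : Superalgebra k L}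

theorem IsLie.mul_mem_swap (hA : A.IsLie) {i j : ZMod 2} {x y : L} (hx : x ∈ A.gr i)
    (hy : y ∈ A.gr j) {N : Submodule k L} (h : A.mul y x ∈ N) : A.mul x y ∈ N := by
  rw [hA.skew i j x hx y hy]
  exact N.neg_mem (N.smul_mem _ h)

/-- The spans of the left-normed products of `s + 1` elements of a family. -/
def chain (A : Superalgebra k L) {ι : Type*} (a : ι → L) : ℕ → Submodule k L
  | 0 => Submodule.span k (Set.range a)
  | s + 1 => ⨆ i, (chain A a s).map (A.mul (a i))

theorem mul_mem_chain {ι : Type*} {a : ι → L} (i : ι) {s : ℕ} {y : L} (hy : y ∈ A.chain a s) :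
    A.mul (a i) y ∈ A.chain a (s + 1) :=
  Submodule.mem_iSup_of_mem (p := fun i => (A.chain a s).map (A.mul (a i))) i ⟨y, hy, rfl⟩

theorem chain_induction {ι : Type*} {a : ι → L} {s : ℕ} {N : Submodule k L} {f : L →ₗ[k] L}
    (h : ∀ i, ∀ y ∈ A.chain a s, f (A.mul (a i) y) ∈ N) {y : L} (hy : y ∈ A.chain a (s + 1)) :
    f y ∈ N := by
  suffices H : A.chain a (s + 1) ≤ N.comap f from H hy
  refine iSup_le fun i => ?_
  rintro _ ⟨y, hy, rfl⟩
  exact h i y hy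

variable {ι : Type*} {a : ι → L} {p : ι → ZMod 2} {H : Submodule k L}

/-- Each member of the family `a` is an eigenvector for `H`, so `H` preserves the length of a
product by the derivation rule. -/
theorem IsLie.cartan_mul_chain (hA : A.IsLie) (ha : ∀ i, a i ∈ A.gr (p i))
    (hH : H ≤ A.gr 0) (hHa : ∀ x ∈ H, ∀ i, ∃ c : k, A.mul x (a i) = c • a i) {x : L} (hx : x ∈ H)
    {s : ℕ} {y : L} (hy : y ∈ A.chain a s) : A.mul x y ∈ A.chain a s := by
  induction s generalizing y with
  | zero =>
    suffices h : A.chain a 0 ≤ (A.chain a 0).comap (A.mul x) from h hy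
    refine Submodule.span_le.2 ?_
    rintro _ ⟨i, rfl⟩
    obtain ⟨c, hc⟩ := hHa x hx i
    change A.mul x (a i) ∈ A.chain a 0
    rw [hc]
    exact Submodule.smul_mem _ _ (Submodule.subset_span ⟨i, rfl⟩)
  | succ s ih =>
    refine chain_induction (fun i z hz => ?_) hy
    refine hA.mul_mul_mem' (hH hx) (ha i) ?_ (mul_mem_chain i (ih hz))
    obtain ⟨c, hc⟩ := hHa x hx i
    rw [hc, map_smul, LinearMap.smul_apply]
    exact Submodule.smul_mem _ _ (mul_mem_chain i hz)

theorem IsLie.mul_chain_zero {b : L} (hab : ∀ i, A.mul b (a i) ∈ H) {y : L}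
    (hy : y ∈ A.chain a 0) : A.mul b y ∈ H := by
  suffices h : A.chain a 0 ≤ H.comap (A.mul b) from h hy
  refine Submodule.span_le.2 ?_
  rintro _ ⟨i, rfl⟩
  exact hab i

theorem IsLie.mul_cartan_mem_chain (hA : A.IsLie) (ha : ∀ i, a i ∈ A.gr (p i))
    (hH : H ≤ A.gr 0) (hHa : ∀ x ∈ H, ∀ i, ∃ c : k, A.mul x (a i) = c • a i) {x : L} (hx : x ∈ H)
    (i : ι) : A.mul (a i) x ∈ A.chain a 0 := by
  refine hA.mul_mem_swap (ha i) (hH hx) ?_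
  obtain ⟨c, hc⟩ := hHa x hx i
  rw [hc]
  exact Submodule.smul_mem _ _ (Submodule.subset_span ⟨i, rfl⟩)

/-- By the Jacobi identity `[b,[aᵢ,z]]` is `[[b,aᵢ],z]` up to adding `±[aᵢ,[b,z]]`. In the first
term `[b,aᵢ] ∈ H` preserves length; the second is handled by induction. For the shortest products
`[b,z]` falls into `H`, and `[aᵢ,H]` is spanned by `aᵢ`. -/
theorem IsLie.mul_chain_succ (hA : A.IsLie) (ha : ∀ i, a i ∈ A.gr (p i))
    (hH : H ≤ A.gr 0) (hHa : ∀ x ∈ H, ∀ i, ∃ c : k, A.mul x (a i) = c • a i) {b : L} {j : ZMod 2}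
    (hb : b ∈ A.gr j) (hab : ∀ i, A.mul b (a i) ∈ H) {s : ℕ} {y : L}
    (hy : y ∈ A.chain a (s + 1)) : A.mul b y ∈ A.chain a s := by
  induction s generalizing y with
  | zero =>
    refine chain_induction (fun i z hz => ?_) hy
    exact hA.mul_mul_mem' hb (ha i) (hA.cartan_mul_chain ha hH hHa (hab i) hz)
      (hA.mul_cartan_mem_chain ha hH hHa (mul_chain_zero hab hz) i)
  | succ s ih =>
    refine chain_induction (fun i z hz => ?_) hy
    exact hA.mul_mul_mem' hb (ha i) (hA.cartan_mul_chain ha hH hHa (hab i) hz)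
      (mul_mem_chain i (ih hz))

end Superalgebra

namespace Realization

open Superalgebra

variable {k : Type*} [Field k] {n : ℕ} {A : Matrix (Fin n) (Fin n) k} {h : Type*} [AddCommGroup h]
  [Module k h] (R : Realization A h) (τ : Finset (Fin n))

/-- A generator, as an element of `𝔤̃(A, τ)`. -/
def tildeGen (x : Gen n h) : R.TildeSpace τ := (R.relIdeal τ).mkQ (gen k x)

/-- The subalgebra `𝔥` of `𝔤̃(A, τ)`. -/
def tildeCartan : h →ₗ[k] R.TildeSpace τ where
  toFun x := R.tildeGen τ (.cartan x)
  map_add' x y := by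
    have := R.mk_eq_zero τ (.cartan_add x y)
    rwa [map_sub, map_sub, sub_sub, sub_eq_zero] at this
  map_smul' c x := by
    have := R.mk_eq_zero τ (.cartan_smul c x)
    rwa [map_sub, map_smul, sub_eq_zero] at this

theorem mk_word_mem (w : FreeMagma (Gen n h)) : (R.relIdeal τ).mkQ (word k w) ∈
    (R.tilde τ).gr (wordParity (Gen.parity τ) w) := by
  rw [Superspace.mem_gr]
  refine (quotSpace_comp _ _ ((R.freeAlg τ).isIdeal_idealSpan _).odd_mem _ _).trans ?_
  exact congrArg _ (Superspace.mem_gr.1 (word_mem _ w))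

theorem tildeGen_mem (x : Gen n h) : R.tildeGen τ x ∈ (R.tilde τ).gr (Gen.parity τ x) :=
  R.mk_word_mem τ (FreeMagma.of x)

theorem tilde_ef_same (i : Fin n) : (R.tilde τ).mul (R.tildeGen τ (.e i)) (R.tildeGen τ (.f i))
    = R.tildeCartan τ (R.coroot i) := by
  have := R.mk_eq_zero τ (.ef_same i)
  rwa [map_sub, sub_eq_zero] at this

theorem tilde_ef_ne {i j : Fin n} (hij : i ≠ j) :
    (R.tilde τ).mul (R.tildeGen τ (.e i)) (R.tildeGen τ (.f j)) = 0 :=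
  R.mk_eq_zero τ (.ef_ne i j hij)

theorem tilde_cartan_cartan (x y : h) :
    (R.tilde τ).mul (R.tildeCartan τ x) (R.tildeCartan τ y) = 0 :=
  R.mk_eq_zero τ (.cartan_cartan x y)

theorem tilde_cartan_e (x : h) (i : Fin n) : (R.tilde τ).mul (R.tildeCartan τ x)
    (R.tildeGen τ (.e i)) = R.root i x • R.tildeGen τ (.e i) := by
  have := R.mk_eq_zero τ (.cartan_e x i)
  rwa [map_sub, map_smul, sub_eq_zero] at this

theorem tilde_cartan_f (x : h) (i : Fin n) : (R.tilde τ).mul (R.tildeCartan τ x)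
    (R.tildeGen τ (.f i)) = (-R.root i x) • R.tildeGen τ (.f i) := by
  have := R.mk_eq_zero τ (.cartan_f x i)
  rwa [map_add, map_smul, add_eq_zero_iff_eq_neg, ← neg_smul] at this

/-- A subspace that is stable under left multiplication by the generators is a left ideal. -/
theorem mul_mem_of_gens {N : Submodule k (R.TildeSpace τ)}
    (hN : ∀ g, ∀ y ∈ N, (R.tilde τ).mul (R.tildeGen τ g) y ∈ N) (x : R.TildeSpace τ)
    {y : R.TildeSpace τ} (hy : y ∈ N) : (R.tilde τ).mul x y ∈ N := by
  obtain ⟨x, rfl⟩ := (R.relIdeal τ).mkQ_surjective x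
  have hx := mem_span_word x
  induction hx using Submodule.span_induction with
  | zero => simp
  | add a b _ _ ha hb => rw [map_add, map_add]; exact N.add_mem ha hb
  | smul c a _ ha => rw [map_smul, map_smul]; exact N.smul_mem _ ha
  | mem x hx =>
    obtain ⟨w, rfl⟩ := hx
    induction w generalizing y with
    | ih1 x => exact hN x y hy
    | ih2 a b ha hb =>
      rw [word_mul, ← R.tilde_mul]
      exact (R.isLie_tilde τ).mul_mul_mem (R.mk_word_mem τ a) (R.mk_word_mem τ b) (ha (hb hy)) (hb (ha hy))

theorem eq_top_of_gens {N : Submodule k (R.TildeSpace τ)} (h1 : ∀ g, R.tildeGen τ g ∈ N)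
    (h2 : ∀ g, ∀ y ∈ N, (R.tilde τ).mul (R.tildeGen τ g) y ∈ N) : N = ⊤ := by
  refine Submodule.eq_top_iff'.2 fun x => ?_
  obtain ⟨x, rfl⟩ := (R.relIdeal τ).mkQ_surjective x
  have hx := mem_span_word x
  induction hx using Submodule.span_induction with
  | zero => simp
  | add a b _ _ ha hb => rw [map_add]; exact N.add_mem ha hb
  | smul c a _ ha => rw [map_smul]; exact N.smul_mem _ ha
  | mem x hx =>
    obtain ⟨w, rfl⟩ := hx
    induction w with
    | ih1 x => exact h1 x
    | ih2 a b _ hb =>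
      rw [word_mul, ← R.tilde_mul]
      exact R.mul_mem_of_gens τ h2 _ hb

/-- The components of the triangular decomposition. -/
def triangular : ℤ → Submodule k (R.TildeSpace τ)
  | .ofNat 0 => LinearMap.range (R.tildeCartan τ)
  | .ofNat (s + 1) => (R.tilde τ).chain (fun i => R.tildeGen τ (.e i)) s
  | .negSucc s => (R.tilde τ).chain (fun i => R.tildeGen τ (.f i)) s

/-- The raising generators lengthen chains of `e`'s and shorten chains of `f`'s, passing through
`𝔥`, and symmetrically for the lowering ones. A chain of index `s` has `s + 1` factors, so degrees
`s + 1` and `-(s + 1)` both carry index `s`. -/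
theorem tildeGen_mul_mem (g : Gen n h) (m : ℤ) {y : R.TildeSpace τ} (hy : y ∈ R.triangular τ m) :
    (R.tilde τ).mul (R.tildeGen τ g) y ∈ R.triangular τ (m + Gen.degree g) := by
  have hL := R.isLie_tilde τ
  have hH : LinearMap.range (R.tildeCartan τ) ≤ (R.tilde τ).gr 0 := by
    rintro _ ⟨x, rfl⟩
    exact R.tildeGen_mem τ (.cartan x)
  have hE : ∀ x ∈ LinearMap.range (R.tildeCartan τ), ∀ i, ∃ c : k,
      (R.tilde τ).mul x (R.tildeGen τ (.e i)) = c • R.tildeGen τ (.e i) := by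
    rintro _ ⟨x, rfl⟩ i
    exact ⟨_, R.tilde_cartan_e τ x i⟩
  have hF : ∀ x ∈ LinearMap.range (R.tildeCartan τ), ∀ i, ∃ c : k,
      (R.tilde τ).mul x (R.tildeGen τ (.f i)) = c • R.tildeGen τ (.f i) := by
    rintro _ ⟨x, rfl⟩ i
    exact ⟨_, R.tilde_cartan_f τ x i⟩
  have hEF : ∀ i j, (R.tilde τ).mul (R.tildeGen τ (.e i)) (R.tildeGen τ (.f j)) ∈
      LinearMap.range (R.tildeCartan τ) := by
    intro i j
    by_cases hij : i = j
    · subst hij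
      exact ⟨_, (R.tilde_ef_same τ i).symm⟩
    · rw [R.tilde_ef_ne τ hij]
      exact Submodule.zero_mem _
  have hFE : ∀ i j, (R.tilde τ).mul (R.tildeGen τ (.f j)) (R.tildeGen τ (.e i)) ∈
      LinearMap.range (R.tildeCartan τ) := fun i j =>
    hL.mul_mem_swap (R.tildeGen_mem τ _) (R.tildeGen_mem τ _) (hEF i j)
  have hgE : ∀ i, R.tildeGen τ (.e i) ∈ (R.tilde τ).gr (Gen.parity τ (.e i)) :=
    fun i => R.tildeGen_mem τ _
  have hgF : ∀ i, R.tildeGen τ (.f i) ∈ (R.tilde τ).gr (Gen.parity τ (.f i)) :=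
    fun i => R.tildeGen_mem τ _
  cases g with
  | cartan x =>
    rw [Gen.degree, add_zero]
    match m with
    | .ofNat 0 =>
      obtain ⟨y, rfl⟩ := hy
      rw [show R.tildeGen τ (.cartan x) = R.tildeCartan τ x from rfl, R.tilde_cartan_cartan]
      exact Submodule.zero_mem _
    | .ofNat (s + 1) => exact hL.cartan_mul_chain hgE hH hE ⟨x, rfl⟩ hy
    | .negSucc s => exact hL.cartan_mul_chain hgF hH hF ⟨x, rfl⟩ hy
  | e i =>
    match m with
    | .ofNat 0 => exact hL.mul_cartan_mem_chain hgE hH hE hy i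
    | .ofNat (s + 1) => exact mul_mem_chain (a := fun i => R.tildeGen τ (.e i)) i hy
    | .negSucc 0 => exact IsLie.mul_chain_zero (hEF i) hy
    | .negSucc (s + 1) => exact hL.mul_chain_succ hgF hH hF (hgE i) (hEF i) hy
  | f i =>
    match m with
    | .ofNat 0 => exact hL.mul_cartan_mem_chain hgF hH hF hy i
    | .ofNat 1 => exact IsLie.mul_chain_zero (fun j => hFE j i) hy
    | .ofNat (s + 2) =>
      have e : Int.ofNat (s + 2) + Gen.degree (.f i : Gen n h) = Int.ofNat (s + 1) := by
        simp only [Gen.degree, Int.ofNat_eq_natCast]; omega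
      rw [e]
      exact hL.mul_chain_succ hgE hH hE (hgF i) (fun j => hFE j i) hy
    | .negSucc s => exact mul_mem_chain (a := fun i => R.tildeGen τ (.f i)) i hy

theorem mk_word_mul_mem (w : FreeMagma (Gen n h)) (m : ℤ) {y : R.TildeSpace τ}
    (hy : y ∈ R.triangular τ m) : (R.tilde τ).mul ((R.relIdeal τ).mkQ (word k w)) y ∈
      R.triangular τ (m + wordDegree Gen.degree w) := by
  induction w generalizing y m with
  | ih1 x => exact R.tildeGen_mul_mem τ x m hy
  | ih2 a b ha hb =>
    rw [word_mul, ← R.tilde_mul]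
    refine (R.isLie_tilde τ).mul_mul_mem (R.mk_word_mem τ a) (R.mk_word_mem τ b) ?_ ?_
    · have := ha _ (hb m hy)
      rwa [add_assoc, add_comm (wordDegree _ b)] at this
    · have := hb _ (ha m hy)
      rwa [add_assoc] at this

theorem tildeGen_mem_triangular (g : Gen n h) :
    R.tildeGen τ g ∈ R.triangular τ (Gen.degree g) := by
  cases g with
  | cartan x => exact ⟨x, rfl⟩
  | e i => exact Submodule.subset_span ⟨i, rfl⟩
  | f i => exact Submodule.subset_span ⟨i, rfl⟩

/-- Only the degrees `0`, `1`, `-1` are used later: there the components lie in `𝔥`, the span of the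
`eᵢ` and the span of the `fᵢ`. -/
theorem tildeDegree_le (m : ℤ) : R.tildeDegree τ m ≤ R.triangular τ m := by
  refine Submodule.map_le_iff_le_comap.2 (Submodule.span_le.2 ?_)
  rintro _ ⟨w, rfl, rfl⟩
  change (R.relIdeal τ).mkQ (word k w) ∈ R.triangular τ _
  induction w with
  | ih1 x => exact R.tildeGen_mem_triangular τ x
  | ih2 a b _ hb =>
    rw [word_mul, ← R.tilde_mul]
    have := R.mk_word_mul_mem τ a _ hb
    rwa [add_comm] at this

end Realization

end Super

namespace Super

/-! ## Models of centerless derived contragredient Lie superalgebras -/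

namespace Realization

open Superalgebra

variable {k : Type*} [Field k] {n : ℕ} {A : Matrix (Fin n) (Fin n) k} {h : Type*} [AddCommGroup h]
  [Module k h] {L : Type*} [AddCommGroup L] [Module k L]

/-- A simple Lie superalgebra with generators `eᵢ`, `fᵢ`, with commuting derivations `D(x)`, `x ∈ 𝔥`,
and with a compatible `ℤ`-grading, given by the projections onto its components, such that the
`eᵢ`, `fᵢ` and `D(x)` satisfy the relations of `𝔤̃(A, τ)`. -/
structure IsModel (R : Realization A h) (τ : Finset (Fin n)) (B : Superalgebra k L)
    (D : h →ₗ[k] Module.End k L) (e f : Fin n → L) (pr : ℤ → L →ₗ[k] L) : Prop where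
  isLie : B.IsLie
  isSimple : B.IsSimple
  eq_zero : ∀ x, B.mul x = 0 → x = 0
  e_mem : ∀ i, e i ∈ B.gr (if i ∈ τ then 1 else 0)
  f_mem : ∀ i, f i ∈ B.gr (if i ∈ τ then 1 else 0)
  D_mem : ∀ x, D x ∈ B.endo.gr 0
  D_mul : ∀ x y z, D x (B.mul y z) = B.mul (D x y) z + B.mul y (D x z)
  D_comm : ∀ x y z, D x (D y z) = D y (D x z)
  D_e : ∀ x i, D x (e i) = R.root i x • e i
  D_f : ∀ x i, D x (f i) = -(R.root i x • f i)
  ef_same : ∀ i, B.mul (B.mul (e i) (f i)) = D (R.coroot i)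
  ef_ne : ∀ i j, i ≠ j → B.mul (e i) (f j) = 0
  generate : ∀ N : Submodule k L, (∀ i, e i ∈ N) → (∀ i, f i ∈ N) → (∀ i, ∀ y ∈ N, B.mul (e i) y ∈ N) →
    (∀ i, ∀ y ∈ N, B.mul (f i) y ∈ N) → N = ⊤
  e_indep : LinearIndependent k e
  f_indep : LinearIndependent k f
  pr_D : ∀ m x y, pr m (D x y) = D x (pr m y)
  pr_e : ∀ m i y, pr (m + 1) (B.mul (e i) y) = B.mul (e i) (pr m y)
  pr_f : ∀ m i y, pr (m + -1) (B.mul (f i) y) = B.mul (f i) (pr m y)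
  pr_pr : ∀ m m' y, pr m (pr m' y) = if m = m' then pr m' y else 0
  pr_ext : ∀ y, (∀ m, pr m y = 0) → y = 0
  two_ne_zero : (2 : k) ≠ 0
  exists_ne_zero : ∃ i, D (R.coroot i) ≠ 0

namespace IsModel

variable {R : Realization A h} {τ : Finset (Fin n)} {B : Superalgebra k L}
  {D : h →ₗ[k] Module.End k L} {e f : Fin n → L} {pr : ℤ → L →ₗ[k] L}

/-- The action of the generators. -/
def action (B : Superalgebra k L) (D : h →ₗ[k] Module.End k L) (e f : Fin n → L) :
    Gen n h → Module.End k L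
  | .cartan x => D x
  | .e i => B.mul (e i)
  | .f i => B.mul (f i)

/-- The representation of the free superalgebra. -/
def freeRep (B : Superalgebra k L) (D : h →ₗ[k] Module.End k L) (e f : Fin n → L) :
    FreeNonUnitalNonAssocAlgebra k (Gen n h) →ₗ[k] Module.End k L :=
  freeLift B.toSuperspace.commutator (action B D e f)

variable (M : R.IsModel τ B D e f pr)
include M

theorem action_mem (x : Gen n h) : action B D e f x ∈ B.endo.gr (Gen.parity τ x) := by
  cases x with
  | cartan x => exact M.D_mem x
  | e i => exact B.mul_mem_gr_ad (M.e_mem i)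
  | f i => exact B.mul_mem_gr_ad (M.f_mem i)

theorem commutator_D (x : h) (y : L) :
    B.toSuperspace.commutator.mul (D x) (B.mul y) = B.mul (D x y) := by
  have key : ∀ j, ∀ y ∈ B.gr j,
      B.toSuperspace.commutator.mul (D x) (B.mul y) = B.mul (D x y) := by
    intro j y hy
    rw [Superspace.commutator_mul (M.D_mem x) (B.mul_mem_gr_ad hy)]
    ext z
    simp [sgn, M.D_mul]
  rw [← B.sum_comp y]
  simp only [map_sum]
  exact Finset.sum_congr rfl fun j _ => key j _ (B.comp_mem j y)

/-- The identities of Lie superalgebras hold because the values are endomorphisms under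
supercommutators; the remaining relators are conditions in `IsModel`. Acting on `L`, rather than
mapping to `L`, leaves room for elements of `𝔥` that act by outer derivations. -/
theorem freeRep_relator {x : FreeNonUnitalNonAssocAlgebra k (Gen n h)} (hx : R.Relator τ x) :
    freeRep B D e f x = 0 := by
  have hm : ∀ i, ∀ x ∈ (R.freeAlg τ).gr i, freeRep B D e f x ∈ B.toSuperspace.commutator.gr i :=
    fun i x hx => freeLift_mem (A := B.toSuperspace.commutator) M.action_mem hx
  have hC := B.toSuperspace.isLie_commutator
  have hmul : ∀ x y, freeRep B D e f (x * y) = B.toSuperspace.commutator.mul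
      (freeRep B D e f x) (freeRep B D e f y) := fun x y => freeLift_mul x y
  have hg : ∀ x, freeRep B D e f (gen k x) = action B D e f x := fun x => freeLift_of x
  cases hx with
  | self_even x hx => rw [hmul]; exact hC.self_even _ (hm 0 x hx)
  | skew i j x y hx hy =>
    rw [map_add, map_smul, hmul, hmul, hC.skew i j _ (hm i x hx) _ (hm j y hy), neg_add_cancel]
  | jacobi i j x y z hx hy =>
    simp only [map_sub, map_smul, hmul]
    rw [hC.jacobi i j _ (hm i x hx) _ (hm j y hy)]
    abel
  | cube_odd x hx => rw [hmul, hmul]; exact hC.cube_odd _ (hm 1 x hx)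
  | cartan_add x y => simp only [map_sub, hg, action, map_add]; abel
  | cartan_smul c x => simp only [map_sub, map_smul, hg, action, sub_self]
  | ef_same i =>
    rw [map_sub, hmul, hg, hg, hg, sub_eq_zero]
    exact (M.isLie.ad_mul _ _).symm.trans (M.ef_same i)
  | ef_ne i j hij =>
    rw [hmul, hg, hg]
    refine (M.isLie.ad_mul _ _).symm.trans ?_
    rw [M.ef_ne i j hij, map_zero]
  | cartan_cartan x y =>
    rw [hmul, hg, hg, action, action, Superspace.commutator_mul (M.D_mem x) (M.D_mem y)]
    ext z
    simp [sgn, M.D_comm x y]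
  | cartan_e x i =>
    rw [map_sub, map_smul, hmul, hg, hg, action, action, M.commutator_D, M.D_e, map_smul, sub_self]
  | cartan_f x i =>
    rw [map_add, map_smul, hmul, hg, hg, action, action, M.commutator_D, M.D_f, map_neg, map_smul,
      neg_add_cancel]

theorem relIdeal_le_ker : R.relIdeal τ ≤ LinearMap.ker (freeRep B D e f) := by
  refine sInf_le ⟨⟨fun x hx => ?_, fun x y hy => ?_, fun x hx y => ?_⟩,
    fun x hx => M.freeRep_relator hx⟩
  · have := freeLift_comp (A := B.toSuperspace.commutator) M.action_mem 1 x
    rw [Superspace.comp_one] at this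
    rw [LinearMap.mem_ker] at *
    exact this.trans ((congrArg _ hx).trans (map_zero _))
  · rw [LinearMap.mem_ker] at *
    refine (freeLift_mul x y).trans ?_
    exact (congrArg _ hy).trans (map_zero _)
  · rw [LinearMap.mem_ker] at *
    refine (freeLift_mul x y).trans ?_
    exact LinearMap.congr_fun ((congrArg _ hx).trans (map_zero _)) _

omit M in
/-- The representation of `𝔤̃(A, τ)`. -/
def rep (M : R.IsModel τ B D e f pr) : R.TildeSpace τ →ₗ[k] Module.End k L :=
  (R.relIdeal τ).liftQ (freeRep B D e f) M.relIdeal_le_ker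

theorem rep_mk (x : FreeNonUnitalNonAssocAlgebra k (Gen n h)) :
    M.rep ((R.relIdeal τ).mkQ x) = freeRep B D e f x := rfl

theorem rep_gen (x : Gen n h) : M.rep (R.tildeGen τ x) = action B D e f x := freeLift_of x

theorem rep_mul (x y : R.TildeSpace τ) : M.rep ((R.tilde τ).mul x y)
    = B.toSuperspace.commutator.mul (M.rep x) (M.rep y) := by
  obtain ⟨x, rfl⟩ := (R.relIdeal τ).mkQ_surjective x
  obtain ⟨y, rfl⟩ := (R.relIdeal τ).mkQ_surjective y
  exact freeLift_mul x y

theorem rep_odd (x : R.TildeSpace τ) : M.rep ((R.tilde τ).odd x) = B.endo.odd (M.rep x) := by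
  obtain ⟨x, rfl⟩ := (R.relIdeal τ).mkQ_surjective x
  have := freeLift_comp (A := B.toSuperspace.commutator) M.action_mem 1 x
  rwa [Superspace.comp_one, Superspace.comp_one] at this

theorem freeRep_word_mem (w : FreeMagma (Gen n h)) : freeRep B D e f (word k w)
    ∈ B.toSuperspace.commutator.gr (wordParity (Gen.parity τ) w) :=
  freeLift_mem (A := B.toSuperspace.commutator) M.action_mem (word_mem _ w)

/-- The elements of `𝔤̃(A, τ)` act by superderivations. -/
theorem commutator_rep (t : R.TildeSpace τ) (y : L) :
    B.toSuperspace.commutator.mul (M.rep t) (B.mul y) = B.mul (M.rep t y) := by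
  obtain ⟨x, rfl⟩ := (R.relIdeal τ).mkQ_surjective t
  have hx := mem_span_word x
  rw [rep_mk]
  induction hx using Submodule.span_induction with
  | zero => simp
  | add a b _ _ ha hb => simp only [map_add, LinearMap.add_apply, ha, hb]
  | smul c a _ ha => simp only [map_smul, LinearMap.smul_apply, ha]
  | mem x hx =>
    obtain ⟨w, rfl⟩ := hx
    induction w generalizing y with
    | ih1 x =>
      have : freeRep B D e f (word k (FreeMagma.of x)) = action B D e f x := freeLift_of x
      rw [this]
      cases x with
      | cartan x => exact M.commutator_D x y
      | e i => exact (M.isLie.ad_mul _ _).symm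
      | f i => exact (M.isLie.ad_mul _ _).symm
    | ih2 a b ha hb =>
      have h1 : freeRep B D e f (word k (a * b)) = B.toSuperspace.commutator.mul
          (freeRep B D e f (word k a)) (freeRep B D e f (word k b)) := by
        rw [word_mul]; exact freeLift_mul _ _
      have hj := B.toSuperspace.isLie_commutator.jacobi _ _ _ (M.freeRep_word_mem a) _
        (M.freeRep_word_mem b) (B.mul y)
      rw [h1, ← sub_eq_of_eq_add hj, hb, ha, ha, hb,
        Superspace.commutator_mul (M.freeRep_word_mem a) (M.freeRep_word_mem b)]
      simp

theorem pr_freeRep_word (w : FreeMagma (Gen n h)) (m : ℤ) (y : L) :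
    pr (m + wordDegree Gen.degree w) (freeRep B D e f (word k w) y)
      = freeRep B D e f (word k w) (pr m y) := by
  induction w generalizing m y with
  | ih1 x =>
    have : freeRep B D e f (word k (FreeMagma.of x)) = action B D e f x := freeLift_of x
    rw [this]
    cases x with
    | cartan x => exact (congrArg (fun m => pr m (D x y)) (add_zero m)).trans (M.pr_D m x y)
    | e i => exact M.pr_e m i y
    | f i => exact M.pr_f m i y
  | ih2 a b ha hb =>
    have h1 : freeRep B D e f (word k (a * b)) = B.toSuperspace.commutator.mul
        (freeRep B D e f (word k a)) (freeRep B D e f (word k b)) := by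
      rw [word_mul]; exact freeLift_mul _ _
    have h2 : wordDegree Gen.degree (a * b) = wordDegree Gen.degree a + wordDegree Gen.degree b :=
      rfl
    rw [h1, Superspace.commutator_mul (M.freeRep_word_mem a) (M.freeRep_word_mem b)]
    simp only [LinearMap.sub_apply, LinearMap.smul_apply, Module.End.mul_apply, map_sub, map_smul]
    rw [← hb, ← ha, ← ha, ← hb, h2]
    congr 3
    · ring
    · rw [add_assoc]

theorem pr_rep {m : ℤ} {t : R.TildeSpace τ} (ht : t ∈ R.tildeDegree τ m) (a : ℤ) (y : L) :
    pr (a + m) (M.rep t y) = M.rep t (pr a y) := by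
  obtain ⟨x, hx, rfl⟩ := ht
  rw [rep_mk]
  induction hx using Submodule.span_induction with
  | zero => simp
  | add a b _ _ ha hb => simp only [map_add, LinearMap.add_apply, ha, hb]
  | smul c a _ ha => simp only [map_smul, LinearMap.smul_apply, ha]
  | mem x hx =>
    obtain ⟨w, rfl, rfl⟩ := hx
    exact M.pr_freeRep_word w a y

/-- The components of an element act as the components of its action. -/
theorem rep_component (s : ℤ →₀ R.TildeSpace τ) (hs : ∀ m, s m ∈ R.tildeDegree τ m) (m a : ℤ)
    (y : L) : pr (a + m) (M.rep (s.sum fun _ x => x) (pr a y)) = M.rep (s m) (pr a y) := by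
  have key : ∀ m', pr (a + m) (M.rep (s m') (pr a y)) = if m' = m then M.rep (s m) (pr a y)
      else 0 := by
    intro m'
    rw [← M.pr_rep (hs m') a y, M.pr_pr]
    by_cases hm : m' = m
    · subst hm
      rw [if_pos rfl, if_pos rfl, M.pr_rep (hs m') a y]
    · rw [if_neg (fun h => hm (add_left_cancel h).symm), if_neg hm]
  rw [Finsupp.sum, map_sum, LinearMap.sum_apply, map_sum, Finset.sum_congr rfl fun m' _ => key m',
    Finset.sum_ite_eq']
  split_ifs with hm
  · rfl
  · rw [Finsupp.notMem_support_iff.1 hm]; simp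

theorem rep_eq_of_pr {m : ℤ} {t : R.TildeSpace τ} (ht : t ∈ R.tildeDegree τ m)
    (h0 : ∀ a y, M.rep t (pr a y) = 0) : M.rep t = 0 := by
  ext y
  refine M.pr_ext _ fun a => ?_
  rw [← sub_add_cancel a m, M.pr_rep ht, h0]

/-- The kernel of the representation is homogeneous: the component of degree `m` is the part of the
action that raises the degree in `L` by `m`. -/
theorem component_mem_ker {s : ℤ →₀ R.TildeSpace τ} (hs : ∀ m, s m ∈ R.tildeDegree τ m)
    (h0 : M.rep (s.sum fun _ x => x) = 0) (m : ℤ) : M.rep (s m) = 0 := by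
  refine M.rep_eq_of_pr (hs m) fun a y => ?_
  rw [← M.rep_component s hs, h0]
  simp

theorem e_ne_zero (i : Fin n) : e i ≠ 0 := M.e_indep.ne_zero i

/-- The representation is faithful in degrees `1` and `-1`. -/
theorem eq_zero_of_degree_one {t : R.TildeSpace τ}
    (ht : t ∈ R.tildeDegree τ 1 ∨ t ∈ R.tildeDegree τ (-1)) (h0 : M.rep t = 0) : t = 0 := by
  have key : ∀ (g : Fin n → Gen n h) (a : Fin n → L), LinearIndependent k a →
      (∀ i, action B D e f (g i) = B.mul (a i)) →
      t ∈ Submodule.span k (Set.range fun i => R.tildeGen τ (g i)) → t = 0 := by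
    intro g a ha hga ht
    obtain ⟨c, rfl⟩ := (Submodule.mem_span_range_iff_exists_fun k).1 ht
    have h1 : B.mul (∑ i, c i • a i) = 0 := by
      rw [← h0]
      simp [M.rep_gen, hga]
    have h2 := Fintype.linearIndependent_iff.1 ha c (M.eq_zero _ h1)
    simp [h2]
  rcases ht with ht | ht
  · exact key _ e M.e_indep (fun _ => rfl) (R.tildeDegree_le τ 1 ht)
  · exact key _ f M.f_indep (fun _ => rfl) (R.tildeDegree_le τ (-1) ht)

end IsModel

end Realization

end Super

/-! ### Identification of a model with `𝔤'(A, τ)/𝔠`. -/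

namespace Super

/-- The first isomorphism theorem. -/
theorem Superalgebra.nonempty_iso_quot {k L N : Type*} [Field k] [AddCommGroup L] [Module k L]
    [AddCommGroup N] [Module k N] {B : Superalgebra k L} {C : Superalgebra k N}
    {I : Submodule k N} (hI : C.IsIdeal I) {φ : N →ₗ[k] L} (hφ : Function.Surjective φ)
    (hker : LinearMap.ker φ = I) (hodd : ∀ x, φ (C.odd x) = B.odd (φ x))
    (hmul : ∀ x y, φ (C.mul x y) = B.mul (φ x) (φ y)) : Nonempty (B.Iso (C.quot I hI)) := by
  let E : (N ⧸ I) ≃ₗ[k] L :=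
    (Submodule.quotEquivOfEq _ _ hker.symm).trans (φ.quotKerEquivOfSurjective hφ)
  have hE : ∀ x, E (I.mkQ x) = φ x := fun x => rfl
  have hE' : ∀ x, E.symm (φ x) = I.mkQ x := fun x => by rw [← hE, E.symm_apply_apply]
  refine ⟨{ toLinearEquiv := E.symm, map_odd := fun x => ?_, map_mul := fun x y => ?_ }⟩
  · obtain ⟨x, rfl⟩ := hφ x
    rw [hE', ← hodd, hE']
    rfl
  · obtain ⟨x, rfl⟩ := hφ x
    obtain ⟨y, rfl⟩ := hφ y
    rw [hE', hE', ← hmul, hE']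
    rfl

namespace Realization

open Superalgebra

variable {k : Type*} [Field k] {n : ℕ} {A : Matrix (Fin n) (Fin n) k} {h : Type*} [AddCommGroup h]
  [Module k h] {L : Type*} [AddCommGroup L] [Module k L]

namespace IsModel

variable {R : Realization A h} {τ : Finset (Fin n)} {B : Superalgebra k L}
  {D : h →ₗ[k] Module.End k L} {e f : Fin n → L} {pr : ℤ → L →ₗ[k] L}
  (M : R.IsModel τ B D e f pr)

/-- The sum of the components of nonzero degree of the kernel of the representation. -/
def kerNonzero : Submodule k (R.TildeSpace τ) :=
  ⨆ m : {m : ℤ // m ≠ 0}, LinearMap.ker M.rep ⊓ R.tildeDegree τ m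

theorem mem_kerNonzero {m : ℤ} (hm : m ≠ 0) {t : R.TildeSpace τ} (h0 : M.rep t = 0)
    (ht : t ∈ R.tildeDegree τ m) : t ∈ M.kerNonzero :=
  Submodule.mem_iSup_of_mem (p := fun m : {m : ℤ // m ≠ 0} =>
    LinearMap.ker M.rep ⊓ R.tildeDegree τ (m : ℤ)) ⟨m, hm⟩ ⟨h0, ht⟩

/-- A generator can bring a kernel element of nonzero degree into degree zero only from degree `1`
or `-1`, and there the kernel vanishes by `eq_zero_of_degree_one`. So these components form an
ideal. It meets `𝔥` trivially because `𝔥` has degree zero in a graded algebra. -/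
theorem isHomogeneousAvoiding_kerNonzero : R.IsHomogeneousAvoiding τ M.kerNonzero where
  isIdeal := by
    refine (R.isLie_tilde τ).isIdeal ?_ fun x y hy => R.mul_mem_of_gens τ (fun g => ?_) x hy
    · change M.kerNonzero ≤ M.kerNonzero.comap (R.tilde τ).odd
      refine iSup_le fun m x hx => M.mem_kerNonzero m.2 ?_ (R.odd_mem_tildeDegree τ hx.2)
      rw [M.rep_odd, LinearMap.mem_ker.1 hx.1, map_zero]
    · change M.kerNonzero ≤ M.kerNonzero.comap ((R.tilde τ).mul (R.tildeGen τ g))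
      refine iSup_le fun m x hx => ?_
      have hg : R.tildeGen τ g ∈ R.tildeDegree τ (Gen.degree g) :=
        ⟨_, word_mem_wordSpan (FreeMagma.of g), rfl⟩
      have h1 := R.mul_mem_tildeDegree τ hg hx.2
      have h0 : M.rep ((R.tilde τ).mul (R.tildeGen τ g) x) = 0 := by
        rw [M.rep_mul, LinearMap.mem_ker.1 hx.1, map_zero]
      by_cases hm : Gen.degree g + m = 0
      · have : x = 0 := by
          refine M.eq_zero_of_degree_one ?_ hx.1
          have hm' := m.2
          have hx2 := hx.2
          rw [show (m : ℤ) = -Gen.degree g by omega] at hm' hx2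
          cases g with
          | cartan x => exact absurd rfl hm'
          | e i => exact Or.inr hx2
          | f i => exact Or.inl hx2
        rw [this]
        exact Submodule.zero_mem _
      · exact M.mem_kerNonzero hm h0 h1
  homogeneous := iSup_le fun m x hx => Submodule.mem_iSup_of_mem (m : ℤ)
    ⟨M.mem_kerNonzero m.2 hx.1 hx.2, hx.2⟩
  avoids x hx := by
    -- An element of degree zero that is a sum of elements of nonzero degrees vanishes.
    refine R.mk_eq_zero_of_mem τ M.two_ne_zero (gen_cartan_mem x) ?_
    exact (iSup_mono fun m => inf_le_right : M.kerNonzero ≤ _) hx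

/-- The elements whose adjoint action comes from `𝔤̃(A, τ)` include the generators of `L` and are
stable under multiplication by them. -/
theorem ad_mem_range (y : L) : B.mul y ∈ LinearMap.range M.rep := by
  suffices H : (LinearMap.range M.rep).comap B.mul = ⊤ by
    exact (H ▸ Submodule.mem_top : y ∈ (LinearMap.range M.rep).comap B.mul)
  refine M.generate _ (fun i => ⟨R.tildeGen τ (.e i), M.rep_gen _⟩)
    (fun i => ⟨R.tildeGen τ (.f i), M.rep_gen _⟩) (fun i y hy => ?_) fun i y hy => ?_
  · obtain ⟨t, ht⟩ := hy
    exact ⟨(R.tilde τ).mul (R.tildeGen τ (.e i)) t, by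
      rw [M.rep_mul, ht, M.isLie.ad_mul, M.rep_gen]; rfl⟩
  · obtain ⟨t, ht⟩ := hy
    exact ⟨(R.tilde τ).mul (R.tildeGen τ (.f i)) t, by
      rw [M.rep_mul, ht, M.isLie.ad_mul, M.rep_gen]; rfl⟩

/-- The representation kills the homogeneous ideals that intersect `𝔥` trivially. -/
theorem le_ker {I : Submodule k (R.TildeSpace τ)} (hI : R.IsHomogeneousAvoiding τ I) :
    I ≤ LinearMap.ker M.rep := by
  -- The elements of `L` whose adjoint action lies in the image of `I` form an ideal of `L`, since
  -- inner derivations are in the image of the representation. Simplicity leaves two cases.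
  have hideal : B.IsIdeal ((I.map M.rep).comap B.mul) := by
    refine M.isLie.isIdeal (fun y hy => ?_) fun x y hy => ?_
    · obtain ⟨t, ht, e⟩ := hy
      refine ⟨(R.tilde τ).odd t, hI.isIdeal.odd_mem t ht, ?_⟩
      rw [M.rep_odd, e]
      have := B.ad_comp 1 y
      rw [Superspace.comp_one, Superspace.comp_one] at this
      exact this.symm
    · obtain ⟨t, ht, e⟩ := hy
      obtain ⟨s, hs⟩ := M.ad_mem_range x
      exact ⟨(R.tilde τ).mul s t, hI.isIdeal.mul_mem_left s t ht, by
        rw [M.rep_mul, e, hs, M.isLie.ad_mul]⟩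
  rcases M.isSimple.2 _ hideal with hb | ht
  · intro t ht
    rw [LinearMap.mem_ker]
    ext y
    obtain ⟨s, hs⟩ := M.ad_mem_range y
    -- In the first case that ideal is zero. The adjoint action of `t · y` is `[t, ad y]`, and this
    -- belongs to the image of `I`.
    have : M.rep t y ∈ (I.map M.rep).comap B.mul :=
      ⟨(R.tilde τ).mul t s, hI.isIdeal.mul_mem_right t ht s, by
        rw [M.rep_mul, hs, M.commutator_rep]⟩
    rw [hb] at this
    exact this
  -- In the second case the adjoint action of `[eᵢ, fᵢ]`, which is `D(hᵢ)`, is that of some `t ∈ I`.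
  -- Its degree-zero component acts in the same way, lies in `I`, and comes from `𝔥`. It therefore
  -- vanishes, contrary to the choice of `i`.
  · exfalso
    obtain ⟨i, hi⟩ := M.exists_ne_zero
    have hmem : B.mul (e i) (f i) ∈ (I.map M.rep).comap B.mul := ht ▸ Submodule.mem_top
    obtain ⟨t, htI, het⟩ := hmem
    rw [M.ef_same] at het
    obtain ⟨s, hs, rfl⟩ :=
      (Submodule.mem_iSup_iff_exists_finsupp _ _).1 (hI.homogeneous htI)
    have h0 : M.rep (s 0) = D (R.coroot i) := by
      ext y
      rw [← sub_eq_zero]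
      refine M.pr_ext _ fun a => ?_
      have h1 := M.rep_component s (fun m => (hs m).2) 0 a y
      rw [het, add_zero, M.pr_D, M.pr_pr, if_pos rfl] at h1
      have h2 := M.pr_rep (hs 0).2 a y
      rw [add_zero] at h2
      rw [map_sub, M.pr_D, h2, ← h1, sub_self]
    obtain ⟨x, hx⟩ := R.tildeDegree_le τ 0 (hs 0).2
    have h1 : R.tildeCartan τ x = 0 := hI.avoids x (by
      change R.tildeCartan τ x ∈ I
      rw [hx]
      exact (hs 0).1)
    rw [← hx, h1, map_zero] at h0
    exact hi h0.symm

theorem maxIdeal_le_ker : R.maxIdeal τ ≤ LinearMap.ker M.rep := sSup_le fun _ hI => M.le_ker hI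

/-- The representation of `𝔤(A, τ)`. -/
def contraRep : (R.TildeSpace τ ⧸ R.maxIdeal τ) →ₗ[k] Module.End k L :=
  (R.maxIdeal τ).liftQ M.rep M.maxIdeal_le_ker

theorem contraRep_mk (t : R.TildeSpace τ) : M.contraRep ((R.maxIdeal τ).mkQ t) = M.rep t := rfl

theorem contraRep_mul (x y : R.TildeSpace τ ⧸ R.maxIdeal τ) :
    M.contraRep ((R.contragredient τ).mul x y)
      = B.toSuperspace.commutator.mul (M.contraRep x) (M.contraRep y) := by
  obtain ⟨x, rfl⟩ := (R.maxIdeal τ).mkQ_surjective x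
  obtain ⟨y, rfl⟩ := (R.maxIdeal τ).mkQ_surjective y
  exact M.rep_mul x y

theorem contraRep_odd (x : R.TildeSpace τ ⧸ R.maxIdeal τ) :
    M.contraRep ((R.contragredient τ).odd x) = B.endo.odd (M.contraRep x) := by
  obtain ⟨x, rfl⟩ := (R.maxIdeal τ).mkQ_surjective x
  exact M.rep_odd x

include M in
/-- The supercommutators of inner derivations and derivations `D(x)` are inner. -/
theorem commutator_mem_range {u v : Module.End k L}
    (hu : u ∈ LinearMap.range B.mul ⊔ LinearMap.range D)
    (hv : v ∈ LinearMap.range B.mul ⊔ LinearMap.range D) :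
    B.toSuperspace.commutator.mul u v ∈ LinearMap.range B.mul := by
  obtain ⟨_, ⟨a, rfl⟩, _, ⟨x, rfl⟩, rfl⟩ := Submodule.mem_sup.1 hu
  obtain ⟨_, ⟨b, rfl⟩, _, ⟨y, rfl⟩, rfl⟩ := Submodule.mem_sup.1 hv
  have hC := B.toSuperspace.isLie_commutator
  have hD : ∀ u v, B.toSuperspace.commutator.mul (D u) (D v) = 0 := fun u v => by
    rw [Superspace.commutator_mul (M.D_mem u) (M.D_mem v)]
    ext z
    simp [sgn, M.D_comm u v]
  have hDa : ∀ a v, B.toSuperspace.commutator.mul (B.mul a) (D v) ∈ LinearMap.range B.mul := by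
    intro a v
    rw [hC.mul_comm]
    refine Submodule.neg_mem _ (Submodule.sum_mem _ fun i _ => Submodule.sum_mem _ fun j _ =>
      Submodule.smul_mem _ _ ?_)
    have h1 : B.toSuperspace.commutator.comp i (B.mul a) = B.mul (B.comp i a) :=
      (B.ad_comp i a).symm
    have h2 : B.toSuperspace.commutator.comp j (D v) = if j = 0 then D v else 0 :=
      Superspace.comp_of_mem (M.D_mem v) j
    rw [h1, h2]
    split_ifs
    · exact ⟨_, (M.commutator_D v _).symm⟩
    · rw [map_zero]; exact Submodule.zero_mem _
  simp only [map_add, LinearMap.add_apply]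
  rw [hD, add_zero, M.commutator_D, ← M.isLie.ad_mul]
  exact Submodule.add_mem _ (Submodule.add_mem _ ⟨_, rfl⟩ ⟨_, rfl⟩) (hDa a y)

theorem rep_mem (t : R.TildeSpace τ) :
    M.rep t ∈ LinearMap.range B.mul ⊔ LinearMap.range D := by
  suffices H : (LinearMap.range B.mul ⊔ LinearMap.range D).comap M.rep = ⊤ from
    (H ▸ Submodule.mem_top : t ∈ (LinearMap.range B.mul ⊔ LinearMap.range D).comap M.rep)
  have hg : ∀ g, M.rep (R.tildeGen τ g) ∈ LinearMap.range B.mul ⊔ LinearMap.range D := by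
    intro g
    rw [M.rep_gen]
    cases g with
    | cartan x => exact Submodule.mem_sup_right ⟨x, rfl⟩
    | e i => exact Submodule.mem_sup_left ⟨_, rfl⟩
    | f i => exact Submodule.mem_sup_left ⟨_, rfl⟩
  refine R.eq_top_of_gens τ hg fun g y hy => ?_
  rw [Submodule.mem_comap, M.rep_mul]
  exact Submodule.mem_sup_left (M.commutator_mem_range (hg g) hy)

theorem contraRep_derived {x : R.TildeSpace τ ⧸ R.maxIdeal τ}
    (hx : x ∈ (R.contragredient τ).derivedSubmodule) :
    M.contraRep x ∈ LinearMap.range B.mul := by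
  suffices H : (R.contragredient τ).derivedSubmodule ≤ (LinearMap.range B.mul).comap M.contraRep
    from H hx
  refine Submodule.span_le.2 ?_
  rintro _ ⟨x, y, rfl⟩
  obtain ⟨x, rfl⟩ := (R.maxIdeal τ).mkQ_surjective x
  obtain ⟨y, rfl⟩ := (R.maxIdeal τ).mkQ_surjective y
  rw [SetLike.mem_coe, Submodule.mem_comap, M.contraRep_mul]
  exact M.commutator_mem_range (M.rep_mem x) (M.rep_mem y)

include M in
theorem ad_injective : Function.Injective B.mul := by
  rw [← LinearMap.ker_eq_bot, LinearMap.ker_eq_bot']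
  exact M.eq_zero

/-- The homomorphism from `𝔤'(A, τ)` onto the model. -/
def derivedHom : (R.contragredient τ).derivedSubmodule →ₗ[k] L :=
  (LinearEquiv.ofInjective B.mul M.ad_injective).symm.toLinearMap ∘ₗ
    (M.contraRep ∘ₗ (R.contragredient τ).derivedSubmodule.subtype).codRestrict _
      fun x => M.contraRep_derived x.2

theorem ad_derivedHom (x : (R.contragredient τ).derivedSubmodule) :
    B.mul (M.derivedHom x) = M.contraRep x :=
  LinearEquiv.ofInjective_symm_apply (f := B.mul) (h := M.ad_injective)
    ⟨M.contraRep x, M.contraRep_derived x.2⟩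

theorem derivedHom_mul (x y : (R.contragredient τ).derivedSubmodule) :
    M.derivedHom ((R.contragredient τ).derived.mul x y)
      = B.mul (M.derivedHom x) (M.derivedHom y) := by
  refine M.ad_injective ?_
  rw [M.isLie.ad_mul, M.ad_derivedHom, M.ad_derivedHom, M.ad_derivedHom]
  exact M.contraRep_mul x y

theorem derivedHom_odd (x : (R.contragredient τ).derivedSubmodule) :
    M.derivedHom ((R.contragredient τ).derived.odd x) = B.odd (M.derivedHom x) := by
  refine M.ad_injective ?_
  have := B.ad_comp 1 (M.derivedHom x)
  rw [Superspace.comp_one, Superspace.comp_one] at this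
  rw [this, M.ad_derivedHom, M.ad_derivedHom]
  exact M.contraRep_odd x

/-- If `αᵢ(x) = 1`, then `[x, eᵢ] = eᵢ` and `[x, fᵢ] = -fᵢ`, so the generators of `L` come from the
derived algebra. Such `x` exist because the roots, being independent, are nonzero. -/
theorem derivedHom_surjective : Function.Surjective M.derivedHom := by
  rw [← LinearMap.range_eq_top]
  have hmul : ∀ g a, action B D e f g = B.mul a → ∀ y ∈ LinearMap.range M.derivedHom,
      B.mul a y ∈ LinearMap.range M.derivedHom := by
    rintro g a hg _ ⟨x, rfl⟩
    refine ⟨⟨(R.contragredient τ).mul ((R.maxIdeal τ).mkQ (R.tildeGen τ g)) x,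
      mul_mem_derived _ _ _⟩, M.ad_injective ?_⟩
    rw [M.ad_derivedHom, M.contraRep_mul, M.contraRep_mk, M.rep_gen, hg, M.isLie.ad_mul,
      M.ad_derivedHom]
  have hgen : ∀ g i a (c : k), c ≠ 0 → action B D e f g = B.mul a →
      (∃ x, R.root i x = 1 ∧ D x a = c • a) → a ∈ LinearMap.range M.derivedHom := by
    rintro g i a c hc hg ⟨x, -, hx⟩
    refine (Submodule.smul_mem_iff _ hc).1 ⟨⟨(R.contragredient τ).mul
      ((R.maxIdeal τ).mkQ (R.tildeGen τ (.cartan x))) ((R.maxIdeal τ).mkQ (R.tildeGen τ g)),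
      mul_mem_derived _ _ _⟩, M.ad_injective ?_⟩
    rw [M.ad_derivedHom, M.contraRep_mul, M.contraRep_mk, M.contraRep_mk, M.rep_gen, M.rep_gen, hg,
      action, M.commutator_D, hx]
  have hroot : ∀ i, ∃ x, R.root i x = 1 := by
    intro i
    obtain ⟨x, hx⟩ : ∃ x, R.root i x ≠ 0 := by
      by_contra! hcon
      exact R.root_indep.ne_zero i (LinearMap.ext hcon)
    exact ⟨(R.root i x)⁻¹ • x, by rw [map_smul, smul_eq_mul, inv_mul_cancel₀ hx]⟩
  refine M.generate _ (fun i => ?_) (fun i => ?_) (fun i => hmul (.e i) _ rfl)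
    fun i => hmul (.f i) _ rfl
  · obtain ⟨x, hx⟩ := hroot i
    exact hgen (.e i) i (e i) 1 one_ne_zero rfl ⟨x, hx, by rw [M.D_e, hx]⟩
  · obtain ⟨x, hx⟩ := hroot i
    exact hgen (.f i) i (f i) (-1) (neg_ne_zero.2 one_ne_zero) rfl
      ⟨x, hx, by rw [M.D_f, hx, neg_smul]⟩

/-- The kernel of the representation is central modulo the maximal ideal. -/
theorem mul_mem_maxIdeal {t : R.TildeSpace τ} (h0 : M.rep t = 0) (y : R.TildeSpace τ) :
    (R.tilde τ).mul y t ∈ R.maxIdeal τ := by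
  have ht : t ∈ ⨆ m : ℤ, R.tildeDegree τ m := R.iSup_tildeDegree τ ▸ Submodule.mem_top
  obtain ⟨s, hs, rfl⟩ := (Submodule.mem_iSup_iff_exists_finsupp _ _).1 ht
  have hs0 := M.component_mem_ker hs h0
  rw [Finsupp.sum, map_sum]
  refine Submodule.sum_mem _ fun m _ => ?_
  -- The degree-zero component of a kernel element is some `x ∈ 𝔥` with `D(x) = 0`. Hence every
  -- `αᵢ(x)` vanishes and `x` commutes with all generators. The other components lie in
  -- `kerNonzero`, hence in the maximal ideal.
  by_cases hm : m = 0
  · subst hm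
    obtain ⟨x, hx⟩ := R.tildeDegree_le τ 0 (hs 0)
    have hD : D x = 0 := by
      have := hs0 0
      rw [← hx] at this
      exact (M.rep_gen (.cartan x)).symm.trans this
    have hr : ∀ i, R.root i x = 0 := by
      intro i
      have := M.D_e x i
      rw [hD, LinearMap.zero_apply] at this
      exact (smul_eq_zero.1 this.symm).resolve_right (M.e_ne_zero i)
    suffices H : LinearMap.ker ((R.tilde τ).mul.flip (R.tildeCartan τ x)) = ⊤ by
      have hy : y ∈ LinearMap.ker ((R.tilde τ).mul.flip (R.tildeCartan τ x)) :=
        H ▸ Submodule.mem_top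
      rw [← hx]
      have hy' : (R.tilde τ).mul y (R.tildeCartan τ x) = 0 := hy
      rw [hy']
      exact Submodule.zero_mem _
    have hL := R.isLie_tilde τ
    have hgr : R.tildeCartan τ x ∈ (R.tilde τ).gr 0 := R.tildeGen_mem τ (.cartan x)
    have hg : ∀ g, (R.tilde τ).mul (R.tildeGen τ g) (R.tildeCartan τ x) = 0 := by
      intro g
      rw [hL.skew _ _ _ (R.tildeGen_mem τ g) _ hgr]
      cases g with
      | cartan y =>
        have : (R.tilde τ).mul (R.tildeCartan τ x) (R.tildeGen τ (.cartan y)) = 0 :=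
          R.tilde_cartan_cartan τ x y
        rw [this, smul_zero, neg_zero]
      | e i => rw [R.tilde_cartan_e, hr, zero_smul, smul_zero, neg_zero]
      | f i => rw [R.tilde_cartan_f, hr, neg_zero, zero_smul, smul_zero, neg_zero]
    refine R.eq_top_of_gens τ hg fun g z hz => ?_
    have hz' : (R.tilde τ).mul z (R.tildeCartan τ x) = 0 := hz
    have key : (R.tilde τ).mul ((R.tilde τ).mul (R.tildeGen τ g) z) (R.tildeCartan τ x) = 0 := by
      rw [← (R.tilde τ).sum_comp z]
      simp only [map_sum, LinearMap.sum_apply]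
      refine Finset.sum_eq_zero fun j _ => ?_
      -- The Jacobi identity is available for homogeneous arguments only. As `x` is even, the
      -- homogeneous components of an element annihilating it also annihilate it.
      have hj : (R.tilde τ).mul ((R.tilde τ).comp j z) (R.tildeCartan τ x) = 0 := by
        have h1 := (R.tilde τ).comp_mul j z (R.tildeCartan τ x)
        have h2 : ∀ l, (R.tilde τ).comp l (R.tildeCartan τ x)
            = if l = 0 then R.tildeCartan τ x else 0 := fun l => Superspace.comp_of_mem hgr l
        rw [hz', map_zero, Finset.sum_eq_single j, Finset.sum_eq_single 0] at h1
        · rw [h2, if_pos rfl, if_pos (add_zero j).symm] at h1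
          exact h1.symm
        · intro l _ hl
          rw [h2, if_neg hl, map_zero, ite_self]
        · simp
        · intro i _ hi
          refine Finset.sum_eq_zero fun l _ => ?_
          rw [h2]
          by_cases hl : l = 0
          · subst hl
            rw [add_zero, if_neg hi.symm]
          · rw [if_neg hl, map_zero, ite_self]
        · simp
      have := hL.jacobi _ _ _ (R.tildeGen_mem τ g) _ ((R.tilde τ).comp_mem j z)
        (R.tildeCartan τ x)
      rw [hj, hg, map_zero, map_zero, smul_zero, add_zero] at this
      exact this.symm
    exact key
  · have : s m ∈ R.maxIdeal τ :=
      le_sSup (a := M.kerNonzero) (s := {I | R.IsHomogeneousAvoiding τ I})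
        M.isHomogeneousAvoiding_kerNonzero (M.mem_kerNonzero hm (hs0 m) (hs m))
    exact ((R.tilde τ).isIdeal_sSup _ fun _ hI => hI.isIdeal).mul_mem_left y _ this

/-- Kernel elements are central by `mul_mem_maxIdeal`; conversely the surjective image of a central
element is central in `L`, which has zero centre. -/
theorem ker_derivedHom : LinearMap.ker M.derivedHom = (R.contragredient τ).derived.center := by
  ext x
  rw [mem_center, LinearMap.mem_ker]
  constructor
  · intro hx y
    have h0 : M.contraRep x = 0 := by rw [← M.ad_derivedHom, hx, map_zero]
    obtain ⟨x, hx'⟩ := x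
    obtain ⟨t, rfl⟩ := (R.maxIdeal τ).mkQ_surjective x
    have hleft : ∀ s, (R.contragredient τ).mul ((R.maxIdeal τ).mkQ s) ((R.maxIdeal τ).mkQ t) = 0 :=
      fun s => (Submodule.Quotient.mk_eq_zero _).2 (M.mul_mem_maxIdeal h0 s)
    have hright : ∀ s,
        (R.contragredient τ).mul ((R.maxIdeal τ).mkQ t) ((R.maxIdeal τ).mkQ s) = 0 := by
      intro s
      have hker : ∀ i, M.rep ((R.tilde τ).comp i t) = 0 := by
        have ht : t ∈ LinearMap.ker M.rep := h0
        refine fun i => comp_mem_of_odd (A := R.tilde τ) (I := LinearMap.ker M.rep) (fun x hx => ?_)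
          i ht
        rw [LinearMap.mem_ker] at *
        rw [M.rep_odd, hx, map_zero]
      refine (Submodule.Quotient.mk_eq_zero _).2 ?_
      change (R.tilde τ).mul t s ∈ R.maxIdeal τ
      rw [(R.isLie_tilde τ).mul_comm]
      exact Submodule.neg_mem _ (Submodule.sum_mem _ fun i _ => Submodule.sum_mem _ fun j _ =>
        Submodule.smul_mem _ _ (M.mul_mem_maxIdeal (hker i) _))
    obtain ⟨y, hy⟩ := y
    obtain ⟨s, rfl⟩ := (R.maxIdeal τ).mkQ_surjective y
    exact ⟨Subtype.ext (hright s), Subtype.ext (hleft s)⟩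
  · intro hx
    refine M.eq_zero _ (LinearMap.ext fun z => ?_)
    obtain ⟨y, rfl⟩ := M.derivedHom_surjective z
    rw [← M.derivedHom_mul, (hx y).1, map_zero, LinearMap.zero_apply]

include M in
/-- A model is isomorphic to the centerless derived contragredient Lie superalgebra. -/
theorem nonempty_iso : Nonempty (B.Iso (R.centerlessDerived τ)) :=
  nonempty_iso_quot _ M.derivedHom_surjective M.ker_derivedHom M.derivedHom_odd M.derivedHom_mul

end IsModel

end Realization

end Super

/-! ### Weights, Cartan derivations and heights: the model for the given Cartan matrix. -/

namespace Super

/-- The coordinates of the roots with respect to the simple roots. -/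
def weightTable : List (List ℤ) :=
  [[1, 1, 1, 0], [-1, -1, -1, 0], [0, 1, 1, 0], [0, -1, -1, 0], [0, 0, 1, 0], [0, 0, -1, 0], [0,
   0, 0, 0], [1, 2, 2, 0], [1, 0, 0, 0], [1, 1, 2, 0], [1, 1, 0, 0], [-1, 0, 0, 0], [-1, -2, -2,
   0], [-1, -1, 0, 0], [-1, -1, -2, 0], [0, 0, 0, 0], [0, 1, 2, 0], [0, 1, 0, 0], [0, -1, 0, 0],
   [0, -1, -2, 0], [0, 0, 0, 0], [0, 0, 0, 1], [1, 1, 1, 1], [0, 1, 1, 1], [1, 2, 2, 1], [0, 0,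
   1, 1], [1, 1, 2, 1], [0, 1, 2, 1], [1, 2, 3, 1], [-1, -2, -3, -1], [0, -1, -2, -1], [-1, -1,
   -2, -1], [0, 0, -1, -1], [-1, -2, -2, -1], [0, -1, -1, -1], [-1, -1, -1, -1], [0, 0, 0, -1]]

/-- A coordinate of a root with respect to the simple roots. -/
def rootWeight (p j : ℕ) : ℤ := (weightTable.getD p []).getD j 0

/-- The Cartan matrix, with integer entries. -/
def cartanInt (i j : ℕ) : ℤ :=
  ([[2, -1, 0, 0], [-1, 2, -1, 0], [0, -2, 2, -1], [0, 0, 1, 0]].getD i []).getD j 0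

/-- The weights are integers, not residues modulo 3, so the same table yields both a `ℤ`-grading by
height and the derivations attached to `𝔥`. The last coordinate is `1` on one half of the odd part,
`-1` on the other, and `0` on the even part. -/
theorem rootWeight_add : allBelow 37 (fun p => allBelow 37 fun q =>
    (structureConst p q).all fun t => allBelow 4 fun j =>
      decide (rootWeight t.1 j = rootWeight p j + rootWeight q j)) = true := by decide +kernel

theorem rootWeight_simple : allBelow 4 (fun i => allBelow 4 fun j =>
    decide (rootWeight (simpleRoots.getD i 0) j = if j = i then 1 else 0) &&
    decide (rootWeight (negSimpleRoots.getD i 0) j = if j = i then -1 else 0)) = true := by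
  decide +kernel

theorem structureConst_simple_ne : allBelow 4 (fun i => allBelow 4 fun j => decide (i = j) ||
    Comb.isZero (structureConst (simpleRoots.getD i 0) (negSimpleRoots.getD j 0))) = true := by
  decide +kernel

/-- The elements `fᵢ` of the model are twice, that is minus, the tabulated opposite root vectors.
With this normalization `[eᵢ, fᵢ]` acts on a vector of weight `∑ cⱼ αⱼ` by `∑ cⱼ aᵢⱼ`, as `hᵢ` must.
-/
theorem structureConst_simple_same : allBelow 4 (fun i => allBelow 37 fun r => Comb.eqv
    (Comb.scale 2 (Comb.bind (structureConst (simpleRoots.getD i 0) (negSimpleRoots.getD i 0))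
      fun s => structureConst s r))
    [(r, ((rootWeight r 0 * cartanInt i 0 + rootWeight r 1 * cartanInt i 1 +
      rootWeight r 2 * cartanInt i 2 + rootWeight r 3 * cartanInt i 3) % 3).toNat)]) = true := by
  decide +kernel

theorem cast_toNat_mod_three {k : Type*} [Field k] [CharP k 3] (z : ℤ) :
    ((z % 3).toNat : k) = (z : k) := by
  have h1 : (((z % 3).toNat : ℤ) : k) = (z : k) := by
    rw [Int.toNat_of_nonneg (Int.emod_nonneg z (by norm_num)), CharP.intCast_eq_intCast k 3]
    exact Int.mod_modEq z 3
  rw [← h1, Int.cast_natCast]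

/-- The centre is a graded ideal, and it is not everything because the product is nonzero. -/
theorem Superalgebra.IsLie.eq_zero_of_isSimple {k L : Type*} [Field k] [AddCommGroup L]
    [Module k L] {A : Superalgebra k L} (hA : A.IsLie) (hs : A.IsSimple) {x : L}
    (hx : A.mul x = 0) : x = 0 := by
  have hc : x ∈ A.center := by
    rw [Superalgebra.mem_center]
    have hcomp : ∀ i, A.mul (A.comp i x) = 0 := fun i => by
      rw [A.ad_comp, hx, map_zero]
    refine fun y => ⟨by rw [hx, LinearMap.zero_apply], ?_⟩
    rw [hA.mul_comm, neg_eq_zero]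
    refine Finset.sum_eq_zero fun i _ => Finset.sum_eq_zero fun j _ => ?_
    rw [hcomp, LinearMap.zero_apply, smul_zero]
  rcases hs.2 _ A.isIdeal_center with h | h
  · rw [h] at hc
    exact hc
  · exfalso
    obtain ⟨y, z, hyz⟩ := hs.1
    have : y ∈ A.center := h ▸ Submodule.mem_top
    exact hyz (Superalgebra.mem_center.1 this z).1

namespace IsRootBasis

variable {k L : Type*} [Field k] [AddCommGroup L] [Module k L] {A : Superalgebra k L} {B : ℕ → L}

/-- The diagonal endomorphism with given eigenvalues. -/
def diag (hB : IsRootBasis A B) (c : ℕ → k) : L →ₗ[k] L :=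
  hB.basis.constr k fun p => c p • B p

theorem diag_apply (hB : IsRootBasis A B) (c : ℕ → k) {p : ℕ} (hp : p < 37) :
    hB.diag c (B p) = c p • B p := by
  have := hB.basis_apply ⟨p, hp⟩
  simp only at this
  conv_lhs => rw [← this]
  exact Module.Basis.constr_basis _ _ _ _

theorem hom_ext₂ (hB : IsRootBasis A B) {M : Type*} [AddCommGroup M] [Module k M]
    {f g : L →ₗ[k] L →ₗ[k] M} (hfg : ∀ p < 37, ∀ q < 37, f (B p) (B q) = g (B p) (B q)) :
    f = g :=
  hB.hom_ext fun p hp => hB.hom_ext fun q hq => hfg p hp q hq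

/-- All basis vectors occurring in a product have the sum of the two weights, so a diagonal map
whose eigenvalue is constant on that weight acts on the product by a scalar. The height projections
and the derivations of `𝔥` are both instances. -/
theorem diag_mul (hB : IsRootBasis A B) {c : ℕ → k} {a : k} {p q : ℕ} (hp : p < 37)
    (hq : q < 37) (h : ∀ r, (∀ j < 4, rootWeight r j = rootWeight p j + rootWeight q j) → c r = a) :
    hB.diag c (A.mul (B p) (B q)) = a • A.mul (B p) (B q) := by
  have hd : ∀ f : L →ₗ[k] L, ∀ ℓ : Comb ℕ, (∀ t ∈ ℓ, f (B t.1) = a • B t.1) →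
      f (Comb.eval k B ℓ) = a • Comb.eval k B ℓ := by
    intro f ℓ hℓ
    induction ℓ with
    | nil => simp
    | cons t ℓ ih =>
      rw [Comb.eval_cons, map_add, map_smul, hℓ t (by simp), ih fun s hs => hℓ s (by simp [hs]),
        smul_add, smul_comm]
  rw [hB.mul p hp q hq]
  refine hd _ _ fun t ht => ?_
  rw [hB.diag_apply _ (lt_of_mem hp hq ht), h]
  intro j hj
  exact of_decide_eq_true (of_allBelow
    (List.all_eq_true.1 (of_allBelow (of_allBelow rootWeight_add hp) hq) t ht) hj)

/-- The height of a root. -/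
def height (p : ℕ) : ℤ := rootWeight p 0 + rootWeight p 1 + rootWeight p 2 + rootWeight p 3

/-- The projections onto the components of the grading by heights. -/
def heightProj (hB : IsRootBasis A B) (m : ℤ) : L →ₗ[k] L :=
  hB.diag fun p => if height p = m then 1 else 0

theorem heightProj_apply (hB : IsRootBasis A B) (m : ℤ) {p : ℕ} (hp : p < 37) :
    hB.heightProj m (B p) = if height p = m then B p else 0 := by
  rw [heightProj, hB.diag_apply _ hp]
  split_ifs <;> simp

theorem heightProj_mul (hB : IsRootBasis A B) (m : ℤ) {p : ℕ} (hp : p < 37) (y : L) :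
    hB.heightProj (m + height p) (A.mul (B p) y) = A.mul (B p) (hB.heightProj m y) := by
  rw [← LinearMap.comp_apply, ← LinearMap.comp_apply]
  congr 1
  refine hB.hom_ext fun q hq => ?_
  rw [LinearMap.comp_apply, LinearMap.comp_apply, hB.heightProj_apply m hq, heightProj,
    hB.diag_mul (a := if height q = m then 1 else 0) hp hq]
  · split_ifs <;> simp
  · intro r hr
    have : height r = height p + height q := by
      simp only [height, hr 0 (by norm_num), hr 1 (by norm_num), hr 2 (by norm_num),
        hr 3 (by norm_num)]
      ring
    refine if_congr ?_ rfl rfl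
    omega

variable {h : Type*} [AddCommGroup h] [Module k h]

/-- The value of a root at an element of `𝔥`. -/
def rootValue (R : Realization (cartanS12S12 k) h) (p : ℕ) (x : h) : k :=
  ∑ j : Fin 4, (rootWeight p j : k) * R.root j x

theorem rootValue_add (R : Realization (cartanS12S12 k) h) (p : ℕ) (x y : h) :
    rootValue R p (x + y) = rootValue R p x + rootValue R p y := by
  simp only [rootValue, map_add, mul_add, Finset.sum_add_distrib]

theorem rootValue_smul (R : Realization (cartanS12S12 k) h) (p : ℕ) (c : k) (x : h) :
    rootValue R p (c • x) = c * rootValue R p x := by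
  simp only [rootValue, map_smul, smul_eq_mul, Finset.mul_sum, mul_left_comm]

theorem diag_add (hB : IsRootBasis A B) (c d : ℕ → k) :
    hB.diag (fun p => c p + d p) = hB.diag c + hB.diag d :=
  hB.hom_ext fun p hp => by
    rw [LinearMap.add_apply, hB.diag_apply _ hp, hB.diag_apply _ hp, hB.diag_apply _ hp, add_smul]

theorem diag_smul (hB : IsRootBasis A B) (a : k) (c : ℕ → k) :
    hB.diag (fun p => a * c p) = a • hB.diag c :=
  hB.hom_ext fun p hp => by
    rw [LinearMap.smul_apply, hB.diag_apply _ hp, hB.diag_apply _ hp, mul_smul]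

/-- The derivation given by an element of `𝔥`. -/
def cartanEnd (hB : IsRootBasis A B) (R : Realization (cartanS12S12 k) h) (x : h) : L →ₗ[k] L :=
  hB.diag fun p => rootValue R p x

theorem cartanEnd_add (hB : IsRootBasis A B) (R : Realization (cartanS12S12 k) h) (x y : h) :
    hB.cartanEnd R (x + y) = hB.cartanEnd R x + hB.cartanEnd R y :=
  (congrArg hB.diag (funext fun p => rootValue_add R p x y)).trans (hB.diag_add _ _)

theorem cartanEnd_smul (hB : IsRootBasis A B) (R : Realization (cartanS12S12 k) h) (c : k) (x : h) :
    hB.cartanEnd R (c • x) = c • hB.cartanEnd R x :=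
  (congrArg hB.diag (funext fun p => rootValue_smul R p c x)).trans (hB.diag_smul _ _)

theorem cartanEnd_apply (hB : IsRootBasis A B) (R : Realization (cartanS12S12 k) h) (x : h) {p : ℕ}
    (hp : p < 37) : hB.cartanEnd R x (B p) = rootValue R p x • B p :=
  hB.diag_apply _ hp

/-- The derivations given by the elements of `𝔥`. -/
def cartanDer (hB : IsRootBasis A B) (R : Realization (cartanS12S12 k) h) :
    h →ₗ[k] Module.End k L :=
  { toFun := hB.cartanEnd R
    map_add' := hB.cartanEnd_add R
    map_smul' := hB.cartanEnd_smul R }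

theorem cartanDer_apply (hB : IsRootBasis A B) (R : Realization (cartanS12S12 k) h) (x : h) {p : ℕ}
    (hp : p < 37) : hB.cartanDer R x (B p) = rootValue R p x • B p :=
  hB.cartanEnd_apply R x hp

theorem cartanEnd_mul_basis (hB : IsRootBasis A B) (R : Realization (cartanS12S12 k) h) (x : h)
    {p q : ℕ} (hp : p < 37) (hq : q < 37) : hB.cartanEnd R x (A.mul (B p) (B q))
      = (rootValue R p x + rootValue R q x) • A.mul (B p) (B q) := by
  rw [cartanEnd]
  refine hB.diag_mul (c := fun p => rootValue R p x) hp hq fun r hr => ?_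
  simp only [rootValue]
  rw [← Finset.sum_add_distrib]
  refine Finset.sum_congr rfl fun j _ => ?_
  rw [hr j j.2]
  push_cast
  ring

theorem cartanEnd_mul (hB : IsRootBasis A B) (R : Realization (cartanS12S12 k) h) (x : h)
    (y z : L) : hB.cartanEnd R x (A.mul y z)
      = A.mul (hB.cartanEnd R x y) z + A.mul y (hB.cartanEnd R x z) := by
  have e : A.mul.compr₂ (hB.cartanEnd R x)
      = A.mul.compl₁₂ (hB.cartanEnd R x) LinearMap.id
        + A.mul.compl₁₂ LinearMap.id (hB.cartanEnd R x) := by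
    refine hB.hom_ext₂ fun p hp q hq => ?_
    rw [LinearMap.compr₂_apply, LinearMap.add_apply, LinearMap.add_apply, LinearMap.compl₁₂_apply,
      LinearMap.compl₁₂_apply, LinearMap.id_apply, LinearMap.id_apply,
      hB.cartanEnd_mul_basis R x hp hq, hB.cartanEnd_apply R x hp, hB.cartanEnd_apply R x hq,
      map_smul, map_smul, LinearMap.smul_apply, add_smul]
  exact LinearMap.congr_fun₂ e y z

variable [CharP k 3]

theorem simple_lt (i : Fin 4) :
    simpleRoots.getD i 0 < 37 ∧ negSimpleRoots.getD i 0 < 37 ∧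
      (21 ≤ simpleRoots.getD i 0 ↔ i = 3) ∧ (21 ≤ negSimpleRoots.getD i 0 ↔ i = 3) := by
  revert i
  decide

/-- The derivation `D(x)` involves `x` only through the values `αⱼ(x)`, extended additively to all
weights, so one construction serves every realization. The index `3` is the odd simple root. -/
theorem isModel (hB : IsRootBasis A B) (R : Realization (cartanS12S12 k) h) :
    R.IsModel {3} A (hB.cartanDer R) (fun i : Fin 4 => B (simpleRoots.getD i 0))
      (fun i : Fin 4 => (2 : k) • B (negSimpleRoots.getD i 0)) hB.heightProj where
  isLie := hB.isLie
  isSimple := hB.isSimple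
  eq_zero _ hx := hB.isLie.eq_zero_of_isSimple hB.isSimple hx
  e_mem i := by
    obtain ⟨h1, -, h2, -⟩ := simple_lt i
    have := hB.mem_gr h1
    rwa [rootParity, if_congr (h2.trans Finset.mem_singleton.symm) rfl rfl] at this
  f_mem i := by
    obtain ⟨-, h1, -, h2⟩ := simple_lt i
    have := hB.mem_gr h1
    rw [rootParity, if_congr (h2.trans Finset.mem_singleton.symm) rfl rfl] at this
    exact Submodule.smul_mem _ _ this
  D_mem x := by
    rw [Superspace.mem_endo_gr]
    intro j y hy
    have e : A.comp j ∘ₗ hB.cartanDer R x = hB.cartanDer R x ∘ₗ A.comp j :=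
      hB.hom_ext fun p hp => by
        rw [LinearMap.comp_apply, LinearMap.comp_apply, hB.cartanDer_apply R x hp, map_smul,
          Superspace.comp_of_mem (hB.mem_gr hp)]
        split_ifs
        · rw [hB.cartanDer_apply R x hp]
        · simp
    rw [add_zero, Superspace.mem_gr]
    have := LinearMap.congr_fun e y
    rwa [LinearMap.comp_apply, LinearMap.comp_apply, Superspace.mem_gr.1 hy] at this
  D_mul := hB.cartanEnd_mul R
  D_comm x y z := by
    rw [← LinearMap.comp_apply, ← LinearMap.comp_apply]
    congr 1
    refine hB.hom_ext fun p hp => ?_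
    simp only [LinearMap.comp_apply, hB.cartanDer_apply R _ hp, map_smul]
    rw [smul_comm]
  D_e x i := by
    rw [hB.cartanDer_apply R x (simple_lt i).1]
    congr 1
    rw [rootValue, Finset.sum_eq_single i]
    · have := of_allBelow (of_allBelow rootWeight_simple i.2) i.2
      rw [Bool.and_eq_true] at this
      rw [of_decide_eq_true this.1]
      simp
    · intro j _ hj
      have := of_allBelow (of_allBelow rootWeight_simple i.2) j.2
      rw [Bool.and_eq_true] at this
      rw [of_decide_eq_true this.1, if_neg (fun h => hj (Fin.ext h))]
      simp
    · simp
  D_f x i := by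
    rw [map_smul, hB.cartanDer_apply R x (simple_lt i).2.1, smul_comm, ← neg_smul]
    congr 1
    rw [rootValue, Finset.sum_eq_single i]
    · have := of_allBelow (of_allBelow rootWeight_simple i.2) i.2
      rw [Bool.and_eq_true] at this
      rw [of_decide_eq_true this.2]
      simp
    · intro j _ hj
      have := of_allBelow (of_allBelow rootWeight_simple i.2) j.2
      rw [Bool.and_eq_true] at this
      rw [of_decide_eq_true this.2, if_neg (fun h => hj (Fin.ext h))]
      simp
    · simp
  ef_same i := by
    obtain ⟨h1, h2, -⟩ := simple_lt i
    refine hB.hom_ext fun r hr => ?_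
    have key := Comb.eval_eq_of_eqv (k := k) B
      (of_allBelow (of_allBelow structureConst_simple_same i.2) hr)
    rw [hB.cartanDer_apply R _ hr, map_smul, map_smul, LinearMap.smul_apply, hB.mul _ h1 _ h2,
      hB.eval_mul hr fun t ht => lt_of_mem h1 h2 ht]
    rw [Comb.eval_scale, Nat.cast_ofNat] at key
    rw [key, Comb.eval_cons, Comb.eval_nil, add_zero, cast_toNat_mod_three]
    congr 1
    have hc : ∀ i j : Fin 4, cartanS12S12 k i j = (cartanInt i j : k) := by
      intro i j
      fin_cases i <;> fin_cases j <;> simp [cartanS12S12, cartanInt]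
    simp only [rootValue, Fin.sum_univ_four, R.root_coroot, hc]
    push_cast
    rfl
  ef_ne i j hij := by
    obtain ⟨h1, -⟩ := simple_lt i
    obtain ⟨-, h2, -⟩ := simple_lt j
    have := of_allBelow (of_allBelow structureConst_simple_ne i.2) j.2
    rw [Bool.or_eq_true] at this
    rw [map_smul, hB.mul _ h1 _ h2, Comb.eval_eq_zero B (this.resolve_left fun h =>
      hij (Fin.ext (of_decide_eq_true h))), smul_zero]
  generate N he hf he' hf' := by
    have h2 : (2 : k) ≠ 0 := by rw [Comb.two_eq_neg_one]; exact neg_ne_zero.2 one_ne_zero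
    have hg : ∀ g ∈ simpleRoots ++ negSimpleRoots,
        B g ∈ N ∧ ∀ y ∈ N, A.mul (B g) y ∈ N := by
      intro g hg
      have h3 : ∀ g ∈ simpleRoots ++ negSimpleRoots, (∃ i : Fin 4, g = simpleRoots.getD i 0) ∨
          ∃ i : Fin 4, g = negSimpleRoots.getD i 0 := by decide
      rcases h3 g hg with ⟨i, rfl⟩ | ⟨i, rfl⟩
      · exact ⟨he i, he' i⟩
      · refine ⟨(Submodule.smul_mem_iff _ h2).1 (hf i), fun y hy => ?_⟩
        have := hf' i y hy
        rw [map_smul, LinearMap.smul_apply] at this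
        exact (Submodule.smul_mem_iff _ h2).1 this
    exact hB.eq_top_of_gens (fun g hg' => (hg g hg').1) fun g hg' => (hg g hg').2
  e_indep := by
    have := hB.linearIndependent.comp
      (fun i : Fin 4 => (⟨simpleRoots.getD i 0, (simple_lt i).1⟩ : Fin 37)) (by decide)
    exact this
  f_indep := by
    have h2 : (2 : k) ≠ 0 := by rw [Comb.two_eq_neg_one]; exact neg_ne_zero.2 one_ne_zero
    have := hB.linearIndependent.comp
      (fun i : Fin 4 => (⟨negSimpleRoots.getD i 0, (simple_lt i).2.1⟩ : Fin 37)) (by decide)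
    exact this.units_smul fun _ => Units.mk0 2 h2
  pr_D m x y := by
    rw [← LinearMap.comp_apply, ← LinearMap.comp_apply]
    congr 1
    refine hB.hom_ext fun p hp => ?_
    rw [LinearMap.comp_apply, LinearMap.comp_apply, hB.cartanDer_apply R x hp, map_smul,
      hB.heightProj_apply m hp]
    split_ifs
    · rw [hB.cartanDer_apply R x hp]
    · simp
  pr_e m i y := by
    have h1 : height (simpleRoots.getD i 0) = 1 := by revert i; decide
    rw [← h1, hB.heightProj_mul m (simple_lt i).1]
  pr_f m i y := by
    have h1 : height (negSimpleRoots.getD i 0) = -1 := by revert i; decide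
    rw [← h1, map_smul, LinearMap.smul_apply, LinearMap.smul_apply, map_smul,
      hB.heightProj_mul m (simple_lt i).2.1]
  pr_pr m m' y := by
    have e : hB.heightProj m ∘ₗ hB.heightProj m' = if m = m' then hB.heightProj m' else 0 := by
      refine hB.hom_ext fun p hp => ?_
      rw [LinearMap.comp_apply, hB.heightProj_apply m' hp]
      by_cases h2 : m = m'
      · subst h2
        by_cases h1 : height p = m <;> simp [h1, hB.heightProj_apply _ hp]
      · by_cases h1 : height p = m'
        · rw [if_pos h1, if_neg h2, hB.heightProj_apply _ hp, if_neg (by omega),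
            LinearMap.zero_apply]
        · rw [if_neg h1, if_neg h2, map_zero, LinearMap.zero_apply]
    have := LinearMap.congr_fun e y
    rw [LinearMap.comp_apply] at this
    rw [this]
    split_ifs <;> rfl
  pr_ext y hy := by
    refine hB.ext_coord fun p hp => ?_
    have e : hB.coord p ∘ₗ hB.heightProj (height p) = hB.coord p := by
      refine hB.hom_ext fun q hq => ?_
      rw [LinearMap.comp_apply, hB.heightProj_apply _ hq]
      split_ifs with h1
      · rfl
      · rw [map_zero, hB.coord_apply hp hq, if_neg]
        rintro rfl
        exact h1 rfl
    rw [← e, LinearMap.comp_apply, hy, map_zero]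
  two_ne_zero := by rw [Comb.two_eq_neg_one]; exact neg_ne_zero.2 one_ne_zero
  exists_ne_zero := by
    have h2 : (2 : k) ≠ 0 := by rw [Comb.two_eq_neg_one]; exact neg_ne_zero.2 one_ne_zero
    -- The first coroot acts on its own root vector `B 8` by the diagonal entry `2` of the Cartan
    -- matrix.
    refine ⟨0, fun h0 => ?_⟩
    have h1 := hB.cartanDer_apply R (R.coroot 0) (p := 8) (by norm_num)
    have h3 : rootValue R 8 (R.coroot 0) = 2 := by
      simp [rootValue, Fin.sum_univ_four, R.root_coroot, cartanS12S12, rootWeight, weightTable]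
    rw [h0, h3] at h1
    exact smul_ne_zero h2 (hB.linearIndependent.ne_zero (8 : Fin 37)) h1.symm

end IsRootBasis

/-! ## A realization of the Cartan matrix -/

/-- The matrix is singular in characteristic 3: its kernel is the line spanned by `(1, 2, 0, -1)`.
This is why realizations have dimension 5. -/
theorem rank_cartanS12S12 (k : Type*) [Field k] [CharP k 3] : (cartanS12S12 k).rank = 3 := by
  have h3 : (3 : k) = 0 := by exact_mod_cast CharP.cast_eq_zero k 3
  have hker : Module.finrank k (LinearMap.ker (cartanS12S12 k).mulVecLin) = 1 := by
    have hv : ![1, 2, 0, -1] ∈ LinearMap.ker (cartanS12S12 k).mulVecLin := by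
      rw [LinearMap.mem_ker, Matrix.mulVecLin_apply]
      ext i
      fin_cases i
      · simp [cartanS12S12, Matrix.mulVec, dotProduct, Fin.sum_univ_four]
      · simp [cartanS12S12, Matrix.mulVec, dotProduct, Fin.sum_univ_four]
        linear_combination h3
      · simp [cartanS12S12, Matrix.mulVec, dotProduct, Fin.sum_univ_four]
        linear_combination -h3
      · simp [cartanS12S12, Matrix.mulVec, dotProduct, Fin.sum_univ_four]
    refine finrank_eq_one ⟨_, hv⟩ (fun h => ?_) fun w => ⟨w.1 0, ?_⟩
    · simpa using congrFun (congrArg Subtype.val h) 0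
    · obtain ⟨w, hw⟩ := w
      rw [LinearMap.mem_ker, Matrix.mulVecLin_apply] at hw
      have e0 := congrFun hw 0
      have e2 := congrFun hw 2
      have e3 := congrFun hw 3
      simp [cartanS12S12, Matrix.mulVec, dotProduct, Fin.sum_univ_four] at e0 e2 e3
      refine Subtype.ext (funext fun i => ?_)
      fin_cases i
      · simp
      · simp
        linear_combination e0
      · simp [e3]
      · simp
        linear_combination e2 - 2 * e0 - 2 * e3 + w 0 * h3
  have := LinearMap.finrank_range_add_finrank_ker (cartanS12S12 k).mulVecLin
  rw [hker, Module.finrank_fin_fun] at this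
  rw [Matrix.rank]
  omega

theorem exists_realization (k : Type*) [Field k] [CharP k 3] :
    Nonempty (Realization (cartanS12S12 k) (Fin 5 → k)) := by
  have h3 : (3 : k) = 0 := by exact_mod_cast CharP.cast_eq_zero k 3
  refine ⟨{
    root := fun j => LinearMap.proj j.castSucc
    -- The roots are the first four coordinates, so a coroot starts with a row of the matrix. The
    -- rows satisfy one relation up to scalars, with nonzero coefficient at the first row; a fifth
    -- coordinate on that row destroys it.
    coroot := fun i => Fin.snoc (cartanS12S12 k i) (if i = 0 then 1 else 0)
    root_indep := ?_
    coroot_indep := ?_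
    root_coroot := fun i j => ?_
    finite := inferInstance
    finrank_add_rank := ?_ }⟩
  · rw [Fintype.linearIndependent_iff]
    intro c hc i
    have := LinearMap.congr_fun hc (Pi.single i.castSucc 1)
    simpa [Pi.single_apply, Finset.sum_ite_eq] using this
  · rw [Fintype.linearIndependent_iff]
    intro c hc
    have key : ∀ j : Fin 4, ∑ i, c i * cartanS12S12 k i j = 0 := fun j => by
      have := congrFun hc j.castSucc
      simpa only [Finset.sum_apply, Pi.smul_apply, Fin.snoc_castSucc, smul_eq_mul,
        Pi.zero_apply] using this
    have e4 : ∑ i, c i * (if i = 0 then 1 else 0) = 0 := by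
      have := congrFun hc (Fin.last 4)
      simpa only [Finset.sum_apply, Pi.smul_apply, Fin.snoc_last, smul_eq_mul,
        Pi.zero_apply] using this
    have e0 := key 0
    have e2 := key 2
    have e3 := key 3
    simp [Fin.sum_univ_four, cartanS12S12] at e0 e2 e3 e4
    have e1 : c 1 = 0 := by linear_combination 2 * e4 - e0
    intro i
    fin_cases i
    · exact e4
    · exact e1
    · exact e3
    · show c 3 = 0
      linear_combination e2 + e1 - 2 * e3
  · simp
  · rw [rank_cartanS12S12, Module.finrank_fin_fun]

end Super

namespace Super

/-! ## Linear maps given by tables -/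

section unitVec

variable {k : Type*} [Field k]

/-- The standard basis of `kⁿ`, numbered by natural numbers. -/
def unitVec (k : Type*) [Field k] (n : ℕ) (i : ℕ) : Fin n → k := fun c => if (c : ℕ) = i then 1 else 0

theorem unitVec_val {n : ℕ} (i : Fin n) : unitVec k n i = Pi.single i 1 := by
  ext c
  simp [unitVec, Pi.single_apply, Fin.ext_iff]

theorem unitVec_hom_ext {n : ℕ} {M : Type*} [AddCommGroup M] [Module k M]
    {f g : (Fin n → k) →ₗ[k] M} (h : ∀ i < n, f (unitVec k n i) = g (unitVec k n i)) : f = g :=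
  (Pi.basisFun k (Fin n)).ext fun i => by
    rw [Pi.basisFun_apply, ← unitVec_val]
    exact h i i.2

theorem unitVec_hom_ext₂ {n m : ℕ} {M : Type*} [AddCommGroup M] [Module k M]
    {f g : (Fin n → k) →ₗ[k] (Fin m → k) →ₗ[k] M}
    (h : ∀ i < n, ∀ j < m, f (unitVec k n i) (unitVec k m j) = g (unitVec k n i) (unitVec k m j)) :
    f = g :=
  unitVec_hom_ext fun i hi => unitVec_hom_ext fun j hj => h i hi j hj

/-- The linear map with given values on the standard basis. -/
def ofValues (n : ℕ) {M : Type*} [AddCommGroup M] [Module k M] (v : ℕ → M) : (Fin n → k) →ₗ[k] M :=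
  (Pi.basisFun k (Fin n)).constr k fun i => v i

theorem ofValues_unitVec {n : ℕ} {M : Type*} [AddCommGroup M] [Module k M] (v : ℕ → M) {i : ℕ}
    (hi : i < n) : ofValues n v (unitVec k n i) = v i := by
  have := unitVec_val (k := k) (⟨i, hi⟩ : Fin n)
  simp only at this
  rw [this, ← Pi.basisFun_apply, ofValues, Module.Basis.constr_basis]

theorem ofValues_eval {n : ℕ} {M : Type*} [AddCommGroup M] [Module k M] (v : ℕ → M) {ℓ : Comb ℕ}
    (hℓ : ∀ t ∈ ℓ, t.1 < n) : ofValues n v (Comb.eval k (unitVec k n) ℓ) = Comb.eval k v ℓ := by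
  rw [Comb.map_eval]
  exact Comb.eval_congr fun t ht => ofValues_unitVec v (hℓ t ht)

theorem proj_unitVec {n : ℕ} (i : Fin n) (j : ℕ) :
    (LinearMap.proj i : (Fin n → k) →ₗ[k] k) (unitVec k n j) = if (i : ℕ) = j then 1 else 0 := rfl

end unitVec

/-! ## The orthogonal Lie algebra -/

/-- The index of the dual basis vector. -/
def dualIndex (i : ℕ) : ℕ := [0, 2, 1, 4, 3, 6, 5].getD i 0

/-- The values of the polar form of `splitForm7` on the standard basis. -/
def gram (i j : ℕ) : ℕ := bif Nat.beq j (dualIndex i) then bif Nat.beq i 0 then 2 else 1 else 0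

/-- The pairs of elements of the standard basis. -/
def pairTable : List (ℕ × ℕ) :=
  [(0, 1), (0, 2), (0, 3), (0, 4), (0, 5), (0, 6), (1, 2), (1, 3), (1, 4), (1, 5), (1, 6), (2, 3),
   (2, 4), (2, 5), (2, 6), (3, 4), (3, 5), (3, 6), (4, 5), (4, 6), (5, 6)]

/-- The pair with a given number. -/
def pairAt (p : ℕ) : ℕ × ℕ := pairTable.getD p (0, 0)

/-- A multiple of a basis element. -/
def Comb.single (i c : ℕ) : Comb ℕ := bif Nat.beq c 0 then [] else [(i, c)]

theorem Comb.eval_single {k L : Type*} [Field k] [AddCommGroup L] [Module k L] (B : ℕ → L)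
    (i c : ℕ) : Comb.eval k B (Comb.single i c) = (c : k) • B i := by
  rcases c with _ | c
  · simp [Comb.single]
  · simp [Comb.single, Nat.beq]

/-- The action of `e_i ∧ e_j` on the standard basis. -/
def wedgeTable (i j c : ℕ) : Comb ℕ := Comb.single i (gram j c) ++ Comb.single j (2 * gram i c)

/-- The numbers of the pair `e_i ∧ e_j` and `e_j ∧ e_i`. -/
def pairComb (i j : ℕ) : Comb ℕ :=
  if i < j then [(pairTable.idxOf (i, j), 1)] else
    if j < i then [(pairTable.idxOf (j, i), 2)] else []

/-- The action of the `p`-th root element of `𝔰𝔬₇` on the standard basis. -/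
def soTable (p c : ℕ) : Comb ℕ := wedgeTable (pairAt p).1 (pairAt p).2 c

theorem pairAt_lt : allBelow 21 (fun p => decide ((pairAt p).1 < 7 ∧ (pairAt p).2 < 7)) = true := by
  decide +kernel

theorem soTable_lt : allBelow 21 (fun p => allBelow 7 fun c => (soTable p c).all fun t =>
    decide (t.1 < 7)) = true := by decide +kernel

/-- The even part of the structure table is closed under brackets and is the commutator table of the
`eᵢ ∧ eⱼ` acting on `k⁷`. -/
theorem soTable_lie : allBelow 21 (fun p => allBelow 21 fun q =>
    (structureConst p q).all (fun t => decide (t.1 < 21)) && allBelow 7 fun c =>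
    Comb.eqv (Comb.bind (soTable q c) (soTable p) ++ Comb.scale 2 (Comb.bind (soTable p c) (soTable q)))
      (Comb.bind (structureConst p q) fun r => soTable r c)) = true := by decide +kernel

theorem soTable_pairComb : allBelow 7 (fun i => allBelow 7 fun j =>
    (pairComb i j).all (fun t => decide (t.1 < 21)) && allBelow 7 fun c =>
    Comb.eqv (wedgeTable i j c) (Comb.bind (pairComb i j) fun r => soTable r c)) = true := by
  decide +kernel

/-- For `i < j` the vector dual to `eⱼ` is sent by `eᵢ ∧ eⱼ` to a vector with `eᵢ`-coordinate 1, and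
other basis elements contribute nothing to that coordinate. So one matrix entry computes each
coordinate on `𝔰𝔬₇`. -/
theorem soTable_coeffAt : allBelow 21 (fun p => allBelow 21 fun q =>
    decide (Comb.coeffAt (pairAt p).1 (soTable q (dualIndex (pairAt p).2)) % 3
      = if p = q then 1 else 0)) = true := by
  decide +kernel

/-! ### Tables for the spin module -/

/-- The sign from moving a fermionic operator past the lower bits. -/
def fermionSign (b m : ℕ) : ℕ := 2 ^ (List.range b).countP fun i => m.testBit i

/-- The action of the standard basis of `k⁷` on the spinors, by creation and annihilation
operators. -/
def gammaTable (i m : ℕ) : Comb ℕ :=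
  if i = 0 then [(m, fermionSign 3 m)] else
    if i % 2 = 1 then
      if m.testBit ((i - 1) / 2) then [] else
        [(m + 2 ^ ((i - 1) / 2), fermionSign ((i - 1) / 2) m)]
    else
      if m.testBit ((i - 1) / 2) then
        [(m - 2 ^ ((i - 1) / 2), fermionSign ((i - 1) / 2) m)] else []

/-- The action of the root elements of `𝔰𝔬₇` on the spinors. -/
def spinTable (p m : ℕ) : Comb ℕ := (structureConst p (21 + m)).map fun t => (t.1 - 21, t.2)

theorem gammaTable_lt : allBelow 7 (fun i => allBelow 8 fun m => (gammaTable i m).all fun t =>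
    decide (t.1 < 8)) = true := by decide +kernel

theorem spinTable_lt : allBelow 21 (fun p => allBelow 8 fun m => (spinTable p m).all fun t =>
    decide (t.1 < 8)) = true := by decide +kernel

/-- `spinTable` is extracted from the first half of the odd part; `spinTable_right` finds the same
matrices on the second half, whence two copies of one module. -/
theorem spinTable_left : allBelow 21 (fun p => allBelow 8 fun m => Comb.eqv
    (structureConst p (21 + m)) ((spinTable p m).map fun t => (21 + t.1, t.2))) = true := by
  decide +kernel

theorem spinTable_right : allBelow 21 (fun p => allBelow 8 fun m => Comb.eqv
    (structureConst p (29 + m)) ((spinTable p m).map fun t => (29 + t.1, t.2))) = true := by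
  decide +kernel

theorem spinTable_lie : allBelow 21 (fun p => allBelow 21 fun q => allBelow 8 fun m =>
    Comb.eqv (Comb.bind (spinTable q m) (spinTable p) ++
        Comb.scale 2 (Comb.bind (spinTable p m) (spinTable q)))
      (Comb.bind (structureConst p q) fun r => spinTable r m)) = true := by decide +kernel

theorem gammaTable_anticomm : allBelow 7 (fun i => allBelow 7 fun j => allBelow 8 fun m =>
    Comb.eqv (Comb.bind (gammaTable j m) (gammaTable i) ++ Comb.bind (gammaTable i m) (gammaTable j))
      [(m, gram i j)]) = true := by decide +kernel

/-- This ties the odd part of the superalgebra to the Clifford algebra: half the commutator of two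
gamma operators is the tabulated action of the corresponding `eᵢ ∧ eⱼ`. -/
theorem gammaTable_comm : allBelow 7 (fun i => allBelow 7 fun j => allBelow 8 fun m =>
    Comb.eqv (Comb.bind (gammaTable j m) (gammaTable i) ++
        Comb.scale 2 (Comb.bind (gammaTable i m) (gammaTable j)))
      (Comb.scale 2 (Comb.bind (pairComb i j) fun r => spinTable r m))) = true := by decide +kernel

/-- The pairs of gamma operators that, applied from the right to the left, project to the `m`-th
basis spinor and take it to the `m'`-th one up to sign. -/
def spinWord (m m' : ℕ) : List (ℕ × ℕ) :=
  ((List.range 3).flatMap fun b => if m.testBit b = m'.testBit b then [] else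
      [(0, if m'.testBit b then 2 * b + 1 else 2 * b + 2)]) ++
    (List.range 3).map fun b => if m.testBit b then (2 * b + 1, 2 * b + 2) else (2 * b + 2, 2 * b + 1)

/-- The action of a word of pairs of gamma operators on a basis spinor. -/
def wordTable : List (ℕ × ℕ) → ℕ → Comb ℕ
  | [], m => [(m, 1)]
  | t :: w, m => Comb.bind (Comb.bind (wordTable w m) (gammaTable t.2)) (gammaTable t.1)

/-- Creation times annihilation at a bit, or the reverse, tests that bit, so three such pairs
project onto one basis spinor. Each bit to be changed is then flipped by a single operator, paired
with the invertible operator of `e₀` to keep the word even. The result is a matrix unit up to sign.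
-/
theorem wordTable_spinWord : allBelow 8 (fun m => allBelow 8 fun m' =>
    (spinWord m m').all (fun t => decide (t.1 < 7 ∧ t.2 < 7)) &&
    (allBelow 8 (fun n => Comb.eqv (wordTable (spinWord m m') n) [(m', if n = m then 1 else 0)]) ||
      allBelow 8 fun n => Comb.eqv (wordTable (spinWord m m') n)
        [(m', if n = m then 2 else 0)])) = true := by decide +kernel

end Super

/-! ### A basis of `𝔰𝔬₇` with its coordinates. -/

namespace Super

variable {k : Type*} [Field k]

theorem polar_splitForm7 (x y : Fin 7 → k) : QuadraticMap.polar (splitForm7 k) x y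
    = 2 * x 0 * y 0 + x 1 * y 2 + x 2 * y 1 + x 3 * y 4 + x 4 * y 3 + x 5 * y 6 + x 6 * y 5 := by
  simp only [QuadraticMap.polar, splitForm7, _root_.add_apply, QuadraticMap.linMulLin_apply,
    LinearMap.proj_apply, Pi.add_apply]
  ring

theorem polar_unitVec {i j : ℕ} (hi : i < 7) (hj : j < 7) :
    QuadraticMap.polar (splitForm7 k) (unitVec k 7 i) (unitVec k 7 j) = (gram i j : k) := by
  rw [polar_splitForm7]
  interval_cases i <;> interval_cases j <;> simp [unitVec, gram, dualIndex, beq_eq_decide]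

theorem polar_dualIndex (x : Fin 7 → k) (i : Fin 7) :
    QuadraticMap.polar (splitForm7 k) x (unitVec k 7 (dualIndex i))
      = (if i = 0 then 2 else 1) * x i := by
  rw [polar_splitForm7]
  fin_cases i <;> simp [unitVec, dualIndex]

theorem mem_so {W : Type*} [AddCommGroup W] [Module k W] {Q : QuadraticForm k W}
    {a : Module.End k W} : a ∈ so Q ↔ ∀ x y,
      QuadraticMap.polar Q (a x) y = -QuadraticMap.polar Q x (a y) := by
  refine ⟨fun h x y => ?_, fun h x y => ?_⟩
  · have := h x y
    rwa [LinearMap.neg_apply, LinearMap.neg_apply] at this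
  · rw [LinearMap.neg_apply, LinearMap.neg_apply]
    exact h x y

/-- The endomorphism `z ↦ Q(y,z) x - Q(x,z) y`. -/
def wedgeEnd {W : Type*} [AddCommGroup W] [Module k W] (Q : QuadraticForm k W) :
    W →ₗ[k] W →ₗ[k] Module.End k W :=
  LinearMap.mk₂ k (fun x y => (Q.polarBilin y).smulRight x - (Q.polarBilin x).smulRight y)
    (fun x x' y => LinearMap.ext fun z => by
      simp only [LinearMap.sub_apply, LinearMap.add_apply, LinearMap.smulRight_apply, map_add,
        smul_add, add_smul]
      abel)
    (fun c x y => LinearMap.ext fun z => by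
      simp only [LinearMap.sub_apply, LinearMap.smul_apply, LinearMap.smulRight_apply, map_smul,
        smul_sub, smul_assoc, smul_comm c])
    (fun x y y' => LinearMap.ext fun z => by
      simp only [LinearMap.sub_apply, LinearMap.add_apply, LinearMap.smulRight_apply, map_add,
        smul_add, add_smul]
      abel)
    (fun c x y => LinearMap.ext fun z => by
      simp only [LinearMap.sub_apply, LinearMap.smul_apply, LinearMap.smulRight_apply, map_smul,
        smul_sub, smul_assoc, smul_comm c])

theorem wedgeEnd_apply {W : Type*} [AddCommGroup W] [Module k W] (Q : QuadraticForm k W)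
    (x y z : W) :
    wedgeEnd Q x y z = QuadraticMap.polar Q y z • x - QuadraticMap.polar Q x z • y := rfl

theorem wedgeEnd_mem {W : Type*} [AddCommGroup W] [Module k W] (Q : QuadraticForm k W) (x y : W) :
    wedgeEnd Q x y ∈ so Q := by
  rw [mem_so]
  intro z w
  simp only [wedgeEnd_apply, sub_eq_add_neg, ← neg_smul, QuadraticMap.polar_add_left,
    QuadraticMap.polar_smul_left, QuadraticMap.polar_add_right, QuadraticMap.polar_smul_right,
    smul_eq_mul]
  rw [QuadraticMap.polar_comm Q z x, QuadraticMap.polar_comm Q z y]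
  ring

theorem wedgeEnd_unitVec {i j c : ℕ} (hi : i < 7) (hj : j < 7) (hc : c < 7) [CharP k 3] :
    wedgeEnd (splitForm7 k) (unitVec k 7 i) (unitVec k 7 j) (unitVec k 7 c)
      = Comb.eval k (unitVec k 7) (wedgeTable i j c) := by
  rw [wedgeEnd_apply, polar_unitVec hj hc, polar_unitVec hi hc, wedgeTable,
    Comb.eval_append, Comb.eval_single, Comb.eval_single, Nat.cast_mul, Nat.cast_ofNat, Comb.two_eq_neg_one,
    neg_one_mul, neg_smul, sub_eq_add_neg]

/-- The basis of `𝔰𝔬₇`. -/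
def soBasis (k : Type*) [Field k] (p : ℕ) : so (splitForm7 k) :=
  ⟨wedgeEnd (splitForm7 k) (unitVec k 7 (pairAt p).1) (unitVec k 7 (pairAt p).2), wedgeEnd_mem _ _ _⟩

theorem Comb.eval_indicator (i : ℕ) (ℓ : Comb ℕ) :
    Comb.eval k (fun j => if j = i then (1 : k) else 0) ℓ = (Comb.coeffAt i ℓ : k) := by
  induction ℓ with
  | nil => simp [Comb.coeffAt]
  | cons t ℓ ih =>
    rw [Comb.eval_cons, ih, Comb.coeffAt]
    split_ifs <;> simp_all

/-- The coordinates of an element of `𝔰𝔬₇`. -/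
def soCoord (k : Type*) [Field k] (p : ℕ) : so (splitForm7 k) →ₗ[k] k :=
  (ofValues 7 fun j => if j = (pairAt p).1 then (1 : k) else 0).comp
    ((LinearMap.applyₗ (unitVec k 7 (dualIndex (pairAt p).2))).comp
      (so (splitForm7 k)).toSubmodule.subtype)

theorem soCoord_apply (a : so (splitForm7 k)) (p : ℕ) {i j : Fin 7} (h : pairAt p = (↑i, ↑j)) :
    soCoord k p a = (a : Module.End k (Fin 7 → k)) (unitVec k 7 (dualIndex j)) i := by
  have e : (ofValues 7 fun j => if j = (i : ℕ) then (1 : k) else 0)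
      = (LinearMap.proj i : (Fin 7 → k) →ₗ[k] k) := by
    refine unitVec_hom_ext fun c hc => ?_
    rw [ofValues_unitVec _ hc, proj_unitVec]
    simp only [eq_comm]
  rw [soCoord, h]
  simp only
  rw [e]
  rfl

variable [CharP k 3]

theorem soBasis_unitVec {p c : ℕ} (hp : p < 21) (hc : c < 7) :
    (soBasis k p : Module.End k (Fin 7 → k)) (unitVec k 7 c)
      = Comb.eval k (unitVec k 7) (soTable p c) := by
  have := of_decide_eq_true (of_allBelow pairAt_lt hp)
  exact wedgeEnd_unitVec this.1 this.2 hc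

theorem soBasis_apply_eval {p : ℕ} (hp : p < 21) {ℓ : Comb ℕ} (hℓ : ∀ t ∈ ℓ, t.1 < 7) :
    (soBasis k p : Module.End k (Fin 7 → k)) (Comb.eval k (unitVec k 7) ℓ)
      = Comb.eval k (unitVec k 7) (Comb.bind ℓ (soTable p)) := by
  rw [Comb.map_eval, Comb.eval_bind]
  exact Comb.eval_congr fun t ht => soBasis_unitVec hp (hℓ t ht)

theorem soTable_mem_lt {p c : ℕ} (hp : p < 21) (hc : c < 7) {t : ℕ × ℕ} (ht : t ∈ soTable p c) :
    t.1 < 7 :=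
  of_decide_eq_true (List.all_eq_true.1 (of_allBelow (of_allBelow soTable_lt hp) hc) t ht)

theorem coe_eval_soBasis {ℓ : Comb ℕ} (hℓ : ∀ t ∈ ℓ, t.1 < 21) {c : ℕ} (hc : c < 7) :
    ((Comb.eval k (soBasis k) ℓ : so (splitForm7 k)) : Module.End k (Fin 7 → k)) (unitVec k 7 c)
      = Comb.eval k (unitVec k 7) (Comb.bind ℓ fun r => soTable r c) := by
  have : ((LinearMap.applyₗ (unitVec k 7 c)).comp (so (splitForm7 k)).toSubmodule.subtype)
      (Comb.eval k (soBasis k) ℓ) = Comb.eval k (unitVec k 7) (Comb.bind ℓ fun r => soTable r c) := by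
    rw [Comb.map_eval, Comb.eval_bind]
    exact Comb.eval_congr fun t ht => soBasis_unitVec (hℓ t ht) hc
  exact this

theorem structureConst_lt_of_even {p q : ℕ} (hp : p < 21) (hq : q < 21) {t : ℕ × ℕ}
    (ht : t ∈ structureConst p q) : t.1 < 21 := by
  have := of_allBelow (of_allBelow soTable_lie hp) hq
  rw [Bool.and_eq_true] at this
  exact of_decide_eq_true (List.all_eq_true.1 this.1 t ht)

theorem soBasis_lie {p q : ℕ} (hp : p < 21) (hq : q < 21) :
    ⁅soBasis k p, soBasis k q⁆ = Comb.eval k (soBasis k) (structureConst p q) := by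
  refine Subtype.ext (unitVec_hom_ext fun c hc => ?_)
  have := of_allBelow (of_allBelow soTable_lie hp) hq
  rw [Bool.and_eq_true] at this
  have key := Comb.eval_eq_of_eqv (k := k) (unitVec k 7) (of_allBelow this.2 hc)
  rw [coe_eval_soBasis (fun t ht => structureConst_lt_of_even hp hq ht) hc, ← key,
    LieSubalgebra.coe_bracket, LieRing.of_associative_ring_bracket, LinearMap.sub_apply,
    Module.End.mul_apply, Module.End.mul_apply, soBasis_unitVec hq hc, soBasis_unitVec hp hc,
    soBasis_apply_eval hp fun t => soTable_mem_lt hq hc, soBasis_apply_eval hq fun t =>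
    soTable_mem_lt hp hc, Comb.eval_append, Comb.eval_scale, Nat.cast_ofNat, Comb.two_eq_neg_one,
    neg_one_smul, sub_eq_add_neg]

theorem wedgeEnd_eq_eval {i j : ℕ} (hi : i < 7) (hj : j < 7) :
    wedgeEnd (splitForm7 k) (unitVec k 7 i) (unitVec k 7 j)
      = (Comb.eval k (soBasis k) (pairComb i j) : so (splitForm7 k)) := by
  refine unitVec_hom_ext fun c hc => ?_
  have := of_allBelow (of_allBelow soTable_pairComb hi) hj
  rw [Bool.and_eq_true] at this
  rw [coe_eval_soBasis (fun t ht => of_decide_eq_true (List.all_eq_true.1 this.1 t ht)) hc,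
    ← Comb.eval_eq_of_eqv (k := k) (unitVec k 7) (of_allBelow this.2 hc), wedgeEnd_unitVec hi hj hc]

theorem soCoord_soBasis {p q : ℕ} (hp : p < 21) (hq : q < 21) :
    soCoord k p (soBasis k q) = if p = q then 1 else 0 := by
  have h1 := of_decide_eq_true (of_allBelow pairAt_lt hp)
  have h2 : dualIndex (pairAt p).2 < 7 := by
    have h : ∀ j < 7, dualIndex j < 7 := by decide
    exact h _ h1.2
  have h3 := of_decide_eq_true (of_allBelow (of_allBelow soTable_coeffAt hp) hq)
  have e : soCoord k p (soBasis k q) = (ofValues 7 fun j => if j = (pairAt p).1 then (1 : k) else 0)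
      ((soBasis k q : Module.End k (Fin 7 → k)) (unitVec k 7 (dualIndex (pairAt p).2))) := rfl
  rw [e, soBasis_unitVec hq h2, ofValues_eval _ fun t => soTable_mem_lt hq h2,
    Comb.eval_indicator]
  rw [CharP.cast_eq_mod k 3, h3]
  split_ifs <;> simp

/-- With the column index replaced by its dual, an element of `𝔰𝔬₇` has a matrix that is skew up to
nonzero factors. It is determined by its 21 entries above the diagonal, because 2 is invertible. -/
theorem eq_zero_of_soCoord {a : so (splitForm7 k)} (h : ∀ p < 21, soCoord k p a = 0) : a = 0 := by
  have h2 : (2 : k) ≠ 0 := by rw [Comb.two_eq_neg_one]; exact neg_ne_zero.2 one_ne_zero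
  have hlt : ∀ i j : Fin 7, i < j →
      (a : Module.End k (Fin 7 → k)) (unitVec k 7 (dualIndex j)) i = 0 := by
    intro i j hij
    obtain ⟨p, hp, hpij⟩ : ∃ p < 21, pairAt p = (↑i, ↑j) := by
      revert i j
      decide
    rw [← soCoord_apply a p hpij, h p hp]
  have hskew : ∀ i j : Fin 7, (if i = 0 then 2 else 1) *
        (a : Module.End k (Fin 7 → k)) (unitVec k 7 (dualIndex j)) i
      = -((if j = 0 then 2 else 1) *
        (a : Module.End k (Fin 7 → k)) (unitVec k 7 (dualIndex i)) j) := by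
    intro i j
    rw [← polar_dualIndex, ← polar_dualIndex, mem_so.1 a.2, QuadraticMap.polar_comm]
  have hall : ∀ i j : Fin 7,
      (a : Module.End k (Fin 7 → k)) (unitVec k 7 (dualIndex j)) i = 0 := by
    intro i j
    have hne : (if i = 0 then 2 else 1 : k) ≠ 0 := by split_ifs <;> simp [h2]
    rcases lt_trichotomy i j with hij | rfl | hij
    · exact hlt i j hij
    · have h5 := hskew i i
      rw [eq_neg_iff_add_eq_zero, ← two_mul] at h5
      exact (mul_eq_zero.1 ((mul_eq_zero.1 h5).resolve_left h2)).resolve_left hne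
    · have h5 := hskew i j
      rw [hlt j i hij, mul_zero, neg_zero] at h5
      exact (mul_eq_zero.1 h5).resolve_left hne
  refine Subtype.ext (unitVec_hom_ext fun c hc => ?_)
  have h6 : dualIndex c < 7 ∧ dualIndex (dualIndex c) = c := by
    clear hall hskew hlt h
    revert c
    decide
  ext i
  have := hall i ⟨dualIndex c, h6.1⟩
  simp only [h6.2] at this
  exact this

end Super

/-! ### Representations of `𝔰𝔬₇` by tables and the Clifford action on spinors. -/

namespace Super

variable {k : Type*} [Field k]

/-- The linear map on `𝔰𝔬₇` with given values on the basis. -/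
def soHom {M : Type*} [AddCommGroup M] [Module k M] (f : ℕ → M) : so (splitForm7 k) →ₗ[k] M :=
  ∑ p : Fin 21, (soCoord k p).smulRight (f p)

/-- The matrices of the action of the standard basis of `k⁷` on the spinors. -/
def gammaBasis (k : Type*) [Field k] (i : ℕ) : Module.End k (Fin 8 → k) :=
  ofValues 8 fun m => Comb.eval k (unitVec k 8) (gammaTable i m)

/-- The action of `k⁷` on the spinors. -/
def gamma (k : Type*) [Field k] : (Fin 7 → k) →ₗ[k] Module.End k (Fin 8 → k) :=
  ofValues 7 (gammaBasis k)

/-- The action of the basis of `𝔰𝔬₇` on the spinors. -/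
def spinBasis (k : Type*) [Field k] (p : ℕ) : Module.End k (Fin 8 → k) :=
  ofValues 8 fun m => Comb.eval k (unitVec k 8) (spinTable p m)

theorem gamma_unitVec_unitVec {i m : ℕ} (hi : i < 7) (hm : m < 8) :
    gamma k (unitVec k 7 i) (unitVec k 8 m) = Comb.eval k (unitVec k 8) (gammaTable i m) := by
  rw [gamma, ofValues_unitVec _ hi, gammaBasis, ofValues_unitVec _ hm]

theorem gammaTable_mem_lt {i m : ℕ} (hi : i < 7) (hm : m < 8) {t : ℕ × ℕ}
    (ht : t ∈ gammaTable i m) : t.1 < 8 :=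
  of_decide_eq_true (List.all_eq_true.1 (of_allBelow (of_allBelow gammaTable_lt hi) hm) t ht)

theorem spinTable_mem_lt {p m : ℕ} (hp : p < 21) (hm : m < 8) {t : ℕ × ℕ}
    (ht : t ∈ spinTable p m) : t.1 < 8 :=
  of_decide_eq_true (List.all_eq_true.1 (of_allBelow (of_allBelow spinTable_lt hp) hm) t ht)

theorem Comb.scale_lt {n c : ℕ} {ℓ : Comb ℕ} (hℓ : ∀ t ∈ ℓ, t.1 < n) :
    ∀ t ∈ Comb.scale c ℓ, t.1 < n := by
  induction ℓ with
  | nil => simp [Comb.scale]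
  | cons s ℓ ih =>
    intro t ht
    rw [Comb.scale, List.mem_cons] at ht
    rcases ht with rfl | ht
    · exact hℓ s (by simp)
    · exact ih (fun s hs => hℓ s (by simp [hs])) t ht

theorem Comb.bind_lt {T : ℕ → Comb ℕ} {n : ℕ} {ℓ : Comb ℕ} (hℓ : ∀ s ∈ ℓ, ∀ t ∈ T s.1, t.1 < n) :
    ∀ t ∈ Comb.bind ℓ T, t.1 < n := by
  induction ℓ with
  | nil => simp [Comb.bind]
  | cons s ℓ ih =>
    intro t ht
    rw [Comb.bind, List.mem_append] at ht
    rcases ht with ht | ht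
    · exact Comb.scale_lt (hℓ s (by simp)) t ht
    · exact ih (fun s hs => hℓ s (by simp [hs])) t ht

theorem spinBasis_unitVec (p : ℕ) {m : ℕ} (hm : m < 8) :
    spinBasis k p (unitVec k 8 m) = Comb.eval k (unitVec k 8) (spinTable p m) := by
  rw [spinBasis, ofValues_unitVec _ hm]

theorem gamma_eval {i : ℕ} (hi : i < 7) {ℓ : Comb ℕ} (hℓ : ∀ t ∈ ℓ, t.1 < 8) :
    gamma k (unitVec k 7 i) (Comb.eval k (unitVec k 8) ℓ)
      = Comb.eval k (unitVec k 8) (Comb.bind ℓ (gammaTable i)) := by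
  rw [Comb.map_eval, Comb.eval_bind]
  exact Comb.eval_congr fun t ht => gamma_unitVec_unitVec hi (hℓ t ht)

theorem spinBasis_eval (p : ℕ) {ℓ : Comb ℕ} (hℓ : ∀ t ∈ ℓ, t.1 < 8) :
    spinBasis k p (Comb.eval k (unitVec k 8) ℓ)
      = Comb.eval k (unitVec k 8) (Comb.bind ℓ (spinTable p)) := by
  rw [Comb.map_eval, Comb.eval_bind]
  exact Comb.eval_congr fun t ht => spinBasis_unitVec p (hℓ t ht)

variable [CharP k 3]

theorem soHom_soBasis {M : Type*} [AddCommGroup M] [Module k M] (f : ℕ → M) {p : ℕ} (hp : p < 21) :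
    soHom f (soBasis k p) = f p := by
  rw [soHom, LinearMap.sum_apply, Finset.sum_eq_single ⟨p, hp⟩]
  · rw [LinearMap.smulRight_apply, soCoord_soBasis hp hp, if_pos rfl, one_smul]
  · intro q _ hq
    rw [LinearMap.smulRight_apply, soCoord_soBasis q.2 hp, if_neg fun h => hq (Fin.ext h), zero_smul]
  · simp

/-- Both sides have the same coordinates, and the coordinates separate points. So the 21 elements
span, and linear maps on `𝔰𝔬₇` can be compared on them. -/
theorem soHom_soBasis_self (a : so (splitForm7 k)) : soHom (soBasis k) a = a := by
  refine sub_eq_zero.1 (eq_zero_of_soCoord fun p hp => ?_)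
  have e : (soCoord k p).comp (soHom (soBasis k)) = soCoord k p := by
    refine LinearMap.ext fun a => ?_
    rw [LinearMap.comp_apply, soHom, LinearMap.sum_apply, map_sum, Finset.sum_eq_single ⟨p, hp⟩]
    · rw [LinearMap.smulRight_apply, map_smul, soCoord_soBasis hp hp, if_pos rfl, smul_eq_mul,
        mul_one]
    · intro q _ hq
      rw [LinearMap.smulRight_apply, map_smul, soCoord_soBasis hp q.2,
        if_neg fun h => hq (Fin.ext h.symm), smul_zero]
    · simp
  rw [map_sub, ← LinearMap.comp_apply, e, sub_self]

theorem so_hom_ext {M : Type*} [AddCommGroup M] [Module k M] {f g : so (splitForm7 k) →ₗ[k] M}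
    (h : ∀ p < 21, f (soBasis k p) = g (soBasis k p)) : f = g := by
  refine LinearMap.ext fun a => ?_
  rw [← soHom_soBasis_self a, soHom, LinearMap.sum_apply, map_sum, map_sum]
  refine Finset.sum_congr rfl fun p _ => ?_
  rw [LinearMap.smulRight_apply, map_smul, map_smul, h p p.2]

/-- The product `m` is an arbitrary bilinear map, so the lemma applies both to commutators of
endomorphisms and to the bracket of the superalgebra itself. -/
theorem soHom_lie {M : Type*} [AddCommGroup M] [Module k M] (m : M →ₗ[k] M →ₗ[k] M) {f : ℕ → M}
    (hf : ∀ p < 21, ∀ q < 21, m (f p) (f q) = Comb.eval k f (structureConst p q))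
    (a b : so (splitForm7 k)) : soHom f ⁅a, b⁆ = m (soHom f a) (soHom f b) := by
  have e : (LieModule.toEnd k (so (splitForm7 k)) (so (splitForm7 k)) :
        so (splitForm7 k) →ₗ[k] so (splitForm7 k) →ₗ[k] so (splitForm7 k)).compr₂ (soHom f)
      = m.compl₁₂ (soHom f) (soHom f) := by
    refine so_hom_ext fun p hp => so_hom_ext fun q hq => ?_
    rw [LinearMap.compl₁₂_apply, soHom_soBasis f hp, soHom_soBasis f hq, hf p hp q hq]
    have h1 : soHom f ⁅soBasis k p, soBasis k q⁆ = Comb.eval k f (structureConst p q) := by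
      rw [soBasis_lie hp hq, Comb.map_eval]
      exact Comb.eval_congr fun t ht => soHom_soBasis f (structureConst_lt_of_even hp hq ht)
    exact h1
  exact LinearMap.congr_fun₂ e a b

/-- The commutator of endomorphisms as a bilinear map. -/
def endCommutator (k M : Type*) [Field k] [AddCommGroup M] [Module k M] :
    Module.End k M →ₗ[k] Module.End k M →ₗ[k] Module.End k M :=
  LinearMap.mk₂ k (fun x y => x * y - y * x)
    (fun _ _ _ => by rw [add_mul, mul_add, add_sub_add_comm])
    (fun _ _ _ => by rw [smul_mul_assoc, mul_smul_comm, smul_sub])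
    (fun _ _ _ => by rw [add_mul, mul_add, add_sub_add_comm])
    (fun _ _ _ => by rw [smul_mul_assoc, mul_smul_comm, smul_sub])

theorem soHom_end_lie {M : Type*} [AddCommGroup M] [Module k M] {f : ℕ → Module.End k M}
    (hf : ∀ p < 21, ∀ q < 21, f p * f q - f q * f p = Comb.eval k f (structureConst p q))
    (a b : so (splitForm7 k)) :
    soHom f ⁅a, b⁆ = ⁅(soHom f a : Module.End k M), (soHom f b : Module.End k M)⁆ := by
  have hf' : ∀ p < 21, ∀ q < 21,
      endCommutator k M (f p) (f q) = Comb.eval k f (structureConst p q) := hf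
  rw [soHom_lie (endCommutator k M) hf' a b]
  rfl

/-- A linear map that preserves brackets as a homomorphism of Lie algebras. -/
def lieHomOfLinearMap {𝔤 M : Type*} [LieRing 𝔤] [LieAlgebra k 𝔤] [AddCommGroup M] [Module k M]
    (g : 𝔤 →ₗ[k] Module.End k M)
    (hg : ∀ a b, g ⁅a, b⁆ = ⁅(g a : Module.End k M), (g b : Module.End k M)⁆) :
    𝔤 →ₗ⁅k⁆ Module.End k M :=
  LieHom.mk g (hg _ _)

/-- The representation of `𝔰𝔬₇` with given values on the basis. -/
def soRep {M : Type*} [AddCommGroup M] [Module k M] (f : ℕ → Module.End k M)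
    (hf : ∀ p < 21, ∀ q < 21, f p * f q - f q * f p = Comb.eval k f (structureConst p q)) :
    so (splitForm7 k) →ₗ⁅k⁆ Module.End k M :=
  lieHomOfLinearMap (soHom f) (soHom_end_lie hf)

/-! ## The spin representation -/

theorem spinBasis_lie {p q : ℕ} (hp : p < 21) (hq : q < 21) :
    spinBasis k p * spinBasis k q - spinBasis k q * spinBasis k p
      = Comb.eval k (spinBasis k) (structureConst p q) := by
  refine unitVec_hom_ext fun m hm => ?_
  have key := Comb.eval_eq_of_eqv (k := k) (unitVec k 8)
    (of_allBelow (of_allBelow (of_allBelow spinTable_lie hp) hq) hm)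
  have e : Comb.eval k (spinBasis k) (structureConst p q) (unitVec k 8 m)
      = Comb.eval k (unitVec k 8) (Comb.bind (structureConst p q) fun r => spinTable r m) := by
    rw [← LinearMap.applyₗ_apply_apply, Comb.map_eval, Comb.eval_bind]
    exact Comb.eval_congr fun t _ => spinBasis_unitVec t.1 hm
  rw [e, ← key, LinearMap.sub_apply, Module.End.mul_apply, Module.End.mul_apply,
    spinBasis_unitVec p hm, spinBasis_unitVec q hm,
    spinBasis_eval p fun t => spinTable_mem_lt hq hm, spinBasis_eval q fun t =>
    spinTable_mem_lt hp hm, Comb.eval_append, Comb.eval_scale, Nat.cast_ofNat, Comb.two_eq_neg_one,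
    neg_one_smul, sub_eq_add_neg]

/-- The spin representation of `𝔰𝔬₇`. -/
def spinRep (k : Type*) [Field k] [CharP k 3] :
    so (splitForm7 k) →ₗ⁅k⁆ Module.End k (Fin 8 → k) :=
  soRep (spinBasis k) fun _ hp _ hq => spinBasis_lie hp hq

omit [CharP k 3] in
theorem gamma_mul_unitVec {i j m : ℕ} (hi : i < 7) (hj : j < 7) (hm : m < 8) :
    (gamma k (unitVec k 7 i) * gamma k (unitVec k 7 j)) (unitVec k 8 m)
      = Comb.eval k (unitVec k 8) (Comb.bind (gammaTable j m) (gammaTable i)) := by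
  rw [Module.End.mul_apply, gamma_unitVec_unitVec hj hm,
    gamma_eval hi fun t => gammaTable_mem_lt hj hm]

theorem gamma_anticomm (x y : Fin 7 → k) : gamma k x * gamma k y + gamma k y * gamma k x
    = QuadraticMap.polar (splitForm7 k) x y • 1 := by
  have e : (LinearMap.mul k (Module.End k (Fin 8 → k))).compl₁₂ (gamma k) (gamma k)
        + ((LinearMap.mul k (Module.End k (Fin 8 → k))).compl₁₂ (gamma k) (gamma k)).flip
      = (splitForm7 k).polarBilin.compr₂ (LinearMap.toSpanSingleton k _ 1) := by
    refine unitVec_hom_ext₂ fun i hi j hj => unitVec_hom_ext fun m hm => ?_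
    have key := Comb.eval_eq_of_eqv (k := k) (unitVec k 8)
      (of_allBelow (of_allBelow (of_allBelow gammaTable_anticomm hi) hj) hm)
    rw [Comb.eval_append, ← gamma_mul_unitVec hi hj hm, ← gamma_mul_unitVec hj hi hm,
      Comb.eval_cons, Comb.eval_nil, add_zero, ← polar_unitVec hi hj] at key
    exact key
  exact LinearMap.congr_fun₂ e x y

/-- Half of the anticommutation relation with both arguments equal; it is the hypothesis of the
universal property of the Clifford algebra. -/
theorem gamma_sq (x : Fin 7 → k) :
    gamma k x * gamma k x = algebraMap k (Module.End k (Fin 8 → k)) (splitForm7 k x) := by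
  have h2 : (2 : k) ≠ 0 := by rw [Comb.two_eq_neg_one]; exact neg_ne_zero.2 one_ne_zero
  have h := gamma_anticomm x x
  rw [QuadraticMap.polar_self, ← two_smul k, ← Nat.cast_smul_eq_nsmul k, smul_assoc,
    Nat.cast_ofNat] at h
  rw [Algebra.algebraMap_eq_smul_one]
  exact smul_right_injective _ h2 h

/-- The action of the even Clifford algebra on the spinors. -/
def evenSpin (k : Type*) [Field k] [CharP k 3] :
    CliffordAlgebra.even (splitForm7 k) →ₐ[k] Module.End k (Fin 8 → k) :=
  (CliffordAlgebra.lift (splitForm7 k) ⟨gamma k, gamma_sq⟩).comp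
    (CliffordAlgebra.even (splitForm7 k)).val

theorem evenSpin_bilin (x y : Fin 7 → k) :
    evenSpin k ((CliffordAlgebra.even.ι (splitForm7 k)).bilin x y) = gamma k x * gamma k y := by
  have : evenSpin k ((CliffordAlgebra.even.ι (splitForm7 k)).bilin x y)
      = CliffordAlgebra.lift (splitForm7 k) ⟨gamma k, gamma_sq⟩
        (CliffordAlgebra.ι (splitForm7 k) x * CliffordAlgebra.ι (splitForm7 k) y) := rfl
  rw [this, map_mul, CliffordAlgebra.lift_ι_apply, CliffordAlgebra.lift_ι_apply]

theorem soHom_eval {M : Type*} [AddCommGroup M] [Module k M] (f : ℕ → M) {ℓ : Comb ℕ}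
    (hℓ : ∀ t ∈ ℓ, t.1 < 21) : soHom f (Comb.eval k (soBasis k) ℓ) = Comb.eval k f ℓ := by
  rw [Comb.map_eval]
  exact Comb.eval_congr fun t ht => soHom_soBasis f (hℓ t ht)

/-- Both sides are bilinear, so `gammaTable_comm` on basis vectors suffices. This is the
compatibility with `½ (xy - yx)` required of a spin representation. -/
theorem gamma_comm (x y : Fin 7 → k) : gamma k x * gamma k y - gamma k y * gamma k x
    = (2 : k) • soHom (spinBasis k) ⟨wedgeEnd (splitForm7 k) x y, wedgeEnd_mem _ _ _⟩ := by
  let w : (Fin 7 → k) →ₗ[k] (Fin 7 → k) →ₗ[k] so (splitForm7 k) :=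
    LinearMap.mk₂ k (fun x y => ⟨wedgeEnd (splitForm7 k) x y, wedgeEnd_mem _ _ _⟩)
      (fun _ _ _ => Subtype.ext (LinearMap.map_add₂ _ _ _ _))
      (fun _ _ _ => Subtype.ext (LinearMap.map_smul₂ _ _ _ _))
      (fun _ _ _ => Subtype.ext (map_add _ _ _))
      (fun _ _ _ => Subtype.ext (map_smul _ _ _))
  have e : (LinearMap.mul k (Module.End k (Fin 8 → k))).compl₁₂ (gamma k) (gamma k)
      = w.compr₂ ((2 : k) • soHom (spinBasis k))
        + ((LinearMap.mul k (Module.End k (Fin 8 → k))).compl₁₂ (gamma k) (gamma k)).flip := by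
    refine unitVec_hom_ext₂ fun i hi j hj => unitVec_hom_ext fun m hm => ?_
    have key := Comb.eval_eq_of_eqv (k := k) (unitVec k 8)
      (of_allBelow (of_allBelow (of_allBelow gammaTable_comm hi) hj) hm)
    have h1 := of_allBelow (of_allBelow soTable_pairComb hi) hj
    rw [Bool.and_eq_true] at h1
    have h2 : w (unitVec k 7 i) (unitVec k 7 j) = Comb.eval k (soBasis k) (pairComb i j) :=
      Subtype.ext (wedgeEnd_eq_eval hi hj)
    have h3 : Comb.eval k (spinBasis k) (pairComb i j) (unitVec k 8 m)
        = Comb.eval k (unitVec k 8) (Comb.bind (pairComb i j) fun r => spinTable r m) := by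
      rw [← LinearMap.applyₗ_apply_apply, Comb.map_eval, Comb.eval_bind]
      exact Comb.eval_congr fun t _ => spinBasis_unitVec t.1 hm
    rw [LinearMap.add_apply, LinearMap.add_apply, LinearMap.add_apply, LinearMap.compr₂_apply, h2,
      LinearMap.smul_apply, soHom_eval _ fun t ht =>
      of_decide_eq_true (List.all_eq_true.1 h1.1 t ht), LinearMap.smul_apply, h3]
    rw [Comb.eval_append, Comb.eval_scale, Comb.eval_scale, ← gamma_mul_unitVec hi hj hm,
      ← gamma_mul_unitVec hj hi hm, Nat.cast_ofNat] at key
    rw [← key, Comb.two_eq_neg_one, neg_one_smul]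
    exact (neg_add_cancel_right _ _).symm
  exact sub_eq_of_eq_add (LinearMap.congr_fun₂ e x y)

/-- The operator on the spinors given by a word of pairs of gamma operators. -/
def wordEnd (k : Type*) [Field k] (w : List (ℕ × ℕ)) : Module.End k (Fin 8 → k) :=
  (w.map fun t => gamma k (unitVec k 7 t.1) * gamma k (unitVec k 7 t.2)).prod

omit [CharP k 3] in
theorem wordEnd_unitVec {w : List (ℕ × ℕ)} (hw : ∀ t ∈ w, t.1 < 7 ∧ t.2 < 7) {m : ℕ} (hm : m < 8) :
    (∀ t ∈ wordTable w m, t.1 < 8) ∧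
      wordEnd k w (unitVec k 8 m) = Comb.eval k (unitVec k 8) (wordTable w m) := by
  induction w with
  | nil => exact ⟨by simp [wordTable, hm], by simp [wordTable, wordEnd]⟩
  | cons t w ih =>
    obtain ⟨h1, h2⟩ := ih fun s hs => hw s (List.mem_cons_of_mem _ hs)
    obtain ⟨h3, h4⟩ := hw t List.mem_cons_self
    have h5 : ∀ s ∈ Comb.bind (wordTable w m) (gammaTable t.2), s.1 < 8 :=
      Comb.bind_lt fun s hs u hu => gammaTable_mem_lt h4 (h1 s hs) hu
    refine ⟨Comb.bind_lt fun s hs u hu => gammaTable_mem_lt h3 (h5 s hs) hu, ?_⟩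
    rw [wordTable, wordEnd, List.map_cons, List.prod_cons, Module.End.mul_apply,
      Module.End.mul_apply]
    rw [wordEnd] at h2
    rw [h2, gamma_eval h4 h1, gamma_eval h3 h5]

theorem wordEnd_spinWord {m m' : ℕ} (hm : m < 8) (hm' : m' < 8) : ∃ c : k, c ≠ 0 ∧
    ∀ v, wordEnd k (spinWord m m') v = (c * v ⟨m, hm⟩) • unitVec k 8 m' := by
  have h := of_allBelow (of_allBelow wordTable_spinWord hm) hm'
  rw [Bool.and_eq_true, Bool.or_eq_true] at h
  have hw : ∀ t ∈ spinWord m m', t.1 < 7 ∧ t.2 < 7 := fun t ht =>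
    of_decide_eq_true (List.all_eq_true.1 h.1 t ht)
  have h2 : ((2 : ℕ) : k) ≠ 0 := by
    rw [Nat.cast_ofNat, Comb.two_eq_neg_one]; exact neg_ne_zero.2 one_ne_zero
  have key : ∀ c : ℕ, allBelow 8 (fun n => Comb.eqv (wordTable (spinWord m m') n)
      [(m', if n = m then c else 0)]) = true →
      ∀ v, wordEnd k (spinWord m m') v = (c * v ⟨m, hm⟩) • unitVec k 8 m' := by
    intro c hc v
    have e : wordEnd k (spinWord m m') = (((c : k) • LinearMap.proj ⟨m, hm⟩ :
        (Fin 8 → k) →ₗ[k] k)).smulRight (unitVec k 8 m') := by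
      refine unitVec_hom_ext fun n hn => ?_
      rw [(wordEnd_unitVec hw hn).2, Comb.eval_eq_of_eqv (k := k) (unitVec k 8) (of_allBelow hc hn),
        Comb.eval_cons, Comb.eval_nil, add_zero, LinearMap.smulRight_apply, LinearMap.smul_apply,
        proj_unitVec]
      simp only [eq_comm (a := m)]
      split_ifs <;> simp
    rw [e]
    rfl
  rcases h.2 with h | h
  · exact ⟨_, by rw [Nat.cast_one]; exact one_ne_zero, key 1 h⟩
  · exact ⟨_, h2, key 2 h⟩

theorem wordEnd_mem {N : Submodule k (Fin 8 → k)} (hN : ∀ c, ∀ m ∈ N, evenSpin k c m ∈ N)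
    (w : List (ℕ × ℕ)) {v : Fin 8 → k} (hv : v ∈ N) : wordEnd k w v ∈ N := by
  induction w with
  | nil => simpa [wordEnd] using hv
  | cons t w ih =>
    rw [wordEnd, List.map_cons, List.prod_cons, Module.End.mul_apply, ← evenSpin_bilin]
    exact hN _ _ ih

/-- Irreducibility holds because the even words of `wordEnd_spinWord` are nonzero multiples of all
the matrix units. -/
theorem isSpinRep_spinRep : IsSpinRep (splitForm7 k) (spinRep k) := by
  have h2 : (2 : k) ≠ 0 := by rw [Comb.two_eq_neg_one]; exact neg_ne_zero.2 one_ne_zero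
  refine ⟨evenSpin k, inferInstance, fun N hN => ?_, fun a x y ha => ?_⟩
  · refine or_iff_not_imp_left.2 fun hbot => ?_
    obtain ⟨v, hv, hv0⟩ := Submodule.exists_mem_ne_zero_of_ne_bot hbot
    obtain ⟨m, hm⟩ := Function.ne_iff.1 hv0
    -- Choose `m` with nonzero `m`-th coordinate of `v`; the matrix unit from `m` to `m'` sends `v`
    -- to a nonzero multiple of the `m'`-th basis spinor.
    have hu : ∀ m' < 8, unitVec k 8 m' ∈ N := by
      intro m' hm'
      obtain ⟨c, hc, hc'⟩ := wordEnd_spinWord (k := k) m.2 hm'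
      have := wordEnd_mem hN (spinWord m m') hv
      rw [hc'] at this
      exact (Submodule.smul_mem_iff _ (mul_ne_zero hc hm)).1 this
    rw [eq_top_iff, ← (Pi.basisFun k (Fin 8)).span_eq, Submodule.span_le]
    rintro _ ⟨i, rfl⟩
    rw [Pi.basisFun_apply, ← unitVec_val]
    exact hu i i.2
  · have e : a = ⟨wedgeEnd (splitForm7 k) x y, wedgeEnd_mem _ _ _⟩ :=
      Subtype.ext (LinearMap.ext ha)
    rw [map_smul, map_sub, evenSpin_bilin, evenSpin_bilin, gamma_comm, smul_smul,
      inv_mul_cancel₀ h2, one_smul, ← e]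
    rfl

/-! ## The even and the odd part -/

namespace IsRootBasis

variable {L : Type*} [AddCommGroup L] [Module k L] {A : Superalgebra k L} {B : ℕ → L}

/-- The pairs of spinors as odd elements. -/
def spinPair (k : Type*) [Field k] {L : Type*} [AddCommGroup L] [Module k L] (B : ℕ → L) :
    (Fin 8 → k) × (Fin 8 → k) →ₗ[k] L :=
  (ofValues 8 fun m => B (21 + m)).coprod (ofValues 8 fun m => B (29 + m))

theorem soHom_injective (hB : IsRootBasis A B) :
    Function.Injective (soHom B : so (splitForm7 k) →ₗ[k] L) := by
  refine (injective_iff_map_eq_zero _).2 fun a ha => eq_zero_of_soCoord fun p hp => ?_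
  have e : soCoord k p = (hB.coord p).comp (soHom B) := so_hom_ext fun q hq => by
    rw [LinearMap.comp_apply, soHom_soBasis B hq, soCoord_soBasis hp hq,
      hB.coord_apply (by omega) (by omega)]
  rw [e, LinearMap.comp_apply, ha, map_zero]

omit [CharP k 3] in
theorem spinPair_injective (hB : IsRootBasis A B) : Function.Injective (spinPair k B) := by
  refine (injective_iff_map_eq_zero _).2 fun m hm => ?_
  have e : ∀ i : Fin 8, (hB.coord (21 + i)).comp (spinPair k B)
      = (LinearMap.proj i).comp (LinearMap.fst k _ _) := fun i =>
    LinearMap.prod_ext (unitVec_hom_ext fun n hn => by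
      simp [spinPair, ofValues_unitVec _ hn, hB.coord_apply (p := 21 + i) (q := 21 + n) (by omega)
        (by omega), unitVec, eq_comm]) (unitVec_hom_ext fun n hn => by
      simp [spinPair, ofValues_unitVec _ hn, hB.coord_apply (p := 21 + i) (q := 29 + n) (by omega)
        (by omega)]
      omega)
  have e' : ∀ i : Fin 8, (hB.coord (29 + i)).comp (spinPair k B)
      = (LinearMap.proj i).comp (LinearMap.snd k _ _) := fun i =>
    LinearMap.prod_ext (unitVec_hom_ext fun n hn => by
      simp [spinPair, ofValues_unitVec _ hn, hB.coord_apply (p := 29 + i) (q := 21 + n) (by omega)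
        (by omega)]
      omega) (unitVec_hom_ext fun n hn => by
      simp [spinPair, ofValues_unitVec _ hn, hB.coord_apply (p := 29 + i) (q := 29 + n) (by omega)
        (by omega), unitVec, eq_comm])
  refine Prod.ext (funext fun i => ?_) (funext fun i => ?_)
  · have := LinearMap.congr_fun (e i) m
    rw [LinearMap.comp_apply, hm, map_zero] at this
    exact this.symm
  · have := LinearMap.congr_fun (e' i) m
    rw [LinearMap.comp_apply, hm, map_zero] at this
    exact this.symm

omit [CharP k 3] in
theorem range_soHom_le (hB : IsRootBasis A B) :
    LinearMap.range (soHom B : so (splitForm7 k) →ₗ[k] L) ≤ A.gr 0 := by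
  rintro _ ⟨a, rfl⟩
  rw [soHom, LinearMap.sum_apply]
  exact Submodule.sum_mem _ fun p _ => Submodule.smul_mem _ _ (hB.even_gr p.2)

omit [CharP k 3] in
theorem range_spinPair_le (hB : IsRootBasis A B) : LinearMap.range (spinPair k B) ≤ A.gr 1 := by
  have h : ∀ s, s = 21 ∨ s = 29 → ∀ m, ofValues (k := k) 8 (fun m => B (s + m)) m ∈ A.gr 1 := by
    intro s hs m
    rw [ofValues, Module.Basis.constr_apply_fintype]
    exact Submodule.sum_mem _ fun p _ => Submodule.smul_mem _ _ (hB.odd_gr (by omega) (by omega))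
  rintro _ ⟨m, rfl⟩
  rw [spinPair, LinearMap.coprod_apply]
  exact add_mem (h 21 (.inl rfl) _) (h 29 (.inr rfl) _)

theorem range_sup_range (hB : IsRootBasis A B) :
    LinearMap.range (soHom B : so (splitForm7 k) →ₗ[k] L) ⊔ LinearMap.range (spinPair k B) = ⊤ := by
  refine hB.eq_top_of_mem fun p hp => ?_
  rcases lt_or_ge p 21 with h | h
  · exact Submodule.mem_sup_left ⟨soBasis k p, soHom_soBasis B h⟩
  · refine Submodule.mem_sup_right ?_
    rcases lt_or_ge p 29 with h' | h'
    · refine ⟨(unitVec k 8 (p - 21), 0), ?_⟩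
      rw [spinPair, LinearMap.coprod_apply, map_zero, add_zero, ofValues_unitVec _ (by omega),
        Nat.add_sub_cancel' h]
    · refine ⟨(0, unitVec k 8 (p - 29)), ?_⟩
      rw [spinPair, LinearMap.coprod_apply, map_zero, zero_add, ofValues_unitVec _ (by omega),
        Nat.add_sub_cancel' h']

omit [CharP k 3] in
-- The even and odd parts meet only in zero, so subspaces of them that together span must fill them.
theorem gr_le_of_sup {E O : Submodule k L} (hE : E ≤ A.gr 0) (hO : O ≤ A.gr 1) (h : E ⊔ O = ⊤) :
    A.gr 0 = E ∧ A.gr 1 = O := by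
  have key : ∀ x : L, A.comp 0 x ∈ E ∧ A.comp 1 x ∈ O := by
    intro x
    obtain ⟨y, hy, z, hz, rfl⟩ := Submodule.mem_sup.1 (h ▸ Submodule.mem_top : x ∈ E ⊔ O)
    rw [map_add, map_add, Superspace.comp_of_mem (hE hy), Superspace.comp_of_mem (hO hz),
      Superspace.comp_of_mem (hE hy), Superspace.comp_of_mem (hO hz)]
    simpa using ⟨hy, hz⟩
  refine ⟨le_antisymm (fun x hx => ?_) hE, le_antisymm (fun x hx => ?_) hO⟩
  · have := (key x).1
    rwa [Superspace.mem_gr.1 hx] at this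
  · have := (key x).2
    rwa [Superspace.mem_gr.1 hx] at this

/-- The offsets 21 and 29 select the two halves of the odd part. Each half is treated by the same
argument, with `spinTable_left` and `spinTable_right` as input. -/
theorem mul_spinPair (hB : IsRootBasis A B) (a : so (splitForm7 k)) (m : (Fin 8 → k) × (Fin 8 → k)) :
    A.mul (soHom B a) (spinPair k B m) = spinPair k B (spinRep k a m.1, spinRep k a m.2) := by
  have h : ∀ s, (∀ p < 21, ∀ m < 8, A.mul (B p) (B (s + m))
      = Comb.eval k B ((spinTable p m).map fun t => (s + t.1, t.2))) → ∀ m,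
      A.mul (soHom B a) (ofValues 8 (fun m => B (s + m)) m)
        = ofValues 8 (fun m => B (s + m)) (spinRep k a m) := by
    intro s hs m
    have e : A.mul.compl₁₂ (soHom B) (ofValues 8 fun m => B (s + m))
        = (soHom (spinBasis k)).compr₂ (ofValues 8 fun m => B (s + m)) := by
      refine so_hom_ext fun p hp => unitVec_hom_ext fun m hm => ?_
      rw [LinearMap.compl₁₂_apply, LinearMap.compr₂_apply, soHom_soBasis _ hp, soHom_soBasis _ hp,
        ofValues_unitVec _ hm, spinBasis_unitVec p hm, ofValues_eval _ fun t =>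
        spinTable_mem_lt hp hm, hs p hp m hm]
      rw [Comb.eval_map B _ fun n => s + n]
    exact LinearMap.congr_fun₂ e a m
  rw [spinPair, LinearMap.coprod_apply, LinearMap.coprod_apply, map_add, h 21, h 29]
  · intro p hp m hm
    rw [hB.mul p (by omega) _ (by omega)]
    exact Comb.eval_eq_of_eqv B (of_allBelow (of_allBelow spinTable_right hp) hm)
  · intro p hp m hm
    rw [hB.mul p (by omega) _ (by omega)]
    exact Comb.eval_eq_of_eqv B (of_allBelow (of_allBelow spinTable_left hp) hm)

theorem exists_so_spin (hB : IsRootBasis A B) : ∃ e : so (splitForm7 k) →ₗ[k] L,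
    Function.Injective e ∧ LinearMap.range e = A.gr 0 ∧ (∀ a b, e ⁅a, b⁆ = A.mul (e a) (e b)) ∧
    ∃ ρ : so (splitForm7 k) →ₗ⁅k⁆ Module.End k (Fin 8 → k), IsSpinRep (splitForm7 k) ρ ∧
      ∃ j : (Fin 8 → k) × (Fin 8 → k) →ₗ[k] L, Function.Injective j ∧
        LinearMap.range j = A.gr 1 ∧ ∀ a m, A.mul (e a) (j m) = j (ρ a m.1, ρ a m.2) := by
  obtain ⟨h0, h1⟩ := gr_le_of_sup hB.range_soHom_le hB.range_spinPair_le hB.range_sup_range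
  exact ⟨soHom B, hB.soHom_injective, h0.symm, soHom_lie A.mul fun p hp q hq =>
    hB.mul p (by omega) q (by omega), spinRep k, isSpinRep_spinRep, spinPair k B,
    hB.spinPair_injective, h1.symm, hB.mul_spinPair⟩

theorem exists_so_spin_prod {k V V' : Type*} [Field k] [CharP k 3] [AddCommGroup V] [Module k V]
    [AddCommGroup V'] [Module k V'] {S : FormedSuperalgebra k (k × V)}
    {S' : FormedSuperalgebra k (k × V')}
    {A : Superalgebra k (S.magicSubmodule S')} {B : ℕ → S.magicSubmodule S'}
    (hB : IsRootBasis A B) : ∃ e : so (splitForm7 k) →ₗ[k] S.magicSubmodule S',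
    Function.Injective e ∧ LinearMap.range e = A.gr 0 ∧ (∀ a b, e ⁅a, b⁆ = A.mul (e a) (e b)) ∧
    ∃ ρ : so (splitForm7 k) →ₗ⁅k⁆ Module.End k (Fin 8 → k), IsSpinRep (splitForm7 k) ρ ∧
      ∃ j : (Fin 8 → k) × (Fin 8 → k) →ₗ[k] S.magicSubmodule S', Function.Injective j ∧
        LinearMap.range j = A.gr 1 ∧ ∀ a m, A.mul (e a) (j m) = j (ρ a m.1, ρ a m.2) :=
  hB.exists_so_spin

end IsRootBasis

end Super

end

theorem mainTheorem8 (k : Type*) [Field k] [CharP k 3]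
    (V : Type*) [AddCommGroup V] [Module k V] (ω : Super.SymplecticPlane k V) :
    (Super.gS12S12 ω).IsLie ∧
    Nonempty (Super.Realization (Super.cartanS12S12 k) (Fin 5 → k)) ∧
    (∀ (h : Type*) [AddCommGroup h] [Module k h]
      (R : Super.Realization (Super.cartanS12S12 k) h),
      Nonempty ((Super.gS12S12 ω).Iso (R.centerlessDerived {3}))) ∧
    (Super.gS12S12 ω).IsSimple ∧
    ∃ e : Super.so (Super.splitForm7 k) →ₗ[k] ω.S12.magicSubmodule ω.S12,
      Function.Injective e ∧ LinearMap.range e = (Super.gS12S12 ω).gr 0 ∧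
      (∀ a b, e ⁅a, b⁆ = (Super.gS12S12 ω).mul (e a) (e b)) ∧
      ∃ ρ : Super.so (Super.splitForm7 k) →ₗ⁅k⁆ Module.End k (Fin 8 → k),
        Super.IsSpinRep (Super.splitForm7 k) ρ ∧
        ∃ j : (Fin 8 → k) × (Fin 8 → k) →ₗ[k] ω.S12.magicSubmodule ω.S12,
          Function.Injective j ∧ LinearMap.range j = (Super.gS12S12 ω).gr 1 ∧
          ∀ a m, (Super.gS12S12 ω).mul (e a) (j m) = j (ρ a m.1, ρ a m.2) := by
  obtain ⟨B, hB⟩ := Super.exists_isRootBasis ω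
  exact ⟨hB.isLie, Super.exists_realization k, fun h _ _ R => (hB.isModel R).nonempty_iso,
    hB.isSimple, hB.exists_so_spin_prod⟩
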